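/- Let $N\ge 1$ and $m\ge1$ be integers, let $n$ be a real number with $0<n<m$, put $\omega=n/m\in(0,1)$, and let $\gamma\in(0,1)$. If $n$ is not an integer, assume in addition $(1-\omega)\gamma<\min(\{n\},1-\{n\})$. Here $[a]$ and $\{a\}$ denote the integer and the fractional part of $a$. Write $x=(x',x_N)\in\mathbb R^N$, $H=\{x\in\mathbb R^N:x_N>0\}$, $Q=H\times(-\infty,\infty)\ni(x,t)$, $x_N^*=\max\{x_N,\overline x_N\}$. Seminorms (with values in $[0,\infty]$; suprema over $H$, $Q$, or equivalently over the closures when the functions extend continuously). For a function $v$ on $H$, $$\langle v\rangle^{(s)}_{\theta,\overline H}=\sup_{x,\overline x}(x_N^*)^{\theta}\frac{|v(x)-v(\overline x)|}{|x-\overline x|^{s}};$$ $\langle v\rangle^{(s)}_{\theta,x_i,\overline H}$ is the same supremum over pairs $x,\overline x$ that differ only in the coordinate $x_i$; $\langle v\rangle^{(s)}_{\theta,x',\overline H}$ is the same supremum over pairs with $x_N=\overline x_N$; the index $\theta$ is omitted if $\theta=0$. For functions on $Q$ the seminorms $\langle\cdot\rangle^{(s)}_{\theta,x,\overline Q}$,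 $\langle\cdot\rangle^{(s)}_{\theta,x_i,\overline Q}$, $\langle\cdot\rangle^{(s)}_{\theta,x',\overline Q}$ are the suprema over $t$ of the corresponding seminorms on $H$ (in the variables $x$, $x_i$, $x'$) of $v(\cdot,t)$; further $$\langle v\rangle^{(s)}_{t,\overline Q}=\sup\frac{|v(x,t)-v(x,\overline t)|}{|t-\overline t|^{s}},\qquad \langle v\rangle^{(\gamma,\gamma/m)}_{\omega\gamma,\overline Q}=\langle v\rangle^{(\gamma)}_{\omega\gamma,x,\overline Q}+\langle v\rangle^{(\gamma/m)}_{t,\overline Q}.$$ **Parabolic case.** There is a constant $C=C(N,\gamma,m,n)$ with the following property. Let $u(x,t)$ be continuous on $\overline Q$, let the pure derivatives $D_{x_i}^m u$ ($i=1,\dots,N$) and $D_tu$ exist in $Q$, and suppose that $$R(u)=\sum_{i=1}^N\langle x_N^nD_{x_i}^mu\rangle^{(\gamma)}_{\omega\gamma,x_i,\overline Q}+\langle D_tu\rangle^{(\gamma/m)}_{t,\overline Q}<\infty .$$ Then $u(\cdot,t)\in C^m(H)$ for every $t$, and $$\sum_{0\le j\le n}\ \sum_{|\alpha|=m-j}\langle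 x_N^{n-j}D_x^\alpha u\rangle^{(\gamma,\gamma/m)}_{\omega\gamma,\overline Q} +\sum_{0\le j\le n}\ \sum_{|\alpha|=m-j}\langle x_N^{n-j\omega}D_x^\alpha u\rangle^{(\frac{\gamma+j}{m})}_{t,\overline Q} +\langle D_tu\rangle^{(\gamma,\gamma/m)}_{\omega\gamma,\overline Q}$$ $$+\sum_{0\le j\le m-n}\ \sum_{|\alpha|=[m-n+(1-\omega)\gamma]-j}\langle D_{x'}^\alpha D_{x_N}^ju\rangle^{(\{m-n+(1-\omega)\gamma\})}_{x',\overline Q} +\sum_{0\le j\le m-n}\ \sum_{|\alpha|=[m-n+\gamma]-j}\langle D_{x'}^\alpha D_{x_N}^ju\rangle^{(\{m-n+\gamma\})}_{\omega\gamma,x',\overline Q}$$ $$+\sum_{1\le j\le m-n}\ \sum_{|\alpha|=j}\langle D_x^\alpha u\rangle^{(1-\frac{j}{m-n}+\frac{\gamma}{m})}_{t,\overline Q}\ \le\ C\,R(u),$$ where on the left-hand side only those terms are included that are finite. Moreover, for all integers $0\le j<n$ and all multi-indices $\alpha$ with $|\alpha|=m-j$ and $\alpha_N<m-j$, $$x_N^{n-j}D_x^\alpha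 u(x,t)\to0\quad\text{as } (x,t)\to(x_0,t_0),\ (x,t)\in Q,$$ for every $(x_0,t_0)$ with $x_{0,N}=0$; that is, as $x_N\to0$, locally uniformly in $(x',t)$. **Elliptic case.** There is a constant $C=C(N,\gamma,m,n)$ with the following property. Let $u(x)$ be continuous on $\overline H$, let the pure derivatives $D_{x_i}^mu$ ($i=1,\dots,N$) exist in $H$, and suppose that $R(u)=\sum_{i=1}^N\langle x_N^nD_{x_i}^mu\rangle^{(\gamma)}_{\omega\gamma,x_i,\overline H}<\infty$. Then $u\in C^m(H)$ and $$\sum_{0\le j\le n}\ \sum_{|\alpha|=m-j}\langle x_N^{n-j}D_x^\alpha u\rangle^{(\gamma)}_{\omega\gamma,\overline H} +\sum_{0\le j\le m-n}\ \sum_{|\alpha|=[m-n+\gamma]-j}\langle D_{x'}^\alpha D_{x_N}^ju\rangle^{(\{m-n+\gamma\})}_{\omega\gamma,x',\overline H}$$ $$+\sum_{0\le j\le m-n}\ \sum_{|\alpha|=[m-n+(1-\omega)\gamma]-j}\langle D_{x'}^\alpha D_{x_N}^ju\rangle^{(\{m-n+(1-\omega)\gamma\})}_{x',\overline H}\ \le\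 C\,R(u),$$ where on the left-hand side only those terms are included that are finite. Moreover $x_N^{n-j}D_x^\alpha u(x)\to0$ as $x\to x_0$, $x\in H$, for every $x_0$ with $x_{0,N}=0$, all integers $0\le j<n$ and all $\alpha$ with $|\alpha|=m-j$, $\alpha_N<m-j$. -/

import Mathlib

open Set Filter Topology
open scoped ENNReal NNReal

noncomputable section

namespace WeightedHolder

/-- The space `R^N` with `N = d + 1`; the distinguished variable `x_N` is the last coordinate. -/
abbrev Space (d : ℕ) : Type := EuclideanSpace ℝ (Fin (d + 1))

/-- The coordinate `x_N`. -/
def xN {d : ℕ} (x : Space d) : ℝ := x (Fin.last d)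

/-- The `i`-th coordinate vector. -/
def e {d : ℕ} (i : Fin (d + 1)) : Space d := EuclideanSpace.single i (1 : ℝ)

/-- The open half-space `H = {x_N > 0}`. -/
def H (d : ℕ) : Set (Space d) := {x | 0 < xN x}

/-- The closed half-space `{x_N ≥ 0}`. -/
def closedH (d : ℕ) : Set (Space d) := {x | 0 ≤ xN x}

/-! ### Derivatives -/

/-- `D_{x_i}^k v`, the pure partial derivative of order `k` in the variable `x_i`. -/
def pureD {d : ℕ} (i : Fin (d + 1)) (k : ℕ) (v : Space d → ℝ) (x : Space d) : ℝ :=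
  iteratedDeriv k (fun s : ℝ => v (x + s • e i)) 0

/-- `D^α v = D_{x_1}^{α_1} ⋯ D_{x_N}^{α_N} v`. -/
def mixedD {d : ℕ} (α : Fin (d + 1) → ℕ) (v : Space d → ℝ) : Space d → ℝ :=
  (List.finRange (d + 1)).foldr (fun i w => pureD i (α i) w) v

/-- In the open half-space `v` is `k` times continuously differentiable along every line parallel
to a coordinate axis (nothing is required of mixed derivatives). -/
def HasPureDerivs {d : ℕ} (k : ℕ) (v : Space d → ℝ) : Prop :=
  ∀ i : Fin (d + 1), ∀ x ∈ H d,
    ContDiffOn ℝ k (fun s : ℝ => v (x + s • e i)) {s : ℝ | x + s • e i ∈ H d}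

/-- All multi-indices `α = (α_1, …, α_M)` with `|α| = k`. -/
def multiIdx (M k : ℕ) : Finset (Fin M → ℕ) :=
  Finset.piAntidiag (Finset.univ : Finset (Fin M)) k

/-- The multi-index `(α_1, …, α_{N-1}, j)`, so that `mixedD (tangIdx α j)` is
`D_{x'}^α D_{x_N}^j`. -/
def tangIdx {d : ℕ} (α : Fin d → ℕ) (j : ℕ) : Fin (d + 1) → ℕ :=
  Fin.snoc (α := fun _ => ℕ) α j

/-! ### Seminorms of functions on the half-space

All suprema are taken in `[0, ∞]` over the open half-space; for quantities that extend
continuously to the closed half-space this is the supremum over the closed one. -/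

/-- `(x_N^*)^θ |v(x) - v(y)| / |x - y|^s`, where `x_N^* = max {x_N, y_N}`. -/
def quot {d : ℕ} (θ s : ℝ) (v : Space d → ℝ) (x y : Space d) : ℝ≥0∞ :=
  ENNReal.ofReal ((max (xN x) (xN y)) ^ θ * |v x - v y| / ‖x - y‖ ^ s)

/-- Weighted Hölder seminorm with respect to all variables `x`. -/
def semiX {d : ℕ} (θ s : ℝ) (v : Space d → ℝ) : ℝ≥0∞ :=
  ⨆ x ∈ H d, ⨆ y ∈ H d, quot θ s v x y

/-- Weighted Hölder seminorm with respect to the single variable `x_i`. -/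
def semiXi {d : ℕ} (θ s : ℝ) (i : Fin (d + 1)) (v : Space d → ℝ) : ℝ≥0∞ :=
  ⨆ x ∈ H d, ⨆ y ∈ H d, ⨆ (_ : ∀ k, k ≠ i → x k = y k), quot θ s v x y

/-- Weighted Hölder seminorm with respect to the tangential variables `x'`
(unweighted if `θ = 0`). -/
def semiTang {d : ℕ} (θ s : ℝ) (v : Space d → ℝ) : ℝ≥0∞ :=
  ⨆ x ∈ H d, ⨆ y ∈ H d, ⨆ (_ : xN x = xN y), quot θ s v x y

/-! ### Seminorms of functions on `Q = H × ℝ` -/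

/-- Unweighted Hölder seminorm with respect to `t`. -/
def semiT {d : ℕ} (s : ℝ) (v : Space d → ℝ → ℝ) : ℝ≥0∞ :=
  ⨆ x ∈ H d, ⨆ (t : ℝ) (τ : ℝ), ENNReal.ofReal (|v x t - v x τ| / |t - τ| ^ s)

/-- The parabolic seminorm with weight `x_N^θ` and exponents `(γ, γ/m)`. -/
def semiXT {d : ℕ} (m : ℕ) (θ γ : ℝ) (v : Space d → ℝ → ℝ) : ℝ≥0∞ :=
  (⨆ t : ℝ, semiX θ γ (fun x => v x t)) + semiT (γ / m) v

/-- The term itself if it is finite; an infinite term is left out (replaced by `0`). -/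
def finitePart (a : ℝ≥0∞) : ℝ≥0∞ :=
  open scoped Classical in if a = ⊤ then 0 else a

/-- `x_N^p D^α v`. -/
def wD {d : ℕ} (p : ℝ) (α : Fin (d + 1) → ℕ) (v : Space d → ℝ) (x : Space d) : ℝ :=
  xN x ^ p * mixedD α v x

/-- `D_t u`. -/
def dT {d : ℕ} (u : Space d → ℝ → ℝ) (x : Space d) (t : ℝ) : ℝ := deriv (u x) t

/-! ### The two sides of the elliptic estimate -/

/-- `∑_i ⟨x_N^n D_{x_i}^m v⟩_{ωγ, x_i}^{(γ)}`, with `ω = n / m`. -/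
def ellipticRHS {d : ℕ} (m : ℕ) (n γ : ℝ) (v : Space d → ℝ) : ℝ≥0∞ :=
  ∑ i : Fin (d + 1), semiXi (n / m * γ) γ i (fun x => xN x ^ n * pureD i m v x)

/-- The sum of the finite ones among the seminorms of the mixed and lower order derivatives. -/
def ellipticLHS {d : ℕ} (m : ℕ) (n γ : ℝ) (v : Space d → ℝ) : ℝ≥0∞ :=
  let ω : ℝ := n / m
  (∑ j ∈ Finset.range (⌊n⌋₊ + 1), ∑ α ∈ multiIdx (d + 1) (m - j),
      finitePart (semiX (ω * γ) γ (wD (n - j) α v)))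
  + (∑ j ∈ Finset.range (⌊m - n⌋₊ + 1), ∑ α ∈ multiIdx d (⌊m - n + γ⌋₊ - j),
      finitePart (semiTang (ω * γ) (Int.fract (m - n + γ)) (mixedD (tangIdx α j) v)))
  + (∑ j ∈ Finset.range (⌊m - n⌋₊ + 1), ∑ α ∈ multiIdx d (⌊m - n + (1 - ω) * γ⌋₊ - j),
      finitePart (semiTang 0 (Int.fract (m - n + (1 - ω) * γ)) (mixedD (tangIdx α j) v)))

/-! ### The two sides of the parabolic estimate -/

/-- `∑_i ⟨x_N^n D_{x_i}^m u⟩_{ωγ, x_i}^{(γ)} + ⟨D_t u⟩_t^{(γ/m)}`, with `ω = n / m`. -/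
def parabolicRHS {d : ℕ} (m : ℕ) (n γ : ℝ) (u : Space d → ℝ → ℝ) : ℝ≥0∞ :=
  (∑ i : Fin (d + 1), ⨆ t : ℝ,
      semiXi (n / m * γ) γ i (fun x => xN x ^ n * pureD i m (fun y => u y t) x))
  + semiT (γ / m) (dT u)

/-- The sum of the finite ones among the seminorms of the mixed and lower order derivatives. -/
def parabolicLHS {d : ℕ} (m : ℕ) (n γ : ℝ) (u : Space d → ℝ → ℝ) : ℝ≥0∞ :=
  let ω : ℝ := n / m
  (∑ j ∈ Finset.range (⌊n⌋₊ + 1), ∑ α ∈ multiIdx (d + 1) (m - j),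
      finitePart (semiXT m (ω * γ) γ (fun x t => wD (n - j) α (fun y => u y t) x)))
  + (∑ j ∈ Finset.range (⌊n⌋₊ + 1), ∑ α ∈ multiIdx (d + 1) (m - j),
      finitePart (semiT ((γ + j) / m) (fun x t => wD (n - j * ω) α (fun y => u y t) x)))
  + finitePart (semiXT m (ω * γ) γ (dT u))
  + (∑ j ∈ Finset.range (⌊m - n⌋₊ + 1), ∑ α ∈ multiIdx d (⌊m - n + (1 - ω) * γ⌋₊ - j),
      finitePart (⨆ t : ℝ, semiTang 0 (Int.fract (m - n + (1 - ω) * γ))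
        (mixedD (tangIdx α j) (fun y => u y t))))
  + (∑ j ∈ Finset.range (⌊m - n⌋₊ + 1), ∑ α ∈ multiIdx d (⌊m - n + γ⌋₊ - j),
      finitePart (⨆ t : ℝ, semiTang (ω * γ) (Int.fract (m - n + γ))
        (mixedD (tangIdx α j) (fun y => u y t))))
  + (∑ j ∈ Finset.Icc 1 ⌊m - n⌋₊, ∑ α ∈ multiIdx (d + 1) j,
      finitePart (semiT (1 - j / (m - n) + γ / m) (fun x t => mixedD α (fun y => u y t) x)))

end WeightedHolder

end

set_option linter.unusedSectionVars false

/-! Everything rests on scaling. Under the dilations `x ↦ l x`, `t ↦ l^(m-n) t` about a boundary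
point the data `R(u)` are multiplied by `l^σ`, where `σ = m - n + (1 - ω)γ` (`Params.Good.scal`).
The functions for which the Hölder quotients along all axes vanish form a finite-dimensional space,
spanned by products of one-variable functions: powers up to `m` in each tangential variable, powers
up to `1` in `t`, and in `x_N` the powers below `m` together with an `m`-fold antiderivative of
`x_N^(-n)`.

At unit distance from the boundary `u` and its derivatives are controlled by `R(u)` modulo this
kernel. Interpolation in one variable after the other gives a kernel function close to `u`
(`Frame.exists_ker_approx`). The pure Hölder conditions are then read as an anisotropic Zygmund
condition on differences of high order, and such a condition yields all mixed derivatives of smaller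
order (`zyg_pdL`, `Frame.IsHolder.exists_ker_pdL_sub_le`).

The kernel functions carry finitely many degrees of homogeneity, so a product of operators `δ -
2^D`, with `δ` the dyadic dilation, annihilates them (`Params.charOp_ker`). Applied to a derivative
of `u`, this product leaves a dyadic sequence of size `R(u) 2^(kσ)` at every scale
(`Params.exists_recurrent`). The number `σ` is not one of the degrees (`Params.σ_notMem_degList`);
this is where the condition on the fractional part of `n` enters. Hence the recurrence can be
inverted among sequences growing at most like `2^(kσ)` (`seq_two_sided`). A finite seminorm on the
left provides exactly this growth for differences taken at dilated pairs of points, with an unknown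
constant that disappears in the inversion. This is why only the finite terms are estimated.

The outcome is an estimate for pairs of points that are close compared with their distance to the
boundary (`Params.exists_local_pair`). For other pairs, the full spatial seminorm is handled by
climbing dyadically to a height where the pair is close (`Params.exists_global_of_local`), and the
tangential and time seminorms by running the recurrence down a pair of vertical columns
(`Params.exists_column`). For the boundary limits, a derivative with at least one tangential
direction leaves only kernel modes of degree above `m - n`, so the weighted derivative decays like a
power of `x_N` (`seq_decay`, `Params.exists_decay`). The elliptic case is the parabolic one for
functions independent of `t`. -/

namespace WeightedHolder

/-! ### Recurrence operators and two-sided dyadic sequences -/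

/-- The product of the operators `δ - 2^d`, `d ∈ ds`. -/
noncomputable def charOp {V : Type*} [AddCommGroup V] [Module ℝ V] (δ : Module.End ℝ V) :
    List ℝ → Module.End ℝ V
  | [] => 1
  | d :: ds => charOp δ ds * (δ - (2 : ℝ) ^ d • (1 : Module.End ℝ V))

section charOp

variable {V : Type*} [AddCommGroup V] [Module ℝ V] (δ : Module.End ℝ V)

@[simp] lemma charOp_nil (v : V) : charOp δ [] v = v := rfl

lemma charOp_cons (d : ℝ) (ds : List ℝ) (v : V) :
    charOp δ (d :: ds) v = charOp δ ds (δ v - (2 : ℝ) ^ d • v) := rfl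

lemma charOp_append (l₁ l₂ : List ℝ) (v : V) :
    charOp δ (l₁ ++ l₂) v = charOp δ l₂ (charOp δ l₁ v) := by
  induction l₁ generalizing v with
  | nil => rfl
  | cons d l ih => rw [List.cons_append, charOp_cons, ih, charOp_cons]

lemma charOp_apply_comm (ds : List ℝ) (v : V) : charOp δ ds (δ v) = δ (charOp δ ds v) := by
  induction ds generalizing v with
  | nil => rfl
  | cons d l ih => simp only [charOp_cons, map_sub, map_smul, ih]

lemma charOp_eq_zero_of_eigen {ds : List ℝ} {d : ℝ} (hd : d ∈ ds) {v : V}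
    (hv : δ v = (2 : ℝ) ^ d • v) : charOp δ ds v = 0 := by
  induction ds generalizing v with
  | nil => simp at hd
  | cons d' l ih =>
    rw [charOp_cons]
    rcases List.mem_cons.1 hd with rfl | h
    · rw [hv, sub_self, map_zero]
    · apply ih h
      rw [map_sub, map_smul, hv]
      simp only [map_smul, hv, smul_sub]
      rw [smul_comm ((2 : ℝ) ^ d)]; congr 1; rw [smul_comm]

lemma charOp_intertwine {W : Type*} [AddCommGroup W] [Module ℝ W] (δ' : Module.End ℝ W)
    (φ : V →ₗ[ℝ] W) (h : ∀ v, φ (δ v) = δ' (φ v)) (ds : List ℝ) (v : V) :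
    φ (charOp δ ds v) = charOp δ' ds (φ v) := by
  induction ds generalizing v with
  | nil => rfl
  | cons d l ih => rw [charOp_cons, charOp_cons, ih, map_sub, map_smul, h]

/-- A constant with `p (charOp δ ds v) ≤ charConst ds * B` when `p (δ^i v) ≤ B`. -/
noncomputable def charConst : List ℝ → ℝ
  | [] => 1
  | d :: ds => charConst ds * (1 + (2 : ℝ) ^ d)

lemma charConst_nonneg (ds : List ℝ) : 0 ≤ charConst ds := by
  induction ds with
  | nil => simp [charConst]
  | cons d l ih => simp only [charConst]; positivity

lemma charOp_bound (p : V → ℝ) (hp : ∀ (c : ℝ) (v w : V), 0 ≤ c → p (v - c • w) ≤ p v + c * p w)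
    (ds : List ℝ) (v : V) (B : ℝ) (h : ∀ i ≤ ds.length, p ((δ ^ i) v) ≤ B) :
    p (charOp δ ds v) ≤ charConst ds * B := by
  induction ds generalizing v B with
  | nil => simpa [charConst] using h 0 le_rfl
  | cons d l ih =>
    rw [charOp_cons]
    have h2 : (0 : ℝ) ≤ 2 ^ d := by positivity
    have := ih (δ v - (2 : ℝ) ^ d • v) ((1 + 2 ^ d) * B) (fun i hi => by
      rw [map_sub, map_smul]
      refine (hp _ _ _ h2).trans ?_
      have h1 := h (i + 1) (by simpa using hi)
      have h0 := h i (by simp; omega)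
      rw [pow_succ, Module.End.mul_apply] at h1
      nlinarith [mul_le_mul_of_nonneg_left h0 h2])
    simpa [charConst, mul_assoc] using this

end charOp

/-- The shift of two-sided sequences. -/
def seqShift : Module.End ℝ (ℤ → ℝ) := LinearMap.funLeft ℝ ℝ (fun k : ℤ => k + 1)

@[simp] lemma seqShift_apply (y : ℤ → ℝ) (k : ℤ) : seqShift y k = y (k + 1) := rfl

/-- Conjugation by the weight `2^(-jη)` lowers every exponent by `η` at the price of a factor `2^η`
per operator. It reduces growth at rate `η` to boundedness. -/
lemma charOp_seqShift_twist (η : ℝ) (ds : List ℝ) (y : ℤ → ℝ) (k : ℤ) :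
    charOp seqShift ds y k = (2 : ℝ) ^ (((k : ℝ) + ds.length) * η) *
      charOp seqShift (ds.map (· - η)) (fun j => (2 : ℝ) ^ (-(j : ℝ) * η) * y j) k := by
  induction ds generalizing y k with
  | nil =>
    simp only [charOp_nil, List.length_nil, List.map_nil]
    rw [← mul_assoc, ← Real.rpow_add two_pos]
    simp
  | cons d l ih =>
    rw [charOp_cons, ih, List.map_cons, charOp_cons]
    have : (fun j : ℤ => (2 : ℝ) ^ (-(j : ℝ) * η) * (seqShift y - (2 : ℝ) ^ d • y) j)
        = (2 : ℝ) ^ η • (seqShift (fun j : ℤ => (2 : ℝ) ^ (-(j : ℝ) * η) * y j)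
          - (2 : ℝ) ^ (d - η) • (fun j : ℤ => (2 : ℝ) ^ (-(j : ℝ) * η) * y j)) := by
      funext j
      simp only [Pi.sub_apply, Pi.smul_apply, seqShift_apply, smul_eq_mul]
      rw [mul_sub, mul_sub, ← mul_assoc, ← mul_assoc, ← mul_assoc, ← mul_assoc,
        ← Real.rpow_add two_pos, ← Real.rpow_add two_pos, ← Real.rpow_add two_pos]
      push_cast
      congr 2
      · congr 1; ring
      · rw [mul_comm, ← Real.rpow_add two_pos]; congr 1; ring
    rw [this, map_smul, Pi.smul_apply, smul_eq_mul, ← mul_assoc, ← Real.rpow_add two_pos]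
    congr 2
    simp only [List.length_cons]
    push_cast
    ring

/-- The a priori bound `M` only makes the supremum `S` finite. The recurrence then gives `q S ≤ B +
p S` or `p S ≤ B + q S`, and the useful one, decided by the sign of `p - q`, absorbs `S`. -/
lemma bounded_of_recurrence {p q B M : ℝ} (hp : 0 < p) (hq : 0 < q) (hpq : p ≠ q) {z : ℤ → ℝ}
    (hM : ∀ k, |z k| ≤ M) (h : ∀ k, |p * z (k + 1) - q * z k| ≤ B) (k : ℤ) :
    |z k| ≤ B / |p - q| := by
  have hbdd : BddAbove (range fun k => |z k|) := ⟨M, by rintro _ ⟨k, rfl⟩; exact hM k⟩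
  set S := ⨆ k, |z k| with hS
  have hle : ∀ k, |z k| ≤ S := fun k => le_ciSup hbdd k
  refine (hle k).trans ?_
  rcases lt_or_gt_of_ne hpq with hlt | hlt
  · rw [abs_of_neg (by linarith), le_div_iff₀ (by linarith)]
    have : S ≤ (B + p * S) / q := ciSup_le fun j => by
      rw [le_div_iff₀ hq]
      have h1 := h j
      have h2 : |q * z j| ≤ |p * z (j + 1) - q * z j| + |p * z (j + 1)| := by
        rw [← abs_neg (p * z (j + 1) - q * z j)]
        refine le_trans (le_of_eq ?_) (abs_add_le _ _); congr 1; ring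
      rw [abs_mul, abs_mul, abs_of_pos hq, abs_of_pos hp] at h2
      nlinarith [hle (j + 1)]
    rw [le_div_iff₀ hq] at this; linarith
  · rw [abs_of_pos (by linarith), le_div_iff₀ (by linarith)]
    have : S ≤ (B + q * S) / p := ciSup_le fun j => by
      rw [le_div_iff₀ hp]
      have h1 := h (j - 1)
      rw [sub_add_cancel] at h1
      have h2 : |p * z j| ≤ |p * z j - q * z (j - 1)| + |q * z (j - 1)| := by
        refine le_trans (le_of_eq ?_) (abs_add_le _ _); congr 1; ring
      rw [abs_mul, abs_mul, abs_of_pos hq, abs_of_pos hp] at h2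
      nlinarith [hle (j - 1)]
    rw [le_div_iff₀ hp] at this; linarith

lemma charOp_seqShift_abs_le (ds : List ℝ) (y : ℤ → ℝ) (B : ℝ) (k : ℤ)
    (h : ∀ i ≤ ds.length, |y (k + i)| ≤ B) : |charOp seqShift ds y k| ≤ charConst ds * B := by
  have hpow : ∀ (i : ℕ) (y : ℤ → ℝ), ((seqShift ^ i) y) k = y (k + i) := by
    intro i
    induction i with
    | zero => intro y; simp
    | succ i ih =>
      intro y
      rw [pow_succ, Module.End.mul_apply, ih, seqShift_apply]; congr 1; push_cast; ring
  refine charOp_bound seqShift (fun y => |y k|) (fun c v w hc => ?_) ds y B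
    (fun i hi => by simpa only [hpow] using h i hi)
  simp only [Pi.sub_apply, Pi.smul_apply, smul_eq_mul]
  refine (abs_sub _ _).trans ?_
  rw [abs_mul, abs_of_nonneg hc]

/-- Two-sided sequences of growth at most `2^{kσ}` are controlled by any recurrence operator none
of whose exponents is `σ`. -/
lemma seq_two_sided (ds : List ℝ) (σ : ℝ) (hσ : σ ∉ ds) :
    ∃ C : ℝ, 0 ≤ C ∧ ∀ (y : ℤ → ℝ) (M B : ℝ), (∀ k : ℤ, |y k| ≤ M * (2 : ℝ) ^ ((k : ℝ) * σ)) →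
      (∀ k : ℤ, |charOp seqShift ds y k| ≤ B * (2 : ℝ) ^ ((k : ℝ) * σ)) →
      ∀ k : ℤ, |y k| ≤ C * B * (2 : ℝ) ^ ((k : ℝ) * σ) := by
  induction ds with
  | nil => exact ⟨1, zero_le_one, fun y M B _ h k => by simpa using h k⟩
  | cons d l ih =>
    obtain ⟨C, hC, H⟩ := ih (fun h => hσ (List.mem_cons_of_mem _ h))
    have hd : (2 : ℝ) ^ σ ≠ 2 ^ d := by
      intro h
      apply hσ
      have := (Real.strictMono_rpow_of_base_gt_one one_lt_two).injective h
      simp [this]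
    refine ⟨C / |2 ^ σ - 2 ^ d|, by positivity, fun y M B hM h k => ?_⟩
    have hs : ∀ k : ℤ, (2 : ℝ) ^ (((k + 1 : ℤ) : ℝ) * σ) = 2 ^ ((k : ℝ) * σ) * 2 ^ σ := fun k => by
      rw [← Real.rpow_add two_pos]; congr 1; push_cast; ring
    -- One factor is peeled off. The growth constant of the new sequence is worse, which is harmless
    -- because `M` does not enter the conclusion.
    have hx := H (seqShift y - (2 : ℝ) ^ d • y) (M * (2 ^ σ + 2 ^ d)) B (fun k => by
      simp only [Pi.sub_apply, Pi.smul_apply, seqShift_apply, smul_eq_mul]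
      refine (abs_sub _ _).trans ?_
      rw [abs_mul, abs_of_pos (Real.rpow_pos_of_pos two_pos d)]
      have h1 := hM (k + 1)
      rw [hs] at h1
      have h2 := mul_le_mul_of_nonneg_left (hM k) (Real.rpow_pos_of_pos two_pos d).le
      linarith) h
    have hw : ∀ k : ℤ, 0 < (2 : ℝ) ^ ((k : ℝ) * σ) := fun k => Real.rpow_pos_of_pos two_pos _
    -- After division by `2^(kσ)` the last factor becomes a two-term recurrence with the unequal
    -- coefficients `2^σ` and `2^d`.
    have := bounded_of_recurrence (p := 2 ^ σ) (q := 2 ^ d) (B := C * B) (M := M)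
      (Real.rpow_pos_of_pos two_pos _) (Real.rpow_pos_of_pos two_pos _) hd
      (z := fun k => y k / 2 ^ ((k : ℝ) * σ)) (fun k => by
        rw [abs_div, abs_of_pos (hw k), div_le_iff₀ (hw k)]; exact hM k) (fun k => by
        have h1 := hx k
        simp only [Pi.sub_apply, Pi.smul_apply, seqShift_apply, smul_eq_mul] at h1
        have : 2 ^ σ * (y (k + 1) / 2 ^ (((k + 1 : ℤ) : ℝ) * σ)) - 2 ^ d * (y k / 2 ^ ((k : ℝ) * σ))
            = (y (k + 1) - 2 ^ d * y k) / 2 ^ ((k : ℝ) * σ) := by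
          rw [hs]; field_simp
        rw [this, abs_div, abs_of_pos (hw k), div_le_iff₀ (hw k)]; exact h1) k
    rw [abs_div, abs_of_pos (hw k), div_le_iff₀ (hw k)] at this
    calc |y k| ≤ _ := this
      _ = _ := by ring

/-- The index `j` stands for the scale `2^(-j)`. The constant `K = 1 + q / (r' - q)` satisfies `q (K
+ 1) ≤ K r'`, which closes the induction; the strict inequality `q < r'` leaves room for the
resonance `q = r`. -/
lemma geom_decay_of_contract {q r r' B C' : ℝ} (hq : 0 ≤ q) (hqr : q < r') (hr : r ≤ r') (hr0 : 0 ≤ r)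
    (hB : 0 ≤ B) (hC' : 1 ≤ C') {z : ℕ → ℝ} (h0 : |z 0| ≤ C' * B)
    (h : ∀ j, |z (j + 1)| ≤ q * (|z j| + C' * B * r ^ j)) (j : ℕ) :
    |z j| ≤ (1 + q / (r' - q)) * C' * B * r' ^ j := by
  set K := 1 + q / (r' - q) with hK
  have hr'0 : 0 ≤ r' := hr0.trans hr
  have hpos : 0 < r' - q := by linarith
  have hq' : 0 ≤ q / (r' - q) := div_nonneg hq hpos.le
  have hKq : q * (K + 1) ≤ K * r' := by
    have : q / (r' - q) * (r' - q) = q := by field_simp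
    rw [hK]; nlinarith
  induction j with
  | zero => simp only [pow_zero, mul_one]; nlinarith [mul_nonneg (by linarith : 0 ≤ C') hB]
  | succ j ih =>
    have hCB : 0 ≤ C' * B := mul_nonneg (by linarith) hB
    have hrj : r ^ j ≤ r' ^ j := pow_le_pow_left₀ hr0 hr j
    have hrj0 : 0 ≤ r' ^ j := pow_nonneg hr'0 j
    calc |z (j + 1)| ≤ q * (|z j| + C' * B * r ^ j) := h j
      _ ≤ q * (K * C' * B * r' ^ j + C' * B * r' ^ j) := by gcongr
      _ = q * (K + 1) * (C' * B * r' ^ j) := by ring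
      _ ≤ K * r' * (C' * B * r' ^ j) := by gcongr
      _ = _ := by rw [pow_succ]; ring

/-- Iterating the inequality `i` times bounds `z j` by `q^i M` plus a geometric series. As `i → ∞`
the a priori bound `M` drops out. -/
lemma geom_decay_of_expand {q r B M : ℝ} (hq : 0 ≤ q) (hq1 : q < 1) (hr : 0 ≤ r) (hr1 : r ≤ 1)
    (hB : 0 ≤ B) {z : ℕ → ℝ} (hM : ∀ j, |z j| ≤ M)
    (h : ∀ j, |z j| ≤ q * |z (j + 1)| + B * r ^ j) (j : ℕ) :
    |z j| ≤ 1 / (1 - q) * B * r ^ j := by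
  have key : ∀ i j : ℕ, |z j| ≤ q ^ i * M + 1 / (1 - q) * B * r ^ j := by
    intro i
    have hp : 0 < 1 - q := by linarith
    induction i with
    | zero => intro j; have := hM j; have : 0 ≤ 1 / (1 - q) * B * r ^ j := by positivity
              rw [pow_zero, one_mul]; linarith [hM j]
    | succ i ih =>
      intro j
      have hrj : r ^ (j + 1) ≤ r ^ j := pow_le_pow_of_le_one hr hr1 (Nat.le_succ j)
      have hK : q * (1 / (1 - q)) + 1 = 1 / (1 - q) := by field_simp; ring
      calc |z j| ≤ q * |z (j + 1)| + B * r ^ j := h j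
        _ ≤ q * (q ^ i * M + 1 / (1 - q) * B * r ^ j) + B * r ^ j := by
          gcongr
          refine (ih (j + 1)).trans ?_
          gcongr q ^ i * M + ?_
          exact mul_le_mul_of_nonneg_left hrj (by positivity)
        _ = q ^ (i + 1) * M + (q * (1 / (1 - q)) + 1) * B * r ^ j := by rw [pow_succ]; ring
        _ = _ := by rw [hK]
  have hlim : Tendsto (fun i : ℕ => q ^ i * M + 1 / (1 - q) * B * r ^ j) atTop
      (𝓝 (0 * M + 1 / (1 - q) * B * r ^ j)) :=
    ((tendsto_pow_atTop_nhds_zero_of_lt_one hq hq1).mul_const M).add_const _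
  rw [zero_mul, zero_add] at hlim
  exact ge_of_tendsto' hlim fun i => key i j

/-- The partial sums show that `z` differs from `-j c` by a bounded amount, so boundedness forces `c
= 0`. The increments are then summable and `z` converges geometrically. -/
lemma limit_of_bounded_increments {r B M c : ℝ} (hr : 0 ≤ r) (hr1 : r < 1) (hB : 0 ≤ B)
    {z : ℕ → ℝ} (hM : ∀ j, |z j| ≤ M) (h0 : |z 0| ≤ B)
    (h : ∀ j, |z j - z (j + 1) - c| ≤ B * r ^ j) :
    ∃ c', |c'| ≤ (1 + 1 / (1 - r)) * B ∧ ∀ j, |z j - c'| ≤ 1 / (1 - r) * B * r ^ j := by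
  have hp : 0 < 1 - r := by linarith
  have hM0 : 0 ≤ M := (abs_nonneg _).trans (hM 0)
  have hsum : ∀ j : ℕ, |z 0 - z j - j * c| ≤ B * (1 / (1 - r)) := by
    intro j
    have : ∀ j : ℕ, |z 0 - z j - j * c| ≤ B * ∑ i ∈ Finset.range j, r ^ i := by
      intro j
      induction j with
      | zero => simp
      | succ j ih =>
        rw [Finset.sum_range_succ, mul_add]
        refine le_trans (le_of_eq ?_) ((abs_add_le _ _).trans (add_le_add ih (h j)))
        congr 1; push_cast; ring
    refine (this j).trans ?_
    gcongr
    rw [one_div, ← tsum_geometric_of_lt_one hr hr1]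
    exact (summable_geometric_of_lt_one hr hr1).sum_le_tsum _ (fun i _ => pow_nonneg hr i)
  have hc : c = 0 := by
    by_contra hc
    have hc' : 0 < |c| := abs_pos.2 hc
    obtain ⟨j, hj⟩ := exists_nat_gt ((B * (1 / (1 - r)) + 2 * M) / |c|)
    rw [div_lt_iff₀ hc'] at hj
    have h1 : |(j : ℝ) * c| ≤ |z 0 - z j - j * c| + |z 0| + |z j| := by
      calc |(j : ℝ) * c| = |-(z 0 - z j - j * c) + z 0 + -z j| := by congr 1; ring
        _ ≤ |-(z 0 - z j - j * c)| + |z 0| + |-z j| := abs_add_three _ _ _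
        _ = _ := by rw [abs_neg, abs_neg]
    rw [abs_mul, Nat.abs_cast] at h1
    linarith [hsum j, hM 0, hM j]
  subst hc
  have hd : ∀ j, dist (z j) (z (j + 1)) ≤ B * r ^ j := fun j => by
    simpa [Real.dist_eq] using h j
  obtain ⟨c', hc'⟩ := cauchySeq_tendsto_of_complete (cauchySeq_of_le_geometric r B hr1 hd)
  have hb : ∀ j, |z j - c'| ≤ 1 / (1 - r) * B * r ^ j := fun j => by
    have := dist_le_of_le_geometric_of_tendsto r B hr1 hd hc' j
    rw [Real.dist_eq] at this
    refine this.trans (le_of_eq ?_); ring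
  refine ⟨c', ?_, hb⟩
  have h2 := hb 0
  rw [pow_zero, mul_one] at h2
  have : |c'| ≤ |z 0 - c'| + |z 0| := by
    calc |c'| = |-(z 0 - c') + z 0| := by congr 1; ring
      _ ≤ |-(z 0 - c')| + |z 0| := abs_add_le _ _
      _ = _ := by rw [abs_neg]
  nlinarith

lemma two_rpow_neg_mul (η : ℝ) (j : ℕ) : (2 : ℝ) ^ (((-(j : ℤ) : ℤ) : ℝ) * η) = ((2 : ℝ) ^ (-η)) ^ j := by
  rw [← Real.rpow_natCast, ← Real.rpow_mul two_pos.le]; congr 1; push_cast; ring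

lemma two_rpow_neg_lt_one {η : ℝ} (h : 0 < η) : (2 : ℝ) ^ (-η) < 1 :=
  Real.rpow_lt_one_of_one_lt_of_neg one_lt_two (by linarith)

/-- One factor of the recurrence operator, for sequences bounded at `-∞`. -/
lemma recurrence_step (d η : ℝ) (hη : 0 < η) :
    ∃ η' C : ℝ, 0 < η' ∧ 0 ≤ C ∧ ∀ (y : ℤ → ℝ) (M B c : ℝ), 0 ≤ B → (∀ k : ℤ, |y k| ≤ M) →
      |y 0| ≤ B → |c| ≤ B →
      (∀ k : ℤ, k ≤ 0 → |y (k + 1) - (2 : ℝ) ^ d * y k - c| ≤ B * (2 : ℝ) ^ ((k : ℝ) * η)) →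
      ∃ c', |c'| ≤ C * B ∧ ∀ k : ℤ, k ≤ 0 → |y k - c'| ≤ C * B * (2 : ℝ) ^ ((k : ℝ) * η') := by
  set r : ℝ := 2 ^ (-η) with hr
  have hr0 : 0 < r := Real.rpow_pos_of_pos two_pos _
  have hr1 : r < 1 := two_rpow_neg_lt_one hη
  have hrec : ∀ (y : ℤ → ℝ) (c B : ℝ), 0 ≤ B →
      (∀ k : ℤ, k ≤ 0 → |y (k + 1) - (2 : ℝ) ^ d * y k - c| ≤ B * (2 : ℝ) ^ ((k : ℝ) * η)) →
      ∀ j : ℕ, |y (-(j : ℤ)) - 2 ^ d * y (-((j + 1 : ℕ) : ℤ)) - c| ≤ B * r ^ j := by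
    intro y c B hB h j
    have h1 := h (-((j + 1 : ℕ) : ℤ)) (by omega)
    rw [two_rpow_neg_mul, ← hr] at h1
    have e : -((j + 1 : ℕ) : ℤ) + 1 = -(j : ℤ) := by push_cast; ring
    rw [e] at h1
    refine h1.trans ?_
    exact mul_le_mul_of_nonneg_left (pow_le_pow_of_le_one hr0.le hr1.le (Nat.le_succ j)) hB
  have hdown : ∀ {P : ℤ → Prop}, (∀ j : ℕ, P (-(j : ℤ))) → ∀ k : ℤ, k ≤ 0 → P k := by
    intro P h k hk
    have := h (-k).toNat
    rwa [Int.toNat_of_nonneg (by omega), neg_neg] at this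
  -- The exponent `0` is resonant: a nonzero limit `c` on the right would produce linear growth. For
  -- `d ≠ 0` the fixed point `c / (1 - 2^d)` is subtracted instead.
  rcases eq_or_ne d 0 with rfl | hd
  · refine ⟨η, 1 + 1 / (1 - r), hη, by have : 0 < 1 - r := by linarith
                                       positivity, fun y M B c hB hM h0 hc h => ?_⟩
    have h' := hrec y c B hB h
    simp only [Real.rpow_zero, one_mul] at h'
    obtain ⟨c', hc', hb⟩ := limit_of_bounded_increments hr0.le hr1 hB
      (z := fun j : ℕ => y (-(j : ℤ))) (fun j => hM _) (by simpa using h0) h'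
    refine ⟨c', hc', hdown fun j => ?_⟩
    rw [two_rpow_neg_mul, ← hr]
    refine (hb j).trans ?_
    have : 0 ≤ B * r ^ j := by positivity
    nlinarith
  · have hd1 : (1 : ℝ) - 2 ^ d ≠ 0 := by
      intro h
      apply hd
      have h2 : (2 : ℝ) ^ d = 2 ^ (0 : ℝ) := by rw [Real.rpow_zero]; linarith
      exact (Real.strictMono_rpow_of_base_gt_one one_lt_two).injective h2
    have h2d : (0 : ℝ) < 2 ^ d := Real.rpow_pos_of_pos two_pos _
    set E : ℝ := 1 / |1 - (2 : ℝ) ^ d| with hE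
    have hE0 : 0 ≤ E := by positivity
    have hz : ∀ (y : ℤ → ℝ) (c B : ℝ), 0 ≤ B →
      (∀ k : ℤ, k ≤ 0 → |y (k + 1) - (2 : ℝ) ^ d * y k - c| ≤ B * (2 : ℝ) ^ ((k : ℝ) * η)) →
      ∀ j : ℕ, |(y (-(j : ℤ)) - c / (1 - 2 ^ d)) -
        2 ^ d * (y (-((j + 1 : ℕ) : ℤ)) - c / (1 - 2 ^ d))| ≤ B * r ^ j := by
      intro y c B hB h j
      refine le_trans (le_of_eq ?_) (hrec y c B hB h j)
      congr 1; field_simp; ring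
    have hcE : ∀ {c B : ℝ}, |c| ≤ B → |c / (1 - 2 ^ d)| ≤ E * B := by
      intro c B h
      rw [abs_div, hE, div_eq_mul_one_div, mul_comm]
      gcongr
    -- For `d < 0` the homogeneous solution `2^(kd)` blows up at `-∞` and is excluded by
    -- boundedness. For `d > 0` it decays there, and its size is fixed by the value at `0`.
    rcases lt_or_gt_of_ne hd with hneg | hpos
    · have hq1 : (2 : ℝ) ^ d < 1 := Real.rpow_lt_one_of_one_lt_of_neg one_lt_two hneg
      refine ⟨η, E + 1 / (1 - 2 ^ d), hη, by have : 0 < 1 - (2 : ℝ) ^ d := by linarith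
                                             positivity, fun y M B c hB hM h0 hc h => ?_⟩
      have hp : 0 < 1 - (2 : ℝ) ^ d := by linarith
      refine ⟨c / (1 - 2 ^ d), (hcE hc).trans ?_, hdown fun j => ?_⟩
      · have : 0 ≤ 1 / (1 - (2 : ℝ) ^ d) * B := by positivity
        linarith
      · have := geom_decay_of_expand (q := 2 ^ d) (r := r) (B := B) (M := M + E * B) h2d.le hq1
          hr0.le hr1.le hB (z := fun j : ℕ => y (-(j : ℤ)) - c / (1 - 2 ^ d))
          (fun j => (abs_sub _ _).trans (add_le_add (hM _) (hcE hc))) (fun j => by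
            have h1 := hz y c B hB h j
            have h2 := abs_sub_abs_le_abs_sub (y (-(j : ℤ)) - c / (1 - 2 ^ d))
              (2 ^ d * (y (-((j + 1 : ℕ) : ℤ)) - c / (1 - 2 ^ d)))
            rw [abs_mul, abs_of_pos h2d] at h2
            linarith) j
        rw [two_rpow_neg_mul, ← hr]
        refine this.trans ?_
        have : 0 ≤ B * r ^ j := by positivity
        nlinarith
    -- Half of the minimum keeps `η'` strictly below `d` even when `η = d`.
    · set η' := min η d / 2 with hη'
      have hm : 0 < min η d := lt_min hη hpos
      have hη'0 : 0 < η' := by positivity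
      have hη'd : η' < d := by have := min_le_right η d; linarith
      have hη'η : η' ≤ η := by have := min_le_left η d; linarith
      have hqr : (2 : ℝ) ^ (-d) < 2 ^ (-η') :=
        Real.rpow_lt_rpow_of_exponent_lt one_lt_two (by linarith)
      have hrr : r ≤ 2 ^ (-η') := Real.rpow_le_rpow_of_exponent_le one_le_two (by linarith)
      have hq0 : (0 : ℝ) ≤ 2 ^ (-d) := (Real.rpow_pos_of_pos two_pos _).le
      set K := 1 + (2 : ℝ) ^ (-d) / (2 ^ (-η') - 2 ^ (-d)) with hK
      have hK1 : 1 ≤ K := by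
        have : 0 ≤ (2 : ℝ) ^ (-d) / (2 ^ (-η') - 2 ^ (-d)) := div_nonneg hq0 (by linarith)
        linarith
      refine ⟨η', K * (1 + E), hη'0, by positivity, fun y M B c hB hM h0 hc h => ?_⟩
      refine ⟨c / (1 - 2 ^ d), (hcE hc).trans ?_, hdown fun j => ?_⟩
      · have : 0 ≤ E * B := by positivity
        nlinarith
      · have := geom_decay_of_contract (C' := 1 + E) hq0 hqr hrr hr0.le hB (by linarith)
          (z := fun j : ℕ => y (-(j : ℤ)) - c / (1 - 2 ^ d))
          (by simpa [add_mul] using (abs_sub _ _).trans (add_le_add h0 (hcE hc))) (fun j => by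
            have h1 := hz y c B hB h j
            rw [abs_sub_comm] at h1
            have h2 := abs_sub_abs_le_abs_sub
              (2 ^ d * (y (-((j + 1 : ℕ) : ℤ)) - c / (1 - 2 ^ d))) (y (-(j : ℤ)) - c / (1 - 2 ^ d))
            rw [abs_mul, abs_of_pos h2d] at h2
            rw [Real.rpow_neg two_pos.le, inv_mul_eq_div, le_div_iff₀ h2d]
            have : B * r ^ j ≤ (1 + E) * B * r ^ j := by
              have : 0 ≤ B * r ^ j := by positivity
              nlinarith
            linarith) j
        rw [two_rpow_neg_mul]
        exact this.trans (le_of_eq (by ring))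

/-- A bounded sequence has no modes of negative exponent at `-∞`, the modes of positive exponent
decay, and only a constant survives as the limit `c`. The induction finds the limit of `δ y - 2^d y`
and inverts one factor by `recurrence_step`. The conclusion depends on `B`, the bound for `k ≥ 0`,
and not on `M`. -/
lemma seq_bounded_asymptotic (ds : List ℝ) (σ : ℝ) (hσ : 0 < σ) :
    ∃ η C : ℝ, 0 < η ∧ 0 ≤ C ∧ ∀ (y : ℤ → ℝ) (M B : ℝ), 0 ≤ B → (∀ k : ℤ, |y k| ≤ M) →
      (∀ k : ℤ, 0 ≤ k → |y k| ≤ B) →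
      (∀ k : ℤ, k ≤ 0 → |charOp seqShift ds y k| ≤ B * (2 : ℝ) ^ ((k : ℝ) * σ)) →
      ∃ c, |c| ≤ C * B ∧ ∀ k : ℤ, k ≤ 0 → |y k - c| ≤ C * B * (2 : ℝ) ^ ((k : ℝ) * η) := by
  induction ds with
  | nil =>
    refine ⟨σ, 1, hσ, zero_le_one, fun y M B hB _ _ h => ⟨0, by simpa using hB, fun k hk => ?_⟩⟩
    simpa using h k hk
  | cons d l ih =>
    obtain ⟨η, C, hη, hC, H⟩ := ih
    obtain ⟨η', C', hη', hC', H'⟩ := recurrence_step d η hη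
    have h2d : (0 : ℝ) < 2 ^ d := Real.rpow_pos_of_pos two_pos _
    refine ⟨η', C' * (1 + C * (1 + 2 ^ d)), hη', by positivity, fun y M B hB hM hp h => ?_⟩
    have hx : ∀ {k : ℤ} {M : ℝ}, |y (k + 1)| ≤ M → |y k| ≤ M →
        |(seqShift y - (2 : ℝ) ^ d • y) k| ≤ (1 + 2 ^ d) * M := by
      intro k M h1 h2
      simp only [Pi.sub_apply, Pi.smul_apply, seqShift_apply, smul_eq_mul]
      refine (abs_sub _ _).trans ?_
      rw [abs_mul, abs_of_pos h2d]
      nlinarith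
    obtain ⟨c, hc, hc'⟩ := H (seqShift y - (2 : ℝ) ^ d • y) ((1 + 2 ^ d) * M) ((1 + 2 ^ d) * B)
      (by positivity) (fun k => hx (hM _) (hM _)) (fun k hk => hx (hp _ (by omega)) (hp _ hk))
      (fun k hk => (h k hk).trans (by
        have : 0 ≤ B * (2 : ℝ) ^ ((k : ℝ) * σ) := by positivity
        nlinarith))
    obtain ⟨c', hc1, hc2⟩ := H' y M ((1 + C * (1 + 2 ^ d)) * B) c (by positivity) hM
      ((hp 0 le_rfl).trans (by nlinarith [mul_nonneg (mul_nonneg hC (by positivity : 0 ≤ 1 + (2:ℝ) ^ d)) hB]))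
      (hc.trans (by nlinarith)) (fun k hk => (hc' k hk).trans (by
        have : 0 ≤ B * (2 : ℝ) ^ ((k : ℝ) * η) := by positivity
        nlinarith))
    exact ⟨c', hc1.trans (le_of_eq (by ring)), fun k hk => (hc2 k hk).trans (le_of_eq (by ring))⟩

/-- Sequences of growth at most `2^{kη}`, controlled for `k ≥ 0`, are controlled for all `k` by a
recurrence operator applied to them that is small at `-∞`. -/
lemma seq_one_sided (ds : List ℝ) {η σ : ℝ} (hησ : η < σ) :
    ∃ C : ℝ, 0 ≤ C ∧ ∀ (y : ℤ → ℝ) (M B : ℝ), 0 ≤ B →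
      (∀ k : ℤ, |y k| ≤ M * (2 : ℝ) ^ ((k : ℝ) * η)) →
      (∀ k : ℤ, 0 ≤ k → |y k| ≤ B * (2 : ℝ) ^ ((k : ℝ) * η)) →
      (∀ k : ℤ, k ≤ 0 → |charOp seqShift ds y k| ≤ B * (2 : ℝ) ^ ((k : ℝ) * σ)) →
      ∀ k : ℤ, |y k| ≤ C * B * (2 : ℝ) ^ ((k : ℝ) * η) := by
  -- Multiplication by `2^(-kη)` makes the sequence bounded, shifts the exponents by `η`, and turns
  -- the bound on the recurrence into decay at the positive rate `σ - η`.
  obtain ⟨η', C, hη', hC, H⟩ := seq_bounded_asymptotic (ds.map (· - η)) (σ - η) (by linarith)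
  set E : ℝ := 2 ^ (-(ds.length : ℝ) * η) with hE
  have hE0 : 0 < E := Real.rpow_pos_of_pos two_pos _
  refine ⟨2 * C * (1 + E) + 1, by positivity, fun y M B hB hM hp h k => ?_⟩
  have hw : ∀ k : ℤ, (2 : ℝ) ^ (-(k : ℝ) * η) * 2 ^ ((k : ℝ) * η) = 1 := fun k => by
    rw [← Real.rpow_add two_pos]; simp
  have hw0 : ∀ k : ℤ, 0 < (2 : ℝ) ^ (-(k : ℝ) * η) := fun k => Real.rpow_pos_of_pos two_pos _
  have hz : ∀ {k : ℤ} {M : ℝ}, |y k| ≤ M * (2 : ℝ) ^ ((k : ℝ) * η) →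
      |(2 : ℝ) ^ (-(k : ℝ) * η) * y k| ≤ M := by
    intro k M h
    rw [abs_mul, abs_of_pos (hw0 k)]
    calc _ ≤ (2 : ℝ) ^ (-(k : ℝ) * η) * (M * (2 : ℝ) ^ ((k : ℝ) * η)) := by
          gcongr
      _ = M * ((2 : ℝ) ^ (-(k : ℝ) * η) * 2 ^ ((k : ℝ) * η)) := by ring
      _ = M := by rw [hw, mul_one]
  obtain ⟨c, hc, hc'⟩ := H (fun j => (2 : ℝ) ^ (-(j : ℝ) * η) * y j) M ((1 + E) * B) (by positivity)
    (fun k => hz (hM k)) (fun k hk => (hz (hp k hk)).trans (by nlinarith)) (fun k hk => by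
      have h1 := h k hk
      rw [charOp_seqShift_twist η, abs_mul, abs_of_pos (Real.rpow_pos_of_pos two_pos _)] at h1
      have h2 : |charOp seqShift (ds.map (· - η)) (fun j => (2 : ℝ) ^ (-(j : ℝ) * η) * y j) k| ≤
          (2 : ℝ) ^ (-(((k : ℝ) + ds.length) * η)) * (B * 2 ^ ((k : ℝ) * σ)) := by
        rw [Real.rpow_neg two_pos.le, inv_mul_eq_div, le_div_iff₀ (Real.rpow_pos_of_pos two_pos _)]
        linarith
      refine h2.trans ?_
      have : (2 : ℝ) ^ (-(((k : ℝ) + ds.length) * η)) * (B * 2 ^ ((k : ℝ) * σ)) =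
          E * B * 2 ^ ((k : ℝ) * (σ - η)) := by
        have : (2 : ℝ) ^ (-(((k : ℝ) + ds.length) * η)) * 2 ^ ((k : ℝ) * σ)
          = E * 2 ^ ((k : ℝ) * (σ - η)) := by
          rw [hE, ← Real.rpow_add two_pos, ← Real.rpow_add two_pos]; congr 1; ring
        linear_combination B * this
      rw [this]
      have : 0 ≤ B * (2 : ℝ) ^ ((k : ℝ) * (σ - η)) := by positivity
      nlinarith)
  rcases le_or_gt 0 k with hk | hk
  · refine (hp k hk).trans ?_
    gcongr
    have : 0 ≤ 2 * C * (1 + E) * B := by positivity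
    linarith
  · have h1 := hc' k hk.le
    have h2 : (2 : ℝ) ^ ((k : ℝ) * η') ≤ 1 := by
      apply Real.rpow_le_one_of_one_le_of_nonpos one_le_two
      have : (k : ℝ) < 0 := by exact_mod_cast hk
      nlinarith
    have h3 : |(2 : ℝ) ^ (-(k : ℝ) * η) * y k| ≤ 2 * C * (1 + E) * B := by
      have h4 : |(2 : ℝ) ^ (-(k : ℝ) * η) * y k| ≤ |(2 : ℝ) ^ (-(k : ℝ) * η) * y k - c| + |c| := by
        refine le_trans (le_of_eq ?_) (abs_add_le _ _); congr 1; ring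
      have : C * ((1 + E) * B) * (2 : ℝ) ^ ((k : ℝ) * η') ≤ C * ((1 + E) * B) :=
        mul_le_of_le_one_right (by positivity) h2
      linarith
    rw [abs_mul, abs_of_pos (hw0 k)] at h3
    have hpos : 0 < (2 : ℝ) ^ ((k : ℝ) * η) := Real.rpow_pos_of_pos two_pos _
    calc |y k| = ((2 : ℝ) ^ (-(k : ℝ) * η) * |y k|) * 2 ^ ((k : ℝ) * η) := by
          linear_combination (-|y k|) * hw k
      _ ≤ 2 * C * (1 + E) * B * 2 ^ ((k : ℝ) * η) := by gcongr
      _ ≤ _ := by gcongr; linarith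

/-- Decay at `-∞` of sequences with no mode of exponent `≤ η`. -/
lemma seq_decay (ds : List ℝ) {η σ : ℝ} (hησ : η < σ) (hds : ∀ d ∈ ds, η < d) :
    ∃ η' C : ℝ, η < η' ∧ 0 ≤ C ∧ ∀ (y : ℤ → ℝ) (B : ℝ), 0 ≤ B →
      (∀ k : ℤ, 0 ≤ k → k ≤ ds.length → |y k| ≤ B) →
      (∀ k : ℤ, k ≤ 0 → |charOp seqShift ds y k| ≤ B * (2 : ℝ) ^ ((k : ℝ) * σ)) →
      ∀ k : ℤ, k ≤ 0 → |y k| ≤ C * B * (2 : ℝ) ^ ((k : ℝ) * η') := by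
  induction ds with
  | nil =>
    refine ⟨σ, 1, hησ, zero_le_one, fun y B hB _ h k hk => ?_⟩
    simpa using h k hk
  | cons d l ih =>
    obtain ⟨η₁, C, hη, hC, H⟩ := ih (fun d' h => hds d' (List.mem_cons_of_mem _ h))
    have hd := hds d List.mem_cons_self
    -- The new rate lies strictly between `η` and both the rate of the remaining factors and `d`, so
    -- going down one scale is a contraction with a strict gain.
    obtain ⟨η', h1, h2⟩ := exists_between (lt_min hη hd)
    have h2d : (0 : ℝ) < 2 ^ d := Real.rpow_pos_of_pos two_pos _
    have hq0 : (0 : ℝ) ≤ 2 ^ (-d) := (Real.rpow_pos_of_pos two_pos _).le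
    have hqr : (2 : ℝ) ^ (-d) < 2 ^ (-η') := Real.rpow_lt_rpow_of_exponent_lt one_lt_two
      (by have := h2.trans_le (min_le_right _ _); linarith)
    have hrr : (2 : ℝ) ^ (-η₁) ≤ 2 ^ (-η') := Real.rpow_le_rpow_of_exponent_le one_le_two
      (by have := h2.trans_le (min_le_left _ _); linarith)
    have hr0 : (0 : ℝ) < 2 ^ (-η₁) := Real.rpow_pos_of_pos two_pos _
    set K := 1 + (2 : ℝ) ^ (-d) / (2 ^ (-η') - 2 ^ (-d)) with hK
    have hK1 : 0 ≤ K := by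
      have : 0 ≤ (2 : ℝ) ^ (-d) / (2 ^ (-η') - 2 ^ (-d)) := div_nonneg hq0 (by linarith)
      linarith
    set E : ℝ := max 1 (2 ^ (-η₁)) with hE
    have hE1 : 1 ≤ E := le_max_left _ _
    refine ⟨η', K * (1 + C * (1 + 2 ^ d) * E), h1, by positivity, fun y B hB hp h => ?_⟩
    -- Each factor looks one index ahead; this is why the initial values are required up to the
    -- length of the list.
    have hx := H (seqShift y - (2 : ℝ) ^ d • y) ((1 + 2 ^ d) * B) (by positivity)
      (fun k hk hk' => by
        simp only [Pi.sub_apply, Pi.smul_apply, seqShift_apply, smul_eq_mul]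
        refine (abs_sub _ _).trans ?_
        rw [abs_mul, abs_of_pos h2d]
        have := hp (k + 1) (by omega) (by simp only [List.length_cons]; push_cast; omega)
        have := hp k (by omega) (by simp only [List.length_cons]; push_cast; omega)
        nlinarith)
      (fun k hk => (h k hk).trans (by
        have : 0 ≤ B * (2 : ℝ) ^ ((k : ℝ) * σ) := by positivity
        nlinarith))
    have key := geom_decay_of_contract (C' := 1 + C * (1 + 2 ^ d) * E) hq0 hqr hrr hr0.le hB
      (by have : 0 ≤ C * (1 + 2 ^ d) * E := by positivity
          linarith)
      (z := fun j : ℕ => y (-(j : ℤ))) (by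
        have := hp 0 le_rfl (by positivity)
        have : 0 ≤ C * (1 + 2 ^ d) * E * B := by positivity
        simp only [Nat.cast_zero, neg_zero]; nlinarith) (fun j => by
        have h3 := hx (-((j + 1 : ℕ) : ℤ)) (by omega)
        simp only [Pi.sub_apply, Pi.smul_apply, seqShift_apply, smul_eq_mul] at h3
        rw [two_rpow_neg_mul] at h3
        have e : -((j + 1 : ℕ) : ℤ) + 1 = -(j : ℤ) := by push_cast; ring
        rw [e, abs_sub_comm] at h3
        have h4 := abs_sub_abs_le_abs_sub (2 ^ d * y (-((j + 1 : ℕ) : ℤ))) (y (-(j : ℤ)))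
        rw [abs_mul, abs_of_pos h2d] at h4
        rw [Real.rpow_neg two_pos.le, inv_mul_eq_div, le_div_iff₀ h2d]
        have h5 : C * ((1 + 2 ^ d) * B) * ((2 : ℝ) ^ (-η₁)) ^ (j + 1) ≤
            (1 + C * (1 + 2 ^ d) * E) * B * ((2 : ℝ) ^ (-η₁)) ^ j := by
          rw [pow_succ]
          have h6 : 0 ≤ C * (1 + 2 ^ d) * B * ((2 : ℝ) ^ (-η₁)) ^ j := by positivity
          have h7 : (2 : ℝ) ^ (-η₁) ≤ E := le_max_right _ _
          have h8 : 0 ≤ B * ((2 : ℝ) ^ (-η₁)) ^ j := by positivity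
          nlinarith [mul_le_mul_of_nonneg_left h7 h6]
        linarith)
    intro k hk
    have := key (-k).toNat
    have e : -((-k).toNat : ℤ) = k := by omega
    rw [← two_rpow_neg_mul, e] at this
    exact this.trans (le_of_eq (by ring))

/-! ### Difference operators as polynomials in a translation -/

section shift

open Polynomial

variable {E : Type*} [AddCommGroup E]

/-- Translation of functions by `b`. -/
def shiftOp (b : E) : Module.End ℝ (E → ℝ) := LinearMap.funLeft ℝ ℝ (fun z => z + b)

@[simp] lemma shiftOp_apply (b : E) (v : E → ℝ) (z : E) : shiftOp b v z = v (z + b) := rfl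

lemma shiftOp_pow_apply (b : E) (l : ℕ) (v : E → ℝ) (z : E) :
    (shiftOp b ^ l) v z = v (z + l • b) := by
  induction l generalizing v with
  | zero => simp
  | succ l ih =>
    rw [pow_succ, Module.End.mul_apply, ih, shiftOp_apply, add_assoc, succ_nsmul]

/-- The difference operator `∑ p_l v(z + l b)` attached to the polynomial `p`. -/
noncomputable def diffOp (p : ℝ[X]) (b : E) : Module.End ℝ (E → ℝ) := aeval (shiftOp b) p

lemma diffOp_apply (p : ℝ[X]) (b : E) (v : E → ℝ) (z : E) :
    diffOp p b v z = ∑ l ∈ p.support, p.coeff l * v (z + l • b) := by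
  rw [diffOp, aeval_def, eval₂_eq_sum, Polynomial.sum_def, LinearMap.sum_apply, Finset.sum_apply]
  refine Finset.sum_congr rfl fun l _ => ?_
  rw [Module.algebraMap_end_eq_smul_id, Module.End.mul_apply, LinearMap.smul_apply, Pi.smul_apply,
    LinearMap.id_apply, shiftOp_pow_apply, smul_eq_mul]

/-- The sum of the absolute values of the coefficients. -/
noncomputable def coeffNorm (p : ℝ[X]) : ℝ := ∑ l ∈ p.support, |p.coeff l|

lemma coeffNorm_nonneg (p : ℝ[X]) : 0 ≤ coeffNorm p := Finset.sum_nonneg fun _ _ => abs_nonneg _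

lemma abs_diffOp_le (p : ℝ[X]) (b : E) (v : E → ℝ) (z : E) (B : ℝ)
    (h : ∀ l ≤ p.natDegree, |v (z + l • b)| ≤ B) : |diffOp p b v z| ≤ coeffNorm p * B := by
  rw [diffOp_apply, coeffNorm, Finset.sum_mul]
  refine (Finset.abs_sum_le_sum_abs _ _).trans (Finset.sum_le_sum fun l hl => ?_)
  rw [abs_mul]
  exact mul_le_mul_of_nonneg_left (h l (le_natDegree_of_mem_supp l hl)) (abs_nonneg _)

lemma diffOp_mul (p q : ℝ[X]) (b : E) (v : E → ℝ) :
    diffOp (p * q) b v = diffOp p b (diffOp q b v) := by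
  rw [diffOp, map_mul]; rfl

/-- Replacing `X` by `X^2` doubles the step. Polynomial identities involving `expand` thereby become
relations between differences of steps `b` and `2b`. -/
lemma diffOp_expand (p : ℝ[X]) (b : E) : diffOp (expand ℝ 2 p) b = diffOp p (b + b) := by
  rw [diffOp, expand_aeval, diffOp]
  have : (shiftOp b : Module.End ℝ (E → ℝ)) ^ 2 = shiftOp (b + b) := by
    ext v z
    rw [shiftOp_pow_apply, shiftOp_apply, two_nsmul]
  rw [this]

lemma diffOp_translate (p : ℝ[X]) (b w : E) (v : E → ℝ) (z : E) :
    diffOp p b (fun y => v (y + w)) z = diffOp p b v (z + w) := by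
  simp only [diffOp_apply]
  exact Finset.sum_congr rfl fun l _ => by rw [add_right_comm]

lemma diffOp_comm (p q : ℝ[X]) (b c : E) (v : E → ℝ) :
    diffOp p b (diffOp q c v) = diffOp q c (diffOp p b v) := by
  ext z
  have : diffOp q c v = ∑ l ∈ q.support, q.coeff l • fun y => v (y + l • c) := by
    ext y; rw [diffOp_apply, Finset.sum_apply]; rfl
  rw [this, map_sum, Finset.sum_apply, diffOp_apply]
  refine Finset.sum_congr rfl fun l _ => ?_
  rw [map_smul, Pi.smul_apply, smul_eq_mul, diffOp_translate]

/-- A polynomial that agrees with `log X` to order `K` at `X = 1`. -/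
noncomputable def logPoly (K : ℕ) : ℝ[X] :=
  -∑ l ∈ Finset.range K, C (1 / ((l : ℝ) + 1)) * (1 - X) ^ (l + 1)

lemma natDegree_logPoly_le (K : ℕ) : (logPoly K).natDegree ≤ K := by
  rw [logPoly, natDegree_neg]
  refine natDegree_sum_le_of_forall_le _ _ fun l hl => ?_
  refine (natDegree_C_mul_le _ _).trans (natDegree_pow_le.trans ?_)
  have : (1 - X : ℝ[X]).natDegree ≤ 1 := by compute_degree
  have := Finset.mem_range.1 hl
  nlinarith

lemma eval_logPoly (K : ℕ) : (logPoly K).eval 1 = 0 := by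
  simp [logPoly, eval_finsetSum]

lemma derivative_logPoly (K : ℕ) :
    derivative (logPoly K) = ∑ l ∈ Finset.range K, (1 - X) ^ l := by
  rw [logPoly, derivative_neg, derivative_sum, ← Finset.sum_neg_distrib]
  refine Finset.sum_congr rfl fun l _ => ?_
  rw [derivative_C_mul, derivative_pow_succ, derivative_sub, derivative_one, derivative_X]
  have : (C (1 / ((l : ℝ) + 1)) : ℝ[X]) * C ((l : ℝ) + 1) = 1 := by
    rw [← C_mul, one_div_mul_cancel (by positivity), C_1]
  linear_combination (1 - X) ^ l * this

lemma eval_derivative_logPoly {K : ℕ} (hK : 1 ≤ K) : (derivative (logPoly K)).eval 1 = 1 := by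
  rw [derivative_logPoly, eval_finsetSum, Finset.sum_eq_single 0]
  · simp
  · intro l _ hl; simp [hl]
  · intro h; simp at h; omega

lemma X_sub_one_pow_dvd_of_derivative {p : ℝ[X]} {k : ℕ} (h1 : p.eval 1 = 0)
    (h : (X - 1) ^ k ∣ derivative p) : (X - 1) ^ (k + 1) ∣ p := by
  rcases eq_or_ne p 0 with rfl | hp
  · exact dvd_zero _
  have e : (X - 1 : ℝ[X]) = X - C 1 := by simp
  rw [e] at h ⊢
  have hroot : p.IsRoot 1 := h1
  rw [← le_rootMultiplicity_iff hp]
  have hpos : 0 < p.rootMultiplicity 1 := (rootMultiplicity_pos hp).2 hroot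
  have hd := derivative_rootMultiplicity_of_root hroot
  have hd0 : derivative p ≠ 0 := by
    intro h0
    have := derivative_eq_zero.1 h0
    rw [eq_C_of_natDegree_eq_zero this] at h1 hp
    simp at h1; simp [h1] at hp
  have := (le_rootMultiplicity_iff hd0).2 h
  omega

/-- This is `2 log X = log X^2` up to an error vanishing to order `K + 1` at `1`. The order is read
off the derivative, using `X * derivative (logPoly K) = 1 - (1 - X)^K`; the degree of `q` comes from
the degree `2K` of the expanded polynomial. -/
lemma logPoly_doubling (K : ℕ) : ∃ q : ℝ[X], q.natDegree ≤ K ∧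
    (2 : ℝ[X]) * logPoly K - expand ℝ 2 (logPoly K) = q * (X - 1) ^ (K + 1) := by
  have hdvd : (X - 1 : ℝ[X]) ^ (K + 1) ∣ (2 : ℝ[X]) * logPoly K - expand ℝ 2 (logPoly K) := by
    apply X_sub_one_pow_dvd_of_derivative
    · have : eval 1 (expand ℝ 2 (logPoly K)) = eval (1 ^ 2) (logPoly K) := expand_eval 2 _ 1
      rw [eval_sub, eval_mul, this]; simp [eval_logPoly]
    · have hX : X * derivative (logPoly K) = 1 - (1 - X) ^ K := by
        rw [derivative_logPoly]
        have := mul_neg_geom_sum (1 - X : ℝ[X]) K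
        rwa [sub_sub_cancel] at this
      have hX2 : X ^ 2 * expand ℝ 2 (derivative (logPoly K)) = 1 - (1 - X ^ 2) ^ K := by
        have := congrArg (expand ℝ 2) hX
        simpa using this
      -- Since `X` is prime to `X - 1`, divisibility may be tested after multiplication by `X`,
      -- where both derivatives are explicit.
      have hcop : IsCoprime ((X - 1 : ℝ[X]) ^ K) X :=
        IsCoprime.pow_left ⟨-1, 1, by ring⟩
      apply hcop.dvd_of_dvd_mul_left
      have h2 : derivative ((2 : ℝ[X]) * logPoly K - expand ℝ 2 (logPoly K)) =
          2 * derivative (logPoly K) - 2 * X * expand ℝ 2 (derivative (logPoly K)) := by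
        rw [derivative_sub, derivative_expand, derivative_mul]
        have : derivative (2 : ℝ[X]) = 0 := derivative_ofNat 2
        rw [this]; push_cast; ring
      have e1 : (1 - X : ℝ[X]) ^ K = (-1) ^ K * (X - 1) ^ K := by rw [← mul_pow]; congr 1; ring
      have e2 : (1 - X ^ 2 : ℝ[X]) ^ K = (X - 1) ^ K * (-(X + 1)) ^ K := by
        rw [← mul_pow]; congr 1; ring
      refine ⟨2 * ((-(X + 1)) ^ K - (-1) ^ K), ?_⟩
      rw [h2]
      linear_combination 2 * hX - 2 * hX2 + 2 * e2 - 2 * e1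
  obtain ⟨q, hq⟩ := hdvd
  refine ⟨q, ?_, by rw [hq, mul_comm]⟩
  rcases eq_or_ne q 0 with rfl | hq0
  · simp
  have e : (X - 1 : ℝ[X]) = X - C 1 := by simp
  have hm : ((X - 1 : ℝ[X]) ^ (K + 1)).Monic := by rw [e]; exact (monic_X_sub_C _).pow _
  have h1 : ((X - 1 : ℝ[X]) ^ (K + 1) * q).natDegree = (K + 1) + q.natDegree := by
    rw [hm.natDegree_mul' hq0, e, natDegree_pow, natDegree_X_sub_C, mul_one]
  have h2 : ((2 : ℝ[X]) * logPoly K - expand ℝ 2 (logPoly K)).natDegree ≤ 2 * K := by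
    refine (natDegree_sub_le _ _).trans (max_le ?_ ?_)
    · have : (2 : ℝ[X]) = C 2 := rfl
      rw [this]
      exact (natDegree_C_mul_le _ _).trans ((natDegree_logPoly_le K).trans (by omega))
    · rw [natDegree_expand]; have := natDegree_logPoly_le K; omega
  rw [hq, h1] at h2
  omega

/-- It follows from `X^2 - 1 = (X - 1)(X + 1)` and `X + 1 ≡ 2` modulo `X - 1`: a difference of order
`k` with doubled step is `2^k` times the original one, up to differences of order `k + 1`. -/
lemma X_sub_one_pow_doubling (k : ℕ) : ∃ q : ℝ[X], q.natDegree ≤ k ∧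
    expand ℝ 2 ((X - 1) ^ k) = (2 : ℝ[X]) ^ k * (X - 1) ^ k + q * (X - 1) ^ (k + 1) := by
  have e : (X - 1 : ℝ[X]) = X - C 1 := by simp
  have h1 : (X - 1 : ℝ[X]) ∣ (X + 1) ^ k - 2 ^ k := by
    have : (X - 1 : ℝ[X]) = (X + 1) - 2 := by ring
    rw [this]; exact sub_dvd_pow_sub_pow _ _ _
  obtain ⟨q, hq⟩ := h1
  refine ⟨q, ?_, ?_⟩
  · rcases eq_or_ne q 0 with rfl | hq0
    · simp
    have h2 : ((X - 1 : ℝ[X]) * q).natDegree = 1 + q.natDegree := by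
      rw [e, (monic_X_sub_C _).natDegree_mul' hq0, natDegree_X_sub_C]
    have h3 : ((X + 1 : ℝ[X]) ^ k - 2 ^ k).natDegree ≤ k := by
      have : (2 : ℝ[X]) ^ k = C (2 ^ k) := by rw [map_pow]; rfl
      rw [this]
      refine (natDegree_sub_C).le.trans (natDegree_pow_le.trans ?_)
      have : (X + 1 : ℝ[X]).natDegree ≤ 1 := by compute_degree
      nlinarith
    rw [hq, h2] at h3; omega
  · have : expand ℝ 2 ((X - 1 : ℝ[X]) ^ k) = (X - 1) ^ k * (X + 1) ^ k := by
      rw [map_pow, ← mul_pow, map_sub, expand_X, map_one]; congr 1; ring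
    rw [this]
    linear_combination (X - 1) ^ k * hq

end shift

/-! ### Derivatives as limits of difference quotients -/

section derivative

open Polynomial

lemma hasDerivAt_diffOp_step (p : ℝ[X]) {Φ : ℝ → ℝ} {c x : ℝ} (h : HasDerivAt Φ c x) :
    HasDerivAt (fun η : ℝ => diffOp p η Φ x) ((derivative p).eval 1 * c) 0 := by
  simp only [diffOp_apply, nsmul_eq_mul]
  have : (derivative p).eval 1 * c = ∑ l ∈ p.support, p.coeff l * (c * l) := by
    rw [derivative_eval, Polynomial.sum_def, Finset.sum_mul]
    exact Finset.sum_congr rfl fun l _ => by simp; ring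
  rw [this]
  refine HasDerivAt.fun_sum fun l _ => HasDerivAt.const_mul _ ?_
  have h1 : HasDerivAt (fun η : ℝ => x + l * η) (l : ℝ) 0 := by
    simpa using ((hasDerivAt_id (0 : ℝ)).const_mul (l : ℝ)).const_add x
  have h2 : HasDerivAt Φ c (x + l * 0) := by simpa using h
  exact h2.comp (0 : ℝ) h1

lemma diffOp_zero (p : ℝ[X]) (Φ : ℝ → ℝ) (x : ℝ) : diffOp p (0 : ℝ) Φ x = p.eval 1 * Φ x := by
  rw [diffOp_apply, eval_eq_sum, Polynomial.sum_def, Finset.sum_mul]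
  exact Finset.sum_congr rfl fun l _ => by simp

/-- The quotients are consistent because `logPoly` vanishes at `1` with derivative `1` there. -/
lemma tendsto_diffOp_div {K : ℕ} (hK : 1 ≤ K) {Φ : ℝ → ℝ} {c x : ℝ} (h : HasDerivAt Φ c x)
    {η : ℕ → ℝ} (hη : Tendsto η atTop (𝓝[≠] 0)) :
    Tendsto (fun k => (η k)⁻¹ * diffOp (logPoly K) (η k) Φ x) atTop (𝓝 c) := by
  have h1 := hasDerivAt_diffOp_step (logPoly K) h
  rw [eval_derivative_logPoly hK, one_mul, hasDerivAt_iff_tendsto_slope_zero] at h1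
  have h2 := h1.comp hη
  refine h2.congr fun k => ?_
  simp only [Function.comp, zero_add, diffOp_zero, eval_logPoly, zero_mul, sub_zero, smul_eq_mul]

lemma hasDerivAt_diffOp (p : ℝ[X]) (η : ℝ) {Φ f : ℝ → ℝ} (h : ∀ x, HasDerivAt Φ (f x) x) (x : ℝ) :
    HasDerivAt (fun y => diffOp p η Φ y) (diffOp p η f x) x := by
  simp only [diffOp_apply]
  refine HasDerivAt.fun_sum fun l _ => HasDerivAt.const_mul _ ?_
  exact (h (x + l • η)).comp_add_const x _

/-- Differentiability of `f` is not known beforehand. The quotients are formed for an antiderivative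
`Φ`: they converge to `f` and their derivatives, the quotients of `f`, converge uniformly to `g`, so
`f' = g`. -/
lemma hasDerivAt_of_diffOp_tendsto {K : ℕ} (hK : 1 ≤ K) {f g : ℝ → ℝ} (hf : Continuous f)
    {s : Set ℝ} (hs : IsOpen s) {η : ℕ → ℝ} (hη : Tendsto η atTop (𝓝[≠] 0))
    (h : TendstoUniformlyOn (fun k x => (η k)⁻¹ * diffOp (logPoly K) (η k) f x) g atTop s)
    {x : ℝ} (hx : x ∈ s) : HasDerivAt f (g x) x := by
  set Φ : ℝ → ℝ := fun x => ∫ t in (0 : ℝ)..x, f t with hΦ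
  have hd : ∀ x, HasDerivAt Φ (f x) x := fun x =>
    intervalIntegral.integral_hasDerivAt_right (hf.intervalIntegrable _ _)
      (hf.stronglyMeasurableAtFilter _ _) hf.continuousAt
  refine hasDerivAt_of_tendstoUniformlyOn (l := atTop)
    (f := fun k x => (η k)⁻¹ * diffOp (logPoly K) (η k) Φ x) hs h ?_ ?_ hx
  · exact Eventually.of_forall fun k x _ => (hasDerivAt_diffOp _ _ hd x).const_mul _
  · exact fun x _ => tendsto_diffOp_div hK (hd x) hη

end derivative

/-- Since `κ < k`, passing from step `2η` to `η` multiplies `φ(η) / η^κ` by `2^κ / 2^k < 1` up to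
the error `B`. The estimate descends through dyadic layers from the top layer `(η₀/2, η₀]`. -/
lemma le_of_doubling {k : ℕ} {κ η₀ : ℝ} (hκ : κ < k) (hκ0 : 0 ≤ κ) (hη : 0 < η₀) :
    ∃ C : ℝ, 0 ≤ C ∧ ∀ (φ : ℝ → ℝ) (B : ℝ), 0 ≤ B →
      (∀ η, η₀ / 2 < η → η ≤ η₀ → φ η ≤ B) →
      (∀ η, 0 < η → η ≤ η₀ / 2 → φ η ≤ (2 ^ k : ℝ)⁻¹ * φ (2 * η) + B * η ^ κ) →
      ∀ η, 0 < η → η ≤ η₀ → φ η ≤ C * B * η ^ κ := by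
  have h2 : (2 : ℝ) ^ κ / 2 ^ k < 1 := by
    rw [div_lt_one (by positivity), ← Real.rpow_natCast]
    exact Real.rpow_lt_rpow_of_exponent_lt one_lt_two hκ
  set t := (2 : ℝ) ^ κ / 2 ^ k with ht
  have ht0 : 0 < 1 - t := by linarith
  have hb : 0 < (η₀ / 2) ^ κ := Real.rpow_pos_of_pos (by positivity) _
  set C := ((η₀ / 2) ^ κ)⁻¹ + 1 / (1 - t) with hC
  have hC0 : 0 ≤ C := by positivity
  have hCt : C * t + 1 ≤ C := by
    have h3 : 1 / (1 - t) * (1 - t) = 1 := by field_simp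
    have h4 : 0 ≤ ((η₀ / 2) ^ κ)⁻¹ * (1 - t) := by positivity
    have h5 : C * (1 - t) = ((η₀ / 2) ^ κ)⁻¹ * (1 - t) + 1 / (1 - t) * (1 - t) := by rw [hC]; ring
    nlinarith
  refine ⟨C, hC0, fun φ B hB h0 h => ?_⟩
  have key : ∀ n : ℕ, ∀ η, η₀ / 2 ^ (n + 1) < η → η ≤ η₀ / 2 ^ n → φ η ≤ C * B * η ^ κ := by
    intro n
    induction n with
    | zero =>
      intro η h1 h3
      rw [zero_add, pow_one] at h1
      have hηp : 0 < η := lt_trans (by positivity) h1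
      refine (h0 η h1 (by simpa using h3)).trans ?_
      have h4 : (η₀ / 2) ^ κ ≤ η ^ κ := Real.rpow_le_rpow (by positivity) h1.le hκ0
      have h5 : 1 ≤ C * η ^ κ := by
        calc (1 : ℝ) = ((η₀ / 2) ^ κ)⁻¹ * (η₀ / 2) ^ κ := by field_simp
          _ ≤ C * η ^ κ := by
            gcongr
            rw [hC]; have : 0 ≤ 1 / (1 - t) := by positivity
            linarith
      nlinarith
    | succ n ih =>
      intro η h1 h3
      have hηp : 0 < η := lt_trans (by positivity) h1
      have h4 : η ≤ η₀ / 2 := h3.trans (by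
        apply div_le_div_of_nonneg_left hη.le two_pos
        rw [pow_succ]; nlinarith [one_le_pow₀ (M₀ := ℝ) one_le_two (n := n)])
      have h5 := ih (2 * η) (by
        rw [pow_succ, div_lt_iff₀ (by positivity)] at h1 ⊢
        rw [pow_succ] at h1
        linarith) (by
        rw [le_div_iff₀ (by positivity)] at h3 ⊢
        rw [pow_succ] at h3; linarith)
      rw [Real.mul_rpow two_pos.le hηp.le] at h5
      have hηκ : 0 ≤ B * η ^ κ := by positivity
      calc φ η ≤ (2 ^ k : ℝ)⁻¹ * φ (2 * η) + B * η ^ κ := h η hηp h4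
        _ ≤ (2 ^ k : ℝ)⁻¹ * (C * B * (2 ^ κ * η ^ κ)) + B * η ^ κ := by gcongr
        _ = (C * t + 1) * (B * η ^ κ) := by rw [ht]; field_simp
        _ ≤ C * (B * η ^ κ) := by gcongr
        _ = _ := by ring
  intro η hη0 hle
  have hlim : Tendsto (fun n : ℕ => η₀ / 2 ^ (n + 1)) atTop (𝓝 0) := by
    have := (tendsto_pow_atTop_nhds_zero_of_lt_one (r := (1/2 : ℝ)) (by norm_num) (by norm_num)).const_mul η₀
    rw [mul_zero] at this
    refine (this.comp (tendsto_add_atTop_nat 1)).congr fun n => ?_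
    simp [div_eq_mul_inv]
  have hex : ∃ n : ℕ, η₀ / 2 ^ (n + 1) < η := ((hlim.eventually_lt_const hη0)).exists
  classical
  have hn := Nat.find_spec hex
  refine key (Nat.find hex) η hn ?_
  rcases Nat.eq_zero_or_pos (Nat.find hex) with h3 | h3
  · rw [h3]; simpa using hle
  · have := Nat.find_min hex (m := Nat.find hex - 1) (by omega)
    rw [Nat.sub_add_cancel h3] at this
    exact not_lt.1 this

/-! ### Anisotropic Zygmund conditions and interior differentiability -/

section Zygmund

open Polynomial

variable {ι : Type*} [Fintype ι] [DecidableEq ι]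

/-- The partial derivative in the variable `z_i`. -/
noncomputable def pd (i : ι) (v : (ι → ℝ) → ℝ) (z : ι → ℝ) : ℝ :=
  deriv (fun s : ℝ => v (z + s • Pi.single i 1)) 0

/-- Iterated partial derivatives. -/
noncomputable def pdL : List ι → ((ι → ℝ) → ℝ) → (ι → ℝ) → ℝ
  | [], v => v
  | i :: L, v => pd i (pdL L v)

/-- A Zygmund type condition of order `τ` on differences of order `M` along the axes, with
anisotropy `a`. -/
def Zyg (M : ℕ) (a : ι → ℝ) (τ A : ℝ) (Ω : Set (ι → ℝ)) (v : (ι → ℝ) → ℝ) : Prop :=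
  ∀ i, ∀ η : ℝ, 0 < η → ∀ z ∈ Ω, z + (M : ℝ) • (η • Pi.single i (1 : ℝ)) ∈ Ω →
    |diffOp ((X - 1) ^ M) (η • Pi.single i (1 : ℝ)) v z| ≤ A * η ^ (τ / a i)

lemma mem_ball_add_smul_single {p z : ι → ℝ} {r r' s : ℝ} (hz : z ∈ Metric.ball p r') (i : ι)
    (hs : |s| ≤ r - r') : z + s • Pi.single i (1 : ℝ) ∈ Metric.ball p r := by
  rw [mem_ball_iff_norm] at hz ⊢
  have h1 : ‖s • (Pi.single i (1 : ℝ) : ι → ℝ)‖ = |s| := by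
    rw [norm_smul, Pi.norm_single]; simp
  have : z + s • Pi.single i (1 : ℝ) - p = (z - p) + s • Pi.single i 1 := by abel
  rw [this]
  refine (norm_add_le _ _).trans_lt ?_
  rw [h1]; linarith

lemma mem_ball_segment {p z : ι → ℝ} {r M η : ℝ} {i : ι} (hz : z ∈ Metric.ball p r)
    (hz' : z + M • (η • Pi.single i (1 : ℝ)) ∈ Metric.ball p r) {l : ℝ} (hl0 : 0 ≤ l) (hl : l ≤ M) :
    z + l • (η • Pi.single i (1 : ℝ)) ∈ Metric.ball p r := by
  rcases eq_or_lt_of_le (hl0.trans hl) with h | hM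
  · have : l = 0 := le_antisymm (hl.trans h.symm.le) hl0
    simpa [this] using hz
  have hc := convex_ball p r
  have := hc hz hz' (a := 1 - l / M) (b := l / M) (by rw [sub_nonneg, div_le_one hM]; exact hl)
    (by positivity) (by ring)
  convert this using 1
  rw [smul_add, ← add_assoc, ← add_smul, smul_smul (l / M) M, div_mul_cancel₀ _ hM.ne']; simp

lemma natCast_smul_eq {ι : Type*} (l : ℕ) (b : ι → ℝ) : l • b = (l : ℝ) • b := (Nat.cast_smul_eq_nsmul ℝ l b).symm

lemma diffOp_line {ι : Type*} (p : ℝ[X]) (b : ι → ℝ) (η : ℝ) (v : (ι → ℝ) → ℝ) (z : ι → ℝ) (s : ℝ) :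
    diffOp p (η • b) v (z + s • b) = diffOp p η (fun s : ℝ => v (z + s • b)) s := by
  simp only [diffOp_apply]
  refine Finset.sum_congr rfl fun l _ => ?_
  rw [add_assoc, natCast_smul_eq, smul_smul, ← add_smul, nsmul_eq_mul]

/-- A reduction to `hasDerivAt_of_diffOp_tendsto` along the line through `z`. The margin `r - r'`
keeps all points of the difference quotients in the ball where `v` is continuous. -/
lemma hasDerivAt_line_of_diffOp {K : ℕ} (hK : 1 ≤ K) {p : ι → ℝ} {r r' : ℝ} {i : ι}
    {v g : (ι → ℝ) → ℝ} (hv : ContinuousOn v (Metric.ball p r)) {η : ℕ → ℝ}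
    (hη0 : ∀ k, 0 < η k) (hη1 : ∀ k, K * η k ≤ r - r') (hη : Tendsto η atTop (𝓝 0))
    (h : TendstoUniformlyOn
      (fun k z => (η k)⁻¹ * diffOp (logPoly K) (η k • Pi.single i (1 : ℝ)) v z) g atTop
      (Metric.ball p r')) {z : ι → ℝ} (hz : z ∈ Metric.ball p r') :
    HasDerivAt (fun s : ℝ => v (z + s • Pi.single i (1 : ℝ))) (g z) 0 := by
  set e : ι → ℝ := Pi.single i 1 with he
  have hz' := mem_ball_iff_norm.1 hz
  set ε := (r' - ‖z - p‖) / 2 with hε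
  have hε0 : 0 < ε := by rw [hε]; linarith
  have hzε : z ∈ Metric.ball p (r' - ε) := by rw [mem_ball_iff_norm]; linarith
  have hK0 : 0 ≤ r - r' := le_trans (by have := hη0 0; positivity) (hη1 0)
  set c := ε + (r - r') with hc
  have hc0 : 0 < c := by linarith
  -- Clamping the parameter makes the restriction to the line continuous on all of `ℝ` without
  -- changing it at the points that the quotients see.
  set cl : ℝ → ℝ := fun s => max (-c) (min c s) with hcl
  have hclI : ∀ s, |cl s| ≤ c := fun s => abs_le.2 ⟨le_max_left _ _,
    max_le (by linarith) (min_le_left _ _)⟩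
  have hcle : ∀ s, |s| ≤ c → cl s = s := fun s hs => by
    rw [hcl]; simp only
    rw [min_eq_right (abs_le.1 hs).2, max_eq_right (abs_le.1 hs).1]
  set f : ℝ → ℝ := fun s => v (z + cl s • e) with hf
  have hfc : Continuous f := by
    refine hv.comp_continuous (by fun_prop) fun s => mem_ball_add_smul_single hzε i ?_
    have := hclI s
    linarith
  have hD : ∀ k, ∀ s ∈ Metric.ball (0 : ℝ) ε,
      diffOp (logPoly K) (η k • e) v (z + s • e) = diffOp (logPoly K) (η k) f s := by
    intro k s hs
    rw [diffOp_line, diffOp_apply, diffOp_apply]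
    refine Finset.sum_congr rfl fun l hl => ?_
    have hlK : (l : ℝ) ≤ K := by
      exact_mod_cast (le_natDegree_of_mem_supp l hl).trans (natDegree_logPoly_le K)
    have hs' : |s| < ε := by simpa using hs
    have : |s + l • η k| ≤ c := by
      rw [nsmul_eq_mul]
      refine (abs_add_le _ _).trans ?_
      rw [abs_mul, Nat.abs_cast, abs_of_pos (hη0 k)]
      have := mul_le_mul_of_nonneg_right hlK (hη0 k).le
      linarith [hη1 k]
    rw [hf]; simp only
    rw [hcle _ this]
  have hu : TendstoUniformlyOn (fun k x => (η k)⁻¹ * diffOp (logPoly K) (η k) f x)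
      (fun s => g (z + s • e)) atTop (Metric.ball 0 ε) := by
    have h1 := (h.comp (fun s : ℝ => z + s • e)).mono (s' := Metric.ball (0 : ℝ) ε) (fun s hs => by
      refine mem_ball_add_smul_single hzε i ?_
      have : |s| < ε := by simpa using hs
      linarith)
    refine h1.congr (Eventually.of_forall fun k s hs => ?_)
    simp only [Function.comp]
    rw [hD k s hs]
  have hη' : Tendsto η atTop (𝓝[≠] 0) :=
    tendsto_nhdsWithin_iff.2 ⟨hη, Eventually.of_forall fun k => (hη0 k).ne'⟩
  have hd := hasDerivAt_of_diffOp_tendsto hK hfc Metric.isOpen_ball hη' hu (x := 0)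
    (Metric.mem_ball_self hε0)
  rw [zero_smul, add_zero] at hd
  refine hd.congr_of_eventuallyEq ?_
  filter_upwards [Metric.ball_mem_nhds (0 : ℝ) hc0] with s hs
  have : |s| < c := by simpa using hs
  rw [hf]; simp only
  rw [hcle s this.le]

/-- By `logPoly_doubling` the quotients with steps `η / 2` and `η` differ by a combination of
differences of order `K + 1`, which `Zyg` controls. -/
lemma diffOp_halving (K : ℕ) : ∃ C : ℝ, 0 ≤ C ∧ ∀ (a : ι → ℝ) (τ A : ℝ) (p : ι → ℝ) (r r' : ℝ)
    (v : (ι → ℝ) → ℝ), (∀ i, 0 < a i) → 0 ≤ τ → 0 ≤ A → Zyg (K + 1) a τ A (Metric.ball p r) v →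
    ∀ i, ∀ η : ℝ, 0 < η → (K + 1) * η ≤ r - r' → ∀ z ∈ Metric.ball p r',
      |(η / 2)⁻¹ * diffOp (logPoly K) ((η / 2) • Pi.single i (1 : ℝ)) v z -
        η⁻¹ * diffOp (logPoly K) (η • Pi.single i (1 : ℝ)) v z| ≤ C * A * η ^ (τ / a i - 1) := by
  obtain ⟨q, hqd, hq⟩ := logPoly_doubling K
  refine ⟨coeffNorm q, coeffNorm_nonneg q, fun a τ A p r r' v ha hτ hA hZ i η hη hηr z hz => ?_⟩
  set b : ι → ℝ := (η / 2) • Pi.single i (1 : ℝ) with hb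
  have hbb : η • (Pi.single i (1 : ℝ) : ι → ℝ) = b + b := by rw [hb, ← add_smul, add_halves]
  have h1 : 2 * diffOp (logPoly K) b v z - diffOp (logPoly K) (b + b) v z =
      diffOp q b (diffOp ((X - 1) ^ (K + 1)) b v) z := by
    rw [← diffOp_mul, ← hq, ← diffOp_expand]
    simp only [diffOp, map_sub, map_mul, map_ofNat]
    rw [LinearMap.sub_apply, Module.End.mul_apply, Pi.sub_apply]
    congr 1
    rw [← one_add_one_eq_two, ← one_add_one_eq_two, LinearMap.add_apply, Pi.add_apply,
      Module.End.one_apply]; ring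
  rw [hbb]
  have h2 : (η / 2)⁻¹ * diffOp (logPoly K) b v z - η⁻¹ * diffOp (logPoly K) (b + b) v z =
      η⁻¹ * diffOp q b (diffOp ((X - 1) ^ (K + 1)) b v) z := by
    rw [← h1]; field_simp
  rw [h2, abs_mul, abs_of_pos (inv_pos.2 hη)]
  have h3 : |diffOp q b (diffOp ((X - 1) ^ (K + 1)) b v) z| ≤ coeffNorm q * (A * η ^ (τ / a i)) := by
    refine abs_diffOp_le _ _ _ _ _ fun l hl => ?_
    have hlK : (l : ℝ) ≤ K := by exact_mod_cast hl.trans hqd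
    have e1 : ∀ t : ℝ, z + t • b = z + (t * (η / 2)) • Pi.single i (1 : ℝ) := fun t => by
      rw [hb, smul_smul]
    rw [natCast_smul_eq]
    refine (hZ i (η / 2) (by positivity) (z + (l : ℝ) • b) ?_ ?_).trans ?_
    · rw [e1]
      refine mem_ball_add_smul_single hz i ?_
      rw [abs_of_nonneg (by positivity)]; nlinarith
    · rw [add_assoc, ← add_smul, e1]
      refine mem_ball_add_smul_single hz i ?_
      rw [abs_of_nonneg (by positivity)]; push_cast; nlinarith
    · gcongr
      · exact div_nonneg hτ (ha i).le
      · linarith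
  calc η⁻¹ * |diffOp q b (diffOp ((X - 1) ^ (K + 1)) b v) z|
      ≤ η⁻¹ * (coeffNorm q * (A * η ^ (τ / a i))) := by gcongr
    _ = _ := by rw [Real.rpow_sub hη, Real.rpow_one]; field_simp

lemma tendsto_of_halving {c ρ : ℝ} (hρ1 : ρ < 1) {F : ℕ → ℝ}
    (h : ∀ k, |F (k + 1) - F k| ≤ c * ρ ^ k) :
    ∃ g, Tendsto F atTop (𝓝 g) ∧ ∀ k, |F k - g| ≤ c * ρ ^ k / (1 - ρ) := by
  have hd : ∀ k, dist (F k) (F (k + 1)) ≤ c * ρ ^ k := fun k => by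
    rw [dist_comm, Real.dist_eq]; exact h k
  obtain ⟨g, hg⟩ := cauchySeq_tendsto_of_complete (cauchySeq_of_le_geometric ρ c hρ1 hd)
  exact ⟨g, hg, fun k => by
    rw [← Real.dist_eq]; exact dist_le_of_le_geometric_of_tendsto ρ c hρ1 hd hg k⟩

/-- Successive halvings change the quotient by a geometric sequence of ratio `2^(-ε)`, where `ε = τ
/ a i - 1` is positive because `a i < τ`. The quotients converge uniformly, and the same series
measures the error at step `η`. -/
lemma diffQuot_approx {K : ℕ} (hK : 1 ≤ K) {a : ι → ℝ} (ha : ∀ i, 0 < a i) {τ : ℝ} {i : ι}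
    (hτ : a i < τ) : ∃ C : ℝ, 0 ≤ C ∧ ∀ (r r' : ℝ), r' < r → ∀ (v : (ι → ℝ) → ℝ) (p : ι → ℝ) (A : ℝ),
      0 ≤ A → ContinuousOn v (Metric.ball p r) → Zyg (K + 1) a τ A (Metric.ball p r) v →
      (∀ z ∈ Metric.ball p r', HasDerivAt (fun s : ℝ => v (z + s • Pi.single i (1 : ℝ))) (pd i v z) 0) ∧
      ContinuousOn (pd i v) (Metric.ball p r') ∧
      ∀ z ∈ Metric.ball p r', ∀ η : ℝ, 0 < η → (K + 1) * η ≤ r - r' →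
        |η⁻¹ * diffOp (logPoly K) (η • Pi.single i (1 : ℝ)) v z - pd i v z| ≤
          C * A * η ^ (τ / a i - 1) := by
  obtain ⟨C, hC, H⟩ := diffOp_halving (ι := ι) K
  have hτ0 : 0 ≤ τ := (ha i).le.trans hτ.le
  set ε := τ / a i - 1 with hε
  have hε0 : 0 < ε := by rw [hε, sub_pos, one_lt_div (ha i)]; exact hτ
  set ρ : ℝ := 2 ^ (-ε) with hρ
  have hρ0 : 0 < ρ := Real.rpow_pos_of_pos two_pos _
  have hρ1 : ρ < 1 := two_rpow_neg_lt_one hε0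
  refine ⟨C / (1 - ρ), div_nonneg hC (by linarith), fun r r' hr v p A hA hv hZ => ?_⟩
  have hlim : ∀ z ∈ Metric.ball p r', ∀ η : ℝ, 0 < η → (K + 1) * η ≤ r - r' →
      ∃ g, Tendsto (fun k : ℕ => (η / 2 ^ k)⁻¹ *
        diffOp (logPoly K) ((η / 2 ^ k) • Pi.single i (1 : ℝ)) v z) atTop (𝓝 g) ∧
      ∀ k : ℕ, |(η / 2 ^ k)⁻¹ * diffOp (logPoly K) ((η / 2 ^ k) • Pi.single i (1 : ℝ)) v z - g| ≤
        C * A * η ^ ε * ρ ^ k / (1 - ρ) := by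
    intro z hz η hη hηr
    refine tendsto_of_halving hρ1 fun k => ?_
    have hk : η / 2 ^ k ≤ η := div_le_self hη.le (one_le_pow₀ one_le_two)
    have := H a τ A p r r' v ha hτ0 hA hZ i (η / 2 ^ k) (by positivity) (by nlinarith) z hz
    rw [div_div, ← pow_succ] at this
    refine this.trans (le_of_eq ?_)
    rw [mul_assoc (C * A)]
    congr 1
    rw [hρ, ← Real.rpow_natCast, ← Real.rpow_natCast, Real.div_rpow hη.le (by positivity),
      ← Real.rpow_mul two_pos.le, ← Real.rpow_mul two_pos.le, div_eq_mul_inv,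
      ← Real.rpow_neg two_pos.le]
    congr 2; ring
  set η₀ := (r - r') / (K + 1) with hη₀
  have hη₀0 : 0 < η₀ := div_pos (by linarith) (by positivity)
  have hη₀r : (K + 1) * η₀ ≤ r - r' := by rw [hη₀]; field_simp; rfl
  choose! g hg hgb using fun z (hz : z ∈ Metric.ball p r') => hlim z hz η₀ hη₀0 hη₀r
  have hpow : Tendsto (fun k : ℕ => ρ ^ k) atTop (𝓝 0) :=
    tendsto_pow_atTop_nhds_zero_of_lt_one hρ0.le hρ1
  have hhalf : ∀ η : ℝ, Tendsto (fun k : ℕ => η / 2 ^ k) atTop (𝓝 0) := fun η => by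
    have := (tendsto_pow_atTop_nhds_zero_of_lt_one (r := (1/2 : ℝ)) (by norm_num) (by norm_num)).const_mul η
    rw [mul_zero] at this
    exact this.congr fun n => by simp [div_eq_mul_inv]
  have hunif : TendstoUniformlyOn
      (fun (k : ℕ) z => (η₀ / 2 ^ k)⁻¹ * diffOp (logPoly K) ((η₀ / 2 ^ k) • Pi.single i (1 : ℝ)) v z) g
      atTop (Metric.ball p r') := by
    rw [Metric.tendstoUniformlyOn_iff]
    intro δ hδ
    have h1 : Tendsto (fun k : ℕ => C * A * η₀ ^ ε * ρ ^ k / (1 - ρ)) atTop (𝓝 0) := by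
      simpa using (hpow.const_mul (C * A * η₀ ^ ε)).div_const (1 - ρ)
    filter_upwards [h1.eventually_lt_const hδ] with k hk z hz
    rw [dist_comm, Real.dist_eq]
    exact (hgb z hz k).trans_lt hk
  have hder : ∀ z ∈ Metric.ball p r',
      HasDerivAt (fun s : ℝ => v (z + s • Pi.single i (1 : ℝ))) (g z) 0 := fun z hz =>
    hasDerivAt_line_of_diffOp hK hv (η := fun k => η₀ / 2 ^ k) (fun k => by positivity) (fun k => by
      have hk : η₀ / 2 ^ k ≤ η₀ := div_le_self hη₀0.le (one_le_pow₀ one_le_two)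
      have : 0 < η₀ / 2 ^ k := by positivity
      nlinarith) (hhalf η₀) hunif hz
  have hpd : ∀ z ∈ Metric.ball p r', pd i v z = g z := fun z hz => (hder z hz).deriv
  refine ⟨fun z hz => by rw [hpd z hz]; exact hder z hz, ?_, fun z hz η hη hηr => ?_⟩
  · refine (hunif.continuousOn (Eventually.of_forall fun k => ?_).frequently).congr hpd
    refine ContinuousOn.mul continuousOn_const ?_
    have : diffOp (logPoly K) ((η₀ / 2 ^ k) • Pi.single i (1 : ℝ)) v = fun z =>
        ∑ l ∈ (logPoly K).support, (logPoly K).coeff l *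
          v (z + l • ((η₀ / 2 ^ k) • Pi.single i (1 : ℝ))) := by
      ext z; rw [diffOp_apply]
    rw [this]
    refine continuousOn_finsetSum _ fun l hl => ContinuousOn.mul continuousOn_const ?_
    refine hv.comp (by fun_prop) fun z hz => ?_
    rw [natCast_smul_eq, smul_smul]
    refine mem_ball_add_smul_single hz i ?_
    rw [abs_of_nonneg (by positivity)]
    have hlK : (l : ℝ) ≤ K := by
      exact_mod_cast (le_natDegree_of_mem_supp l hl).trans (natDegree_logPoly_le K)
    have hk : η₀ / 2 ^ k ≤ η₀ := div_le_self hη₀0.le (one_le_pow₀ one_le_two)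
    have : 0 < η₀ / 2 ^ k := by positivity
    nlinarith
  -- For an arbitrary step the quotients along `η / 2^k` converge to the same derivative, so the
  -- rate is available at every admissible `η`.
  · obtain ⟨g', hg', hb⟩ := hlim z hz η hη hηr
    have h1 : Tendsto (fun k : ℕ => (η / 2 ^ k)⁻¹ *
        diffOp (logPoly K) ((η / 2 ^ k) • Pi.single i (1 : ℝ)) v z) atTop (𝓝 (g z)) := by
      refine (tendsto_diffOp_div hK (hder z hz) (η := fun k => η / 2 ^ k)
        (tendsto_nhdsWithin_iff.2 ⟨hhalf η, Eventually.of_forall fun k => ?_⟩)).congr fun k => ?_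
      · exact (by positivity : (0 : ℝ) < η / 2 ^ k).ne'
      · have := diffOp_line (logPoly K) (Pi.single i (1 : ℝ)) (η / 2 ^ k) v z 0
        rw [zero_smul, add_zero] at this
        rw [this]
    rw [hpd z hz, tendsto_nhds_unique h1 hg']
    have := hb 0
    simp only [pow_zero, div_one, mul_one] at this
    refine this.trans (le_of_eq ?_); ring

end Zygmund

section Zygmund

open Polynomial

variable {ι : Type*} [Fintype ι] [DecidableEq ι]

lemma natDegree_X_sub_one_pow (M : ℕ) : ((X - 1 : ℝ[X]) ^ M).natDegree = M := by
  have e : (X - 1 : ℝ[X]) = X - C 1 := by simp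
  rw [e, natDegree_pow, natDegree_X_sub_C, mul_one]

lemma step_le_of_mem_ball {p z : ι → ℝ} {r M ζ : ℝ} {j : ι} (hM : 1 ≤ M) (hζ : 0 < ζ)
    (hz : z ∈ Metric.ball p r) (hz' : z + M • (ζ • Pi.single j (1 : ℝ)) ∈ Metric.ball p r) :
    ζ ≤ 2 * r := by
  rw [mem_ball_iff_norm] at hz hz'
  have h1 : ‖M • (ζ • (Pi.single j (1 : ℝ) : ι → ℝ))‖ = M * ζ := by
    rw [smul_smul, norm_smul, Pi.norm_single, norm_one, mul_one, Real.norm_eq_abs,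
      abs_of_nonneg (by positivity)]
  have h2 : M • (ζ • (Pi.single j (1 : ℝ) : ι → ℝ)) =
      (z + M • (ζ • Pi.single j (1 : ℝ)) - p) - (z - p) := by abel
  have h3 := norm_sub_le (z + M • (ζ • Pi.single j (1 : ℝ)) - p) (z - p)
  rw [← h2, h1] at h3
  nlinarith

-- A derivative in direction `i` costs `a i` in the order. For a difference of step `ζ` in direction
-- `j`, `pd i v` is replaced by the quotient `D` of step `η`, and `η` is balanced with `ζ`: with `h
-- = ζ^(1 / a j)` and `η ~ h^(a i)`, both the error `pd i v - D` and the difference of `D` have size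
-- `h^(τ - a i)`.
set_option maxHeartbeats 1000000 in
lemma zyg_pd {K : ℕ} (hK : 1 ≤ K) {a : ι → ℝ} (ha : ∀ i, 0 < a i) {τ : ℝ} {i : ι}
    (hτ : a i < τ) {r r' : ℝ} (hr' : 0 < r') (hr : r' < r) : ∃ C : ℝ, 0 ≤ C ∧
      ∀ (v : (ι → ℝ) → ℝ) (p : ι → ℝ) (A : ℝ), 0 ≤ A → ContinuousOn v (Metric.ball p r) →
      (∀ z ∈ Metric.ball p r, |v z| ≤ A) → Zyg (K + 1) a τ A (Metric.ball p r) v →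
      (∀ z ∈ Metric.ball p r', HasDerivAt (fun s : ℝ => v (z + s • Pi.single i (1 : ℝ))) (pd i v z) 0) ∧
      ContinuousOn (pd i v) (Metric.ball p r') ∧ (∀ z ∈ Metric.ball p r', |pd i v z| ≤ C * A) ∧
      Zyg (K + 1) a (τ - a i) (C * A) (Metric.ball p r') (pd i v) := by
  obtain ⟨C, hC, H⟩ := diffQuot_approx hK ha hτ
  have hτ0 : 0 ≤ τ := (ha i).le.trans hτ.le
  set ε := τ / a i - 1 with hε
  set η₀ := (r - r') / (K + 1) with hη₀
  have hη₀0 : 0 < η₀ := div_pos (by linarith) (by positivity)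
  have hη₀r : (K + 1) * η₀ = r - r' := by rw [hη₀]; field_simp
  -- An upper bound for all values of `h`, because admissible steps do not exceed `2 r'`. The
  -- constant `c₀` below then keeps `η ≤ η₀`.
  set hm : ℝ := 1 + ∑ j, (2 * r') ^ (1 / a j) with hhm
  have hm0 : 0 < hm := by
    have : 0 ≤ ∑ j, (2 * r') ^ (1 / a j) := Finset.sum_nonneg fun j _ => by positivity
    linarith
  have hmj : ∀ j, (2 * r') ^ (1 / a j) ≤ hm := fun j => by
    have := Finset.single_le_sum (f := fun j => (2 * r') ^ (1 / a j))
      (fun j _ => by positivity) (Finset.mem_univ j)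
    exact this.trans (by rw [hhm]; linarith)
  set c₀ := η₀ / hm ^ a i with hc₀
  have hc₀0 : 0 < c₀ := by positivity
  set cM := coeffNorm ((X - 1 : ℝ[X]) ^ (K + 1)) with hcM
  have hcM0 : 0 ≤ cM := coeffNorm_nonneg _
  set cL := coeffNorm (logPoly K) with hcL
  have hcL0 : 0 ≤ cL := coeffNorm_nonneg _
  refine ⟨(cL / η₀ + C * η₀ ^ ε) + (cL / c₀ + cM * C * c₀ ^ ε), by positivity,
    fun v p A hA hv hvA hZ => ?_⟩
  obtain ⟨h1, h2, h3⟩ := H r r' hr v p A hA hv hZ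
  have hpt : ∀ z ∈ Metric.ball p r', ∀ η : ℝ, 0 < η → η ≤ η₀ → ∀ l ≤ (logPoly K).natDegree,
      z + l • (η • (Pi.single i (1 : ℝ) : ι → ℝ)) ∈ Metric.ball p r := by
    intro z hz η hη hη' l hl
    rw [natCast_smul_eq, smul_smul]
    refine mem_ball_add_smul_single hz i ?_
    rw [abs_of_nonneg (by positivity), ← hη₀r]
    have : (l : ℝ) ≤ K := by exact_mod_cast hl.trans (natDegree_logPoly_le K)
    nlinarith
  refine ⟨h1, h2, fun z hz => ?_, fun j ζ hζ z hz hz' => ?_⟩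
  · have h4 := h3 z hz η₀ hη₀0 hη₀r.le
    have h5 : |diffOp (logPoly K) (η₀ • Pi.single i (1 : ℝ)) v z| ≤ cL * A :=
      abs_diffOp_le _ _ _ _ _ fun l hl => hvA _ (hpt z hz η₀ hη₀0 le_rfl l hl)
    have h6 : |η₀⁻¹ * diffOp (logPoly K) (η₀ • Pi.single i (1 : ℝ)) v z| ≤ cL / η₀ * A := by
      rw [abs_mul, abs_of_pos (inv_pos.2 hη₀0), div_mul_eq_mul_div, ← div_eq_inv_mul]
      gcongr
    have h7 : |pd i v z| ≤ (cL / η₀ + C * η₀ ^ ε) * A := by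
      rw [abs_sub_comm] at h4
      have := abs_sub_abs_le_abs_sub (pd i v z)
        (η₀⁻¹ * diffOp (logPoly K) (η₀ • Pi.single i (1 : ℝ)) v z)
      linarith
    refine h7.trans (mul_le_mul_of_nonneg_right ?_ hA)
    have : 0 ≤ cL / c₀ + cM * C * c₀ ^ ε := by positivity
    linarith
  · set h := ζ ^ (1 / a j) with hh
    have hh0 : 0 < h := Real.rpow_pos_of_pos hζ _
    have hpw : ∀ x : ℝ, h ^ x = ζ ^ (x / a j) := fun x => by
      rw [hh, ← Real.rpow_mul hζ.le]; congr 1; ring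
    have hhm' : h ≤ hm := by
      refine le_trans ?_ (hmj j)
      refine Real.rpow_le_rpow hζ.le ?_ (by have := ha j; positivity)
      refine step_le_of_mem_ball (M := ((K + 1 : ℕ) : ℝ)) ?_ hζ hz hz'
      push_cast; have : (0 : ℝ) ≤ K := by positivity
      linarith
    set η := c₀ * h ^ a i with hη
    have hη0 : 0 < η := by positivity
    have hηη : η ≤ η₀ := by
      have : h ^ a i ≤ hm ^ a i := Real.rpow_le_rpow hh0.le hhm' (ha i).le
      calc η ≤ c₀ * hm ^ a i := by rw [hη]; gcongr
        _ = η₀ := by rw [hc₀]; field_simp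
    have hηr : (K + 1) * η ≤ r - r' := by rw [← hη₀r]; gcongr
    set D := (fun z => η⁻¹ * diffOp (logPoly K) (η • Pi.single i (1 : ℝ)) v z) with hD
    have hmem : ∀ l ≤ ((X - 1 : ℝ[X]) ^ (K + 1)).natDegree,
        z + l • (ζ • (Pi.single j (1 : ℝ) : ι → ℝ)) ∈ Metric.ball p r' := fun l hl => by
      rw [natCast_smul_eq]
      refine mem_ball_segment hz hz' (by positivity) ?_
      rw [natDegree_X_sub_one_pow] at hl; exact_mod_cast hl
    have h4 : |diffOp ((X - 1) ^ (K + 1)) (ζ • Pi.single j (1 : ℝ)) (pd i v - D) z| ≤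
        cM * (C * A * η ^ ε) := by
      refine abs_diffOp_le _ _ _ _ _ fun l hl => ?_
      rw [Pi.sub_apply, abs_sub_comm]
      exact h3 _ (hmem l hl) η hη0 hηr
    have h5 : |diffOp ((X - 1) ^ (K + 1)) (ζ • Pi.single j (1 : ℝ)) D z| ≤
        η⁻¹ * (cL * (A * ζ ^ (τ / a j))) := by
      have : D = η⁻¹ • diffOp (logPoly K) (η • Pi.single i (1 : ℝ)) v := rfl
      rw [this, map_smul, Pi.smul_apply, smul_eq_mul, abs_mul, abs_of_pos (inv_pos.2 hη0), diffOp_comm]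
      gcongr
      refine abs_diffOp_le _ _ _ _ _ fun l hl => hZ j ζ hζ _ (hpt z hz η hη0 hηη l hl) ?_
      rw [add_right_comm]
      exact hpt _ hz' η hη0 hηη l hl
    have e1 : η ^ ε = c₀ ^ ε * ζ ^ ((τ - a i) / a j) := by
      rw [hη, Real.mul_rpow hc₀0.le (by positivity), ← Real.rpow_mul hh0.le, hpw]
      congr 3; rw [hε]; have := (ha i).ne'; field_simp
    have e2 : η⁻¹ * ζ ^ (τ / a j) = c₀⁻¹ * ζ ^ ((τ - a i) / a j) := by
      rw [hη, mul_inv, hpw, mul_assoc, ← Real.rpow_neg hζ.le, ← Real.rpow_add hζ]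
      congr 2; ring
    have h6 : diffOp ((X - 1) ^ (K + 1)) (ζ • Pi.single j (1 : ℝ)) (pd i v) z =
        diffOp ((X - 1) ^ (K + 1)) (ζ • Pi.single j (1 : ℝ)) (pd i v - D) z +
        diffOp ((X - 1) ^ (K + 1)) (ζ • Pi.single j (1 : ℝ)) D z := by
      rw [map_sub, Pi.sub_apply, sub_add_cancel]
    rw [h6]
    refine (abs_add_le _ _).trans ((add_le_add h4 h5).trans ?_)
    have e3 : cM * (C * A * η ^ ε) + η⁻¹ * (cL * (A * ζ ^ (τ / a j))) =
        (cL / c₀ + cM * C * c₀ ^ ε) * A * ζ ^ ((τ - a i) / a j) := by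
      rw [e1]
      have : η⁻¹ * (cL * (A * ζ ^ (τ / a j))) = cL * A * (η⁻¹ * ζ ^ (τ / a j)) := by ring
      rw [this, e2]; field_simp; ring
    rw [e3]
    refine mul_le_mul_of_nonneg_right (mul_le_mul_of_nonneg_right ?_ hA)
      (Real.rpow_nonneg hζ.le _)
    have : 0 ≤ cL / η₀ + C * η₀ ^ ε := by positivity
    linarith

/-- Lowering the order of differences in a fixed direction (Marchaud's inequality). -/
lemma marchaud_step {k : ℕ} (hk : 1 ≤ k) {κ : ℝ} (hκ0 : 0 ≤ κ) (hκ : κ < k) {r r' : ℝ}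
    (hr : r' < r) : ∃ C : ℝ, 0 ≤ C ∧
      ∀ (v : (ι → ℝ) → ℝ) (p : ι → ℝ) (i : ι) (B : ℝ), 0 ≤ B →
      (∀ z ∈ Metric.ball p r, |v z| ≤ B) →
      (∀ z ∈ Metric.ball p r, ∀ η : ℝ, 0 < η →
        z + ((k + 1 : ℕ) : ℝ) • (η • Pi.single i (1 : ℝ)) ∈ Metric.ball p r →
        |diffOp ((X - 1) ^ (k + 1)) (η • Pi.single i (1 : ℝ)) v z| ≤ B * η ^ κ) →
      (∀ z ∈ Metric.ball p r', ∀ η : ℝ, 0 < η →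
        z + (k : ℝ) • (η • Pi.single i (1 : ℝ)) ∈ Metric.ball p r' →
        |diffOp ((X - 1) ^ k) (η • Pi.single i (1 : ℝ)) v z| ≤ C * B * η ^ κ) := by
  obtain ⟨q, hqd, hq⟩ := X_sub_one_pow_doubling k
  set η₀ := (r - r') / (2 * k + 1) with hη₀
  have hη₀0 : 0 < η₀ := div_pos (by linarith) (by positivity)
  have hη₀r : (2 * k + 1) * η₀ = r - r' := by rw [hη₀]; field_simp
  obtain ⟨C, hC, H⟩ := le_of_doubling hκ hκ0 hη₀0
  set cq := coeffNorm q with hcq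
  have hcq0 : 0 ≤ cq := coeffNorm_nonneg _
  set ck := coeffNorm ((X - 1 : ℝ[X]) ^ k) with hck
  have hck0 : 0 ≤ ck := coeffNorm_nonneg _
  refine ⟨C * (cq + ck) + ck * (η₀ ^ κ)⁻¹, by positivity, fun v p i B hB hvB hZ z hz η hη hz' => ?_⟩
  have hpow : (0 : ℝ) < 2 ^ k := by positivity
  -- Small steps are treated by doubling, the margin between the balls making room for it. For large
  -- steps the bound on `v` suffices.
  rcases le_or_gt η η₀ with hle | hgt
  · have hball : ∀ t : ℝ, 0 ≤ t → t ≤ (2 * k + 1) * η₀ →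
        z + t • (Pi.single i (1 : ℝ) : ι → ℝ) ∈ Metric.ball p r := fun t ht ht' =>
      mem_ball_add_smul_single hz i (by rw [abs_of_nonneg ht, ← hη₀r]; exact ht')
    have := H (fun η => |diffOp ((X - 1) ^ k) (η • Pi.single i (1 : ℝ)) v z|) ((cq + ck) * B)
      (by positivity) (fun η h1 h2 => by
        have : |diffOp ((X - 1) ^ k) (η • Pi.single i (1 : ℝ)) v z| ≤ ck * B := by
          refine abs_diffOp_le _ _ _ _ _ fun l hl => hvB _ ?_
          rw [natDegree_X_sub_one_pow] at hl
          have hl' : (l : ℝ) ≤ k := by exact_mod_cast hl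
          have : 0 ≤ (l : ℝ) := by positivity
          rw [natCast_smul_eq, smul_smul]
          exact hball _ (by nlinarith) (by nlinarith)
        refine this.trans (mul_le_mul_of_nonneg_right (by linarith) hB)) (fun η h1 h2 => by
        set b : ι → ℝ := η • Pi.single i (1 : ℝ) with hb
        have hbb : (2 * η) • (Pi.single i (1 : ℝ) : ι → ℝ) = b + b := by rw [hb, ← add_smul, two_mul]
        have h3 : diffOp ((X - 1) ^ k) (b + b) v z = 2 ^ k * diffOp ((X - 1) ^ k) b v z +
            diffOp q b (diffOp ((X - 1) ^ (k + 1)) b v) z := by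
          rw [← diffOp_expand, hq, ← diffOp_mul]
          have : (2 : ℝ[X]) ^ k = Polynomial.C (2 ^ k) := by rw [map_pow]; rfl
          rw [this, ← smul_eq_C_mul]
          simp only [diffOp, map_add, map_smul]; rfl
        have h4 : |diffOp q b (diffOp ((X - 1) ^ (k + 1)) b v) z| ≤ cq * (B * η ^ κ) := by
          refine abs_diffOp_le _ _ _ _ _ fun l hl => ?_
          have hl' : (l : ℝ) ≤ k := by exact_mod_cast hl.trans hqd
          have hl0 : 0 ≤ (l : ℝ) := by positivity
          have hk0 : (0 : ℝ) ≤ k := by positivity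
          rw [natCast_smul_eq]
          refine hZ _ ?_ η h1 ?_
          · rw [hb, smul_smul]
            exact hball _ (by positivity) (by nlinarith)
          · rw [hb, add_assoc, smul_smul, smul_smul, ← add_smul]
            refine hball _ (by positivity) ?_
            push_cast; nlinarith
        rw [hbb]
        have h5 : diffOp ((X - 1) ^ k) b v z = (2 ^ k)⁻¹ * (diffOp ((X - 1) ^ k) (b + b) v z -
            diffOp q b (diffOp ((X - 1) ^ (k + 1)) b v) z) := by rw [h3]; field_simp; ring
        have h6 : |diffOp ((X - 1) ^ k) b v z| ≤ (2 ^ k)⁻¹ * (|diffOp ((X - 1) ^ k) (b + b) v z| +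
            cq * (B * η ^ κ)) := by
          conv_lhs => rw [h5]
          rw [abs_mul, abs_of_pos (inv_pos.2 hpow)]
          gcongr
          exact (abs_sub _ _).trans (by gcongr)
        refine h6.trans ?_
        rw [mul_add]
        have h7 : (2 ^ k : ℝ)⁻¹ ≤ 1 := inv_le_one_of_one_le₀ (one_le_pow₀ one_le_two)
        have h8 : 0 ≤ B * η ^ κ := by positivity
        have h9 : (2 ^ k : ℝ)⁻¹ * (cq * (B * η ^ κ)) ≤ (cq + ck) * (B * η ^ κ) := by
          rw [← mul_assoc]
          refine mul_le_mul_of_nonneg_right ?_ h8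
          nlinarith
        linarith) η hη hle
    refine this.trans (le_trans (le_of_eq (by ring : _ = C * (cq + ck) * B * η ^ κ)) ?_)
    gcongr
    have : 0 ≤ ck * (η₀ ^ κ)⁻¹ := by positivity
    linarith
  · have h1 : |diffOp ((X - 1) ^ k) (η • Pi.single i (1 : ℝ)) v z| ≤ ck * B := by
      refine abs_diffOp_le _ _ _ _ _ fun l hl => hvB _ ?_
      rw [natDegree_X_sub_one_pow] at hl
      rw [natCast_smul_eq]
      exact Metric.ball_subset_ball hr.le (mem_ball_segment hz hz' (by positivity) (by exact_mod_cast hl))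
    have h2 : 1 ≤ (η₀ ^ κ)⁻¹ * η ^ κ := by
      rw [← div_eq_inv_mul, one_le_div (by positivity)]
      exact Real.rpow_le_rpow hη₀0.le hgt.le hκ0
    calc _ ≤ ck * B := h1
      _ ≤ ck * B * ((η₀ ^ κ)⁻¹ * η ^ κ) := le_mul_of_one_le_right (by positivity) h2
      _ = ck * (η₀ ^ κ)⁻¹ * B * η ^ κ := by ring
      _ ≤ _ := by
        gcongr
        have : 0 ≤ C * (cq + ck) := by positivity
        linarith

/-- Repeated use of `marchaud_step` through nested balls. The exponent `κ < 1` stays below the order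
of the difference down to order one. -/
lemma marchaud (j : ℕ) {κ : ℝ} (hκ0 : 0 ≤ κ) (hκ : κ < 1) {r r' : ℝ}
    (hr : r' < r) : ∃ C : ℝ, 0 ≤ C ∧
      ∀ (v : (ι → ℝ) → ℝ) (p : ι → ℝ) (i : ι) (B : ℝ), 0 ≤ B →
      (∀ z ∈ Metric.ball p r, |v z| ≤ B) →
      (∀ z ∈ Metric.ball p r, ∀ η : ℝ, 0 < η →
        z + ((j + 1 : ℕ) : ℝ) • (η • Pi.single i (1 : ℝ)) ∈ Metric.ball p r →
        |diffOp ((X - 1) ^ (j + 1)) (η • Pi.single i (1 : ℝ)) v z| ≤ B * η ^ κ) →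
      (∀ z ∈ Metric.ball p r', ∀ η : ℝ, 0 < η → z + η • Pi.single i (1 : ℝ) ∈ Metric.ball p r' →
        |v (z + η • Pi.single i (1 : ℝ)) - v z| ≤ C * B * η ^ κ) := by
  induction j generalizing r with
  | zero =>
    refine ⟨1, zero_le_one, fun v p i B hB hvB hZ z hz η hη hz' => ?_⟩
    have hs := Metric.ball_subset_ball (x := p) hr.le
    have := hZ z (hs hz) η hη (by simpa using hs hz')
    rw [zero_add, pow_one] at this
    simpa [diffOp] using this
  | succ j ih =>
    obtain ⟨s, h1, h2⟩ := exists_between hr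
    obtain ⟨C, hC, H⟩ := ih h1
    obtain ⟨C', hC', H'⟩ := marchaud_step (ι := ι) (k := j + 1) (by omega) hκ0
      (hκ.trans_le (by push_cast; have : (0:ℝ) ≤ j := by positivity
                       linarith)) h2
    refine ⟨C * (1 + C'), by positivity, fun v p i B hB hvB hZ z hz η hη hz' => ?_⟩
    have h3 := H' v p i B hB hvB hZ
    refine (H v p i ((1 + C') * B) (by positivity) (fun z hz => ?_) (fun z hz η hη hz' => ?_)
      z hz η hη hz').trans (le_of_eq (by ring))
    · have := hvB z (Metric.ball_subset_ball h2.le hz); nlinarith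
    · refine (h3 z hz η hη hz').trans ?_
      gcongr; linarith

/-- Interior regularity: all derivatives of order less than `τ`. -/
lemma zyg_pdL {K : ℕ} (hK : 1 ≤ K) {a : ι → ℝ} (ha : ∀ i, 0 < a i) {τ : ℝ} (L : List ι)
    (hτ : (L.map a).sum < τ) {r r' : ℝ} (hr' : 0 < r') (hr : r' < r) : ∃ C : ℝ, 0 ≤ C ∧
      ∀ (v : (ι → ℝ) → ℝ) (p : ι → ℝ) (A : ℝ), 0 ≤ A → ContinuousOn v (Metric.ball p r) →
      (∀ z ∈ Metric.ball p r, |v z| ≤ A) → Zyg (K + 1) a τ A (Metric.ball p r) v →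
      ContinuousOn (pdL L v) (Metric.ball p r') ∧ (∀ z ∈ Metric.ball p r', |pdL L v z| ≤ C * A) ∧
      Zyg (K + 1) a (τ - (L.map a).sum) (C * A) (Metric.ball p r') (pdL L v) := by
  induction L generalizing r' with
  | nil =>
    refine ⟨1, zero_le_one, fun v p A hA hv hvA hZ => ?_⟩
    have hs := Metric.ball_subset_ball (x := p) hr.le
    simp only [pdL, one_mul, List.map_nil, List.sum_nil, sub_zero]
    exact ⟨hv.mono hs, fun z hz => hvA z (hs hz), fun i η hη z hz hz' => hZ i η hη z (hs hz) (hs hz')⟩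
  | cons i L ih =>
    rw [List.map_cons, List.sum_cons] at hτ
    obtain ⟨s, h1, h2⟩ := exists_between hr
    obtain ⟨C, hC, H⟩ := ih (by have := ha i; linarith) (hr'.trans h1) h2
    obtain ⟨C', hC', H'⟩ := zyg_pd hK ha (τ := τ - (L.map a).sum) (i := i) (by linarith) hr' h1
    refine ⟨C' * C, by positivity, fun v p A hA hv hvA hZ => ?_⟩
    obtain ⟨a1, a2, a3⟩ := H v p A hA hv hvA hZ
    obtain ⟨-, b2, b3, b4⟩ := H' (pdL L v) p (C * A) (by positivity) a1 a2 a3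
    refine ⟨b2, fun z hz => (b3 z hz).trans (le_of_eq (by ring)), ?_⟩
    have e : τ - ((i :: L).map a).sum = τ - (L.map a).sum - a i := by
      rw [List.map_cons, List.sum_cons]; ring
    rw [e, mul_assoc]
    exact b4

end Zygmund

/-! ### Taylor approximation, differences and interpolation in one variable -/

section OneDim

open Polynomial

lemma degree_C_mul_le_degree (c : ℝ) (p : ℝ[X]) : (C c * p).degree ≤ p.degree := by
  rw [← smul_eq_C_mul]; exact degree_smul_le c p

lemma contDiff_polynomial (q : ℝ[X]) (n : WithTop ℕ∞) : ContDiff ℝ n (fun s => q.eval s) := by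
  simpa [coe_aeval_eq_eval] using q.contDiff_aeval (𝕜 := ℝ) n

/-- Each factor `X - 1` replaces `q` by `taylor η q - q`, in which the leading terms cancel. -/
lemma diffOp_X_sub_one_pow_polynomial (M : ℕ) (q : ℝ[X]) (hq : q.degree < M) (η : ℝ) :
    diffOp ((X - 1) ^ M) η (fun s => q.eval s) = 0 := by
  induction M generalizing q with
  | zero =>
    have : q = 0 := by rw [← degree_eq_bot]; simpa using hq
    subst this
    ext s; simp [diffOp_apply]
  | succ M ih =>
    have h1 : diffOp (X - 1) η (fun s => q.eval s) = fun s => (taylor η q - q).eval s := by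
      ext s; simp [diffOp, taylor_eval]
    rw [pow_succ, diffOp_mul, h1]
    apply ih
    rcases eq_or_ne q 0 with rfl | hq0
    · simp
    have h2 : (taylor η q - q).degree < (taylor η q).degree :=
      degree_sub_lt_left (degree_taylor q η) (by rwa [Ne, taylor_eq_zero]) (by rw [leadingCoeff_taylor])
    rw [degree_taylor] at h2
    have h3 : q.degree ≤ M := by
      rw [degree_eq_natDegree hq0] at hq ⊢
      have := WithBot.coe_lt_coe.1 hq
      exact WithBot.coe_le_coe.2 (Nat.lt_succ_iff.1 this)
    exact h2.trans_le h3

lemma iteratedDeriv_polynomial (q : ℝ[X]) (k : ℕ) :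
    iteratedDeriv k (fun s : ℝ => q.eval s) = fun s => (derivative^[k] q).eval s := by
  induction k with
  | zero => simp
  | succ k ih =>
    rw [iteratedDeriv_succ, ih, Function.iterate_succ_apply']
    ext s; exact Polynomial.deriv _

lemma iteratedDeriv_polynomial_eq_zero {q : ℝ[X]} {k : ℕ} (hq : q.degree < k) (s : ℝ) :
    iteratedDeriv k (fun s : ℝ => q.eval s) s = 0 := by
  rw [iteratedDeriv_polynomial, iterate_derivative_eq_zero_of_degree_lt hq]; exact eval_zero

lemma exists_taylor_polynomial {f : ℝ → ℝ} {J : Set ℝ} (hJ : IsOpen J) {m : ℕ} (hm : 1 ≤ m)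
    {a b A : ℝ} (hab : a < b) (hI : Icc a b ⊆ J) (hf : ContDiffOn ℝ m f J)
    (hA : ∀ s ∈ Icc a b, |iteratedDeriv m f s| ≤ A) :
    ∃ q : ℝ[X], q.degree < m ∧ ∀ s ∈ Icc a b, |f s - q.eval s| ≤ A * (b - a) ^ m := by
  obtain ⟨n, rfl⟩ : ∃ n, m = n + 1 := ⟨m - 1, by omega⟩
  refine ⟨∑ k ∈ Finset.range (n + 1), C (((k.factorial : ℝ))⁻¹ *
    iteratedDerivWithin k f (Icc a b) a) * (X - C a) ^ k, ?_, fun s hs => ?_⟩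
  · refine lt_of_le_of_lt (degree_sum_le _ _) ?_
    rw [Finset.sup_lt_iff (WithBot.bot_lt_coe _)]
    intro k hk
    refine lt_of_le_of_lt (degree_C_mul_le_degree _ _) ?_
    rw [degree_pow, degree_X_sub_C, nsmul_one]
    exact_mod_cast Finset.mem_range.1 hk
  · have h0 : 0 ≤ A := (abs_nonneg _).trans (hA s hs)
    have h1 := taylor_mean_remainder_bound (f := f) (n := n) hab.le
      (by exact_mod_cast hf.mono hI) hs (C := A) (fun y hy => by
        rw [iteratedDerivWithin_eq_iteratedDeriv (uniqueDiffOn_Icc hab)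
          (hf.contDiffAt (hJ.mem_nhds (hI hy))) hy]
        exact hA y hy)
    rw [Real.norm_eq_abs, taylor_within_apply] at h1
    have h2 : (∑ k ∈ Finset.range (n + 1), C (((k.factorial : ℝ))⁻¹ *
        iteratedDerivWithin k f (Icc a b) a) * (X - C a) ^ k).eval s =
        ∑ k ∈ Finset.range (n + 1), (((k.factorial : ℝ))⁻¹ * (s - a) ^ k) •
          iteratedDerivWithin k f (Icc a b) a := by
      rw [eval_finsetSum]
      refine Finset.sum_congr rfl fun k _ => ?_
      simp; ring
    rw [h2]
    refine h1.trans ?_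
    have h3 : (1 : ℝ) ≤ n.factorial := by exact_mod_cast Nat.one_le_iff_ne_zero.2 n.factorial_ne_zero
    have h4 : (s - a) ^ (n + 1) ≤ (b - a) ^ (n + 1) :=
      pow_le_pow_left₀ (by linarith [hs.1]) (by linarith [hs.2]) _
    refine (div_le_self (mul_nonneg h0 (pow_nonneg (by linarith [hs.1]) _)) h3).trans ?_
    gcongr

/-- Functions with Hölder continuous derivative of order `m` satisfy the difference condition. -/
lemma abs_diffOp_le_of_holder {m M : ℕ} (hm : 1 ≤ m) (hmM : m < M) {κ : ℝ} (hκ : 0 ≤ κ) :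
    ∃ C : ℝ, 0 ≤ C ∧ ∀ (f : ℝ → ℝ) (J : Set ℝ) (A x η : ℝ), IsOpen J → 0 < η →
      Icc x (x + M * η) ⊆ J → ContDiffOn ℝ m f J → 0 ≤ A →
      (∀ s ∈ Icc x (x + M * η), |iteratedDeriv m f s - iteratedDeriv m f x| ≤ A * |s - x| ^ κ) →
      |diffOp ((X - 1) ^ M) η f x| ≤ C * A * η ^ (m + κ) := by
  refine ⟨coeffNorm ((X - 1) ^ M) * (M : ℝ) ^ κ * (M : ℝ) ^ m,
    by have := coeffNorm_nonneg ((X - 1 : ℝ[X]) ^ M); positivity,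
    fun f J A x η hJ hη hI hf hA h => ?_⟩
  have hM0 : (0 : ℝ) < M := by exact_mod_cast (by omega : 0 < M)
  have hab : x < x + M * η := by nlinarith [mul_pos hM0 hη]
  -- The monomial carries the value of the `m`-th derivative at `x`. What is left has a derivative
  -- of size `A (Mη)^κ`, so it is close to a polynomial of degree below `m`; both polynomials are
  -- killed by the difference.
  set q₀ : ℝ[X] := C (iteratedDeriv m f x / m.factorial) * X ^ m with hq₀
  have hq₀d : ∀ s, iteratedDeriv m (fun s => q₀.eval s) s = iteratedDeriv m f x := by
    intro s
    rw [iteratedDeriv_polynomial, hq₀]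
    simp only [iterate_derivative_C_mul, iterate_derivative_X_pow_eq_C_mul, Nat.sub_self, pow_zero,
      mul_one, eval_mul, eval_C, Nat.descFactorial_self]
    field_simp
  have hcd : ∀ {q : ℝ[X]}, ContDiff ℝ m (fun s => q.eval s) := fun {q} => contDiff_polynomial q m
  obtain ⟨q, hq, hqb⟩ := exists_taylor_polynomial hJ hm (A := A * (M * η) ^ κ) hab hI
    (f := f - fun s => q₀.eval s) (hf.sub hcd.contDiffOn) (fun s hs => by
      rw [iteratedDeriv_sub (hf.contDiffAt (hJ.mem_nhds (hI hs))) hcd.contDiffAt, hq₀d]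
      refine (h s hs).trans ?_
      gcongr
      rw [abs_of_nonneg (by linarith [hs.1])]; linarith [hs.2])
  have hq0 : q₀.degree < M := by
    refine lt_of_le_of_lt (degree_C_mul_X_pow_le _ _) ?_
    exact_mod_cast hmM
  have hq' : q.degree < M := hq.trans (by exact_mod_cast hmM)
  have e : diffOp ((X - 1) ^ M) η f x =
      diffOp ((X - 1) ^ M) η (f - (fun s => q₀.eval s) - fun s => q.eval s) x := by
    rw [map_sub, map_sub, diffOp_X_sub_one_pow_polynomial M q₀ hq0,
      diffOp_X_sub_one_pow_polynomial M q hq', sub_zero, sub_zero]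
  rw [e]
  have h1 : |diffOp ((X - 1) ^ M) η (f - (fun s => q₀.eval s) - fun s => q.eval s) x| ≤
      coeffNorm ((X - 1) ^ M) * (A * (M * η) ^ κ * (M * η) ^ m) := by
    refine abs_diffOp_le _ _ _ _ _ fun l hl => ?_
    rw [natDegree_X_sub_one_pow] at hl
    have hl' : (l : ℝ) ≤ M := by exact_mod_cast hl
    have := hqb (x + l • η) (by
      rw [nsmul_eq_mul]
      exact ⟨by nlinarith [(by positivity : (0 : ℝ) ≤ l * η)], by gcongr⟩)
    rwa [add_sub_cancel_left] at this
  refine h1.trans (le_of_eq ?_)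
  rw [Real.mul_rpow hM0.le hη.le, mul_pow, Real.rpow_add hη, Real.rpow_natCast]
  ring

/-- The functions `1, s, …, s^(m-1), F`. -/
def basisFun (m : ℕ) (F : ℝ → ℝ) (b : Fin (m + 1)) (s : ℝ) : ℝ :=
  if (b : ℕ) < m then s ^ (b : ℕ) else F s

lemma exists_coeff_basisFun (m : ℕ) (F : ℝ → ℝ) (q : ℝ[X]) (hq : q.degree < m) (c : ℝ) :
    ∃ w : Fin (m + 1) → ℝ, ∀ s, q.eval s + c * F s = ∑ b, w b * basisFun m F b s := by
  refine ⟨Fin.snoc (α := fun _ => ℝ) (fun b : Fin m => q.coeff b) c, fun s => ?_⟩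
  rw [Fin.sum_univ_castSucc]
  simp only [Fin.snoc_castSucc, Fin.snoc_last, basisFun, Fin.val_castSucc, Fin.is_lt, if_true,
    Fin.val_last, lt_irrefl, if_false]
  congr 1
  rcases Nat.eq_zero_or_pos m with rfl | hm
  · have : q = 0 := by rw [← degree_eq_bot]; simpa using hq
    simp [this]
  rw [eval_eq_sum_range' (n := m), Finset.sum_range]
  rcases eq_or_ne q 0 with rfl | hq0
  · simpa using hm
  · rwa [natDegree_lt_iff_degree_lt hq0]

/-- Interpolation in the span of `1, s, …, s^(m-1), F`. -/
lemma exists_interpolation {m : ℕ} (hm : 1 ≤ m) {J : Set ℝ} (hJ : IsOpen J) {a b : ℝ} (hab : a < b)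
    (hI : Icc a b ⊆ J) {F : ℝ → ℝ} (hF : ContDiffOn ℝ m F J)
    (hF0 : ∀ s ∈ Icc a b, iteratedDeriv m F s ≠ 0) :
    ∃ (node : Fin (m + 1) → ℝ) (w : Fin (m + 1) → Fin (m + 1) → ℝ) (C : ℝ), 0 ≤ C ∧
      (∀ k, node k ∈ Icc a b) ∧
      (∀ k, ∀ s ∈ Icc a b, |∑ j, w k j * basisFun m F j s| ≤ C) ∧
      ∀ (f : ℝ → ℝ) (c A : ℝ), 0 ≤ A → ContDiffOn ℝ m f J →
        (∀ s ∈ Icc a b, |iteratedDeriv m f s - c * iteratedDeriv m F s| ≤ A) →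
        (∀ s ∈ Icc a b, |f s - ∑ k, f (node k) * ∑ j, w k j * basisFun m F j s| ≤ C * A) ∧
        (∀ B, (∀ s ∈ Icc a b, |f s| ≤ B) → |c| ≤ C * (A + B)) := by
  classical
  have hm0 : (0 : ℝ) < m := by exact_mod_cast hm
  set x : Fin m → ℝ := fun k => a + (b - a) * (k / m) with hx
  have hxI : ∀ k, x k ∈ Icc a b := fun k => by
    have h1 : ((k : ℕ) : ℝ) / m ≤ 1 := by
      rw [div_le_one hm0]; exact_mod_cast k.2.le
    have h2 : (0 : ℝ) ≤ (k : ℕ) / m := by positivity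
    constructor
    · rw [hx]; simp only; nlinarith
    · rw [hx]; simp only; nlinarith
  have hinj : Set.InjOn x (Finset.univ : Finset (Fin m)) := by
    intro i _ j _ hij
    simp only [hx, add_right_inj] at hij
    have h1 := mul_left_cancel₀ (by linarith : b - a ≠ 0) hij
    rw [div_left_inj' hm0.ne'] at h1
    exact Fin.ext (by exact_mod_cast h1)
  set β : Fin m → ℝ[X] := fun k => Lagrange.basis Finset.univ x k with hβ
  have hβd : ∀ k, (β k).degree < m := fun k => by
    rw [hβ]
    simp only
    rw [Lagrange.degree_basis hinj (Finset.mem_univ k), Finset.card_univ, Fintype.card_fin]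
    exact_mod_cast Nat.sub_lt hm one_pos
  set Lp : (ℝ → ℝ) → ℝ[X] := fun f => ∑ k, C (f (x k)) * β k with hLp
  have hLpd : ∀ f, (Lp f).degree < m := fun f => by
    refine lt_of_le_of_lt (degree_sum_le _ _) ?_
    rw [Finset.sup_lt_iff (WithBot.bot_lt_coe _)]
    exact fun k _ => lt_of_le_of_lt (degree_C_mul_le_degree _ _) (hβd k)
  have hLq : ∀ q : ℝ[X], q.degree < m → Lp (fun s => q.eval s) = q := fun q hq => by
    have := Lagrange.eq_interpolate (f := q) hinj
      (by rwa [Finset.card_univ, Fintype.card_fin])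
    rw [Lagrange.interpolate_apply] at this
    exact this.symm
  have hLe : ∀ f s, (Lp f).eval s = ∑ k, f (x k) * (β k).eval s := fun f s => by
    rw [hLp]; simp only [eval_finsetSum, eval_mul, eval_C]
  -- If `F` agreed with its Lagrange polynomial on the interval, its `m`-th derivative would vanish
  -- in the interior. The point `y` is the additional node.
  obtain ⟨y, hy, hyF⟩ : ∃ y ∈ Icc a b, F y ≠ (Lp F).eval y := by
    by_contra! h
    have hmid : (a + b) / 2 ∈ Ioo a b := ⟨by linarith, by linarith⟩
    apply hF0 _ (Ioo_subset_Icc_self hmid)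
    have : F =ᶠ[𝓝 ((a + b) / 2)] fun s => (Lp F).eval s := by
      filter_upwards [isOpen_Ioo.mem_nhds hmid] with s hs using h s (Ioo_subset_Icc_self hs)
    rw [this.iteratedDeriv_eq, iteratedDeriv_polynomial_eq_zero (hLpd F)]
  set D := F y - (Lp F).eval y with hD
  have hD0 : D ≠ 0 := sub_ne_zero.2 hyF
  -- the interpolation functions
  set ℓq : Fin (m + 1) → ℝ[X] := Fin.snoc (α := fun _ => ℝ[X])
    (fun k => β k + C ((β k).eval y / D) * Lp F) (-(C (1 / D) * Lp F)) with hℓq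
  set ℓc : Fin (m + 1) → ℝ := Fin.snoc (α := fun _ => ℝ) (fun k => -((β k).eval y / D)) (1 / D) with hℓc
  have hℓqd : ∀ k, (ℓq k).degree < m := fun k => by
    refine Fin.lastCases ?_ (fun k => ?_) k
    · rw [hℓq, Fin.snoc_last, degree_neg]
      exact lt_of_le_of_lt (degree_C_mul_le_degree _ _) (hLpd F)
    · rw [hℓq, Fin.snoc_castSucc]
      exact lt_of_le_of_lt (degree_add_le _ _)
        (max_lt (hβd k) (lt_of_le_of_lt (degree_C_mul_le_degree _ _) (hLpd F)))
  choose w hw using fun k => exists_coeff_basisFun m F (ℓq k) (hℓqd k) (ℓc k)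
  set node : Fin (m + 1) → ℝ := Fin.snoc (α := fun _ => ℝ) x y with hnode
  have hnI : ∀ k, node k ∈ Icc a b := fun k => by
    refine Fin.lastCases ?_ (fun k => ?_) k
    · rw [hnode, Fin.snoc_last]; exact hy
    · rw [hnode, Fin.snoc_castSucc]; exact hxI k
  -- The interpolant is the Lagrange polynomial plus the multiple of `F - Lp F` that matches `f` at
  -- `y`. It reproduces polynomials of degree below `m` and `F` itself.
  have hIf : ∀ (f : ℝ → ℝ) s, ∑ k, f (node k) * ∑ j, w k j * basisFun m F j s =
      (Lp f).eval s + (f y - (Lp f).eval y) / D * (F s - (Lp F).eval s) := by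
    intro f s
    simp only [← hw]
    rw [Fin.sum_univ_castSucc]
    simp only [hnode, hℓq, hℓc, Fin.snoc_castSucc, Fin.snoc_last, eval_add, eval_mul, eval_C, eval_neg]
    have e1 : ∑ k, f (x k) * ((β k).eval s + (β k).eval y / D * (Lp F).eval s +
        -((β k).eval y / D) * F s) = ∑ k, f (x k) * (β k).eval s +
        (∑ k, f (x k) * (β k).eval y) * (((Lp F).eval s - F s) / D) := by
      rw [Finset.sum_mul, ← Finset.sum_add_distrib]
      refine Finset.sum_congr rfl fun k _ => ?_
      field_simp; ring
    rw [e1, ← hLe, ← hLe]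
    field_simp; ring
  have hFc : ContinuousOn F (Icc a b) := hF.continuousOn.mono hI
  have hbd : ∀ k, ∃ C, ∀ s ∈ Icc a b, |∑ j, w k j * basisFun m F j s| ≤ C := fun k => by
    have hc : ContinuousOn (fun s => (ℓq k).eval s + ℓc k * F s) (Icc a b) :=
      (ℓq k).continuousOn.add (continuousOn_const.mul hFc)
    obtain ⟨C, hC⟩ := isCompact_Icc.exists_bound_of_continuousOn hc
    exact ⟨C, fun s hs => by rw [← hw]; exact hC s hs⟩
  choose Ck hCk using hbd
  have hCk0 : ∀ k, 0 ≤ Ck k := fun k => (abs_nonneg _).trans (hCk k a ⟨le_rfl, hab.le⟩)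
  set Λ := ∑ k, Ck k with hΛ
  have hΛ0 : 0 ≤ Λ := Finset.sum_nonneg fun k _ => hCk0 k
  set P := (b - a) ^ m with hP
  have hP0 : 0 ≤ P := pow_nonneg (by linarith) m
  set Y := ∑ k, |(β k).eval y| with hY
  have hY0 : 0 ≤ Y := Finset.sum_nonneg fun k _ => abs_nonneg _
  have hLy : ∀ (f : ℝ → ℝ) B, (∀ s ∈ Icc a b, |f s| ≤ B) → |(Lp f).eval y| ≤ Y * B := by
    intro f B hB
    rw [hLe, hY, Finset.sum_mul]
    refine (Finset.abs_sum_le_sum_abs _ _).trans (Finset.sum_le_sum fun k _ => ?_)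
    rw [abs_mul, mul_comm]
    exact mul_le_mul_of_nonneg_left (hB _ (hxI k)) (abs_nonneg _)
  set W := (1 + Y) * (1 + P) / |D| with hW
  have hW0 : 0 ≤ W := by positivity
  refine ⟨node, w, Λ + (1 + Λ) * P + W, by positivity, hnI, fun k s hs => ?_, fun f c A hA hf h => ?_⟩
  · refine (hCk k s hs).trans ((Finset.single_le_sum (fun k _ => hCk0 k) (Finset.mem_univ k)).trans ?_)
    have : 0 ≤ (1 + Λ) * P + W := by positivity
    linarith
  -- Since `f - c F` has `m`-th derivative at most `A`, it equals a polynomial `q` up to a remainder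
  -- `g` of size `A P`. Interpolation leaves `q` and `c F` unchanged, so only `g` enters the error.
  · have hcF : ContDiffOn ℝ m (fun s => c * F s) J := contDiffOn_const.mul hF
    obtain ⟨q, hq, hqb⟩ := exists_taylor_polynomial hJ hm (A := A) hab hI
      (f := f - fun s => c * F s) (hf.sub hcF) (fun s hs => by
        have hs' := hJ.mem_nhds (hI hs)
        rw [iteratedDeriv_sub (hf.contDiffAt hs') (hcF.contDiffAt hs'), iteratedDeriv_const_mul_field]
        exact h s hs)
    set g : ℝ → ℝ := fun s => f s - c * F s - q.eval s with hg
    have hgb : ∀ s ∈ Icc a b, |g s| ≤ A * P := hqb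
    have hfg : ∀ s, f s = g s + c * F s + q.eval s := fun s => by rw [hg]; ring
    have hLf : ∀ s, (Lp f).eval s = (Lp g).eval s + c * (Lp F).eval s + q.eval s := fun s => by
      conv_rhs => rw [← hLq q hq]
      simp only [hLe]
      rw [Finset.mul_sum, ← Finset.sum_add_distrib, ← Finset.sum_add_distrib]
      exact Finset.sum_congr rfl fun k _ => by rw [hfg]; ring
    constructor
    · intro s hs
      have e1 : f s - ∑ k, f (node k) * ∑ j, w k j * basisFun m F j s =
          g s - ∑ k, g (node k) * ∑ j, w k j * basisFun m F j s := by
        rw [hIf, hIf, hLf, hLf, hfg s, hfg y]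
        have : F y - (Lp F).eval y = D := rfl
        field_simp
        rw [hD]; ring
      rw [e1]
      have h2 : |∑ k, g (node k) * ∑ j, w k j * basisFun m F j s| ≤ A * P * Λ := by
        rw [hΛ, Finset.mul_sum]
        refine (Finset.abs_sum_le_sum_abs _ _).trans (Finset.sum_le_sum fun k _ => ?_)
        rw [abs_mul]
        exact mul_le_mul (hgb _ (hnI k)) (hCk k s hs) (abs_nonneg _) (by positivity)
      refine (abs_sub _ _).trans ((add_le_add (hgb s hs) h2).trans ?_)
      have : 0 ≤ (Λ + W) * A := by positivity
      nlinarith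
    · intro B hB
      have hB0 : 0 ≤ B := (abs_nonneg _).trans (hB a ⟨le_rfl, hab.le⟩)
      -- The Lagrange defect at `y` vanishes on polynomials of degree below `m` and equals `D ≠ 0`
      -- on `F`; it therefore isolates the coefficient `c`.
      have e1 : c * D = (f y - (Lp f).eval y) - (g y - (Lp g).eval y) := by
        rw [hfg y, hLf, hD]; ring
      have h1 : |c * D| ≤ (1 + Y) * (B + A * P) := by
        rw [e1]
        have a1 := abs_sub (f y - (Lp f).eval y) (g y - (Lp g).eval y)
        have a2 := abs_sub (f y) ((Lp f).eval y)
        have a3 := abs_sub (g y) ((Lp g).eval y)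
        have a4 := hB y hy
        have a5 := hLy f B hB
        have a6 := hgb y hy
        have a7 := hLy g _ hgb
        nlinarith
      rw [abs_mul] at h1
      have hDp : 0 < |D| := abs_pos.2 hD0
      have h2 : |c| ≤ W * (A + B) := by
        rw [hW, div_mul_eq_mul_div, le_div_iff₀ hDp]
        refine h1.trans ?_
        rw [mul_assoc]
        gcongr
        nlinarith [mul_nonneg hP0 hB0]
      refine h2.trans (mul_le_mul_of_nonneg_right ?_ (by positivity))
      have : 0 ≤ Λ + (1 + Λ) * P := by positivity
      linarith

end OneDim

/-! ### Frames and approximation by the kernel -/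

/-- One-dimensional data for each coordinate: the order `m i`, a function `F i` whose derivative of
order `m i` does not vanish, an open set `J i` containing the interval `[lo i, hi i]`, and a Hölder
exponent `κ i`. -/
structure Frame (ι : Type*) where
  m : ι → ℕ
  F : ι → ℝ → ℝ
  J : ι → Set ℝ
  lo : ι → ℝ
  hi : ι → ℝ
  κ : ι → ℝ
  one_le_m : ∀ i, 1 ≤ m i
  isOpen_J : ∀ i, IsOpen (J i)
  lo_lt_hi : ∀ i, lo i < hi i
  Icc_subset : ∀ i, Icc (lo i) (hi i) ⊆ J i
  contDiffOn_F : ∀ i, ContDiffOn ℝ (m i) (F i) (J i)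
  deriv_F_ne : ∀ i, ∀ s ∈ Icc (lo i) (hi i), iteratedDeriv (m i) (F i) s ≠ 0
  κ_nonneg : ∀ i, 0 ≤ κ i
  holder_F : ∀ i, ∃ C : ℝ, ∀ s ∈ Icc (lo i) (hi i), ∀ s' ∈ Icc (lo i) (hi i),
    |iteratedDeriv (m i) (F i) s - iteratedDeriv (m i) (F i) s'| ≤ C * |s - s'| ^ κ i

namespace Frame

variable {ι : Type*} [Fintype ι] [DecidableEq ι] (f : Frame ι)

/-- The closed box. -/
def box : Set (ι → ℝ) := {z | ∀ i, z i ∈ Icc (f.lo i) (f.hi i)}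

/-- The quotient of the derivatives of order `m i` of `v` in the variable `z_i` and of `F i`. -/
noncomputable def ratio (v : (ι → ℝ) → ℝ) (i : ι) (z : ι → ℝ) (s : ℝ) : ℝ :=
  iteratedDeriv (f.m i) (fun s => v (Function.update z i s)) s / iteratedDeriv (f.m i) (f.F i) s

/-- Hölder continuity of the quotients `ratio` along the coordinate axes. -/
def IsHolder (A : ℝ) (v : (ι → ℝ) → ℝ) : Prop :=
  ∀ i, ∀ z ∈ f.box, ContDiffOn ℝ (f.m i) (fun s => v (Function.update z i s)) (f.J i) ∧
    ∀ s ∈ Icc (f.lo i) (f.hi i), ∀ s' ∈ Icc (f.lo i) (f.hi i),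
      |f.ratio v i z s - f.ratio v i z s'| ≤ A * |s - s'| ^ f.κ i

/-- The product functions annihilated by the Hölder conditions. -/
def kerFun (b : ∀ i, Fin (f.m i + 1)) (z : ι → ℝ) : ℝ :=
  ∏ i, basisFun (f.m i) (f.F i) (b i) (z i)

/-- The span of the functions `kerFun`. -/
def ker : Submodule ℝ ((ι → ℝ) → ℝ) := Submodule.span ℝ (range f.kerFun)

variable {f}

lemma update_mem_box {z : ι → ℝ} (hz : z ∈ f.box) {i : ι} {s : ℝ}
    (hs : s ∈ Icc (f.lo i) (f.hi i)) : Function.update z i s ∈ f.box := by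
  intro j
  rcases eq_or_ne j i with rfl | h
  · simpa using hs
  · simpa [h] using hz j

lemma exists_abs_deriv_F_le (f : Frame ι) (i : ι) : ∃ C : ℝ, 0 ≤ C ∧ ∀ s ∈ Icc (f.lo i) (f.hi i),
    |iteratedDeriv (f.m i) (f.F i) s| ≤ C := by
  have h := (f.contDiffOn_F i).continuousOn_iteratedDerivWithin le_rfl (f.isOpen_J i).uniqueDiffOn
  have h2 : ContinuousOn (iteratedDeriv (f.m i) (f.F i)) (Icc (f.lo i) (f.hi i)) :=
    (h.congr fun s hs => (iteratedDerivWithin_of_isOpen (f.isOpen_J i) hs).symm).mono (f.Icc_subset i)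
  obtain ⟨C, hC⟩ := isCompact_Icc.exists_bound_of_continuousOn h2
  exact ⟨C, (norm_nonneg _).trans (hC _ ⟨le_rfl, (f.lo_lt_hi i).le⟩), hC⟩

/-- On a bounded interval the Hölder condition makes the ratio constant up to `O(A)`, so along each
line the derivative is `O(A)`-close to a fixed multiple of that of `F i`. This is the hypothesis of
`exists_interpolation`. -/
lemma IsHolder.abs_sub_le (f : Frame ι) (i : ι) : ∃ C : ℝ, 0 ≤ C ∧ ∀ (v : (ι → ℝ) → ℝ) (A : ℝ), 0 ≤ A →
    f.IsHolder A v → ∀ z ∈ f.box, ∀ s ∈ Icc (f.lo i) (f.hi i), ∀ s' ∈ Icc (f.lo i) (f.hi i),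
    |iteratedDeriv (f.m i) (fun s => v (Function.update z i s)) s -
      f.ratio v i z s' * iteratedDeriv (f.m i) (f.F i) s| ≤ C * A := by
  obtain ⟨C, hC, hb⟩ := f.exists_abs_deriv_F_le i
  have hp : 0 ≤ (f.hi i - f.lo i) ^ f.κ i := Real.rpow_nonneg (by linarith [f.lo_lt_hi i]) _
  refine ⟨(f.hi i - f.lo i) ^ f.κ i * C, by positivity, fun v A hA hv z hz s hs s' hs' => ?_⟩
  have h0 := f.deriv_F_ne i s hs
  have : iteratedDeriv (f.m i) (fun s => v (Function.update z i s)) s -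
      f.ratio v i z s' * iteratedDeriv (f.m i) (f.F i) s =
      (f.ratio v i z s - f.ratio v i z s') * iteratedDeriv (f.m i) (f.F i) s := by
    rw [sub_mul]; congr 1; rw [ratio, div_mul_cancel₀ _ h0]
  rw [this, abs_mul]
  have h1 := (hv i z hz).2 s hs s' hs'
  have h2 : |s - s'| ^ f.κ i ≤ (f.hi i - f.lo i) ^ f.κ i := by
    refine Real.rpow_le_rpow (abs_nonneg _) ?_ (f.κ_nonneg i)
    rw [abs_le]; constructor <;> linarith [hs.1, hs.2, hs'.1, hs'.2]
  calc _ ≤ (A * (f.hi i - f.lo i) ^ f.κ i) * C :=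
        mul_le_mul (h1.trans (by gcongr)) (hb s hs) (abs_nonneg _) (by positivity)
    _ = _ := by ring

/-- Product functions in the variables `S` with coefficients depending on the other variables. -/
def partialKer (f : Frame ι) (S : Finset ι) : Submodule ℝ ((ι → ℝ) → ℝ) :=
  Submodule.span ℝ {G | ∃ (b : ∀ i, Fin (f.m i + 1)) (g : (ι → ℝ) → ℝ),
    (∀ i ∈ S, ∀ z s, g (Function.update z i s) = g z) ∧
    G = fun z => (∏ i ∈ S, basisFun (f.m i) (f.F i) (b i) (z i)) * g z}

/-- Interpolation in the variable `z_j`. -/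
def interp (f : Frame ι) (j : ι) (node : Fin (f.m j + 1) → ℝ)
    (w : Fin (f.m j + 1) → Fin (f.m j + 1) → ℝ) : Module.End ℝ ((ι → ℝ) → ℝ) where
  toFun v z := ∑ k, v (Function.update z j (node k)) *
    ∑ b, w k b * basisFun (f.m j) (f.F j) b (z j)
  map_add' v v' := by
    ext z; simp only [Pi.add_apply, add_mul, Finset.sum_add_distrib]
  map_smul' c v := by
    ext z; simp only [Pi.smul_apply, smul_eq_mul, RingHom.id_apply, Finset.mul_sum, mul_assoc]

/-- Interpolation freezes `z j` at the nodes inside the coefficient and puts the dependence on `z j`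
into basis functions; the variables already treated are untouched. -/
lemma interp_mem_partialKer {S : Finset ι} {j : ι} (hj : j ∉ S) (node : Fin (f.m j + 1) → ℝ)
    (w : Fin (f.m j + 1) → Fin (f.m j + 1) → ℝ) {v : (ι → ℝ) → ℝ} (hv : v ∈ f.partialKer S) :
    f.interp j node w v ∈ f.partialKer (insert j S) := by
  induction hv using Submodule.span_induction with
  | mem v hv =>
    obtain ⟨b, g, hg, rfl⟩ := hv
    have : f.interp j node w (fun z => (∏ i ∈ S, basisFun (f.m i) (f.F i) (b i) (z i)) * g z) =
        ∑ k, ∑ c, w k c • fun z => (∏ i ∈ insert j S, basisFun (f.m i) (f.F i)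
          (Function.update b j c i) (z i)) * g (Function.update z j (node k)) := by
      ext z
      simp only [interp, LinearMap.coe_mk, AddHom.coe_mk, Finset.sum_apply, Pi.smul_apply, smul_eq_mul]
      refine Finset.sum_congr rfl fun k _ => ?_
      rw [Finset.mul_sum]
      refine Finset.sum_congr rfl fun c _ => ?_
      rw [Finset.prod_insert hj, Function.update_self]
      have e1 : ∏ i ∈ S, basisFun (f.m i) (f.F i) (b i) (Function.update z j (node k) i) =
          ∏ i ∈ S, basisFun (f.m i) (f.F i) (Function.update b j c i) (z i) :=
        Finset.prod_congr rfl fun i hi => by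
          have : i ≠ j := fun h => hj (h ▸ hi)
          rw [Function.update_of_ne this, Function.update_of_ne this]
      rw [e1]; ring
    rw [this]
    refine Submodule.sum_mem _ fun k _ => Submodule.sum_mem _ fun c _ => Submodule.smul_mem _ _
      (Submodule.subset_span ⟨Function.update b j c, fun z => g (Function.update z j (node k)),
        fun i hi z s => ?_, rfl⟩)
    simp only
    rcases eq_or_ne i j with rfl | hij
    · rw [Function.update_idem]
    · rw [Function.update_comm hij]
      exact hg i (Finset.mem_of_mem_insert_of_ne hi hij) _ _
  | zero => rw [map_zero]; exact zero_mem _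
  | add v w _ _ h1 h2 => rw [map_add]; exact add_mem h1 h2
  | smul c v _ h => rw [map_smul]; exact Submodule.smul_mem _ _ h

/-- One variable is treated at a time. The interpolation in `z j` is applied to the approximant `K`,
not to `v`; the error is the one-variable interpolation error of `v` plus the interpolant of `v -
K`, which is bounded because the nodes stay in the box. -/
lemma exists_partialKer_approx (f : Frame ι) (S : Finset ι) : ∃ C : ℝ, 0 ≤ C ∧
    ∀ (v : (ι → ℝ) → ℝ) (A : ℝ), 0 ≤ A → f.IsHolder A v →
      ∃ K ∈ f.partialKer S, ∀ z ∈ f.box, |v z - K z| ≤ C * A := by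
  induction S using Finset.induction_on with
  | empty =>
    refine ⟨0, le_rfl, fun v A hA hv => ⟨v, Submodule.subset_span
      ⟨fun i => 0, v, by simp, by simp⟩, by simp⟩⟩
  | insert j S hj ih =>
    obtain ⟨C, hC, H⟩ := ih
    obtain ⟨C₁, hC₁, H₁⟩ := IsHolder.abs_sub_le f j
    obtain ⟨node, w, C₂, hC₂, hn, hw, H₂⟩ := exists_interpolation (f.one_le_m j) (f.isOpen_J j)
      (f.lo_lt_hi j) (f.Icc_subset j) (f.contDiffOn_F j) (f.deriv_F_ne j)
    refine ⟨C₂ * C₁ + (f.m j + 1) * (C * C₂), by positivity, fun v A hA hv => ?_⟩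
    obtain ⟨K, hK, hKb⟩ := H v A hA hv
    refine ⟨f.interp j node w K, interp_mem_partialKer hj node w hK, fun z hz => ?_⟩
    have hlo : f.lo j ∈ Icc (f.lo j) (f.hi j) := ⟨le_rfl, (f.lo_lt_hi j).le⟩
    have h1 := (H₂ (fun s => v (Function.update z j s)) (f.ratio v j z (f.lo j)) (C₁ * A)
      (by positivity) (hv j z hz).1 (fun s hs => H₁ v A hA hv z hz s hs _ hlo)).1 (z j) (hz j)
    rw [Function.update_eq_self] at h1
    have h2 : |∑ k, (v (Function.update z j (node k)) - K (Function.update z j (node k))) *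
        ∑ b, w k b * basisFun (f.m j) (f.F j) b (z j)| ≤ (f.m j + 1) * (C * C₂) * A := by
      refine (Finset.abs_sum_le_sum_abs _ _).trans ?_
      have : ∀ k ∈ (Finset.univ : Finset (Fin (f.m j + 1))),
          |(v (Function.update z j (node k)) - K (Function.update z j (node k))) *
          ∑ b, w k b * basisFun (f.m j) (f.F j) b (z j)| ≤ C * A * C₂ := fun k _ => by
        rw [abs_mul]
        exact mul_le_mul (hKb _ (update_mem_box hz (hn k))) (hw k _ (hz j)) (abs_nonneg _)
          (by positivity)
      refine (Finset.sum_le_sum this).trans (le_of_eq ?_)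
      rw [Finset.sum_const, Finset.card_univ, Fintype.card_fin, nsmul_eq_mul]; push_cast; ring
    have e : v z - f.interp j node w K z =
        (v z - ∑ k, v (Function.update z j (node k)) * ∑ b, w k b * basisFun (f.m j) (f.F j) b (z j)) +
        ∑ k, (v (Function.update z j (node k)) - K (Function.update z j (node k))) *
        ∑ b, w k b * basisFun (f.m j) (f.F j) b (z j) := by
      simp only [interp, LinearMap.coe_mk, AddHom.coe_mk, sub_mul, Finset.sum_sub_distrib]; ring
    rw [e]
    refine (abs_add_le _ _).trans ((add_le_add h1 h2).trans (le_of_eq ?_)); ring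

lemma eq_of_forall_update_eq {g : (ι → ℝ) → ℝ} (S : Finset ι)
    (hg : ∀ i ∈ S, ∀ z s, g (Function.update z i s) = g z) (z z' : ι → ℝ) :
    g (S.piecewise z' z) = g z := by
  induction S using Finset.induction_on with
  | empty => simp
  | insert j S hj ih =>
    rw [Finset.piecewise_insert, hg j (Finset.mem_insert_self _ _)]
    exact ih fun i hi => hg i (Finset.mem_insert_of_mem hi)

lemma partialKer_univ_le (f : Frame ι) : f.partialKer Finset.univ ≤ f.ker := by
  refine Submodule.span_le.2 ?_
  rintro _ ⟨b, g, hg, rfl⟩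
  have : (fun z => (∏ i, basisFun (f.m i) (f.F i) (b i) (z i)) * g z) = g 0 • f.kerFun b := by
    ext z
    have := eq_of_forall_update_eq Finset.univ hg z 0
    rw [Finset.piecewise_univ] at this
    rw [Pi.smul_apply, smul_eq_mul, kerFun, this, mul_comm]
  rw [this]
  exact Submodule.smul_mem _ _ (Submodule.subset_span (mem_range_self b))

/-- Approximation by elements of the kernel. -/
lemma exists_ker_approx (f : Frame ι) : ∃ C : ℝ, 0 ≤ C ∧
    ∀ (v : (ι → ℝ) → ℝ) (A : ℝ), 0 ≤ A → f.IsHolder A v →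
      ∃ K ∈ f.ker, ∀ z ∈ f.box, |v z - K z| ≤ C * A := by
  obtain ⟨C, hC, H⟩ := f.exists_partialKer_approx Finset.univ
  exact ⟨C, hC, fun v A hA hv => let ⟨K, hK, h⟩ := H v A hA hv; ⟨K, f.partialKer_univ_le hK, h⟩⟩

lemma contDiffOn_basisFun (f : Frame ι) (i : ι) (b : Fin (f.m i + 1)) :
    ContDiffOn ℝ (f.m i) (basisFun (f.m i) (f.F i) b) (f.J i) := by
  by_cases h : (b : ℕ) < f.m i
  · have : basisFun (f.m i) (f.F i) b = fun s => s ^ (b : ℕ) := by ext s; simp [basisFun, h]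
    rw [this]; exact (contDiff_id.pow _).contDiffOn
  · have : basisFun (f.m i) (f.F i) b = f.F i := by ext s; simp [basisFun, h]
    rw [this]; exact f.contDiffOn_F i

lemma exists_iteratedDeriv_basisFun (f : Frame ι) (i : ι) (b : Fin (f.m i + 1)) :
    ∃ c : ℝ, ∀ s, iteratedDeriv (f.m i) (basisFun (f.m i) (f.F i) b) s =
      c * iteratedDeriv (f.m i) (f.F i) s := by
  by_cases h : (b : ℕ) < f.m i
  · refine ⟨0, fun s => ?_⟩
    have : basisFun (f.m i) (f.F i) b = fun s => ((Polynomial.X : Polynomial ℝ) ^ (b : ℕ)).eval s := by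
      ext s; simp [basisFun, h]
    rw [this, iteratedDeriv_polynomial_eq_zero, zero_mul]
    rw [Polynomial.degree_X_pow]; exact_mod_cast h
  · refine ⟨1, fun s => ?_⟩
    have : basisFun (f.m i) (f.F i) b = f.F i := by ext s; simp [basisFun, h]
    rw [this, one_mul]

lemma kerFun_update (f : Frame ι) (b : ∀ i, Fin (f.m i + 1)) (z : ι → ℝ) (i : ι) (s : ℝ) :
    f.kerFun b (Function.update z i s) =
      (∏ j ∈ Finset.univ.erase i, basisFun (f.m j) (f.F j) (b j) (z j)) *
        basisFun (f.m i) (f.F i) (b i) s := by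
  rw [kerFun, ← Finset.mul_prod_erase _ _ (Finset.mem_univ i), Function.update_self, mul_comm]
  congr 1
  exact Finset.prod_congr rfl fun j hj => by rw [Function.update_of_ne (Finset.ne_of_mem_erase hj)]

lemma IsHolder.sub {A B : ℝ} {v w : (ι → ℝ) → ℝ} (hv : f.IsHolder A v) (hw : f.IsHolder B w) :
    f.IsHolder (A + B) (v - w) := by
  intro i z hz
  obtain ⟨h1, h2⟩ := hv i z hz
  obtain ⟨h3, h4⟩ := hw i z hz
  refine ⟨h1.sub h3, fun s hs s' hs' => ?_⟩
  have hr : ∀ s ∈ Icc (f.lo i) (f.hi i), f.ratio (v - w) i z s = f.ratio v i z s - f.ratio w i z s := by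
    intro s hs
    have hs' := (f.isOpen_J i).mem_nhds (f.Icc_subset i hs)
    rw [ratio, ratio, ratio, ← sub_div, ← iteratedDeriv_sub (h1.contDiffAt hs') (h3.contDiffAt hs')]
    rfl
  rw [hr s hs, hr s' hs', add_mul]
  have : f.ratio v i z s - f.ratio w i z s - (f.ratio v i z s' - f.ratio w i z s') =
      (f.ratio v i z s - f.ratio v i z s') - (f.ratio w i z s - f.ratio w i z s') := by ring
  rw [this]
  exact (abs_sub _ _).trans (add_le_add (h2 s hs s' hs') (h4 s hs s' hs'))

lemma IsHolder.smul {A : ℝ} {v : (ι → ℝ) → ℝ} (c : ℝ) (hv : f.IsHolder A v) :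
    f.IsHolder (|c| * A) (c • v) := by
  intro i z hz
  obtain ⟨h1, h2⟩ := hv i z hz
  refine ⟨contDiffOn_const.mul h1, fun s hs s' hs' => ?_⟩
  have hr : ∀ s, f.ratio (c • v) i z s = c * f.ratio v i z s := by
    intro s
    rw [ratio, ratio, ← mul_div_assoc, ← iteratedDeriv_const_mul_field]
    rfl
  rw [hr s, hr s', ← mul_sub, abs_mul, mul_assoc]
  exact mul_le_mul_of_nonneg_left (h2 s hs s' hs') (abs_nonneg _)

/-- Along an axis a kernel function is a multiple of a basis function, whose ratio is a constant;
the Hölder constant is therefore `0`. -/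
lemma isHolder_of_mem_ker {K : (ι → ℝ) → ℝ} (hK : K ∈ f.ker) : f.IsHolder 0 K := by
  have h0 : f.IsHolder 0 (0 : (ι → ℝ) → ℝ) := by
    intro i z hz
    refine ⟨contDiffOn_const, fun s hs s' hs' => ?_⟩
    simp [ratio]
  induction hK using Submodule.span_induction with
  | mem v hv =>
    obtain ⟨b, rfl⟩ := hv
    intro i z hz
    have he : (fun s => f.kerFun b (Function.update z i s)) = fun s =>
      (∏ j ∈ Finset.univ.erase i, basisFun (f.m j) (f.F j) (b j) (z j)) *
        basisFun (f.m i) (f.F i) (b i) s := by ext s; exact f.kerFun_update b z i s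
    refine ⟨?_, fun s hs s' hs' => ?_⟩
    · rw [he]; exact contDiffOn_const.mul (f.contDiffOn_basisFun i (b i))
    · obtain ⟨c, hc⟩ := f.exists_iteratedDeriv_basisFun i (b i)
      have h1 := f.deriv_F_ne i s hs
      have h2 := f.deriv_F_ne i s' hs'
      rw [ratio, ratio, he, iteratedDeriv_const_mul_field, iteratedDeriv_const_mul_field, hc, hc,
        zero_mul]
      field_simp
      simp
  | zero => exact h0
  | add v w _ _ h1 h2 =>
    have := h1.sub (h0.sub h2)
    simpa using this
  | smul c v _ h => simpa using h.smul c

lemma continuousOn_of_mem_ker {K : (ι → ℝ) → ℝ} (hK : K ∈ f.ker) : ContinuousOn K f.box := by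
  induction hK using Submodule.span_induction with
  | mem v hv =>
    obtain ⟨b, rfl⟩ := hv
    refine continuousOn_finsetProd _ fun i _ => ?_
    exact ((f.contDiffOn_basisFun i (b i)).continuousOn.mono (f.Icc_subset i)).comp
      (continuous_apply i).continuousOn fun z hz => hz i
  | zero => exact continuousOn_const
  | add v w _ _ h1 h2 => exact h1.add h2
  | smul c v _ h => exact h.const_smul c

end Frame

/-! ### Interior estimates modulo the kernel -/

section Regularity

variable {ι : Type*} [Fintype ι] [DecidableEq ι]

/-- All the successive derivatives of `v` along the list `L` exist in `Ω`. -/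
def PdReg : List ι → Set (ι → ℝ) → ((ι → ℝ) → ℝ) → Prop
  | [], _, _ => True
  | i :: L, Ω, v => PdReg L Ω v ∧
      ∀ z ∈ Ω, DifferentiableAt ℝ (fun s : ℝ => pdL L v (z + s • Pi.single i 1)) 0

lemma PdReg.mono {L : List ι} {Ω Ω' : Set (ι → ℝ)} {v : (ι → ℝ) → ℝ} (h : PdReg L Ω v)
    (hs : Ω' ⊆ Ω) : PdReg L Ω' v := by
  induction L with
  | nil => trivial
  | cons i L ih => exact ⟨ih h.1, fun z hz => h.2 z (hs hz)⟩

lemma eventually_line_mem {Ω : Set (ι → ℝ)} (hΩ : IsOpen Ω) {z : ι → ℝ} (hz : z ∈ Ω) (b : ι → ℝ) :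
    ∀ᶠ s : ℝ in 𝓝 0, z + s • b ∈ Ω := by
  have h : ContinuousAt (fun s : ℝ => z + s • b) 0 := by fun_prop
  exact h.preimage_mem_nhds (by simpa using hΩ.mem_nhds hz)

lemma pdL_sub {L : List ι} {Ω : Set (ι → ℝ)} (hΩ : IsOpen Ω) {v w : (ι → ℝ) → ℝ}
    (hv : PdReg L Ω v) (hw : PdReg L Ω w) : ∀ z ∈ Ω, pdL L (v - w) z = pdL L v z - pdL L w z := by
  induction L with
  | nil => intro z _; rfl
  | cons i L ih =>
    intro z hz
    have h := ih hv.1 hw.1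
    have he : (fun s : ℝ => pdL L (v - w) (z + s • Pi.single i 1)) =ᶠ[𝓝 0]
        (fun s : ℝ => pdL L v (z + s • Pi.single i 1)) -
          (fun s : ℝ => pdL L w (z + s • Pi.single i 1)) := by
      filter_upwards [eventually_line_mem hΩ hz (Pi.single i 1)] with s hs using h _ hs
    change deriv _ 0 = deriv _ 0 - deriv _ 0
    rw [he.deriv_eq, deriv_sub (hv.2 z hz) (hw.2 z hz)]

lemma list_sum_nonneg {a : ι → ℝ} (ha : ∀ i, 0 < a i) (L : List ι) : 0 ≤ (L.map a).sum := by
  induction L with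
  | nil => simp
  | cons i L ih => simpa using add_nonneg (ha i).le ih

lemma pdReg_of_zyg {K : ℕ} (hK : 1 ≤ K) {a : ι → ℝ} (ha : ∀ i, 0 < a i) {τ : ℝ} (L : List ι)
    (hτ : (L.map a).sum < τ) {r r' : ℝ} (hr' : 0 < r') (hr : r' < r) {v : (ι → ℝ) → ℝ} {p : ι → ℝ}
    {A : ℝ} (hA : 0 ≤ A) (hv : ContinuousOn v (Metric.ball p r))
    (hb : ∀ z ∈ Metric.ball p r, |v z| ≤ A) (hz : Zyg (K + 1) a τ A (Metric.ball p r) v) :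
    PdReg L (Metric.ball p r') v := by
  induction L generalizing r' with
  | nil => trivial
  | cons i L ih =>
    have hs : a i + (L.map a).sum < τ := by simpa using hτ
    have hL : (L.map a).sum < τ := by linarith [ha i]
    refine ⟨ih hL hr' hr, ?_⟩
    set ρ := (r' + r) / 2 with hρ
    have h1 : r' < ρ := by rw [hρ]; linarith
    have h2 : ρ < r := by rw [hρ]; linarith
    obtain ⟨C, hC, HC⟩ := zyg_pdL hK ha L hL (hr'.trans h1) h2
    obtain ⟨c1, c2, c3⟩ := HC v p A hA hv hb hz
    obtain ⟨C', hC', HC'⟩ := zyg_pd (i := i) hK ha (τ := τ - (L.map a).sum) (by linarith) hr' h1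
    intro z hz
    exact ((HC' _ p (C * A) (by positivity) c1 c2 c3).1 z hz).differentiableAt

namespace Frame

lemma update_eq_line (z : ι → ℝ) (i : ι) (s : ℝ) :
    Function.update z i s = z + (s - z i) • Pi.single i (1 : ℝ) := by
  ext j
  rcases eq_or_ne j i with rfl | h
  · simp
  · simp [h]

/-- The bound on `v` makes the ratio bounded, by the coefficient estimate in `exists_interpolation`.
The derivative of order `m i` is the ratio times that of `F i`, hence a product of bounded Hölder
functions, and the one-variable difference estimate applies. -/
lemma IsHolder.abs_diffOp_le (f : Frame ι) {K : ℕ} (i : ι) (hK : f.m i ≤ K) : ∃ C : ℝ, 0 ≤ C ∧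
    ∀ (v : (ι → ℝ) → ℝ) (A : ℝ), 0 ≤ A → f.IsHolder A v → (∀ z ∈ f.box, |v z| ≤ A) →
    ∀ η : ℝ, 0 < η → ∀ z ∈ f.box, z + ((K + 1 : ℕ) : ℝ) • (η • Pi.single i (1 : ℝ)) ∈ f.box →
      |diffOp ((Polynomial.X - 1) ^ (K + 1)) (η • Pi.single i (1 : ℝ)) v z| ≤
        C * A * η ^ (f.m i + f.κ i) := by
  obtain ⟨C₁, hC₁, H₁⟩ := IsHolder.abs_sub_le f i
  obtain ⟨node, w, C₂, hC₂, hn, hw, H₂⟩ := exists_interpolation (f.one_le_m i) (f.isOpen_J i)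
    (f.lo_lt_hi i) (f.Icc_subset i) (f.contDiffOn_F i) (f.deriv_F_ne i)
  obtain ⟨C₃, hC₃, H₃⟩ := abs_diffOp_le_of_holder (f.one_le_m i) (Nat.lt_succ_of_le hK) (f.κ_nonneg i)
  obtain ⟨C₄, hC₄, H₄⟩ := f.exists_abs_deriv_F_le i
  obtain ⟨C₅', H₅'⟩ := f.holder_F i
  set C₅ := max C₅' 0 with hC₅d
  have hC₅ : 0 ≤ C₅ := le_max_right _ _
  have H₅ : ∀ s ∈ Icc (f.lo i) (f.hi i), ∀ s' ∈ Icc (f.lo i) (f.hi i),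
    |iteratedDeriv (f.m i) (f.F i) s - iteratedDeriv (f.m i) (f.F i) s'| ≤ C₅ * |s - s'| ^ f.κ i :=
    fun s hs s' hs' => (H₅' s hs s' hs').trans
      (mul_le_mul_of_nonneg_right (le_max_left _ _) (Real.rpow_nonneg (abs_nonneg _) _))
  refine ⟨C₃ * (C₄ + C₂ * (C₁ + 1) * C₅), by positivity, fun v A hA hv hb η hη z hz hz' => ?_⟩
  set φ : ℝ → ℝ := fun s => v (Function.update z i s) with hφ
  have e0 : diffOp ((Polynomial.X - 1) ^ (K + 1)) (η • Pi.single i (1 : ℝ)) v z =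
      diffOp ((Polynomial.X - 1) ^ (K + 1)) η φ (z i) := by
    have h1 := diffOp_line ((Polynomial.X - 1) ^ (K + 1)) (Pi.single i (1 : ℝ)) η v
      (Function.update z i 0) (z i)
    have h2 : Function.update z i 0 + z i • Pi.single i (1 : ℝ) = z := by
      rw [update_eq_line]; ext j; simp
    rw [h2] at h1
    have h3 : (fun s : ℝ => v (Function.update z i 0 + s • Pi.single i (1 : ℝ))) = φ := by
      funext s
      have : Function.update z i 0 + s • Pi.single i (1 : ℝ) = Function.update z i s := by
        rw [update_eq_line, update_eq_line z i s]; ext j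
        simp only [Pi.add_apply, Pi.smul_apply, smul_eq_mul]; ring
      rw [hφ, this]
    rw [h1, h3]
  have hi := hz i
  have hi' := hz' i
  simp only [Pi.add_apply, Pi.smul_apply, Pi.single_eq_same, smul_eq_mul, mul_one] at hi'
  have hsub : Icc (z i) (z i + (K + 1 : ℕ) * η) ⊆ Icc (f.lo i) (f.hi i) := Icc_subset_Icc hi.1 hi'.2
  have hr : ∀ s' ∈ Icc (f.lo i) (f.hi i), |f.ratio v i z s'| ≤ C₂ * (C₁ + 1) * A := by
    intro s' hs'
    have := (H₂ φ (f.ratio v i z s') (C₁ * A) (by positivity) (hv i z hz).1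
      (fun s hs => H₁ v A hA hv z hz s hs s' hs')).2 A (fun s hs => hb _ (update_mem_box hz hs))
    exact this.trans (le_of_eq (by ring))
  rw [e0]
  refine (H₃ φ (f.J i) ((C₄ + C₂ * (C₁ + 1) * C₅) * A) (z i) η (f.isOpen_J i) hη
    (hsub.trans (f.Icc_subset i)) (hv i z hz).1 (by positivity) ?_).trans (le_of_eq (by ring))
  intro s hs
  have hs' := hsub hs
  have g1 := f.deriv_F_ne i s hs'
  have g2 := f.deriv_F_ne i (z i) hi
  have e1 : ∀ s ∈ Icc (f.lo i) (f.hi i), iteratedDeriv (f.m i) φ s =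
      f.ratio v i z s * iteratedDeriv (f.m i) (f.F i) s := fun s hs => by
    rw [ratio, div_mul_cancel₀ _ (f.deriv_F_ne i s hs)]
  rw [e1 s hs', e1 _ hi]
  have e2 : f.ratio v i z s * iteratedDeriv (f.m i) (f.F i) s -
      f.ratio v i z (z i) * iteratedDeriv (f.m i) (f.F i) (z i) =
      (f.ratio v i z s - f.ratio v i z (z i)) * iteratedDeriv (f.m i) (f.F i) s +
      f.ratio v i z (z i) * (iteratedDeriv (f.m i) (f.F i) s - iteratedDeriv (f.m i) (f.F i) (z i)) := by
    ring
  have hp : 0 ≤ |s - z i| ^ f.κ i := Real.rpow_nonneg (abs_nonneg _) _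
  rw [e2]
  refine (abs_add_le _ _).trans ?_
  rw [abs_mul, abs_mul]
  calc _ ≤ (A * |s - z i| ^ f.κ i) * C₄ + (C₂ * (C₁ + 1) * A) * (C₅ * |s - z i| ^ f.κ i) :=
        add_le_add (mul_le_mul ((hv i z hz).2 s hs' _ hi) (H₄ s hs') (abs_nonneg _) (by positivity))
          (mul_le_mul (hr _ hi) (H₅ s hs' _ hi) (abs_nonneg _) (by positivity))
    _ = _ := by ring

/-- The weights `a i` are chosen so that `a i * (m i + κ i)` is the same number `τ` in all
directions; the one-directional estimates then form a single Zygmund condition. -/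
lemma IsHolder.zyg (f : Frame ι) {K : ℕ} (hK : ∀ i, f.m i ≤ K) {a : ι → ℝ} (ha : ∀ i, 0 < a i)
    {τ : ℝ} (hτ : ∀ i, τ = a i * (f.m i + f.κ i)) : ∃ C : ℝ, 1 ≤ C ∧
    ∀ (v : (ι → ℝ) → ℝ) (A : ℝ), 0 ≤ A → f.IsHolder A v → (∀ z ∈ f.box, |v z| ≤ A) →
    ∀ Ω ⊆ f.box, Zyg (K + 1) a τ (C * A) Ω v := by
  choose C hC H using fun i => IsHolder.abs_diffOp_le f i (hK i)
  refine ⟨1 + ∑ i, C i, by linarith [Finset.sum_nonneg fun i (_ : i ∈ Finset.univ) => hC i],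
    fun v A hA hv hb Ω hΩ i η hη z hz hz' => ?_⟩
  have h1 := H i v A hA hv hb η hη z (hΩ hz) (hΩ hz')
  have h2 : τ / a i = f.m i + f.κ i := by rw [hτ i, mul_div_cancel_left₀ _ (ha i).ne']
  rw [h2]
  refine h1.trans (mul_le_mul_of_nonneg_right (mul_le_mul_of_nonneg_right ?_ hA)
    (Real.rpow_nonneg hη.le _))
  have := Finset.single_le_sum (f := C) (fun i _ => hC i) (Finset.mem_univ i)
  linarith

lemma isCompact_box (f : Frame ι) : IsCompact f.box := by
  have : f.box = Set.pi univ fun i => Icc (f.lo i) (f.hi i) := by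
    ext z; simp only [box, Set.mem_pi, mem_ofPred_eq, mem_univ, forall_const]
  rw [this]; exact isCompact_univ_pi fun i => isCompact_Icc

/-- Interior estimate: bounds for functions that are bounded and satisfy the Hölder conditions. -/
lemma IsHolder.pdL_le (f : Frame ι) {K : ℕ} (hK1 : 1 ≤ K) (hK : ∀ i, f.m i ≤ K) {a : ι → ℝ}
    (ha : ∀ i, 0 < a i) {τ : ℝ} (hτ : ∀ i, τ = a i * (f.m i + f.κ i)) (L : List ι)
    (hL : (L.map a).sum < τ) {r r' : ℝ} (hr' : 0 < r') (hr : r' < r) {κ : ι → ℝ}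
    (hκ0 : ∀ i, 0 ≤ κ i) (hκ1 : ∀ i, κ i < 1) (hκ : ∀ i, κ i * a i ≤ τ - (L.map a).sum) :
    ∃ C : ℝ, 0 ≤ C ∧ ∀ (v : (ι → ℝ) → ℝ) (A : ℝ) (p : ι → ℝ), 0 ≤ A → f.IsHolder A v →
      (∀ z ∈ f.box, |v z| ≤ A) → ContinuousOn v f.box → Metric.ball p r ⊆ f.box →
      PdReg L (Metric.ball p r') v ∧ ContinuousOn (pdL L v) (Metric.ball p r') ∧
      (∀ z ∈ Metric.ball p r', |pdL L v z| ≤ C * A) ∧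
      ∀ i, ∀ z ∈ Metric.ball p r', ∀ η : ℝ, 0 < η → z + η • Pi.single i (1 : ℝ) ∈ Metric.ball p r' →
        |pdL L v (z + η • Pi.single i (1 : ℝ)) - pdL L v z| ≤ C * A * η ^ κ i := by
  obtain ⟨C₁, hC₁, H₁⟩ := IsHolder.zyg f hK ha hτ
  set ρ := (r' + r) / 2 with hρ
  have h1 : r' < ρ := by rw [hρ]; linarith
  have h2 : ρ < r := by rw [hρ]; linarith
  have hρ0 : 0 < ρ := hr'.trans h1
  obtain ⟨C₂, hC₂, H₂⟩ := zyg_pdL (K := K) hK1 ha L hL hρ0 h2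
  choose C₃ hC₃ H₃ using fun i => marchaud (ι := ι) K (hκ0 i) (hκ1 i) h1
  -- Steps inside the ball of radius `ρ` are at most `2ρ`, so lowering the exponent of the step to
  -- `κ i` costs this factor.
  set D : ι → ℝ := fun i => (2 * ρ) ^ ((τ - (L.map a).sum) / a i - κ i) with hD
  have hD0 : ∀ i, 0 ≤ D i := fun i => Real.rpow_nonneg (by linarith) _
  set S : ℝ := ∑ i, C₃ i * (C₂ * C₁ * (1 + D i)) with hS
  have hS0 : ∀ i, 0 ≤ C₃ i * (C₂ * C₁ * (1 + D i)) := fun i => by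
    have := hD0 i; have := hC₃ i; positivity
  have hS00 : 0 ≤ S := Finset.sum_nonneg fun i _ => hS0 i
  refine ⟨C₂ * C₁ + S, by positivity, fun v A p hA hv hb hc hp => ?_⟩
  have hA' : A ≤ C₁ * A := le_mul_of_one_le_left hA hC₁
  have hA0 : 0 ≤ C₁ * A := hA.trans hA'
  have hz := H₁ v A hA hv hb _ hp
  have hb' : ∀ z ∈ Metric.ball p r, |v z| ≤ C₁ * A := fun z hz => (hb z (hp hz)).trans hA'
  obtain ⟨c1, c2, c3⟩ := H₂ v p (C₁ * A) hA0 (hc.mono hp) hb' hz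
  have hsub : Metric.ball p r' ⊆ Metric.ball p ρ := Metric.ball_subset_ball h1.le
  refine ⟨pdReg_of_zyg hK1 ha L hL hr' hr hA0 (hc.mono hp) hb' hz, c1.mono hsub, fun z hz => ?_,
    fun i z hz η hη hz' => ?_⟩
  · refine (c2 z (hsub hz)).trans ?_
    have : 0 ≤ S * A := by positivity
    linarith
  · have hB : 0 ≤ C₂ * (C₁ * A) * (1 + D i) := by have := hD0 i; positivity
    have h3 := H₃ i (pdL L v) p i (C₂ * (C₁ * A) * (1 + D i)) hB
      (fun z hz => (c2 z hz).trans (le_mul_of_one_le_right (by positivity) (by linarith [hD0 i])))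
      (fun z hz η hη hz' => ?_) z hz η hη hz'
    · refine h3.trans (mul_le_mul_of_nonneg_right ?_ (Real.rpow_nonneg hη.le _))
      have h4 := Finset.single_le_sum (fun i _ => hS0 i) (Finset.mem_univ i)
      calc _ = C₃ i * (C₂ * C₁ * (1 + D i)) * A := by ring
        _ ≤ S * A := mul_le_mul_of_nonneg_right h4 hA
        _ ≤ _ := mul_le_mul_of_nonneg_right (le_add_of_nonneg_left (by positivity)) hA
    · refine (c3 i η hη z hz hz').trans ?_
      have h5 : η ≤ 2 * ρ := step_le_of_mem_ball (by norm_num) hη hz hz'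
      have h6 : η ^ ((τ - (L.map a).sum) / a i) ≤ (1 + D i) * η ^ κ i := by
        have h7 : η ^ ((τ - (L.map a).sum) / a i) =
            η ^ ((τ - (L.map a).sum) / a i - κ i) * η ^ κ i := by
          rw [← Real.rpow_add hη]; congr 1; ring
        rw [h7]
        refine mul_le_mul_of_nonneg_right ?_ (Real.rpow_nonneg hη.le _)
        have h8 : κ i ≤ (τ - (L.map a).sum) / a i := (le_div_iff₀ (ha i)).2 (hκ i)
        have := Real.rpow_le_rpow hη.le h5 (sub_nonneg.2 h8)
        exact this.trans (le_add_of_nonneg_left zero_le_one)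
      rw [mul_assoc _ (1 + D i)]
      exact mul_le_mul_of_nonneg_left h6 (by positivity)

/-- Interior estimate modulo the kernel. -/
lemma IsHolder.exists_ker_pdL_sub_le (f : Frame ι) {K : ℕ} (hK1 : 1 ≤ K) (hK : ∀ i, f.m i ≤ K)
    {a : ι → ℝ} (ha : ∀ i, 0 < a i) {τ : ℝ} (hτ : ∀ i, τ = a i * (f.m i + f.κ i)) (L : List ι)
    (hL : (L.map a).sum < τ) {r r' : ℝ} (hr' : 0 < r') (hr : r' < r) {κ : ι → ℝ}
    (hκ0 : ∀ i, 0 ≤ κ i) (hκ1 : ∀ i, κ i < 1) (hκ : ∀ i, κ i * a i ≤ τ - (L.map a).sum) :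
    ∃ C : ℝ, 0 ≤ C ∧ ∀ (v : (ι → ℝ) → ℝ) (A : ℝ) (p : ι → ℝ), 0 ≤ A → f.IsHolder A v →
      ContinuousOn v f.box → Metric.ball p r ⊆ f.box →
      PdReg L (Metric.ball p r') v ∧ ContinuousOn (pdL L v) (Metric.ball p r') ∧
      ∃ k ∈ f.ker, (∀ z ∈ Metric.ball p r', |pdL L v z - pdL L k z| ≤ C * A) ∧
      ∀ i, ∀ z ∈ Metric.ball p r', ∀ η : ℝ, 0 < η → z + η • Pi.single i (1 : ℝ) ∈ Metric.ball p r' →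
        |(pdL L v (z + η • Pi.single i (1 : ℝ)) - pdL L k (z + η • Pi.single i (1 : ℝ))) -
          (pdL L v z - pdL L k z)| ≤ C * A * η ^ κ i := by
  obtain ⟨C, hC, H⟩ := IsHolder.pdL_le f hK1 hK ha hτ L hL hr' hr hκ0 hκ1 hκ
  obtain ⟨C', hC', H'⟩ := f.exists_ker_approx
  refine ⟨C * (1 + C'), by positivity, fun v A p hA hv hc hp => ?_⟩
  -- A qualitative statement: on the compact box any continuous function is bounded by some
  -- uncontrolled constant, which suffices for differentiability. It is used for `v` and the kernel
  -- function separately, so that the derivative of their difference can be split.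
  have key : ∀ w : (ι → ℝ) → ℝ, ∀ B, 0 ≤ B → f.IsHolder B w → ContinuousOn w f.box →
      PdReg L (Metric.ball p r') w ∧ ContinuousOn (pdL L w) (Metric.ball p r') := by
    intro w B hB hw hcw
    obtain ⟨b, hb⟩ := f.isCompact_box.exists_bound_of_continuousOn hcw
    have h1 : f.IsHolder (max B b) w := fun i z hz => ⟨(hw i z hz).1, fun s hs s' hs' =>
      ((hw i z hz).2 s hs s' hs').trans (mul_le_mul_of_nonneg_right (le_max_left _ _)
        (Real.rpow_nonneg (abs_nonneg _) _))⟩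
    have := H w (max B b) p (hB.trans (le_max_left _ _)) h1
      (fun z hz => (hb z hz).trans (le_max_right _ _)) hcw hp
    exact ⟨this.1, this.2.1⟩
  obtain ⟨r1, r2⟩ := key v A hA hv hc
  refine ⟨r1, r2, ?_⟩
  obtain ⟨k, hk, hkb⟩ := H' v A hA hv
  have hkh := isHolder_of_mem_ker hk
  have hkc := continuousOn_of_mem_ker hk
  obtain ⟨k1, k2⟩ := key k 0 le_rfl hkh hkc
  refine ⟨k, hk, ?_⟩
  have hsh : f.IsHolder ((1 + C') * A) (v - k) := fun i z hz =>
    ⟨((hv.sub hkh) i z hz).1, fun s hs s' hs' => (((hv.sub hkh) i z hz).2 s hs s' hs').trans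
      (mul_le_mul_of_nonneg_right (by nlinarith) (Real.rpow_nonneg (abs_nonneg _) _))⟩
  obtain ⟨-, -, g1, g2⟩ := H (v - k) ((1 + C') * A) p (by positivity) hsh
    (fun z hz => (hkb z hz).trans (by nlinarith)) (hc.sub hkc) hp
  have hsub := pdL_sub Metric.isOpen_ball r1 k1
  refine ⟨fun z hz => ?_, fun i z hz η hη hz' => ?_⟩
  · rw [← hsub z hz, mul_assoc]; exact g1 z hz
  · rw [← hsub z hz, ← hsub _ hz', mul_assoc C]; exact g2 i z hz η hη hz'

end Frame

end Regularity

/-! ### The normal profile -/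

section OneDim

lemma iteratedDeriv_comp_affine (k : ℕ) (f : ℝ → ℝ) (c l : ℝ) :
    iteratedDeriv k (fun s => f (c + l * s)) = fun s => l ^ k * iteratedDeriv k f (c + l * s) := by
  induction k with
  | zero => ext s; simp
  | succ k ih =>
    ext s
    rw [iteratedDeriv_succ, ih, iteratedDeriv_succ, deriv_const_mul_field]
    have h1 := deriv_comp_mul_left l (fun s => iteratedDeriv k f (c + s)) s
    simp only [smul_eq_mul] at h1
    rw [h1, deriv_comp_const_add, pow_succ]; ring

lemma exists_antideriv {f : ℝ → ℝ} (hf : ContDiffOn ℝ (⊤ : ℕ∞) f (Ioi 0)) :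
    ∃ F : ℝ → ℝ, ContDiffOn ℝ (⊤ : ℕ∞) F (Ioi 0) ∧ ∀ s ∈ Ioi (0 : ℝ), deriv F s = f s := by
  have hd : ∀ s ∈ Ioi (0 : ℝ), HasDerivAt (fun s => ∫ x in (1 : ℝ)..s, f x) (f s) s := by
    intro s hs
    have hu : uIcc 1 s ⊆ Ioi (0 : ℝ) := (convex_Ioi (0 : ℝ)).ordConnected.uIcc_subset (by simp) hs
    refine intervalIntegral.integral_hasDerivAt_right ((hf.continuousOn.mono hu).intervalIntegrable)
      (hf.continuousOn.stronglyMeasurableAtFilter isOpen_Ioi s hs)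
      (hf.continuousOn.continuousAt (isOpen_Ioi.mem_nhds hs))
  refine ⟨fun s => ∫ x in (1 : ℝ)..s, f x, ?_, fun s hs => (hd s hs).deriv⟩
  refine (contDiffOn_infty_iff_deriv_of_isOpen isOpen_Ioi).2
    ⟨fun s hs => (hd s hs).differentiableAt.differentiableWithinAt, ?_⟩
  exact hf.congr fun s hs => (hd s hs).deriv

lemma exists_iterated_antideriv (m : ℕ) {f : ℝ → ℝ} (hf : ContDiffOn ℝ (⊤ : ℕ∞) f (Ioi 0)) :
    ∃ F : ℝ → ℝ, ContDiffOn ℝ (⊤ : ℕ∞) F (Ioi 0) ∧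
      ∀ s ∈ Ioi (0 : ℝ), iteratedDeriv m F s = f s := by
  induction m generalizing f with
  | zero => exact ⟨f, hf, fun s _ => by simp⟩
  | succ m ih =>
    obtain ⟨G, hG, hGf⟩ := ih hf
    obtain ⟨F, hF, hFG⟩ := exists_antideriv hG
    refine ⟨F, hF, fun s hs => ?_⟩
    rw [iteratedDeriv_succ', ← hGf s hs]
    refine Filter.EventuallyEq.iteratedDeriv_eq m ?_
    filter_upwards [isOpen_Ioi.mem_nhds hs] with x hx using hFG x hx

/-- On each compact interval the Taylor error is zero. The polynomials found on larger intervals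
agree with the one on `[1, 2]`, an infinite set. -/
lemma eq_polynomial_of_iteratedDeriv_eq_zero {m : ℕ} (hm : 1 ≤ m) {G : ℝ → ℝ}
    (hG : ContDiffOn ℝ m G (Ioi 0)) (h0 : ∀ s ∈ Ioi (0 : ℝ), iteratedDeriv m G s = 0) :
    ∃ q : Polynomial ℝ, q.degree < m ∧ ∀ s ∈ Ioi (0 : ℝ), G s = q.eval s := by
  have key : ∀ a b : ℝ, 0 < a → a < b → ∃ q : Polynomial ℝ, q.degree < m ∧
      ∀ s ∈ Icc a b, G s = q.eval s := by
    intro a b ha hab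
    have hI : Icc a b ⊆ Ioi (0 : ℝ) := fun s hs => ha.trans_le hs.1
    obtain ⟨q, hq, h⟩ := exists_taylor_polynomial isOpen_Ioi hm hab hI hG (A := 0)
      (fun s hs => by rw [h0 s (hI hs), abs_zero])
    exact ⟨q, hq, fun s hs => by
      have := h s hs
      rw [zero_mul] at this
      exact sub_eq_zero.1 (abs_nonpos_iff.1 this)⟩
  obtain ⟨q, hq, h⟩ := key 1 2 one_pos one_lt_two
  refine ⟨q, hq, fun s hs => ?_⟩
  obtain ⟨q', hq', h'⟩ := key (min s 1) (max s 2) (lt_min hs one_pos)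
    (lt_of_le_of_lt (min_le_right _ _) (one_lt_two.trans_le (le_max_right _ _)))
  have : q = q' := by
    refine Polynomial.eq_of_infinite_eval_eq q q' ((Icc_infinite (one_lt_two (α := ℝ))).mono ?_)
    intro x hx
    change q.eval x = q'.eval x
    rw [← h x hx, ← h' x ⟨(min_le_right _ _).trans hx.1, hx.2.trans (le_max_right _ _)⟩]
  rw [this]
  exact h' s ⟨min_le_left _ _, le_max_left _ _⟩

/-- An antiderivative of order `m` of `s ^ (-n)` and its behaviour under dyadic dilations. -/
lemma exists_normal_profile {m : ℕ} (hm : 1 ≤ m) (n : ℝ) : ∃ F : ℝ → ℝ,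
    ContDiffOn ℝ (⊤ : ℕ∞) F (Ioi 0) ∧ (∀ s ∈ Ioi (0 : ℝ), iteratedDeriv m F s = s ^ (-n)) ∧
    ∃ q : Polynomial ℝ, q.degree < m ∧ ∀ k : ℕ, ∀ s ∈ Ioi (0 : ℝ),
      2 ^ k * iteratedDeriv k F (2 * s) = 2 ^ ((m : ℝ) - n) * iteratedDeriv k F s +
        iteratedDeriv k (fun s => q.eval s) s := by
  have hf : ContDiffOn ℝ (⊤ : ℕ∞) (fun s : ℝ => s ^ (-n)) (Ioi 0) := fun s hs =>
    (Real.contDiffAt_rpow_const_of_ne (ne_of_gt hs)).contDiffWithinAt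
  obtain ⟨F, hF, hFm⟩ := exists_iterated_antideriv m hf
  refine ⟨F, hF, hFm, ?_⟩
  have hmem : ∀ s ∈ Ioi (0 : ℝ), Ioi (0 : ℝ) ∈ 𝓝 s := fun s hs => isOpen_Ioi.mem_nhds hs
  have h2s : ∀ s ∈ Ioi (0 : ℝ), 2 * s ∈ Ioi (0 : ℝ) := fun s hs => Set.mem_Ioi.2 (mul_pos two_pos hs)
  have hF2 : ContDiffOn ℝ (⊤ : ℕ∞) (fun s => F (2 * s)) (Ioi 0) :=
    hF.comp (contDiff_const.mul contDiff_id).contDiffOn h2s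
  have hcF : ContDiffOn ℝ (⊤ : ℕ∞) (fun s => 2 ^ ((m : ℝ) - n) * F s) (Ioi 0) := contDiffOn_const.mul hF
  have hat : ∀ (k : ℕ) (f : ℝ → ℝ), ContDiffOn ℝ (⊤ : ℕ∞) f (Ioi 0) → ∀ s ∈ Ioi (0 : ℝ),
      ContDiffAt ℝ k f s := fun k f hf s hs =>
    (hf.contDiffAt (hmem s hs)).of_le (by exact_mod_cast le_top)
  have hk : ∀ k : ℕ, ∀ s ∈ Ioi (0 : ℝ),
      iteratedDeriv k ((fun s => F (2 * s)) - fun s => 2 ^ ((m : ℝ) - n) * F s) s =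
      2 ^ k * iteratedDeriv k F (2 * s) - 2 ^ ((m : ℝ) - n) * iteratedDeriv k F s := by
    intro k s hs
    rw [iteratedDeriv_sub (hat k _ hF2 s hs) (hat k _ hcF s hs), iteratedDeriv_const_mul_field]
    have := iteratedDeriv_comp_affine k F 0 2
    simp only [zero_add] at this
    rw [this]
  -- The function `F(2s) - 2^(m-n) F(s)` has vanishing `m`-th derivative. The polynomial `q`
  -- accounts in particular for the logarithm that may occur in `F` when `n` is an integer.
  obtain ⟨q, hq, hqG⟩ := eq_polynomial_of_iteratedDeriv_eq_zero hm
    (G := (fun s => F (2 * s)) - fun s => 2 ^ ((m : ℝ) - n) * F s)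
    ((hF2.sub hcF).of_le (by exact_mod_cast le_top)) (fun s hs => by
      rw [hk m s hs, hFm _ (h2s s hs), hFm s hs, Real.mul_rpow two_pos.le (le_of_lt hs), ← mul_assoc,
        ← Real.rpow_natCast, ← Real.rpow_add two_pos, ← sub_eq_add_neg, sub_self])
  refine ⟨q, hq, fun k s hs => ?_⟩
  have h1 := hk k s hs
  have h2 : iteratedDeriv k ((fun s => F (2 * s)) - fun s => 2 ^ ((m : ℝ) - n) * F s) s =
      iteratedDeriv k (fun s => q.eval s) s := by
    refine Filter.EventuallyEq.iteratedDeriv_eq k ?_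
    filter_upwards [hmem s hs] with x hx using hqG x hx
  linarith

end OneDim

/-! ### Parameters, scaling weights and dilations -/

/-- The parameters `m`, `n`, `γ`. -/
structure Params where
  m : ℕ
  n : ℝ
  γ : ℝ
  one_le_m : 1 ≤ m
  n_pos : 0 < n
  n_lt : n < m
  γ_pos : 0 < γ
  γ_lt : γ < 1
  frac : (¬ ∃ k : ℤ, (k : ℝ) = n) → γ * (1 - n / m) < min (Int.fract n) (1 - Int.fract n)

/-- The index set of the variables `(x, t)`; `none` stands for `t`. -/
abbrev Idx (d : ℕ) : Type := Option (Fin (d + 1))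

/-- The index of `x_N`. -/
abbrev nrm (d : ℕ) : Idx d := some (Fin.last d)

/-- The half-space `x_N > 0` in the variables `(x, t)`. -/
def halfQ (d : ℕ) : Set (Idx d → ℝ) := {z | 0 < z (nrm d)}

lemma isOpen_halfQ (d : ℕ) : IsOpen (halfQ d) := isOpen_lt continuous_const (continuous_apply _)

namespace Params

variable (P : Params) {d : ℕ}

/-- The scaling weight of `t`. -/
noncomputable def μ : ℝ := P.m - P.n

/-- The homogeneity of the problem. -/
noncomputable def σ : ℝ := P.m - P.n + (1 - P.n / P.m) * P.γ

lemma m_pos : (0 : ℝ) < P.m := by exact_mod_cast P.one_le_m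

lemma μ_pos : 0 < P.μ := sub_pos.2 P.n_lt

/-- The homogeneity seen from the time direction: `μ` for one derivative in `t` and `μ γ / m` for
its Hölder exponent. It agrees with that of the space directions. -/
lemma σ_eq : P.σ = P.μ + P.μ * (P.γ / P.m) := by
  have := P.m_pos.ne'
  rw [σ, μ]; field_simp

/-- The scaling weights. -/
noncomputable def wt : Idx d → ℝ
  | none => P.μ
  | some _ => 1

/-- The orders of the variables in the interior. -/
noncomputable def ord : Idx d → ℝ
  | none => P.m
  | some _ => 1

/-- The number of derivatives in each variable. -/
def mi : Idx d → ℕ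
  | none => 1
  | some _ => P.m

/-- The Hölder exponents. -/
noncomputable def ki : Idx d → ℝ
  | none => P.γ / P.m
  | some _ => P.γ

/-- The exponents of the weight of the Hölder quotients. -/
noncomputable def θi : Idx d → ℝ
  | none => 0
  | some _ => P.n / P.m * P.γ

/-- The exponents of the weight of the derivatives. -/
noncomputable def νi : Idx d → ℝ
  | none => 0
  | some _ => P.n

/-- The domain of each variable. -/
def Ji (i : Idx d) : Set ℝ := if i = nrm d then Ioi 0 else univ

lemma isOpen_Ji (i : Idx d) : IsOpen (Ji i) := by
  unfold Ji; split_ifs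
  · exact isOpen_Ioi
  · exact isOpen_univ

lemma update_mem_halfQ {z : Idx d → ℝ} (hz : z ∈ halfQ d) {i : Idx d} {s : ℝ} (hs : s ∈ Ji i) :
    Function.update z i s ∈ halfQ d := by
  unfold halfQ Ji at *
  by_cases h : i = nrm d
  · subst h; simpa using hs
  · simpa [Ne.symm h] using hz

lemma wt_pos (i : Idx d) : 0 < P.wt i := by
  rcases i with _ | i
  · exact P.μ_pos
  · exact one_pos

lemma ord_pos (i : Idx d) : 0 < P.ord i := by
  rcases i with _ | i
  · exact P.m_pos
  · exact one_pos

lemma one_le_mi (i : Idx d) : 1 ≤ P.mi i := by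
  rcases i with _ | i
  · exact le_rfl
  · exact P.one_le_m

lemma mi_le (i : Idx d) : P.mi i ≤ P.m := by
  rcases i with _ | i
  · exact P.one_le_m
  · exact le_rfl

lemma ki_nonneg (i : Idx d) : 0 ≤ P.ki i := by
  rcases i with _ | i
  · exact div_nonneg P.γ_pos.le P.m_pos.le
  · exact P.γ_pos.le

lemma θi_nonneg (i : Idx d) : 0 ≤ P.θi i := by
  rcases i with _ | i
  · exact le_rfl
  · exact mul_nonneg (div_nonneg P.n_pos.le P.m_pos.le) P.γ_pos.le

lemma νi_nonneg (i : Idx d) : 0 ≤ P.νi i := by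
  rcases i with _ | i
  · exact le_rfl
  · exact P.n_pos.le

/-- Away from the boundary the weight `x_N^n` is harmless and `t` counts as `m` space variables, so
the common interior order is `m + γ`. This differs from the boundary scaling `wt`, in which `t`
counts `m - n`. -/
lemma ord_mul (i : Idx d) : (P.m : ℝ) + P.γ = P.ord i * (P.mi i + P.ki i) := by
  have := P.m_pos.ne'
  rcases i with _ | i
  · simp only [ord, mi, ki]; push_cast; field_simp
  · simp only [ord, mi, ki]; ring

lemma σ_eq_wt (i : Idx d) : P.σ = P.wt i * P.mi i - P.θi i - P.νi i + P.wt i * P.ki i := by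
  rcases i with _ | i
  · rw [σ_eq]; simp only [wt, mi, ki, θi, νi]; push_cast; ring
  · rw [σ]; simp only [wt, mi, ki, θi, νi]; ring

/-- The hypotheses on the pure derivatives, with constant `A`. -/
structure Good (A : ℝ) (U : (Idx d → ℝ) → ℝ) : Prop where
  continuousOn : ContinuousOn U (halfQ d)
  contDiffOn : ∀ i, ∀ z ∈ halfQ d, ContDiffOn ℝ (P.mi i) (fun s => U (Function.update z i s)) (Ji i)
  holder : ∀ i, ∀ z ∈ halfQ d, ∀ s ∈ Ji i, ∀ s' ∈ Ji i,
    max (Function.update z i s (nrm d)) (Function.update z i s' (nrm d)) ^ P.θi i *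
      |Function.update z i s (nrm d) ^ P.νi i *
          iteratedDeriv (P.mi i) (fun s => U (Function.update z i s)) s -
        Function.update z i s' (nrm d) ^ P.νi i *
          iteratedDeriv (P.mi i) (fun s => U (Function.update z i s)) s'| ≤ A * |s - s'| ^ P.ki i

/-- The anisotropic dilations. -/
noncomputable def scal (l : ℝ) (c z : Idx d → ℝ) : Idx d → ℝ := fun i => c i + l ^ P.wt i * z i

lemma scal_update (l : ℝ) (c z : Idx d → ℝ) (i : Idx d) (s : ℝ) :
    P.scal l c (Function.update z i s) =
      Function.update (P.scal l c z) i (c i + l ^ P.wt i * s) := by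
  ext j
  rcases eq_or_ne j i with rfl | h
  · simp [scal]
  · simp [scal, h]

lemma scal_add_single (l : ℝ) (c z : Idx d → ℝ) (i : Idx d) (s : ℝ) :
    P.scal l c (z + s • Pi.single i 1) = P.scal l c z + (l ^ P.wt i * s) • Pi.single i 1 := by
  ext j
  rcases eq_or_ne j i with rfl | h
  · simp [scal]; ring
  · simp [scal, h]

lemma scal_nrm {l : ℝ} {c : Idx d → ℝ} (hc : c (nrm d) = 0) (z : Idx d → ℝ) :
    P.scal l c z (nrm d) = l * z (nrm d) := by
  simp only [scal, hc, wt, Real.rpow_one, zero_add]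

lemma scal_mem {l : ℝ} (hl : 0 < l) {c : Idx d → ℝ} (hc : c (nrm d) = 0) {z : Idx d → ℝ}
    (hz : z ∈ halfQ d) : P.scal l c z ∈ halfQ d := by
  show 0 < P.scal l c z (nrm d)
  rw [P.scal_nrm hc]; exact mul_pos hl hz

lemma scal_mem_Ji {l : ℝ} (hl : 0 < l) {c : Idx d → ℝ} (hc : c (nrm d) = 0) {i : Idx d} {s : ℝ}
    (hs : s ∈ Ji i) : c i + l ^ P.wt i * s ∈ Ji i := by
  unfold Ji at *
  split_ifs at * with h
  · subst h; rw [hc, zero_add]; exact mul_pos (Real.rpow_pos_of_pos hl _) hs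
  · trivial

lemma continuous_scal (l : ℝ) (c : Idx d → ℝ) : Continuous (P.scal l c) := by
  unfold scal; fun_prop

/-- The centre lies on the boundary, so the dilation multiplies `x_N` by `l` and all weights are
homogeneous. Collecting the powers of `l` in each direction gives `σ` by `σ_eq_wt`. -/
lemma Good.scal {A : ℝ} {U : (Idx d → ℝ) → ℝ} (hU : P.Good A U) {l : ℝ} (hl : 0 < l)
    {c : Idx d → ℝ} (hc : c (nrm d) = 0) : P.Good (A * l ^ P.σ) (fun z => U (P.scal l c z)) where
  continuousOn := hU.continuousOn.comp (P.continuous_scal l c).continuousOn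
    fun z hz => P.scal_mem hl hc hz
  contDiffOn i z hz := by
    simp only [P.scal_update]
    exact (hU.contDiffOn i _ (P.scal_mem hl hc hz)).comp
      (contDiff_const.add (contDiff_const.mul contDiff_id)).contDiffOn
      fun s hs => P.scal_mem_Ji hl hc hs
  holder i z hz s hs s' hs' := by
    simp only [P.scal_update]
    have h := hU.holder i _ (P.scal_mem hl hc hz) _ (P.scal_mem_Ji hl hc hs) _
      (P.scal_mem_Ji hl hc hs')
    rw [iteratedDeriv_comp_affine (P.mi i) (fun s => U (Function.update (P.scal l c z) i s))]
    beta_reduce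
    rw [← P.scal_update, ← P.scal_update, P.scal_nrm hc, P.scal_nrm hc] at h
    set a := Function.update z i s (nrm d)
    set a' := Function.update z i s' (nrm d)
    have ha : 0 < a := update_mem_halfQ hz hs
    have ha' : 0 < a' := update_mem_halfQ hz hs'
    set D := iteratedDeriv (P.mi i) (fun s => U (Function.update (P.scal l c z) i s)) (c i + l ^ P.wt i * s)
    set D' := iteratedDeriv (P.mi i) (fun s => U (Function.update (P.scal l c z) i s)) (c i + l ^ P.wt i * s')
    have e1 : c i + l ^ P.wt i * s - (c i + l ^ P.wt i * s') = l ^ P.wt i * (s - s') := by ring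
    have hw : 0 < l ^ P.wt i := Real.rpow_pos_of_pos hl _
    have hm : max (l * a) (l * a') = l * max a a' := by
      rw [mul_max_of_nonneg _ _ hl.le]
    have hM : 0 < max a a' := lt_max_of_lt_left ha
    rw [e1, abs_mul, abs_of_pos hw, Real.mul_rpow hw.le (abs_nonneg _), hm,
      Real.mul_rpow hl.le hM.le, Real.mul_rpow hl.le ha.le, Real.mul_rpow hl.le ha'.le,
      mul_assoc (l ^ P.θi i), mul_assoc (l ^ P.νi i), mul_assoc (l ^ P.νi i), ← mul_sub, abs_mul, abs_of_pos (Real.rpow_pos_of_pos hl _)] at h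
    have e2 : a ^ P.νi i * ((l ^ P.wt i) ^ P.mi i * D) - a' ^ P.νi i * ((l ^ P.wt i) ^ P.mi i * D') =
        (l ^ P.wt i) ^ P.mi i * (a ^ P.νi i * D - a' ^ P.νi i * D') := by ring
    rw [e2, abs_mul, abs_of_pos (pow_pos hw _)]
    have e3 : (l ^ P.wt i) ^ P.mi i = l ^ (P.wt i * P.mi i) := by
      rw [← Real.rpow_natCast, ← Real.rpow_mul hl.le]
    have e4 : (l ^ P.wt i) ^ P.ki i = l ^ (P.wt i * P.ki i) := by rw [← Real.rpow_mul hl.le]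
    have e5 : l ^ P.σ = l ^ (P.wt i * P.mi i) / l ^ P.θi i / l ^ P.νi i * l ^ (P.wt i * P.ki i) := by
      rw [P.σ_eq_wt i, Real.rpow_add hl, Real.rpow_sub hl, Real.rpow_sub hl]
    have hp1 : 0 < l ^ P.θi i := Real.rpow_pos_of_pos hl _
    have hp2 : 0 < l ^ P.νi i := Real.rpow_pos_of_pos hl _
    have hp3 : 0 < l ^ (P.wt i * P.mi i) := Real.rpow_pos_of_pos hl _
    rw [e3, e5]
    rw [e4] at h
    set E := |a ^ P.νi i * D - a' ^ P.νi i * D'|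
    have h2 := mul_le_mul_of_nonneg_left h (a := l ^ (P.wt i * P.mi i) / l ^ P.θi i / l ^ P.νi i)
      (by positivity)
    calc max a a' ^ P.θi i * (l ^ (P.wt i * ↑(P.mi i)) * E)
        = l ^ (P.wt i * ↑(P.mi i)) / l ^ P.θi i / l ^ P.νi i *
          (l ^ P.θi i * (max a a' ^ P.θi i * (l ^ P.νi i * E))) := by field_simp
      _ ≤ _ := h2
      _ = _ := by ring

lemma pdL_scal {l : ℝ} (hl : 0 < l) (c : Idx d → ℝ) (U : (Idx d → ℝ) → ℝ) (L : List (Idx d))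
    (z : Idx d → ℝ) : pdL L (fun z => U (P.scal l c z)) z =
      l ^ (L.map P.wt).sum * pdL L U (P.scal l c z) := by
  induction L generalizing z with
  | nil => simp [pdL]
  | cons i L ih =>
    change deriv (fun s : ℝ => pdL L (fun z => U (P.scal l c z)) (z + s • Pi.single i 1)) 0 =
      _ * deriv (fun s : ℝ => pdL L U (P.scal l c z + s • Pi.single i 1)) 0
    simp only [ih, P.scal_add_single]
    rw [deriv_const_mul_field]
    have h1 := deriv_comp_mul_left (l ^ P.wt i)
      (fun s : ℝ => pdL L U (P.scal l c z + s • Pi.single i 1)) 0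
    simp only [smul_eq_mul, mul_zero] at h1
    rw [h1, List.map_cons, List.sum_cons, Real.rpow_add hl]; ring

/-- The frame adapted to the normalized region `1/32 ≤ z_N ≤ 2R`, `|z_i| ≤ R`. -/
noncomputable def frame (d : ℕ) (R : ℝ) (hR : 1 < R) : Frame (Idx d) where
  m := P.mi
  F i s := if i = nrm d then (exists_normal_profile P.one_le_m P.n).choose s else s ^ P.mi i
  J := Ji
  lo i := if i = nrm d then 1 / 32 else -R
  hi i := if i = nrm d then 2 * R else R
  κ := P.ki
  one_le_m := P.one_le_mi
  isOpen_J := isOpen_Ji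
  lo_lt_hi i := by split_ifs <;> linarith
  Icc_subset i := by
    unfold Ji
    split_ifs
    · intro s hs; exact lt_of_lt_of_le (by norm_num) hs.1
    · exact subset_univ _
  contDiffOn_F i := by
    by_cases h : i = nrm d
    · subst h
      simp only [Ji, if_true]
      exact (exists_normal_profile P.one_le_m P.n).choose_spec.1.of_le (by exact_mod_cast le_top)
    · simp only [if_neg h]
      exact (contDiff_id.pow _).contDiffOn
  deriv_F_ne i s hs := by
    by_cases h : i = nrm d
    · subst h
      simp only [if_true] at *
      have hs0 : 0 < s := lt_of_lt_of_le (by norm_num) hs.1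
      have := (exists_normal_profile P.one_le_m P.n).choose_spec.2.1 s hs0
      simp only [mi]
      rw [this]
      exact (Real.rpow_pos_of_pos hs0 _).ne'
    · simp only [if_neg h]
      rw [iteratedDeriv_pow]
      simp [Nat.descFactorial_self, Nat.factorial_ne_zero]
  κ_nonneg := P.ki_nonneg
  holder_F i := by
    by_cases h : i = nrm d
    · subst h
      simp only [if_true]
      have hF := (exists_normal_profile P.one_le_m P.n).choose_spec.2.1
      have hd : ∀ s ∈ Icc (1 / 32 : ℝ) (2 * R), ∀ s' ∈ Icc (1 / 32 : ℝ) (2 * R),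
          |s ^ (-P.n) - s' ^ (-P.n)| ≤ (P.n * (1 / 32 : ℝ) ^ (-P.n - 1)) * |s - s'| := by
        intro s hs s' hs'
        have := (convex_Icc (1 / 32 : ℝ) (2 * R)).norm_image_sub_le_of_norm_hasDerivWithin_le
          (f := fun s => s ^ (-P.n)) (f' := fun s => -P.n * s ^ (-P.n - 1))
          (C := P.n * (1 / 32 : ℝ) ^ (-P.n - 1)) (fun x hx => ?_) (fun x hx => ?_) hs' hs
        · simpa [Real.norm_eq_abs] using this
        · have hx0 : (0 : ℝ) < x := lt_of_lt_of_le (by norm_num) hx.1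
          exact (Real.hasDerivAt_rpow_const (Or.inl hx0.ne')).hasDerivWithinAt
        · have hx0 : (0 : ℝ) < x := lt_of_lt_of_le (by norm_num) hx.1
          rw [Real.norm_eq_abs, abs_mul, abs_neg, abs_of_pos P.n_pos,
            abs_of_pos (Real.rpow_pos_of_pos hx0 _)]
          refine mul_le_mul_of_nonneg_left ?_ P.n_pos.le
          exact Real.rpow_le_rpow_of_nonpos (by norm_num) hx.1 (by linarith [P.n_pos])
      refine ⟨(P.n * (1 / 32 : ℝ) ^ (-P.n - 1)) * (2 * R) ^ (1 - P.γ), fun s hs s' hs' => ?_⟩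
      have hs0 : 0 < s := lt_of_lt_of_le (by norm_num) hs.1
      have hs0' : 0 < s' := lt_of_lt_of_le (by norm_num) hs'.1
      simp only [mi, ki]
      rw [hF s hs0, hF s' hs0', mul_assoc]
      refine (hd s hs s' hs').trans (mul_le_mul_of_nonneg_left ?_
        (mul_nonneg P.n_pos.le (Real.rpow_nonneg (by norm_num) _)))
      rcases eq_or_ne s s' with rfl | hne
      · simp [P.γ_pos.ne']
      · have h0 : 0 < |s - s'| := abs_pos.2 (sub_ne_zero.2 hne)
        have h1 : |s - s'| = |s - s'| ^ (1 - P.γ) * |s - s'| ^ P.γ := by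
          rw [← Real.rpow_add h0]; simp
        conv_lhs => rw [h1]
        refine mul_le_mul_of_nonneg_right (Real.rpow_le_rpow h0.le ?_ (by linarith [P.γ_lt]))
          (Real.rpow_nonneg h0.le _)
        rw [abs_le]; constructor <;> linarith [hs.1, hs.2, hs'.1, hs'.2]
    · refine ⟨0, fun s hs s' hs' => ?_⟩
      simp only [if_neg h]
      rw [iteratedDeriv_pow]
      simp

/-- In the box `z_N ≥ 1/32`, so the weights are bounded below, which costs the power of `32`. In the
normal direction the ratio is exactly `z_N^n` times the derivative, since `F` has derivative
`s^(-n)`. In the other directions the weight is constant along the line and the ratio is the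
derivative divided by a factorial. -/
lemma Good.isHolder {A : ℝ} {U : (Idx d → ℝ) → ℝ} (hU : P.Good A U) (R : ℝ) (hR : 1 < R) :
    (P.frame d R hR).IsHolder ((32 : ℝ) ^ (P.n / P.m * P.γ + P.n) * A) U := by
  intro i z hz
  have hzN : 1 / 32 ≤ z (nrm d) := by simpa [frame] using (hz (nrm d)).1
  have hzQ : z ∈ halfQ d := lt_of_lt_of_le (by norm_num) hzN
  refine ⟨hU.contDiffOn i z hzQ, fun s hs s' hs' => ?_⟩
  have hsJ := (P.frame d R hR).Icc_subset i hs
  have hsJ' := (P.frame d R hR).Icc_subset i hs'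
  have h := hU.holder i z hzQ s hsJ s' hsJ'
  have hθ0 : 0 ≤ P.n / P.m * P.γ := P.θi_nonneg (some (Fin.last d))
  have hn0 := P.n_pos.le
  have h32 : ∀ x y : ℝ, 0 ≤ x → x ≤ P.n / P.m * P.γ + P.n → 1 / 32 ≤ y →
      1 ≤ (32 : ℝ) ^ (P.n / P.m * P.γ + P.n) * y ^ x := by
    intro x y hx hx' hy
    have h1 : (1 / 32 : ℝ) ^ x ≤ y ^ x := Real.rpow_le_rpow (by norm_num) hy hx
    have h2 : (32 : ℝ) ^ x ≤ (32 : ℝ) ^ (P.n / P.m * P.γ + P.n) :=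
      Real.rpow_le_rpow_of_exponent_le (by norm_num) hx'
    calc (1 : ℝ) = (32 : ℝ) ^ x * (1 / 32 : ℝ) ^ x := by
          rw [← Real.mul_rpow (by norm_num) (by norm_num)]; norm_num
      _ ≤ _ := mul_le_mul h2 h1 (Real.rpow_nonneg (by norm_num) _) (by positivity)
  set c := (32 : ℝ) ^ (P.n / P.m * P.γ + P.n)
  have hp : 0 ≤ |s - s'| ^ P.ki i := Real.rpow_nonneg (abs_nonneg _) _
  have fin : ∀ w E : ℝ, 1 ≤ c * w → 0 ≤ E → w * E ≤ A * |s - s'| ^ P.ki i →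
      E ≤ c * A * |s - s'| ^ P.ki i := by
    intro w E hw hE hwE
    have hc0 : 0 ≤ c := Real.rpow_nonneg (by norm_num) _
    calc E ≤ (c * w) * E := le_mul_of_one_le_left hE hw
      _ = c * (w * E) := by ring
      _ ≤ c * (A * |s - s'| ^ P.ki i) := mul_le_mul_of_nonneg_left hwE hc0
      _ = _ := by ring
  by_cases hi : i = nrm d
  · subst hi
    simp only [Function.update_self, θi, νi] at h
    have hs1 : 1 / 32 ≤ s := by simpa [frame] using hs.1
    have hs1' : 1 / 32 ≤ s' := by simpa [frame] using hs'.1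
    have hr : ∀ s : ℝ, 1 / 32 ≤ s → (P.frame d R hR).ratio U (nrm d) z s =
        s ^ P.n * iteratedDeriv (P.mi (nrm d)) (fun s => U (Function.update z (nrm d) s)) s := by
      intro s hs
      have hs0 : 0 < s := lt_of_lt_of_le (by norm_num) hs
      have hF := (exists_normal_profile P.one_le_m P.n).choose_spec.2.1 s hs0
      simp only [Frame.ratio, frame, if_true]
      simp only [mi] at *
      rw [hF, Real.rpow_neg hs0.le, div_inv_eq_mul, mul_comm]
    rw [hr s hs1, hr s' hs1']
    refine fin (max s s' ^ (P.n / P.m * P.γ)) _ (h32 _ _ hθ0 (by linarith) (hs1.trans (le_max_left _ _)))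
      (abs_nonneg _) h
  · have hne : (nrm d) ≠ i := Ne.symm hi
    simp only [Function.update_of_ne hne, max_self] at h
    have hr : ∀ s : ℝ, (P.frame d R hR).ratio U i z s =
        iteratedDeriv (P.mi i) (fun s => U (Function.update z i s)) s / (P.mi i).factorial := by
      intro s
      simp only [Frame.ratio, frame, if_neg hi]
      rw [iteratedDeriv_pow]
      simp [Nat.descFactorial_self]
    rw [hr, hr, ← sub_div, abs_div]
    have hf : (1 : ℝ) ≤ |((P.mi i).factorial : ℝ)| := by
      rw [Nat.abs_cast]; exact_mod_cast Nat.one_le_iff_ne_zero.2 (Nat.factorial_ne_zero _)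
    refine (div_le_self (abs_nonneg _) hf).trans ?_
    rw [← mul_sub, abs_mul, abs_of_pos (Real.rpow_pos_of_pos hzQ _), ← mul_assoc,
      ← Real.rpow_add hzQ] at h
    have hle : P.θi i + P.νi i ≤ P.n / P.m * P.γ + P.n := by
      rcases i with _ | i
      · simp only [θi, νi]; linarith
      · exact le_rfl
    exact fin _ _ (h32 _ _ (add_nonneg (P.θi_nonneg i) (P.νi_nonneg i)) hle hzN) (abs_nonneg _) h

end Params

/-! ### Derivatives of sums and products; Hölder bounds from coordinate bounds -/

section PdAlgebra

variable {ι : Type*} [Fintype ι] [DecidableEq ι]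

lemma PdReg.add {L : List ι} {Ω : Set (ι → ℝ)} (hΩ : IsOpen Ω) {v w : (ι → ℝ) → ℝ}
    (hv : PdReg L Ω v) (hw : PdReg L Ω w) :
    PdReg L Ω (v + w) ∧ ∀ z ∈ Ω, pdL L (v + w) z = pdL L v z + pdL L w z := by
  induction L with
  | nil => exact ⟨trivial, fun z _ => rfl⟩
  | cons i L ih =>
    obtain ⟨h1, h2⟩ := ih hv.1 hw.1
    have he : ∀ z ∈ Ω, (fun s : ℝ => pdL L (v + w) (z + s • Pi.single i 1)) =ᶠ[𝓝 0]
        (fun s : ℝ => pdL L v (z + s • Pi.single i 1)) +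
          (fun s : ℝ => pdL L w (z + s • Pi.single i 1)) := by
      intro z hz
      filter_upwards [eventually_line_mem hΩ hz (Pi.single i 1)] with s hs using h2 _ hs
    refine ⟨⟨h1, fun z hz => ((hv.2 z hz).add (hw.2 z hz)).congr_of_eventuallyEq (he z hz)⟩,
      fun z hz => ?_⟩
    change deriv _ 0 = deriv _ 0 + deriv _ 0
    rw [(he z hz).deriv_eq, deriv_add (hv.2 z hz) (hw.2 z hz)]

lemma pdL_smul (L : List ι) (c : ℝ) (v : (ι → ℝ) → ℝ) : pdL L (c • v) = c • pdL L v := by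
  induction L with
  | nil => rfl
  | cons i L ih =>
    ext z
    change deriv (fun s : ℝ => pdL L (c • v) (z + s • Pi.single i 1)) 0 =
      c * deriv (fun s : ℝ => pdL L v (z + s • Pi.single i 1)) 0
    rw [ih, ← deriv_const_mul_field]; rfl

lemma PdReg.smul {L : List ι} {Ω : Set (ι → ℝ)} {v : (ι → ℝ) → ℝ} (hv : PdReg L Ω v) (c : ℝ) :
    PdReg L Ω (c • v) := by
  induction L with
  | nil => trivial
  | cons i L ih =>
    refine ⟨ih hv.1, fun z hz => ?_⟩
    rw [pdL_smul]
    exact (hv.2 z hz).const_mul c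

lemma prod_line (h : ι → ℝ → ℝ) (z : ι → ℝ) (i : ι) (s : ℝ) :
    ∏ j, h j ((z + s • Pi.single i (1 : ℝ) : ι → ℝ) j) =
      (∏ j ∈ Finset.univ.erase i, h j (z j)) * h i (z i + s) := by
  rw [← Finset.mul_prod_erase _ _ (Finset.mem_univ i), mul_comm]
  congr 1
  · exact Finset.prod_congr rfl fun j hj => by simp [Finset.ne_of_mem_erase hj]
  · simp

lemma pdL_prod (L : List ι) (h : ι → ℝ → ℝ) :
    pdL L (fun z => ∏ i, h i (z i)) = fun z => ∏ i, iteratedDeriv (L.count i) (h i) (z i) := by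
  induction L with
  | nil => simp [pdL]
  | cons i L ih =>
    ext z
    change deriv (fun s : ℝ => pdL L (fun z => ∏ i, h i (z i)) (z + s • Pi.single i 1)) 0 = _
    rw [ih]
    simp only [prod_line (fun j => iteratedDeriv (L.count j) (h j))]
    rw [deriv_const_mul_field, deriv_comp_const_add, add_zero, ← iteratedDeriv_succ,
      ← Finset.mul_prod_erase _ _ (Finset.mem_univ i), mul_comm, List.count_cons_self]
    congr 1
    exact Finset.prod_congr rfl fun j hj => by
      rw [List.count_cons_of_ne (Finset.ne_of_mem_erase hj).symm]

lemma pdReg_prod {L : List ι} {Ω : Set (ι → ℝ)} {J : ι → Set ℝ} (hJ : ∀ i, IsOpen (J i))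
    (hΩ : ∀ z ∈ Ω, ∀ i, z i ∈ J i) {h : ι → ℝ → ℝ} (hh : ∀ i, ContDiffOn ℝ (⊤ : ℕ∞) (h i) (J i)) :
    PdReg L Ω (fun z => ∏ i, h i (z i)) := by
  induction L with
  | nil => trivial
  | cons i L ih =>
    refine ⟨ih, fun z hz => ?_⟩
    rw [pdL_prod]
    simp only [prod_line (fun j => iteratedDeriv (L.count j) (h j))]
    refine DifferentiableAt.const_mul ?_ _
    have hd : DifferentiableAt ℝ (iteratedDeriv (L.count i) (h i)) (z i + 0) := by
      rw [add_zero]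
      have hz' := hΩ z hz i
      have h1 := (hh i).differentiableOn_iteratedDerivWithin (m := L.count i)
        (by exact_mod_cast WithTop.coe_lt_top _) (hJ i).uniqueDiffOn
      refine (h1.differentiableAt ((hJ i).mem_nhds hz')).congr_of_eventuallyEq ?_
      filter_upwards [(hJ i).mem_nhds hz'] with x hx
      exact (iteratedDerivWithin_of_isOpen (hJ i) hx).symm
    exact hd.comp (0 : ℝ) (by fun_prop)

/-- The coordinates are exchanged one at a time. In the supremum norm every intermediate point,
mixing coordinates of `z` and `z'`, stays in the ball. -/
lemma abs_sub_le_sum_of_coordinates {p : ι → ℝ} {r B : ℝ} {κ : ι → ℝ} (hB : 0 ≤ B) {f : (ι → ℝ) → ℝ}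
    (hf : ∀ i, ∀ z ∈ Metric.ball p r, ∀ η : ℝ, 0 < η → z + η • Pi.single i (1 : ℝ) ∈ Metric.ball p r →
      |f (z + η • Pi.single i (1 : ℝ)) - f z| ≤ B * η ^ κ i)
    {z z' : ι → ℝ} (hz : z ∈ Metric.ball p r) (hz' : z' ∈ Metric.ball p r) :
    |f z' - f z| ≤ B * ∑ i, |z' i - z i| ^ κ i := by
  have hr : 0 < r := dist_nonneg.trans_lt (Metric.mem_ball.1 hz)
  have one : ∀ i, ∀ y ∈ Metric.ball p r, ∀ s, Function.update y i s ∈ Metric.ball p r →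
      |f (Function.update y i s) - f y| ≤ B * |s - y i| ^ κ i := by
    intro i y hy s hs
    rcases lt_trichotomy (s - y i) 0 with h | h | h
    · have := hf i _ hs (y i - s) (by linarith)
      have e : Function.update y i s + (y i - s) • Pi.single i (1 : ℝ) = y := by
        rw [Frame.update_eq_line]; ext j; simp; ring
      rw [e] at this
      rw [abs_sub_comm, abs_of_neg h, neg_sub]; exact this hy
    · have e : Function.update y i s = y := by
        rw [Frame.update_eq_line, h, zero_smul, add_zero]
      rw [e, sub_self, abs_zero]; positivity
    · rw [abs_of_pos h]
      rw [Frame.update_eq_line] at hs ⊢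
      exact hf i y hy _ h hs
  have key : ∀ S : Finset ι, |f (S.piecewise z' z) - f z| ≤ B * ∑ i ∈ S, |z' i - z i| ^ κ i := by
    intro S
    induction S using Finset.induction_on with
    | empty => simp
    | insert i S hi ih =>
      have hmem : ∀ T : Finset ι, T.piecewise z' z ∈ Metric.ball p r := by
        intro T
        rw [Metric.mem_ball, dist_pi_lt_iff hr]
        intro j
        by_cases hj : j ∈ T
        · rw [Finset.piecewise_eq_of_mem _ _ _ hj]; exact (dist_pi_lt_iff hr).1 (Metric.mem_ball.1 hz') j
        · rw [Finset.piecewise_eq_of_notMem _ _ _ hj]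
          exact (dist_pi_lt_iff hr).1 (Metric.mem_ball.1 hz) j
      have h1 := one i _ (hmem S) (z' i) (by rw [← Finset.piecewise_insert]; exact hmem _)
      rw [← Finset.piecewise_insert, Finset.piecewise_eq_of_notMem _ _ _ hi] at h1
      rw [Finset.sum_insert hi, mul_add]
      have := abs_sub_le (f ((insert i S).piecewise z' z)) (f (S.piecewise z' z)) (f z)
      linarith
  simpa using key Finset.univ

end PdAlgebra

/-! ### Annihilation of the kernel along dyadic dilations -/

namespace Params

variable (P : Params) {d : ℕ}

/-- The values of `g` along a dyadic sequence of dilations. -/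
noncomputable def seqAt (b l : ℝ) (c z : Idx d → ℝ) : ((Idx d → ℝ) → ℝ) →ₗ[ℝ] (ℤ → ℝ) where
  toFun g k := (l * (2 : ℝ) ^ (k : ℝ)) ^ b * g (P.scal (l * (2 : ℝ) ^ (k : ℝ)) c z)
  map_add' g g' := by ext k; simp only [Pi.add_apply, mul_add]
  map_smul' a g := by ext k; simp only [Pi.smul_apply, smul_eq_mul, RingHom.id_apply]; ring

lemma seqAt_apply (b l : ℝ) (c z : Idx d → ℝ) (g : (Idx d → ℝ) → ℝ) (k : ℤ) :
    P.seqAt b l c z g k = (l * (2 : ℝ) ^ (k : ℝ)) ^ b * g (P.scal (l * (2 : ℝ) ^ (k : ℝ)) c z) := rfl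

/-- A list of degrees of homogeneity. -/
noncomputable def degs (d α s : ℕ) : List ℝ :=
  (Finset.Icc α ((d + 1) * P.m) ×ˢ Finset.range 2).toList.map fun p => p.1 + (p.2 + s) * P.μ

lemma mem_degs {α s : ℕ} {x : ℝ} : x ∈ P.degs d α s ↔
    ∃ l a : ℕ, α ≤ l ∧ l ≤ (d + 1) * P.m ∧ a < 2 ∧ (l : ℝ) + (a + s) * P.μ = x := by
  simp only [degs, List.mem_map, Finset.mem_toList, Finset.mem_product, Finset.mem_Icc,
    Finset.mem_range, Prod.exists]
  constructor
  · rintro ⟨l, a, ⟨⟨h1, h2⟩, h3⟩, h4⟩; exact ⟨l, a, h1, h2, h3, h4⟩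
  · rintro ⟨l, a, h1, h2, h3, h4⟩; exact ⟨l, a, ⟨⟨h1, h2⟩, h3⟩, h4⟩

/-- The number of spatial derivatives in `L`. -/
def cnt (L : List (Idx d)) : ℕ := ∑ i : Fin (d + 1), L.count (some i)

/-- The number of tangential derivatives in `L`. -/
def tcnt (L : List (Idx d)) : ℕ := ∑ i : Fin d, L.count (some i.castSucc)

/-- The degrees of the homogeneous components of the derivatives of the kernel functions. -/
noncomputable def degList (L : List (Idx d)) : List ℝ :=
  P.degs d (cnt L) 0 ++ P.degs d (tcnt L) 1

/-- Nonresonance. Put `x = (1 - n/m) γ`, a number in `(0, 1)`. Then `σ = m - n + x` is not an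
integer: this is clear for integral `n`, and otherwise it would force `x = {n}`, which the
hypothesis forbids. It is not `l + μ`, because `σ - μ = x`, and not `l + 2μ`, because `σ = μ (1 +
γ/m) < 2μ`. -/
lemma σ_notMem_degList (L : List (Idx d)) : P.σ ∉ P.degList L := by
  have hω : 0 < 1 - P.n / P.m := by
    rw [sub_pos, div_lt_one P.m_pos]; exact P.n_lt
  have hω1 : 1 - P.n / P.m < 1 := by linarith [div_pos P.n_pos P.m_pos]
  have hx0 : 0 < (1 - P.n / P.m) * P.γ := mul_pos hω P.γ_pos
  have hx1 : (1 - P.n / P.m) * P.γ < 1 := by nlinarith [P.γ_pos, P.γ_lt]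
  have h0 : ∀ l : ℕ, P.σ ≠ l := by
    intro l hl
    by_cases hint : ∃ k : ℤ, (k : ℝ) = P.n
    · obtain ⟨k, hk⟩ := hint
      have h1 : (1 - P.n / P.m) * P.γ = ((l - P.m + k : ℤ) : ℝ) := by
        push_cast; rw [hk]; rw [σ] at hl; linarith
      rw [h1] at hx0 hx1
      have h2 : (0 : ℤ) < l - P.m + k := by exact_mod_cast hx0
      have h3 : (l : ℤ) - P.m + k < 1 := by exact_mod_cast hx1
      omega
    · have h1 := P.frac hint
      rw [lt_min_iff] at h1
      have h2 := Int.self_sub_floor P.n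
      have e : ((l - P.m + ⌊P.n⌋ : ℤ) : ℝ) = (1 - P.n / P.m) * P.γ - Int.fract P.n := by
        push_cast; rw [σ] at hl; linarith
      have h3 : ((l - P.m + ⌊P.n⌋ : ℤ) : ℝ) < 0 := by rw [e]; linarith [h1.1]
      have h4 : (-1 : ℝ) < ((l - P.m + ⌊P.n⌋ : ℤ) : ℝ) := by
        rw [e]; linarith [Int.fract_lt_one P.n]
      have h5 : (l : ℤ) - P.m + ⌊P.n⌋ < 0 := by exact_mod_cast h3
      have h6 : (-1 : ℤ) < l - P.m + ⌊P.n⌋ := by exact_mod_cast h4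
      omega
  have hx : P.σ = P.μ + (1 - P.n / P.m) * P.γ := rfl
  have h1 : ∀ l : ℕ, P.σ ≠ l + P.μ := by
    intro l hl
    have h2 : (1 - P.n / P.m) * P.γ = l := by linarith
    rw [h2] at hx0 hx1
    have h3 : 0 < l := by exact_mod_cast hx0
    have h4 : l < 1 := by exact_mod_cast hx1
    omega
  have h2 : ∀ l : ℕ, P.σ ≠ l + 2 * P.μ := by
    intro l hl
    rw [P.σ_eq] at hl
    have h3 : P.γ / P.m < 1 := by
      rw [div_lt_one P.m_pos]
      have : (1 : ℝ) ≤ P.m := by exact_mod_cast P.one_le_m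
      linarith [P.γ_lt]
    have : (0 : ℝ) ≤ l := Nat.cast_nonneg l
    nlinarith [P.μ_pos]
  intro h
  rw [degList, List.mem_append, mem_degs, mem_degs] at h
  rcases h with ⟨l, a, -, -, ha, h⟩ | ⟨l, a, -, -, ha, h⟩
  · interval_cases a
    · exact h0 l (by rw [← h]; push_cast; ring)
    · exact h1 l (by rw [← h]; push_cast; ring)
  · interval_cases a
    · exact h1 l (by rw [← h]; push_cast; ring)
    · exact h2 l (by rw [← h]; push_cast; ring)

/-- If `a > e`, the truncated exponent `e - a` does no harm, as the falling factorial vanishes. -/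
lemma iteratedDeriv_pow_smul (X x : ℝ) (e a : ℕ) :
    X ^ a * iteratedDeriv a (fun s : ℝ => s ^ e) (X * x) = X ^ e * (e.descFactorial a * x ^ (e - a)) := by
  rw [iteratedDeriv_pow]
  rcases le_or_gt a e with h | h
  · rw [mul_pow]
    have : X ^ e = X ^ a * X ^ (e - a) := by rw [← pow_add, Nat.add_sub_cancel' h]
    rw [this]; ring
  · rw [Nat.descFactorial_eq_zero_iff_lt.2 h]; simp

lemma monomial_seq (S : Finset (Idx d)) (a e : Idx d → ℕ) (z : Idx d → ℝ) (k : ℝ) :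
    ∏ i ∈ S, (((2 : ℝ) ^ k) ^ P.wt i) ^ a i *
      iteratedDeriv (a i) (fun s : ℝ => s ^ e i) (((2 : ℝ) ^ k) ^ P.wt i * z i) =
    (2 : ℝ) ^ (k * ∑ i ∈ S, P.wt i * e i) *
      ∏ i ∈ S, ((e i).descFactorial (a i) * z i ^ (e i - a i) : ℝ) := by
  rw [Finset.mul_sum, Real.rpow_sum_of_pos two_pos, ← Finset.prod_mul_distrib]
  refine Finset.prod_congr rfl fun i _ => ?_
  rw [iteratedDeriv_pow_smul, ← Real.rpow_natCast, ← Real.rpow_mul two_pos.le,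
    ← Real.rpow_mul two_pos.le, mul_assoc]

lemma charOp_geom {ds : List ℝ} {D : ℝ} (u : ℝ) (h : u ≠ 0 → D ∈ ds) :
    charOp seqShift ds (fun k : ℤ => (2 : ℝ) ^ ((k : ℝ) * D) * u) = 0 := by
  by_cases hu : u = 0
  · have : (fun k : ℤ => (2 : ℝ) ^ ((k : ℝ) * D) * u) = 0 := by ext k; simp [hu]
    rw [this, map_zero]
  · refine charOp_eq_zero_of_eigen seqShift (h hu) ?_
    ext k
    rw [seqShift_apply, Pi.smul_apply, smul_eq_mul, ← mul_assoc, ← Real.rpow_add two_pos]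
    push_cast; congr 2; ring

/-- The factor `w e` depends on neither `X` nor `x` and only records which modes survive `a`
derivatives; those with `e < a` are absent. -/
lemma polynomial_seq (q : Polynomial ℝ) {m : ℕ} (hq : q.degree < m) (a : ℕ) : ∃ w : ℕ → ℝ,
    (∀ e, e < a → w e = 0) ∧ ∃ w' : ℕ → ℝ → ℝ, ∀ X x : ℝ,
      X ^ a * iteratedDeriv a (fun s => q.eval s) (X * x) =
        ∑ e ∈ Finset.range m, w e * w' e x * X ^ e := by
  refine ⟨fun e => e.descFactorial a, fun e he => by
    simp [Nat.descFactorial_eq_zero_iff_lt.2 he],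
    fun e x => q.coeff e * x ^ (e - a), fun X x => ?_⟩
  have hn : q.natDegree < m ∨ q = 0 := by
    by_cases h : q = 0
    · exact Or.inr h
    · exact Or.inl ((Polynomial.natDegree_lt_iff_degree_lt h).2 hq)
  have e1 : (fun s => q.eval s) = fun s => ∑ e ∈ Finset.range m, q.coeff e * s ^ e := by
    rcases hn with hn | hn
    · ext s; exact Polynomial.eval_eq_sum_range' hn s
    · subst hn; ext s; simp
  rw [e1, iteratedDeriv_fun_sum fun e _ => (contDiff_const.mul (contDiff_id.pow _)).contDiffAt,
    Finset.mul_sum]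
  refine Finset.sum_congr rfl fun e _ => ?_
  rw [iteratedDeriv_const_mul_field]
  have := iteratedDeriv_pow_smul X x e a
  calc _ = q.coeff e * (X ^ a * iteratedDeriv a (fun s : ℝ => s ^ e) (X * x)) := by ring
    _ = _ := by rw [this]; ring

end Params

namespace Params

variable (P : Params) {d : ℕ}

lemma rpow_sum_wt {X : ℝ} (hX : 0 < X) (L : List (Idx d)) :
    X ^ (L.map P.wt).sum = ∏ i, (X ^ P.wt i) ^ L.count i := by
  induction L with
  | nil => simp
  | cons i L ih =>
    rw [List.map_cons, List.sum_cons, Real.rpow_add hX, ih,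
      ← Finset.mul_prod_erase _ _ (Finset.mem_univ i),
      ← Finset.mul_prod_erase _ (fun j => (X ^ P.wt j) ^ (i :: L).count j) (Finset.mem_univ i),
      List.count_cons_self, pow_succ]
    have : ∏ j ∈ Finset.univ.erase i, (X ^ P.wt j) ^ (i :: L).count j =
        ∏ j ∈ Finset.univ.erase i, (X ^ P.wt j) ^ L.count j :=
      Finset.prod_congr rfl fun j hj => by
        rw [List.count_cons_of_ne (Finset.ne_of_mem_erase hj).symm]
    rw [this]; ring

lemma sum_wt_univ (e : Idx d → ℕ) :
    ∑ i, P.wt i * (e i : ℝ) = (∑ j : Fin (d + 1), (e (some j) : ℝ)) + e none * P.μ := by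
  rw [Fintype.sum_option]; simp only [wt, one_mul]; ring

lemma sum_wt_erase (e : Idx d → ℕ) :
    ∑ i ∈ Finset.univ.erase (nrm d), P.wt i * (e i : ℝ) =
      (∑ j : Fin d, (e (some j.castSucc) : ℝ)) + e none * P.μ := by
  have h1 := Finset.add_sum_erase Finset.univ (fun i => P.wt i * (e i : ℝ)) (Finset.mem_univ (nrm d))
  rw [sum_wt_univ, Fin.sum_univ_castSucc] at h1
  simp only [wt, one_mul] at h1 ⊢
  linarith

lemma sum_le_of_le {k : ℕ} {f : Fin k → ℕ} {m : ℕ} (h : ∀ j, f j ≤ m) : ∑ j, f j ≤ k * m := by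
  simpa using Finset.sum_le_card_nsmul Finset.univ f m fun j _ => h j

/-- A derivative of a monomial is one geometric mode, whose exponent is the weighted degree. It
vanishes unless each exponent is at least the number of derivatives taken, whence the lower bound
`cnt L` on the spatial degree. -/
lemma charOp_monomials (L : List (Idx d)) (e : Idx d → ℕ) (he : ∀ i, e i ≤ P.mi i) (z : Idx d → ℝ)
    {h : Idx d → ℝ → ℝ} (hh : ∀ i, h i = fun s => s ^ e i) :
    charOp seqShift (P.degs d (cnt L) 0)
      (P.seqAt (L.map P.wt).sum 1 0 z (fun z => ∏ i, iteratedDeriv (L.count i) (h i) (z i))) = 0 := by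
  have : P.seqAt (L.map P.wt).sum 1 0 z (fun z => ∏ i, iteratedDeriv (L.count i) (h i) (z i)) =
      fun k : ℤ => (2 : ℝ) ^ ((k : ℝ) * ∑ i, P.wt i * e i) *
        ∏ i, ((e i).descFactorial (L.count i) * z i ^ (e i - L.count i) : ℝ) := by
    ext k
    rw [seqAt_apply, one_mul, P.rpow_sum_wt (Real.rpow_pos_of_pos two_pos _),
      ← Finset.prod_mul_distrib, ← monomial_seq]
    refine Finset.prod_congr rfl fun i _ => ?_
    simp only [hh, scal, Pi.zero_apply, zero_add]
  rw [this]
  refine charOp_geom _ fun hu => ?_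
  have hle : ∀ i, L.count i ≤ e i := by
    intro i
    by_contra hlt
    refine hu (Finset.prod_eq_zero (Finset.mem_univ i) ?_)
    rw [Nat.descFactorial_eq_zero_iff_lt.2 (not_le.1 hlt)]; simp
  rw [mem_degs, sum_wt_univ]
  refine ⟨∑ j : Fin (d + 1), e (some j), e none, Finset.sum_le_sum fun j _ => hle _,
    sum_le_of_le fun j => he (some j), Nat.lt_succ_of_le (he none), ?_⟩
  push_cast; ring

/-- The profile satisfies `F(2s) = 2^μ F(s) + q(s)`, so its sequence is a generalized mode: `δ -
2^(D + μ)`, with `D` the weighted degree in the other variables, leaves only the polynomial modes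
coming from `q`. The first half of `degList` kills those, the second half contains `D + μ`. Only
tangential derivatives bound the degree from below here, hence `tcnt L`. -/
lemma charOp_profile (L : List (Idx d)) (e : Idx d → ℕ) (he : ∀ i, e i ≤ P.mi i) (z : Idx d → ℝ)
    (hz : z ∈ halfQ d) {h : Idx d → ℝ → ℝ} (hh : ∀ i, i ≠ nrm d → h i = fun s => s ^ e i)
    {q : Polynomial ℝ} (hq : q.degree < P.m)
    (hF : ∀ k : ℕ, ∀ s ∈ Ioi (0 : ℝ), 2 ^ k * iteratedDeriv k (h (nrm d)) (2 * s) =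
      2 ^ ((P.m : ℝ) - P.n) * iteratedDeriv k (h (nrm d)) s + iteratedDeriv k (fun s => q.eval s) s) :
    charOp seqShift (P.degList L)
      (P.seqAt (L.map P.wt).sum 1 0 z (fun z => ∏ i, iteratedDeriv (L.count i) (h i) (z i))) = 0 := by
  set S := Finset.univ.erase (nrm d) with hS
  set D := ∑ i ∈ S, P.wt i * (e i : ℝ) with hD
  set u : ℝ := ∏ i ∈ S, ((e i).descFactorial (L.count i) * z i ^ (e i - L.count i) : ℝ) with hu
  set a := L.count (nrm d) with ha
  set y := P.seqAt (L.map P.wt).sum 1 0 z (fun z => ∏ i, iteratedDeriv (L.count i) (h i) (z i)) with hy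
  have hyk : ∀ k : ℤ, y k = (2 : ℝ) ^ ((k : ℝ) * D) * u *
      (((2 : ℝ) ^ (k : ℝ)) ^ a * iteratedDeriv a (h (nrm d)) ((2 : ℝ) ^ (k : ℝ) * z (nrm d))) := by
    intro k
    rw [hy, seqAt_apply, one_mul, P.rpow_sum_wt (Real.rpow_pos_of_pos two_pos _),
      ← Finset.prod_mul_distrib, ← Finset.mul_prod_erase _ _ (Finset.mem_univ (nrm d)), mul_comm, hD, hu,
      ← monomial_seq]
    congr 1
    · refine Finset.prod_congr rfl fun i hi => ?_
      rw [hh i (Finset.ne_of_mem_erase hi)]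
      simp only [scal, Pi.zero_apply, zero_add]
    · simp only [scal, Pi.zero_apply, zero_add, wt, Real.rpow_one, ha]
  by_cases hu0 : u = 0
  · have : y = 0 := by ext k; rw [hyk, hu0]; simp
    rw [this, map_zero]
  have hle : ∀ i, i ≠ nrm d → L.count i ≤ e i := by
    intro i hi
    by_contra hlt
    refine hu0 (Finset.prod_eq_zero (Finset.mem_erase.2 ⟨hi, Finset.mem_univ i⟩) ?_)
    rw [Nat.descFactorial_eq_zero_iff_lt.2 (not_le.1 hlt)]; simp
  have hne : ∀ j : Fin d, (some j.castSucc : Idx d) ≠ nrm d := fun j hj =>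
    (Fin.castSucc_lt_last j).ne (Option.some_injective _ hj)
  have ht : tcnt L ≤ ∑ j : Fin d, e (some j.castSucc) := Finset.sum_le_sum fun j _ => hle _ (hne j)
  have ht2 : ∑ j : Fin d, e (some j.castSucc) ≤ d * P.m := sum_le_of_le fun j => he _
  have hn2 : e none < 2 := Nat.lt_succ_of_le (he none)
  obtain ⟨w, hw, w', hww⟩ := polynomial_seq q hq a
  -- The remainder of the dilation identity, expanded into pure modes of exponents `D + i`.
  have hstep : seqShift y - (2 : ℝ) ^ (D + P.μ) • y = ∑ i ∈ Finset.range P.m,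
      fun k : ℤ => (2 : ℝ) ^ ((k : ℝ) * (D + i)) * ((2 : ℝ) ^ D * u * w i * w' i (z (nrm d))) := by
    ext k
    rw [Pi.sub_apply, Pi.smul_apply, seqShift_apply, hyk, hyk, smul_eq_mul, Finset.sum_apply]
    have hX : (0 : ℝ) < (2 : ℝ) ^ (k : ℝ) := Real.rpow_pos_of_pos two_pos _
    set X := (2 : ℝ) ^ (k : ℝ) with hXd
    have e1 : (2 : ℝ) ^ ((k + 1 : ℤ) : ℝ) = 2 * X := by
      push_cast; rw [Real.rpow_add two_pos, Real.rpow_one, mul_comm]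
    have e2 : (2 : ℝ) ^ (((k + 1 : ℤ) : ℝ) * D) = (2 : ℝ) ^ ((k : ℝ) * D) * 2 ^ D := by
      push_cast; rw [add_mul, one_mul, Real.rpow_add two_pos]
    have e3 := hF a (X * z (nrm d)) (Set.mem_Ioi.2 (mul_pos hX hz))
    have e4 := hww X (z (nrm d))
    have e5 : ∀ i : ℕ, (2 : ℝ) ^ ((k : ℝ) * (D + i)) = (2 : ℝ) ^ ((k : ℝ) * D) * X ^ i := by
      intro i
      rw [mul_add, Real.rpow_add two_pos, hXd, ← Real.rpow_mul_natCast two_pos.le]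
    have e6 : ∑ i ∈ Finset.range P.m, (2 : ℝ) ^ ((k : ℝ) * (D + i)) *
        ((2 : ℝ) ^ D * u * w i * w' i (z (nrm d))) = (2 : ℝ) ^ ((k : ℝ) * D) * 2 ^ D * u *
        ∑ i ∈ Finset.range P.m, w i * w' i (z (nrm d)) * X ^ i := by
      rw [Finset.mul_sum]
      exact Finset.sum_congr rfl fun i _ => by rw [e5]; ring
    rw [e1, e2, e6, ← e4, mul_pow, mul_assoc 2 X, Real.rpow_add two_pos]
    have e7 : (2 : ℝ) ^ P.μ = 2 ^ ((P.m : ℝ) - P.n) := rfl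
    rw [e7]
    linear_combination ((2 : ℝ) ^ ((k : ℝ) * D) * 2 ^ D * u * X ^ a) * e3
  -- Once the first half has removed the remainder `hstep`, what is left is a genuine eigenvector
  -- for `2^(D + μ)`.
  rw [degList, charOp_append]
  refine charOp_eq_zero_of_eigen seqShift (d := D + P.μ) ?_ ?_
  · rw [mem_degs]
    refine ⟨_, _, ht, ht2.trans (Nat.mul_le_mul_right _ (Nat.le_succ d)), hn2, ?_⟩
    rw [hD, sum_wt_erase]; push_cast; ring
  · rw [← sub_eq_zero, ← charOp_apply_comm, ← map_smul, ← map_sub, hstep, map_sum]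
    refine Finset.sum_eq_zero fun i hi => charOp_geom _ fun h0 => ?_
    have hai : a ≤ i := by
      by_contra hlt
      rw [hw i (not_le.1 hlt)] at h0; simp at h0
    have him := Finset.mem_range.1 hi
    rw [mem_degs, hD, sum_wt_erase]
    refine ⟨(∑ j : Fin d, e (some j.castSucc)) + i, e none, ?_, ?_, hn2, ?_⟩
    · rw [cnt, Fin.sum_univ_castSucc]
      exact add_le_add ht hai
    · rw [add_mul, one_mul]; exact add_le_add ht2 him.le
    · push_cast; ring

lemma pdL_prod_idx (L : List (Idx d)) (h : Idx d → ℝ → ℝ) :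
    pdL L (fun z => ∏ i, h i (z i)) = fun z => ∏ i, iteratedDeriv (L.count i) (h i) (z i) := by
  rw [pdL_prod, lawful_beq_subsingleton (instBEqOfDecidableEq : BEq (Idx d)) Option.instBEq]

/-- By linearity only the product functions matter: those with a power in the normal variable fall
under `charOp_monomials`, those with the profile under `charOp_profile`. -/
lemma charOp_ker (L : List (Idx d)) {R : ℝ} (hR : 1 < R) {K : (Idx d → ℝ) → ℝ}
    (hK : K ∈ (P.frame d R hR).ker) : PdReg L (halfQ d) K ∧ ∀ z ∈ halfQ d,
      charOp seqShift (P.degList L) (P.seqAt (L.map P.wt).sum 1 0 z (pdL L K)) = 0 := by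
  have ext_seq : ∀ {g g' : (Idx d → ℝ) → ℝ}, (∀ z ∈ halfQ d, g z = g' z) → ∀ z ∈ halfQ d,
      P.seqAt (L.map P.wt).sum 1 0 z g = P.seqAt (L.map P.wt).sum 1 0 z g' := by
    intro g g' h z hz
    ext k
    rw [seqAt_apply, seqAt_apply, h _ (P.scal_mem (by positivity) rfl hz)]
  induction hK using Submodule.span_induction with
  | mem v hv =>
    obtain ⟨b, rfl⟩ := hv
    set h : Idx d → ℝ → ℝ := fun i => basisFun ((P.frame d R hR).m i) ((P.frame d R hR).F i) (b i) with hh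
    have hk : (P.frame d R hR).kerFun b = fun z => ∏ i, h i (z i) := rfl
    have hb : ∀ i, (b i : ℕ) ≤ P.mi i := fun i => Nat.lt_succ_iff.1 (b i).2
    have hmon : ∀ i, (i ≠ nrm d ∨ (b i : ℕ) < P.mi i) → h i = fun s => s ^ (b i : ℕ) := by
      intro i hi
      ext s
      simp only [hh, basisFun]
      split_ifs with h1
      · rfl
      · rcases hi with hi | hi
        · have : (b i : ℕ) = P.mi i := le_antisymm (hb i) (not_lt.1 h1)
          rw [this]; simp [frame, hi]
        · exact absurd hi h1
    have hprof : ¬ ((b (nrm d) : ℕ) < P.mi (nrm d)) →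
        h (nrm d) = (exists_normal_profile P.one_le_m P.n).choose := by
      intro hlt
      ext s
      have : h (nrm d) s = (P.frame d R hR).F (nrm d) s := by
        simp only [hh, basisFun]; rw [if_neg]; exact hlt
      rw [this]; simp [frame]
    obtain ⟨hF1, -, q, hq, hF3⟩ := (exists_normal_profile P.one_le_m P.n).choose_spec
    constructor
    · rw [hk]
      refine pdReg_prod isOpen_Ji (fun z hz i => ?_) fun i => ?_
      · unfold Ji
        split_ifs with h1
        · subst h1; exact hz
        · trivial
      · by_cases h1 : i ≠ nrm d ∨ (b i : ℕ) < P.mi i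
        · rw [hmon i h1]; exact (contDiff_id.pow _).contDiffOn
        · push Not at h1
          obtain ⟨rfl, h2⟩ := h1
          rw [hprof (not_lt.2 h2)]; simpa [Ji] using hF1
    · intro z hz
      rw [hk, pdL_prod_idx]
      by_cases h1 : (b (nrm d) : ℕ) < P.mi (nrm d)
      · rw [degList, charOp_append, P.charOp_monomials L (fun i => b i) hb z fun i => hmon i ?_, map_zero]
        by_cases h2 : i = nrm d
        · subst h2; exact Or.inr h1
        · exact Or.inl h2
      · refine P.charOp_profile L (fun i => b i) hb z hz (fun i hi => hmon i (Or.inl hi)) hq ?_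
        rw [hprof h1]; exact hF3
  | zero =>
    have h0 : ∀ L : List (Idx d), pdL L (0 : (Idx d → ℝ) → ℝ) = 0 := fun L => by
      have := pdL_smul L 0 (0 : (Idx d → ℝ) → ℝ)
      simpa using this
    have h1 : ∀ L : List (Idx d), PdReg L (halfQ d) (0 : (Idx d → ℝ) → ℝ) := fun L => by
      induction L with
      | nil => trivial
      | cons i L ih => exact ⟨ih, fun z _ => by rw [h0]; exact differentiableAt_const _⟩
    exact ⟨h1 L, fun z _ => by rw [h0, map_zero, map_zero]⟩
  | add v w _ _ h1 h2 =>
    obtain ⟨r1, r2⟩ := h1.1.add (isOpen_halfQ d) h2.1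
    refine ⟨r1, fun z hz => ?_⟩
    rw [ext_seq (g' := pdL L v + pdL L w) r2 z hz, map_add, map_add, h1.2 z hz, h2.2 z hz, add_zero]
  | smul c v _ h =>
    refine ⟨h.1.smul c, fun z hz => ?_⟩
    rw [pdL_smul, map_smul, map_smul, h.2 z hz, smul_zero]

end Params

/-! ### Scale-invariant bounds for the derivatives -/

namespace Params

variable (P : Params) {d : ℕ}

/-- A normalized region. -/
def unitBox (d : ℕ) : Set (Idx d → ℝ) :=
  {z | (∀ i, |z i| ≤ 1) ∧ 1 / 4 ≤ z (nrm d)}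

/-- The estimates satisfied by the derivatives of good functions. -/
structure Recurrent (ds : List ℝ) (b : ℝ) (κ : Idx d → ℝ) (B : ℝ) (g : (Idx d → ℝ) → ℝ) : Prop where
  bound : ∀ l : ℝ, 0 < l → ∀ c : Idx d → ℝ, c (nrm d) = 0 → ∀ z ∈ unitBox d, ∀ k : ℤ,
    |charOp seqShift ds (P.seqAt b l c z g) k| ≤ B * (l * (2 : ℝ) ^ (k : ℝ)) ^ P.σ
  holder : ∀ l : ℝ, 0 < l → ∀ c : Idx d → ℝ, c (nrm d) = 0 → ∀ z ∈ unitBox d, ∀ z' ∈ unitBox d,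
    ∀ k : ℤ, |charOp seqShift ds (P.seqAt b l c z' g - P.seqAt b l c z g) k| ≤
      B * (l * (2 : ℝ) ^ (k : ℝ)) ^ P.σ * ∑ i, |z' i - z i| ^ κ i

lemma scal_scal {l l' : ℝ} (hl : 0 < l) (hl' : 0 < l') (c z : Idx d → ℝ) :
    P.scal l c (P.scal l' 0 z) = P.scal (l * l') c z := by
  ext i
  simp only [scal, Pi.zero_apply, zero_add, Real.mul_rpow hl.le hl'.le]; ring

/-- Moving along the dyadic sequence amounts to dilating the function, so bounds at index `0` for
all dilates of `U` give bounds at every index. -/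
lemma seqAt_shift {l : ℝ} (hl : 0 < l) (c z : Idx d → ℝ) (U : (Idx d → ℝ) → ℝ)
    (L : List (Idx d)) (k j : ℤ) :
    P.seqAt (L.map P.wt).sum l c z (pdL L U) (k + j) =
      P.seqAt (L.map P.wt).sum 1 0 z
        (pdL L (fun y => U (P.scal (l * (2 : ℝ) ^ (k : ℝ)) c y))) j := by
  have h2 : ∀ x : ℝ, (0 : ℝ) < (2 : ℝ) ^ x := fun x => Real.rpow_pos_of_pos two_pos _
  have hlk : 0 < l * (2 : ℝ) ^ (k : ℝ) := mul_pos hl (h2 _)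
  rw [seqAt_apply, seqAt_apply, P.pdL_scal hlk, one_mul, P.scal_scal hlk (h2 _)]
  have e : l * (2 : ℝ) ^ ((k + j : ℤ) : ℝ) = l * (2 : ℝ) ^ (k : ℝ) * (2 : ℝ) ^ (j : ℝ) := by
    push_cast; rw [Real.rpow_add two_pos]; ring
  rw [e, Real.mul_rpow hlk.le (h2 _).le]; ring

lemma charOp_seqShift_shift (ds : List ℝ) (y : ℤ → ℝ) (k : ℤ) :
    charOp seqShift ds y k = charOp seqShift ds (fun j => y (k + j)) 0 := by
  let φ : (ℤ → ℝ) →ₗ[ℝ] (ℤ → ℝ) :=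
    { toFun := fun y j => y (k + j), map_add' := fun _ _ => rfl, map_smul' := fun _ _ => rfl }
  have := congrFun (charOp_intertwine seqShift seqShift φ (fun y => by
    ext j; simp only [φ, LinearMap.coe_mk, AddHom.coe_mk, seqShift_apply, add_assoc]) ds y) 0
  simpa [φ] using this

lemma Good.isHolder_continuousOn {A : ℝ} {U : (Idx d → ℝ) → ℝ} (hU : P.Good A U) (R : ℝ)
    (hR : 1 < R) : ContinuousOn U (P.frame d R hR).box := hU.continuousOn.mono fun z hz => by
  have : 1 / 32 ≤ z (nrm d) := by simpa [frame] using (hz (nrm d)).1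
  exact show 0 < z (nrm d) by linarith

/-- The centre of the balls adapted to the frames. -/
def centre (d : ℕ) (R : ℝ) : Idx d → ℝ := Function.update 0 (nrm d) R

lemma ball_centre_subset {R : ℝ} (hR : 1 < R) :
    Metric.ball (centre d R) (R - 1 / 16) ⊆ (P.frame d R hR).box := by
  intro z hz i
  have h := (dist_le_pi_dist z (centre d R) i).trans_lt (Metric.mem_ball.1 hz)
  rw [Real.dist_eq, abs_lt] at h
  by_cases hi : i = nrm d
  · subst hi
    simp only [centre, Function.update_self] at h
    simp only [frame, if_true]
    constructor <;> linarith [h.1, h.2]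
  · simp only [centre, Function.update_of_ne hi, Pi.zero_apply, sub_zero] at h
    simp only [frame, if_neg hi]
    constructor <;> linarith [h.1, h.2]

lemma scal_mem_ball {N : ℕ} {R : ℝ} (hR : (2 : ℝ) ^ (N * max 1 P.μ) + 2 ≤ R) {z : Idx d → ℝ}
    (hz : z ∈ unitBox d) {i : ℕ} (hi : i ≤ N) :
    P.scal ((2 : ℝ) ^ (i : ℝ)) 0 z ∈ Metric.ball (centre d R) (R - 1 / 8) := by
  have hp : (0 : ℝ) < (2 : ℝ) ^ (N * max 1 P.μ) := Real.rpow_pos_of_pos two_pos _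
  rw [Metric.mem_ball, dist_pi_lt_iff (by linarith)]
  intro j
  have hw : P.wt j ≤ max 1 P.μ := by
    rcases j with _ | j
    · exact le_max_right _ _
    · exact le_max_left _ _
  have hiN : (i : ℝ) ≤ N := by exact_mod_cast hi
  have h1 : ((2 : ℝ) ^ (i : ℝ)) ^ P.wt j ≤ (2 : ℝ) ^ (N * max 1 P.μ) := by
    rw [← Real.rpow_mul two_pos.le]
    exact Real.rpow_le_rpow_of_exponent_le one_le_two
      (mul_le_mul hiN hw (P.wt_pos j).le (Nat.cast_nonneg _))
  have h1' : (1 : ℝ) ≤ ((2 : ℝ) ^ (i : ℝ)) ^ P.wt j := by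
    rw [← Real.rpow_mul two_pos.le]
    exact Real.one_le_rpow one_le_two (mul_nonneg (Nat.cast_nonneg _) (P.wt_pos j).le)
  have h2 : |((2 : ℝ) ^ (i : ℝ)) ^ P.wt j * z j| ≤ (2 : ℝ) ^ (N * max 1 P.μ) := by
    rw [abs_mul, abs_of_pos (by linarith)]
    exact (mul_le_mul h1 (hz.1 j) (abs_nonneg _) hp.le).trans (by rw [mul_one])
  simp only [scal, Pi.zero_apply, zero_add, Real.dist_eq]
  rw [abs_le] at h2
  by_cases hj : j = nrm d
  · subst hj
    simp only [centre, Function.update_self]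
    have h3 : 1 / 4 ≤ ((2 : ℝ) ^ (i : ℝ)) ^ P.wt (nrm d) * z (nrm d) := by nlinarith [hz.2]
    rw [abs_lt]; constructor <;> linarith [h2.1, h2.2]
  · simp only [centre, Function.update_of_ne hj, Pi.zero_apply, sub_zero]
    rw [abs_lt]; constructor <;> linarith [h2.1, h2.2]

lemma unitBox_subset : unitBox d ⊆ halfQ d := fun z hz => by
  have := hz.2
  exact show 0 < z (nrm d) by linarith

/-- At index `0` the operator involves only the dilates by `2^i` with `i ≤ N`. A single frame
contains them all; there `U` is replaced by `U - K` with `K` in its kernel, which the operator does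
not see, and the interior estimate modulo the kernel applies. -/
lemma exists_normalized_bound (L : List (Idx d)) (hL : (L.map P.ord).sum < P.m + P.γ)
    {κ : Idx d → ℝ} (hκ0 : ∀ i, 0 ≤ κ i) (hκ1 : ∀ i, κ i < 1)
    (hκ : ∀ i, κ i * P.ord i ≤ P.m + P.γ - (L.map P.ord).sum) :
    ∃ C : ℝ, 0 ≤ C ∧ ∀ (U : (Idx d → ℝ) → ℝ) (A : ℝ), 0 ≤ A → P.Good A U →
      (∀ z ∈ unitBox d,
        |charOp seqShift (P.degList L) (P.seqAt (L.map P.wt).sum 1 0 z (pdL L U)) 0| ≤ C * A) ∧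
      ∀ z ∈ unitBox d, ∀ z' ∈ unitBox d, |charOp seqShift (P.degList L)
        (P.seqAt (L.map P.wt).sum 1 0 z' (pdL L U) - P.seqAt (L.map P.wt).sum 1 0 z (pdL L U)) 0| ≤
          C * A * ∑ i, |z' i - z i| ^ κ i := by
  set ds := P.degList L with hds
  set N := ds.length with hN
  set b := (L.map P.wt).sum with hb
  have hb0 : 0 ≤ b := list_sum_nonneg P.wt_pos L
  set E : ℝ := (2 : ℝ) ^ (N * max 1 P.μ) with hE
  have hE0 : 0 < E := Real.rpow_pos_of_pos two_pos _
  -- `E` bounds the dilation factors of all coordinates up to `2^N`, so the dilated normalized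
  -- regions fit into the frame of size `R` with a margin.
  set R : ℝ := E + 2 with hRd
  have hR : 1 < R := by linarith
  obtain ⟨C, hC, H⟩ := Frame.IsHolder.exists_ker_pdL_sub_le (P.frame d R hR) (K := P.m) P.one_le_m
    P.mi_le P.ord_pos P.ord_mul L hL (r := R - 1 / 16) (r' := R - 1 / 8) (by linarith) (by linarith)
    hκ0 hκ1 hκ
  set c32 : ℝ := (32 : ℝ) ^ (P.n / P.m * P.γ + P.n) with hc32
  have hc0 : 0 < c32 := Real.rpow_pos_of_pos (by norm_num) _
  set G : ℝ := ∑ i : Idx d, E ^ κ i with hG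
  have hG0 : ∀ i ∈ (Finset.univ : Finset (Idx d)), 0 ≤ E ^ κ i := fun i _ => (Real.rpow_pos_of_pos hE0 _).le
  have hGG : 0 ≤ G := Finset.sum_nonneg hG0
  have h2N : (0 : ℝ) < (2 : ℝ) ^ (N * b) := Real.rpow_pos_of_pos two_pos _
  have hcc := charConst_nonneg ds
  refine ⟨charConst ds * ((2 : ℝ) ^ (N * b) * (C * c32) * (1 + G)), by positivity,
    fun U A hA hU => ?_⟩
  obtain ⟨-, -, K, hK, hK1, hK2⟩ := H U (c32 * A) (centre d R) (by positivity) (hU.isHolder P R hR)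
    (hU.isHolder_continuousOn P R hR) (P.ball_centre_subset hR)
  have hkill : ∀ z ∈ halfQ d, charOp seqShift ds (P.seqAt b 1 0 z (pdL L K)) = 0 :=
    (P.charOp_ker L hR hK).2
  have hpw : ∀ i ≤ N, ((2 : ℝ) ^ (i : ℝ)) ^ b ≤ (2 : ℝ) ^ (N * b) := fun i hi => by
    rw [← Real.rpow_mul two_pos.le]
    exact Real.rpow_le_rpow_of_exponent_le one_le_two
      (mul_le_mul_of_nonneg_right (by exact_mod_cast hi) hb0)
  constructor
  · intro z hz
    have e1 : charOp seqShift ds (P.seqAt b 1 0 z (pdL L U)) =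
        charOp seqShift ds (P.seqAt b 1 0 z (pdL L U) - P.seqAt b 1 0 z (pdL L K)) := by
      rw [map_sub, hkill z (unitBox_subset hz), sub_zero]
    rw [e1]
    refine (charOp_seqShift_abs_le ds _ ((2 : ℝ) ^ (N * b) * (C * (c32 * A))) 0 fun i hi => ?_).trans ?_
    · rw [Pi.sub_apply, seqAt_apply, seqAt_apply, ← mul_sub, abs_mul]
      simp only [zero_add, one_mul, Int.cast_natCast]
      rw [abs_of_pos (by positivity)]
      exact mul_le_mul (hpw i hi) (hK1 _ (P.scal_mem_ball le_rfl hz hi)) (abs_nonneg _) h2N.le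
    · rw [mul_assoc (charConst ds)]
      refine mul_le_mul_of_nonneg_left ?_ hcc
      have : 0 ≤ (2 : ℝ) ^ (N * b) * (C * c32) * G * A := by positivity
      nlinarith
  · intro z hz z' hz'
    set S := ∑ i, |z' i - z i| ^ κ i with hS
    have hS0 : 0 ≤ S := Finset.sum_nonneg fun i _ => Real.rpow_nonneg (abs_nonneg _) _
    have e1 : charOp seqShift ds (P.seqAt b 1 0 z' (pdL L U) - P.seqAt b 1 0 z (pdL L U)) =
        charOp seqShift ds (P.seqAt b 1 0 z' (pdL L U - pdL L K) - P.seqAt b 1 0 z (pdL L U - pdL L K)) := by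
      simp only [map_sub, hkill z (unitBox_subset hz), hkill z' (unitBox_subset hz'), sub_zero]
    rw [e1]
    refine (charOp_seqShift_abs_le ds _ ((2 : ℝ) ^ (N * b) * (C * (c32 * A) * (G * S))) 0
      fun i hi => ?_).trans ?_
    · rw [Pi.sub_apply, seqAt_apply, seqAt_apply, ← mul_sub, abs_mul]
      simp only [zero_add, one_mul, Int.cast_natCast]
      rw [abs_of_pos (by positivity)]
      refine mul_le_mul (hpw i hi) ?_ (abs_nonneg _) h2N.le
      refine (abs_sub_le_sum_of_coordinates (by positivity) hK2
        (P.scal_mem_ball le_rfl hz hi) (P.scal_mem_ball le_rfl hz' hi)).trans ?_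
      refine mul_le_mul_of_nonneg_left ?_ (by positivity)
      rw [hS, Finset.mul_sum]
      refine Finset.sum_le_sum fun j _ => ?_
      have hw : P.wt j ≤ max 1 P.μ := by
        rcases j with _ | j
        · exact le_max_right _ _
        · exact le_max_left _ _
      have h1 : ((2 : ℝ) ^ (i : ℝ)) ^ P.wt j ≤ E := by
        rw [← Real.rpow_mul two_pos.le]
        exact Real.rpow_le_rpow_of_exponent_le one_le_two
          (mul_le_mul (by exact_mod_cast hi) hw (P.wt_pos j).le (Nat.cast_nonneg _))
      have h0 : (0 : ℝ) < ((2 : ℝ) ^ (i : ℝ)) ^ P.wt j := by positivity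
      simp only [scal, Pi.zero_apply, zero_add]
      rw [← mul_sub, abs_mul, abs_of_pos h0, Real.mul_rpow h0.le (abs_nonneg _)]
      refine mul_le_mul_of_nonneg_right ?_ (Real.rpow_nonneg (abs_nonneg _) _)
      exact (Real.rpow_le_rpow h0.le h1 (hκ0 j)).trans (Finset.single_le_sum hG0 (Finset.mem_univ j))
    · rw [mul_assoc (charConst ds), mul_assoc (charConst ds)]
      refine mul_le_mul_of_nonneg_left ?_ hcc
      have : 0 ≤ (2 : ℝ) ^ (N * b) * (C * c32) * A * S := by positivity
      nlinarith

/-- The derivatives of good functions are recurrent. -/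
lemma exists_recurrent (L : List (Idx d)) (hL : (L.map P.ord).sum < P.m + P.γ)
    {κ : Idx d → ℝ} (hκ0 : ∀ i, 0 ≤ κ i) (hκ1 : ∀ i, κ i < 1)
    (hκ : ∀ i, κ i * P.ord i ≤ P.m + P.γ - (L.map P.ord).sum) :
    ∃ C : ℝ, 0 ≤ C ∧ ∀ (U : (Idx d → ℝ) → ℝ) (A : ℝ), 0 ≤ A → P.Good A U →
      P.Recurrent (P.degList L) (L.map P.wt).sum κ (C * A) (pdL L U) := by
  obtain ⟨C, hC, H⟩ := P.exists_normalized_bound L hL hκ0 hκ1 hκ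
  refine ⟨C, hC, fun U A hA hU => ?_⟩
  have key : ∀ l : ℝ, 0 < l → ∀ c : Idx d → ℝ, c (nrm d) = 0 → ∀ k : ℤ, _ := fun l hl c hc k =>
    H _ (A * (l * (2 : ℝ) ^ (k : ℝ)) ^ P.σ) (by positivity) (hU.scal P (l := l * (2 : ℝ) ^ (k : ℝ))
      (by positivity) hc)
  constructor
  · intro l hl c hc z hz k
    rw [charOp_seqShift_shift]
    simp only [P.seqAt_shift hl]
    have := (key l hl c hc k).1 z hz
    rw [mul_assoc]; exact this
  · intro l hl c hc z hz z' hz' k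
    rw [charOp_seqShift_shift]
    simp only [Pi.sub_apply, P.seqAt_shift hl]
    have := (key l hl c hc k).2 z hz z' hz'
    rw [mul_assoc C]; exact this

lemma pdReg_iff_forall {L : List (Idx d)} {Ω : Set (Idx d → ℝ)} {v : (Idx d → ℝ) → ℝ} :
    PdReg L Ω v ↔ ∀ z ∈ Ω, PdReg L {z} v := by
  induction L with
  | nil => exact ⟨fun _ _ _ => trivial, fun _ => trivial⟩
  | cons i L ih =>
    constructor
    · intro h z hz
      exact h.mono (by simpa using hz)
    · intro h
      exact ⟨ih.2 fun z hz => (h z hz).1, fun z hz => (h z hz).2 z rfl⟩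

lemma pdReg_scal {l : ℝ} (hl : 0 < l) (c : Idx d → ℝ) {U : (Idx d → ℝ) → ℝ} {L : List (Idx d)}
    {z : Idx d → ℝ} (h : PdReg L {P.scal l c z} U) : PdReg L {z} (fun z => U (P.scal l c z)) := by
  induction L with
  | nil => trivial
  | cons i L ih =>
    refine ⟨ih h.1, ?_⟩
    rintro y rfl
    simp only [P.pdL_scal hl, P.scal_add_single]
    refine DifferentiableAt.const_mul ?_ _
    have h1 := h.2 _ rfl
    have h2 : DifferentiableAt ℝ (fun s : ℝ => l ^ P.wt i * s) 0 := by fun_prop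
    refine DifferentiableAt.comp (g := fun s : ℝ => pdL L U (P.scal l c y + s • Pi.single i 1)) (0 : ℝ)
      ?_ h2
    rw [mul_zero]; exact h1

/-- Existence and continuity of the derivatives of good functions. -/
lemma Good.pdReg_continuousOn (L : List (Idx d)) (hL : (L.map P.ord).sum < P.m + P.γ) {A : ℝ}
    (hA : 0 ≤ A) {U : (Idx d → ℝ) → ℝ} (hU : P.Good A U) :
    PdReg L (halfQ d) U ∧ ContinuousOn (pdL L U) (halfQ d) := by
  have hR : (1 : ℝ) < 3 := by norm_num
  obtain ⟨C, hC, H⟩ := Frame.IsHolder.exists_ker_pdL_sub_le (P.frame d 3 hR) (K := P.m) P.one_le_m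
    P.mi_le P.ord_pos P.ord_mul L hL (r := 3 - 1 / 16) (r' := 3 - 1 / 8) (by linarith) (by linarith)
    (κ := 0) (fun _ => le_rfl) (fun _ => one_pos) (fun i => by
      rw [Pi.zero_apply, zero_mul]; linarith)
  -- The dilation about the projection of `z` moves `z` to height `1` with all other coordinates
  -- `0`. This point lies in the inner ball around the centre at height `3`, where regularity is
  -- known, and the inverse dilation carries it back.
  have key : ∀ z ∈ halfQ d, PdReg L {z} U ∧ ContinuousAt (pdL L U) z := by
    intro z hz
    set l := z (nrm d) with hl
    have hl0 : 0 < l := hz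
    set c : Idx d → ℝ := Function.update z (nrm d) 0 with hc
    have hcN : c (nrm d) = 0 := by simp [hc]
    set V : (Idx d → ℝ) → ℝ := fun y => U (P.scal l c y) with hV
    have hGV := hU.scal P hl0 hcN
    have hA' : 0 ≤ A * l ^ P.σ := mul_nonneg hA (Real.rpow_nonneg hl0.le _)
    obtain ⟨h1, h2, -⟩ := H V _ (centre d 3) (by positivity) (hGV.isHolder P 3 hR)
      (hGV.isHolder_continuousOn P 3 hR) (P.ball_centre_subset hR)
    set c' : Idx d → ℝ := fun i => -(l⁻¹ ^ P.wt i) * c i with hc'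
    have hinv : ∀ y, P.scal l c (P.scal l⁻¹ c' y) = y := by
      intro y; ext i
      have : l ^ P.wt i * l⁻¹ ^ P.wt i = 1 := by
        rw [← Real.mul_rpow hl0.le (inv_nonneg.2 hl0.le), mul_inv_cancel₀ hl0.ne', Real.one_rpow]
      simp only [Params.scal, hc']
      linear_combination (y i - c i) * this
    have hz0 : P.scal l⁻¹ c' z ∈ Metric.ball (centre d 3) (3 - 1 / 8) := by
      rw [Metric.mem_ball, dist_pi_lt_iff (by norm_num)]
      intro i
      by_cases hi : i = nrm d
      · subst hi
        rw [P.scal_nrm (by simp [hc', hcN]), ← hl, inv_mul_cancel₀ hl0.ne', centre,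
          Function.update_self, Real.dist_eq]
        norm_num
      · simp only [Params.scal, hc', hc, centre, Function.update_of_ne hi, Pi.zero_apply]
        rw [Real.dist_eq]; simp; norm_num
    have hU' : U = fun y => V (P.scal l⁻¹ c' y) := by
      ext y; rw [hV]; simp only [hinv]
    constructor
    · rw [hU']
      exact P.pdReg_scal (inv_pos.2 hl0) c' (h1.mono (by simpa using hz0))
    · have e : pdL L U = fun y => l⁻¹ ^ (L.map P.wt).sum * pdL L V (P.scal l⁻¹ c' y) := by
        ext y
        conv_lhs => rw [hU']
        exact P.pdL_scal (inv_pos.2 hl0) c' V L y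
      rw [e]
      refine continuousAt_const.mul ?_
      exact ContinuousAt.comp (h2.continuousAt (Metric.isOpen_ball.mem_nhds hz0))
        (P.continuous_scal _ _).continuousAt
  exact ⟨pdReg_iff_forall.2 fun z hz => (key z hz).1,
    fun z hz => (key z hz).2.continuousWithinAt⟩

end Params

/-! ### Normalization at a point and the basic estimate for nearby pairs -/

/-- The Euclidean distance of the spatial parts. -/
noncomputable def spd {d : ℕ} (z z' : Idx d → ℝ) : ℝ :=
  ‖(WithLp.toLp 2 fun i : Fin (d + 1) => z (some i) - z' (some i) : Space d)‖

section spd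

variable {d : ℕ}

lemma spd_nonneg (z z' : Idx d → ℝ) : 0 ≤ spd z z' := norm_nonneg _

lemma spd_eq (z z' : Idx d → ℝ) :
    spd z z' = √(∑ i : Fin (d + 1), (z (some i) - z' (some i)) ^ 2) := by
  rw [spd, EuclideanSpace.norm_eq]
  simp

lemma spd_comm (z z' : Idx d → ℝ) : spd z z' = spd z' z := by
  rw [spd_eq, spd_eq]; congr 1
  exact Finset.sum_congr rfl fun i _ => by ring

lemma abs_sub_le_spd (z z' : Idx d → ℝ) (i : Fin (d + 1)) :
    |z (some i) - z' (some i)| ≤ spd z z' := by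
  have := PiLp.norm_apply_le (WithLp.toLp 2 fun i : Fin (d + 1) => z (some i) - z' (some i) : Space d) i
  simpa [spd] using this

lemma spd_le_of_abs_le {z z' y y' : Idx d → ℝ}
    (h : ∀ i : Fin (d + 1), |z (some i) - z' (some i)| ≤ |y (some i) - y' (some i)|) :
    spd z z' ≤ spd y y' := by
  rw [spd_eq, spd_eq]
  exact Real.sqrt_le_sqrt (Finset.sum_le_sum fun i _ => sq_le_sq.2 (h i))

lemma spd_vertical {z z' : Idx d → ℝ} (h : ∀ i, i ≠ nrm d → z i = z' i) :
    spd z z' = |z (nrm d) - z' (nrm d)| := by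
  rw [spd_eq, Fin.sum_univ_castSucc, Finset.sum_eq_zero, zero_add, Real.sqrt_sq_eq_abs]
  intro j _
  rw [h _ fun hj => (Fin.castSucc_lt_last j).ne (Option.some_injective _ hj), sub_self]
  norm_num

lemma spd_scal (P : Params) {l : ℝ} (hl : 0 < l) (c z z' : Idx d → ℝ) :
    spd (P.scal l c z) (P.scal l c z') = l * spd z z' := by
  rw [spd_eq, spd_eq, ← Real.sqrt_sq hl.le, ← Real.sqrt_mul (sq_nonneg l), Finset.mul_sum,
    Real.sqrt_sq hl.le]
  congr 1
  refine Finset.sum_congr rfl fun i _ => ?_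
  simp only [Params.scal, Params.wt, Real.rpow_one]; ring

end spd

namespace Params

variable (P : Params) {d : ℕ}

/-- The normalized base point. -/
def e1 (d : ℕ) : Idx d → ℝ := Function.update 0 (nrm d) 1

/-- The projection to the boundary. -/
def base (z : Idx d → ℝ) : Idx d → ℝ := Function.update z (nrm d) 0

/-- The point `z'` in the coordinates normalized at `z`. -/
noncomputable def nz (z z' : Idx d → ℝ) : Idx d → ℝ :=
  fun i => (z (nrm d) ^ P.wt i)⁻¹ * (z' i - base z i)

lemma base_nrm (z : Idx d → ℝ) : base z (nrm d) = 0 := by simp [base]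

lemma e1_nrm : e1 d (nrm d) = 1 := by simp [e1]

lemma scal_e1_base {z : Idx d → ℝ} : P.scal (z (nrm d)) (base z) (e1 d) = z := by
  ext i
  by_cases hi : i = nrm d
  · subst hi; rw [P.scal_nrm (base_nrm z), e1_nrm, mul_one]
  · simp [scal, base, e1, hi]

lemma scal_nz {z : Idx d → ℝ} (hz : z ∈ halfQ d) (z' : Idx d → ℝ) :
    P.scal (z (nrm d)) (base z) (P.nz z z') = z' := by
  ext i
  have : z (nrm d) ^ P.wt i ≠ 0 := (Real.rpow_pos_of_pos hz _).ne'
  simp only [scal, nz]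
  rw [mul_inv_cancel_left₀ this]; ring

lemma nz_sub_e1 {z : Idx d → ℝ} (hz : z ∈ halfQ d) (z' : Idx d → ℝ) (i : Idx d) :
    P.nz z z' i - e1 d i = (z (nrm d) ^ P.wt i)⁻¹ * (z' i - z i) := by
  by_cases hi : i = nrm d
  · subst hi
    have : z (nrm d) ≠ 0 := ne_of_gt hz
    simp only [nz, base_nrm, e1_nrm, wt, Real.rpow_one]; field_simp; ring
  · simp [nz, base, e1, hi]

lemma nz_nrm (z z' : Idx d → ℝ) : P.nz z z' (nrm d) = (z (nrm d))⁻¹ * z' (nrm d) := by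
  simp only [nz, base_nrm, wt, Real.rpow_one, sub_zero]

lemma e1_mem : e1 d ∈ unitBox d := by
  refine ⟨fun i => ?_, by rw [e1_nrm]; norm_num⟩
  by_cases hi : i = nrm d
  · subst hi; rw [e1_nrm]; norm_num
  · simp [e1, hi]

lemma nz_mem {z z' : Idx d → ℝ} (hz : z ∈ halfQ d) (hN : z' (nrm d) ≤ z (nrm d))
    (hN' : z (nrm d) / 4 ≤ z' (nrm d))
    (hi : ∀ i, i ≠ nrm d → |z' i - z i| ≤ z (nrm d) ^ P.wt i) : P.nz z z' ∈ unitBox d := by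
  have hz0 : 0 < z (nrm d) := hz
  have h1 : 1 / 4 ≤ P.nz z z' (nrm d) := by
    rw [nz_nrm, inv_mul_eq_div, le_div_iff₀ hz0]; linarith
  refine ⟨fun i => ?_, h1⟩
  by_cases h : i = nrm d
  · subst h
    rw [abs_of_nonneg (by linarith), nz_nrm, inv_mul_eq_div, div_le_one hz0]; exact hN
  · have hp : 0 < z (nrm d) ^ P.wt i := Real.rpow_pos_of_pos hz0 _
    have := hi i h
    simp only [nz, base, Function.update_of_ne h]
    rw [abs_mul, abs_of_pos (inv_pos.2 hp), inv_mul_eq_div, div_le_one hp]; exact this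

lemma rpow_dyadic {l : ℝ} (hl : 0 < l) (k : ℤ) (x : ℝ) :
    (l * (2 : ℝ) ^ (k : ℝ)) ^ x = l ^ x * (2 : ℝ) ^ ((k : ℝ) * x) := by
  rw [Real.mul_rpow hl.le (Real.rpow_nonneg two_pos.le _), ← Real.rpow_mul two_pos.le]

/-- The weighted function `z_N ^ p g`. -/
noncomputable def wf (p : ℝ) (g : (Idx d → ℝ) → ℝ) (z : Idx d → ℝ) : ℝ := z (nrm d) ^ p * g z

lemma wf_scal {l : ℝ} (hl : 0 < l) {c : Idx d → ℝ} (hc : c (nrm d) = 0) (p : ℝ)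
    (g : (Idx d → ℝ) → ℝ) {z : Idx d → ℝ} (hz : 0 ≤ z (nrm d)) :
    wf p g (P.scal l c z) = l ^ p * (z (nrm d) ^ p * g (P.scal l c z)) := by
  rw [wf, P.scal_nrm hc, Real.mul_rpow hl.le hz, mul_assoc]

/-- The points `z` and `z'` become `e1` and `nz z z'` after dilation about the projection of `z`,
and differences of `wf p g` are followed along all dyadic dilates of this pair. The hypothesis with
`M` says that they grow like `2^(kσ)` after normalization, while `Recurrent` bounds the recurrence
quantitatively. `seq_two_sided` removes `M`, and index `0` is the original pair. -/
lemma exists_local_pair {ds : List ℝ} (hσ : P.σ ∉ ds) (b : ℝ) (κ : Idx d → ℝ) (p : ℝ) :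
    ∃ C : ℝ, 0 ≤ C ∧ ∀ (g : (Idx d → ℝ) → ℝ) (B : ℝ), 0 ≤ B → P.Recurrent ds b κ B g →
    ∀ z ∈ halfQ d, ∀ z' ∈ halfQ d, P.nz z z' ∈ unitBox d → ∀ M : ℝ,
      (∀ l : ℝ, 0 < l → |wf p g (P.scal l (base z) (e1 d)) - wf p g (P.scal l (base z) (P.nz z z'))| ≤
        M * l ^ (p + P.σ - b)) →
      |wf p g z - wf p g z'| ≤ C * B * z (nrm d) ^ (p + P.σ - b) *
        (∑ i, ((z (nrm d) ^ P.wt i)⁻¹ * |z' i - z i|) ^ κ i + |1 - P.nz z z' (nrm d) ^ p|) := by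
  obtain ⟨C, hC, H⟩ := seq_two_sided ds P.σ hσ
  refine ⟨C, hC, fun g B hB hg z hz z' hz' hnz M hM => ?_⟩
  set l := z (nrm d) with hl
  have hl0 : 0 < l := hz
  set c := base z with hc
  have hcN : c (nrm d) = 0 := base_nrm z
  set q := P.nz z z' (nrm d) ^ p with hq
  have hnz0 : 0 ≤ P.nz z z' (nrm d) := by linarith [hnz.2]
  set S := ∑ i, ((l ^ P.wt i)⁻¹ * |z' i - z i|) ^ κ i with hS
  have hSe : ∑ i, |P.nz z z' i - e1 d i| ^ κ i = S := by
    refine Finset.sum_congr rfl fun i _ => ?_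
    rw [P.nz_sub_e1 hz, abs_mul, abs_of_pos (inv_pos.2 (Real.rpow_pos_of_pos hz _))]
  have hS0 : 0 ≤ S := by rw [← hSe]; exact Finset.sum_nonneg fun i _ => Real.rpow_nonneg (abs_nonneg _) _
  -- The factor `q` corrects the different heights of the two points: up to a power of the scale,
  -- `y` is the difference of the weighted functions.
  set y : ℤ → ℝ := P.seqAt b l c (e1 d) g - q • P.seqAt b l c (P.nz z z') g with hy
  have h2 : ∀ x : ℝ, (0 : ℝ) < (2 : ℝ) ^ x := fun x => Real.rpow_pos_of_pos two_pos _
  have hyk : ∀ k : ℤ, y k = (l * (2 : ℝ) ^ (k : ℝ)) ^ (b - p) *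
      (wf p g (P.scal (l * (2 : ℝ) ^ (k : ℝ)) c (e1 d)) -
        wf p g (P.scal (l * (2 : ℝ) ^ (k : ℝ)) c (P.nz z z'))) := by
    intro k
    have hL : 0 < l * (2 : ℝ) ^ (k : ℝ) := mul_pos hl0 (h2 _)
    rw [hy, Pi.sub_apply, Pi.smul_apply, seqAt_apply, seqAt_apply, smul_eq_mul,
      P.wf_scal hL hcN p g (by rw [e1_nrm]; norm_num), P.wf_scal hL hcN p g hnz0, e1_nrm,
      Real.one_rpow, Real.rpow_sub hL]
    have := (Real.rpow_pos_of_pos hL p).ne'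
    rw [← hq]
    field_simp
  have hb1 : ∀ k : ℤ, |y k| ≤ (M * l ^ P.σ) * (2 : ℝ) ^ ((k : ℝ) * P.σ) := by
    intro k
    have hL : 0 < l * (2 : ℝ) ^ (k : ℝ) := mul_pos hl0 (h2 _)
    rw [hyk, abs_mul, abs_of_pos (Real.rpow_pos_of_pos hL _), mul_assoc, ← rpow_dyadic hl0]
    refine (mul_le_mul_of_nonneg_left (hM _ hL) (Real.rpow_pos_of_pos hL _).le).trans (le_of_eq ?_)
    have : (l * (2 : ℝ) ^ (k : ℝ)) ^ P.σ =
        (l * (2 : ℝ) ^ (k : ℝ)) ^ (b - p) * (l * (2 : ℝ) ^ (k : ℝ)) ^ (p + P.σ - b) := by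
      rw [← Real.rpow_add hL]; congr 1; ring
    rw [this]; ring
  have hb2 : ∀ k : ℤ, |charOp seqShift ds y k| ≤
      (B * l ^ P.σ * (S + |1 - q|)) * (2 : ℝ) ^ ((k : ℝ) * P.σ) := by
    -- The recurrence applied to `y` splits into the effect of the weight, proportional to `1 - q`,
    -- and the difference of `g` at the two normalized points.
    intro k
    have e : charOp seqShift ds y k = (1 - q) * charOp seqShift ds (P.seqAt b l c (P.nz z z') g) k -
        charOp seqShift ds (P.seqAt b l c (P.nz z z') g - P.seqAt b l c (e1 d) g) k := by
      rw [hy]; simp only [map_sub, map_smul, Pi.sub_apply, Pi.smul_apply, smul_eq_mul]; ring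
    rw [e]
    refine (abs_sub _ _).trans ?_
    have g1 := hg.bound l hl0 c hcN _ hnz k
    have g2 := hg.holder l hl0 c hcN _ e1_mem _ hnz k
    rw [hSe] at g2
    rw [rpow_dyadic hl0] at g1 g2
    rw [abs_mul]
    have := mul_le_mul_of_nonneg_left g1 (abs_nonneg (1 - q))
    calc _ ≤ |1 - q| * (B * (l ^ P.σ * 2 ^ ((k : ℝ) * P.σ))) +
          B * (l ^ P.σ * 2 ^ ((k : ℝ) * P.σ)) * S := add_le_add this g2
      _ = _ := by ring
  have h3 := H y _ _ hb1 hb2 0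
  rw [hyk] at h3
  simp only [Int.cast_zero, Real.rpow_zero, mul_one, zero_mul] at h3
  rw [P.scal_nz hz, hl, hc, P.scal_e1_base, ← hl, abs_mul, abs_of_pos (Real.rpow_pos_of_pos hl0 _)] at h3
  have h4 := mul_le_mul_of_nonneg_left h3 (Real.rpow_pos_of_pos hl0 (p - b)).le
  rw [← mul_assoc, ← Real.rpow_add hl0] at h4
  have e5 : p - b + (b - p) = 0 := by ring
  rw [e5, Real.rpow_zero, one_mul] at h4
  refine h4.trans (le_of_eq ?_)
  have e6 : l ^ (p + P.σ - b) = l ^ (p - b) * l ^ P.σ := by rw [← Real.rpow_add hl0]; congr 1; ring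
  rw [e6]; ring

/-- Bernoulli's inequality for the integer exponent `⌈p⌉₊`, since `x^p` only decreases when `p` is
rounded up. -/
lemma one_sub_rpow_le {x p : ℝ} (hx0 : 0 < x) (hx1 : x ≤ 1) (hp : 0 ≤ p) :
    |1 - x ^ p| ≤ ⌈p⌉₊ * (1 - x) := by
  have h1 : x ^ p ≤ 1 := Real.rpow_le_one hx0.le hx1 hp
  have h2 : x ^ (⌈p⌉₊ : ℝ) ≤ x ^ p := Real.rpow_le_rpow_of_exponent_ge hx0 hx1 (Nat.le_ceil p)
  have h3 := one_add_mul_le_pow (a := x - 1) (by linarith) ⌈p⌉₊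
  rw [add_sub_cancel, ← Real.rpow_natCast] at h3
  rw [abs_of_nonneg (by linarith)]; linarith

end Params

/-! ### The weighted spatial seminorm -/

namespace Params

variable (P : Params) {d : ℕ}

lemma sum_normalized_le {l s δ : ℝ} (hl : 0 < l) (hs : 0 ≤ s) {κ : Idx d → ℝ} (hκs : ∀ i, κ (some i) = s)
    (hκt : 0 < κ none) {z z' : Idx d → ℝ} (ht : z none = z' none) (hδ : spd z z' ≤ δ) :
    ∑ i, ((l ^ P.wt i)⁻¹ * |z' i - z i|) ^ κ i ≤ (d + 1) * (δ / l) ^ s := by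
  rw [Fintype.sum_option, ht, sub_self, abs_zero, mul_zero, Real.zero_rpow hκt.ne', zero_add]
  refine (Finset.sum_le_card_nsmul _ _ ((δ / l) ^ s) fun i _ => ?_).trans (by simp)
  rw [hκs]
  refine Real.rpow_le_rpow (by positivity) ?_ hs
  simp only [wt, Real.rpow_one]
  rw [inv_mul_eq_div, abs_sub_comm]
  exact div_le_div_of_nonneg_right ((abs_sub_le_spd z z' i).trans hδ) hl.le

/-- Local spatial estimate. -/
lemma exists_x_local {ds : List ℝ} (hσ : P.σ ∉ ds) {b : ℝ} {κ : Idx d → ℝ} {p θ s : ℝ} (hp : 0 ≤ p)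
    (hs0 : 0 < s) (hs1 : s ≤ 1) (hs : θ + (p + P.σ - b) = s) (hκs : ∀ i, κ (some i) = s)
    (hκt : 0 < κ none) :
    ∃ C : ℝ, 0 ≤ C ∧ ∀ (g : (Idx d → ℝ) → ℝ) (B M : ℝ), 0 ≤ B → P.Recurrent ds b κ B g →
    (∀ z ∈ halfQ d, ∀ z' ∈ halfQ d, z none = z' none →
      max (z (nrm d)) (z' (nrm d)) ^ θ * |wf p g z - wf p g z'| ≤ M * spd z z' ^ s) →
    ∀ z ∈ halfQ d, ∀ z' ∈ halfQ d, z none = z' none →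
      spd z z' ≤ max (z (nrm d)) (z' (nrm d)) / 2 →
      max (z (nrm d)) (z' (nrm d)) ^ θ * |wf p g z - wf p g z'| ≤ C * B * spd z z' ^ s := by
  obtain ⟨C, hC, H⟩ := P.exists_local_pair (d := d) hσ b κ p
  refine ⟨C * (d + 1 + ⌈p⌉₊), by positivity, fun g B M hB hg hM => ?_⟩
  have key : ∀ z ∈ halfQ d, ∀ z' ∈ halfQ d, z none = z' none → z' (nrm d) ≤ z (nrm d) →
      spd z z' ≤ z (nrm d) / 2 →
      z (nrm d) ^ θ * |wf p g z - wf p g z'| ≤ C * (d + 1 + ⌈p⌉₊) * B * spd z z' ^ s := by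
    intro z hz z' hz' ht hN hd
    have hl0 : 0 < z (nrm d) := hz
    have hz0' : 0 < z' (nrm d) := hz'
    have hcoord := abs_sub_le_spd z z'
    have hlast := (abs_le.1 ((hcoord (Fin.last d)).trans hd)).2
    have hnz : P.nz z z' ∈ unitBox d := by
      refine P.nz_mem hz hN (by linarith) fun i hi => ?_
      rcases i with _ | i
      · rw [ht, sub_self, abs_zero]; exact Real.rpow_nonneg hl0.le _
      · rw [abs_sub_comm]; simp only [wt, Real.rpow_one]; exact (hcoord i).trans (by linarith)
    have hx0 : 0 < P.nz z z' (nrm d) := by linarith [hnz.2]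
    have hx1 : P.nz z z' (nrm d) ≤ 1 := (le_abs_self _).trans (hnz.1 _)
    set l := z (nrm d) with hl
    have h1 := H g B hB hg z hz z' hz' hnz (M * spd (e1 d) (P.nz z z') ^ s) ?_
    · rw [← hl] at h1
      have hS := P.sum_normalized_le hl0 hs0.le hκs hκt ht (le_refl (spd z z'))
      have hq := one_sub_rpow_le hx0 hx1 hp
      have hr0 : 0 ≤ spd z z' / l := div_nonneg (spd_nonneg _ _) hl0.le
      have hr1 : spd z z' / l ≤ 1 := by rw [div_le_one hl0]; linarith
      have h2 : 1 - P.nz z z' (nrm d) ≤ (spd z z' / l) ^ s := by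
        have : 1 - P.nz z z' (nrm d) ≤ spd z z' / l := by
          rw [nz_nrm, ← hl, inv_mul_eq_div, one_sub_div hl0.ne']
          refine div_le_div_of_nonneg_right ?_ hl0.le
          exact (le_abs_self _).trans (hcoord _)
        refine this.trans ?_
        rcases hr0.eq_or_lt with h0 | h0
        · rw [← h0]; exact Real.rpow_nonneg le_rfl _
        · exact (Real.rpow_le_rpow_of_exponent_ge h0 hr1 hs1).trans_eq' (Real.rpow_one _)
      have h3 : ∑ i, ((l ^ P.wt i)⁻¹ * |z' i - z i|) ^ κ i + |1 - P.nz z z' (nrm d) ^ p| ≤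
          (d + 1 + ⌈p⌉₊) * (spd z z' / l) ^ s := by
        rw [add_mul _ (⌈p⌉₊ : ℝ)]
        exact add_le_add hS (hq.trans (mul_le_mul_of_nonneg_left h2 (Nat.cast_nonneg _)))
      have h4 : l ^ θ * (l ^ (p + P.σ - b) * (spd z z' / l) ^ s) = spd z z' ^ s := by
        rw [← mul_assoc, ← Real.rpow_add hl0, hs, ← Real.mul_rpow hl0.le hr0, mul_div_cancel₀ _ hl0.ne']
      calc l ^ θ * |wf p g z - wf p g z'|
          ≤ l ^ θ * (C * B * l ^ (p + P.σ - b) * ((d + 1 + ⌈p⌉₊) * (spd z z' / l) ^ s)) :=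
            mul_le_mul_of_nonneg_left (h1.trans (mul_le_mul_of_nonneg_left h3 (by positivity)))
              (Real.rpow_nonneg hl0.le _)
        _ = C * (d + 1 + ⌈p⌉₊) * B * (l ^ θ * (l ^ (p + P.σ - b) * (spd z z' / l) ^ s)) := by ring
        _ = _ := by rw [h4]
    -- The dilated pair has distance `l'` times the normalized one and maximal height `l'`; the
    -- finite seminorm therefore bounds the difference by a multiple of `l'^(s - θ)`, which is the
    -- required growth.
    · intro l' hl'
      have h5 := hM _ (P.scal_mem hl' (base_nrm z) (unitBox_subset e1_mem)) _
        (P.scal_mem hl' (base_nrm z) (unitBox_subset hnz)) (by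
          simp only [scal, nz, base]; simp [e1, ht])
      rw [P.scal_nrm (base_nrm z), P.scal_nrm (base_nrm z), e1_nrm, max_eq_left (by nlinarith), mul_one,
        spd_scal P hl', Real.mul_rpow hl'.le (spd_nonneg _ _)] at h5
      have h6 : p + P.σ - b = s - θ := by linarith
      have hp' : 0 < l' ^ θ := Real.rpow_pos_of_pos hl' _
      rw [h6, Real.rpow_sub hl', ← mul_div_assoc, le_div_iff₀ hp']
      linarith
  intro z hz z' hz' ht hd
  rcases le_total (z' (nrm d)) (z (nrm d)) with h | h
  · rw [max_eq_left h] at hd ⊢; exact key z hz z' hz' ht h hd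
  · rw [max_eq_right h] at hd ⊢
    rw [abs_sub_comm, spd_comm] at *
    exact key z' hz' z hz ht.symm h hd

/-- Nonlocal spatial estimates follow from local ones. -/
lemma exists_global_of_local (d : ℕ) {θ s : ℝ} (hθ : 0 ≤ θ) (hs : θ < s) :
    ∃ C : ℝ, 0 ≤ C ∧ ∀ (w : (Idx d → ℝ) → ℝ) (A : ℝ), 0 ≤ A →
    (∀ z ∈ halfQ d, ∀ z' ∈ halfQ d, z none = z' none →
      spd z z' ≤ max (z (nrm d)) (z' (nrm d)) / 2 →
      max (z (nrm d)) (z' (nrm d)) ^ θ * |w z - w z'| ≤ A * spd z z' ^ s) →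
    ∀ z ∈ halfQ d, ∀ z' ∈ halfQ d, z none = z' none →
      max (z (nrm d)) (z' (nrm d)) ^ θ * |w z - w z'| ≤ C * A * spd z z' ^ s := by
  set ϑ := s - θ with hϑ
  have hϑ0 : 0 < ϑ := sub_pos.2 hs
  have hs0 : 0 < s := hθ.trans_lt hs
  set t : ℝ := 2 ^ (-ϑ) with ht
  have ht1 : t < 1 := Real.rpow_lt_one_of_one_lt_of_neg one_lt_two (by linarith)
  have ht0 : 0 < t := Real.rpow_pos_of_pos two_pos _
  set D : ℝ := 1 / (1 - t) with hD
  have hD0 : 0 < D := div_pos one_pos (by linarith)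
  have hDt : 1 + D * t = D := by 
    have : 1 - t ≠ 0 := by linarith
    rw [hD]; field_simp; ring
  have h2θ : (1 : ℝ) ≤ 2 ^ θ := Real.one_le_rpow one_le_two hθ
  refine ⟨1 + 2 ^ θ * (2 * D * 4 ^ ϑ + 1), by positivity, fun w A hA hw => ?_⟩
  have up : ∀ z ∈ halfQ d, ∀ h, 0 < h → Function.update z (nrm d) h ∈ halfQ d := fun z hz h hh => by
    show 0 < Function.update z (nrm d) h (nrm d)
    simpa using hh
  have loc : ∀ z ∈ halfQ d, ∀ S : ℝ, 0 < S → ∀ r, S / 2 ≤ r → r ≤ S →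
      |w (Function.update z (nrm d) S) - w (Function.update z (nrm d) r)| ≤ A * S ^ ϑ := by
    intro z hz S hS r hr hr'
    have hr0 : 0 < r := by linarith
    have hsp : spd (Function.update z (nrm d) S) (Function.update z (nrm d) r) = S - r := by
      rw [spd_vertical fun i hi => by simp [Function.update_of_ne hi]]
      simp only [Function.update_self]; exact abs_of_nonneg (by linarith)
    have := hw _ (up z hz S hS) _ (up z hz r hr0) (by simp) (by
      rw [hsp]; simp only [Function.update_self, max_eq_left hr']; linarith)
    rw [hsp] at this
    simp only [Function.update_self, max_eq_left hr'] at this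
    have h1 : (S - r) ^ s ≤ S ^ s := Real.rpow_le_rpow (by linarith) (by linarith) hs0.le
    have h2 : S ^ ϑ = S ^ s / S ^ θ := Real.rpow_sub hS _ _
    have hSθ : 0 < S ^ θ := Real.rpow_pos_of_pos hS _
    rw [h2, ← mul_div_assoc, le_div_iff₀ hSθ, mul_comm]
    exact this.trans (mul_le_mul_of_nonneg_left h1 hA)
  have chain : ∀ z ∈ halfQ d, ∀ j : ℕ, ∀ S : ℝ, 0 < S → ∀ r, S / 2 ^ j ≤ r → r ≤ S →
      |w (Function.update z (nrm d) S) - w (Function.update z (nrm d) r)| ≤ A * D * S ^ ϑ := by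
    intro z hz j
    induction j with
    | zero =>
      intro S hS r hr hr'
      have : r = S := le_antisymm hr' (by simpa using hr)
      subst this
      rw [sub_self, abs_zero]
      exact mul_nonneg (by positivity) (Real.rpow_nonneg hS.le _)
    | succ j ih =>
      intro S hS r hr hr'
      have hSϑ : 0 < S ^ ϑ := Real.rpow_pos_of_pos hS _
      rcases le_total (S / 2) r with h | h
      · refine (loc z hz S hS r h hr').trans (mul_le_mul_of_nonneg_right ?_ hSϑ.le)
        have : 0 ≤ A * (D * t) := by positivity
        nlinarith
      · have h1 := loc z hz S hS (S / 2) le_rfl (by linarith)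
        have h2 := ih (S / 2) (by linarith) r (by rw [div_div, ← pow_succ']; exact hr) h
        have h3 : (S / 2) ^ ϑ = S ^ ϑ * t := by
          rw [Real.div_rpow hS.le two_pos.le, ht, Real.rpow_neg two_pos.le, div_eq_mul_inv]
        rw [h3] at h2
        refine (abs_sub_le _ (w (Function.update z (nrm d) (S / 2))) _).trans ?_
        calc _ ≤ A * S ^ ϑ + A * D * (S ^ ϑ * t) := add_le_add h1 h2
          _ = A * (1 + D * t) * S ^ ϑ := by ring
          _ = _ := by rw [hDt]
  -- Upward from any height to `S` the dyadic increments form a geometric series, because the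
  -- exponent `ϑ = s - θ` is positive; the sum does not depend on how close `z` is to the boundary.
  have vert : ∀ z ∈ halfQ d, ∀ S : ℝ, z (nrm d) ≤ S →
      |w (Function.update z (nrm d) S) - w z| ≤ A * D * S ^ ϑ := by
    intro z hz S hS
    have hz0 : 0 < z (nrm d) := hz
    obtain ⟨j, hj⟩ := pow_unbounded_of_one_lt (S / z (nrm d)) one_lt_two
    have := chain z hz j S (hz0.trans_le hS) (z (nrm d)) (by
      rw [div_lt_iff₀ hz0] at hj
      rw [div_le_iff₀ (by positivity)]; linarith) hS
    rwa [Function.update_eq_self] at this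
  intro z hz z' hz' hzt
  set r := spd z z' with hr
  have hr0 : 0 ≤ r := spd_nonneg _ _
  have hrs : 0 ≤ r ^ s := Real.rpow_nonneg hr0 _
  set m := max (z (nrm d)) (z' (nrm d)) with hm
  rcases le_or_gt r (m / 2) with h | h
  · refine (hw z hz z' hz' hzt h).trans (mul_le_mul_of_nonneg_right ?_ hrs)
    exact le_mul_of_one_le_left hA (le_add_of_nonneg_right (by positivity))
  · have hz0 : 0 < z (nrm d) := hz
    have hm0 : 0 < m := lt_max_of_lt_left hz0
    have hrp : 0 < r := by linarith
    -- Both points lie below height `2r`. At height `4r` their lifts are at distance at most `r`, so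
    -- the local estimate applies to them.
    set S := 4 * r with hS
    have hS0 : 0 < S := by positivity
    have h1 := vert z hz S (by linarith [le_max_left (z (nrm d)) (z' (nrm d))])
    have h2 := vert z' hz' S (by linarith [le_max_right (z (nrm d)) (z' (nrm d))])
    have hsp : spd (Function.update z (nrm d) S) (Function.update z' (nrm d) S) ≤ r := by
      refine spd_le_of_abs_le fun i => ?_
      by_cases hi : (some i : Idx d) = nrm d
      · rw [hi]; simp
      · rw [Function.update_of_ne hi, Function.update_of_ne hi]
    have h3 := hw _ (up z hz S hS0) _ (up z' hz' S hS0) (by simp [hzt])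
      (by simp only [Function.update_self, max_self]; linarith)
    simp only [Function.update_self, max_self] at h3
    have h4 : |w (Function.update z (nrm d) S) - w (Function.update z' (nrm d) S)| ≤ A * r ^ ϑ := by
      have hSθ : 0 < S ^ θ := Real.rpow_pos_of_pos hS0 _
      have hrθ : 0 < r ^ θ := Real.rpow_pos_of_pos hrp _
      have h5 : r ^ θ ≤ S ^ θ := Real.rpow_le_rpow hr0 (by linarith) hθ
      rw [Real.rpow_sub hrp, ← mul_div_assoc, le_div_iff₀ hrθ]
      have h6 := Real.rpow_le_rpow (spd_nonneg _ _) hsp hs0.le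
      have h7 := mul_le_mul_of_nonneg_left h5
        (abs_nonneg (w (Function.update z (nrm d) S) - w (Function.update z' (nrm d) S)))
      have h8 := mul_le_mul_of_nonneg_left h6 hA
      linarith
    have h5 : S ^ ϑ = 4 ^ ϑ * r ^ ϑ := Real.mul_rpow (by norm_num) hr0
    rw [h5] at h1 h2
    have h6 : |w z - w z'| ≤ A * (2 * D * 4 ^ ϑ + 1) * r ^ ϑ := by
      have e : w z - w z' = -(w (Function.update z (nrm d) S) - w z) +
          (w (Function.update z (nrm d) S) - w (Function.update z' (nrm d) S)) +
          (w (Function.update z' (nrm d) S) - w z') := by ring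
      rw [e]
      refine (abs_add_three _ _ _).trans ?_
      rw [abs_neg]
      calc _ ≤ A * D * (4 ^ ϑ * r ^ ϑ) + A * r ^ ϑ + A * D * (4 ^ ϑ * r ^ ϑ) := by gcongr
        _ = _ := by ring
    have h7 : m ^ θ ≤ 2 ^ θ * r ^ θ := by
      rw [← Real.mul_rpow two_pos.le hr0]
      exact Real.rpow_le_rpow hm0.le (by linarith) hθ
    have h8 : r ^ s = r ^ θ * r ^ ϑ := by rw [← Real.rpow_add hrp]; congr 1; rw [hϑ]; ring
    calc m ^ θ * |w z - w z'| ≤ (2 ^ θ * r ^ θ) * (A * (2 * D * 4 ^ ϑ + 1) * r ^ ϑ) :=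
          mul_le_mul h7 h6 (abs_nonneg _) (by positivity)
      _ = 2 ^ θ * (2 * D * 4 ^ ϑ + 1) * A * r ^ s := by rw [h8]; ring
      _ ≤ _ := by
        refine mul_le_mul_of_nonneg_right (mul_le_mul_of_nonneg_right ?_ hA) hrs
        linarith

/-- Spatial estimate. -/
lemma exists_x_bound {ds : List ℝ} (hσ : P.σ ∉ ds) {b : ℝ} {κ : Idx d → ℝ} {p θ s : ℝ} (hp : 0 ≤ p)
    (hθ : 0 ≤ θ) (hθs : θ < s) (hs1 : s ≤ 1) (hs : θ + (p + P.σ - b) = s)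
    (hκs : ∀ i, κ (some i) = s) (hκt : 0 < κ none) :
    ∃ C : ℝ, 0 ≤ C ∧ ∀ (g : (Idx d → ℝ) → ℝ) (B M : ℝ), 0 ≤ B → P.Recurrent ds b κ B g →
    (∀ z ∈ halfQ d, ∀ z' ∈ halfQ d, z none = z' none →
      max (z (nrm d)) (z' (nrm d)) ^ θ * |wf p g z - wf p g z'| ≤ M * spd z z' ^ s) →
    ∀ z ∈ halfQ d, ∀ z' ∈ halfQ d, z none = z' none →
      max (z (nrm d)) (z' (nrm d)) ^ θ * |wf p g z - wf p g z'| ≤ C * B * spd z z' ^ s := by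
  obtain ⟨C₁, hC₁, H₁⟩ := P.exists_x_local (d := d) hσ hp (hθ.trans_lt hθs) hs1 hs hκs hκt
  obtain ⟨C₂, hC₂, H₂⟩ := exists_global_of_local d hθ hθs
  refine ⟨C₂ * C₁, by positivity, fun g B M hB hg hM => ?_⟩
  have := H₂ (wf p g) (C₁ * B) (by positivity) (H₁ g B M hB hg hM)
  simpa only [mul_assoc] using this

end Params

/-! ### Columns: tangential, time and boundary estimates -/

namespace Params

variable (P : Params) {d : ℕ}

lemma scal_e1 {c : Idx d → ℝ} (hc : c (nrm d) = 0) (l : ℝ) :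
    P.scal l c (e1 d) = Function.update c (nrm d) l := by
  ext i
  by_cases hi : i = nrm d
  · subst hi; rw [P.scal_nrm hc, e1_nrm, mul_one, Function.update_self]
  · simp [scal, e1, hi]

lemma exists_dyadic {h h0 : ℝ} (hh : 0 < h) (hlt : h < h0) :
    ∃ n : ℕ, h0 ≤ h * 2 ^ n ∧ h * 2 ^ n < 2 * h0 := by
  have hex : ∃ n : ℕ, h0 ≤ h * 2 ^ n := by
    obtain ⟨n, hn⟩ := pow_unbounded_of_one_lt (h0 / h) one_lt_two
    exact ⟨n, by rw [div_lt_iff₀ hh] at hn; linarith⟩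
  classical
  refine ⟨Nat.find hex, Nat.find_spec hex, ?_⟩
  obtain ⟨k, hk⟩ : ∃ k, Nat.find hex = k + 1 := by
    refine Nat.exists_eq_succ_of_ne_zero fun h0' => ?_
    have := Nat.find_spec hex
    rw [h0', pow_zero, mul_one] at this
    linarith
  have := Nat.find_min hex (m := k) (by omega)
  rw [hk, pow_succ]
  linarith [not_le.1 this]

lemma rpow_neg_dyadic (h : ℝ) (n : ℕ) : h * 2 ^ n * (2 : ℝ) ^ (((-(n : ℤ) : ℤ)) : ℝ) = h := by
  push_cast
  rw [Real.rpow_neg two_pos.le, Real.rpow_natCast, mul_inv_cancel_right₀ (by positivity)]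

/-- Extension of an estimate on the difference of two columns to small heights. -/
lemma exists_column {ds : List ℝ} (hσ : P.σ ∉ ds) {b p : ℝ} {κ : Idx d → ℝ} (hϑ : 0 ≤ p + P.σ - b) :
    ∃ C : ℝ, 0 ≤ C ∧ ∀ (g : (Idx d → ℝ) → ℝ) (B A M h0 : ℝ) (c c' : Idx d → ℝ), 0 ≤ B → 0 ≤ A → 0 < h0 →
    P.Recurrent ds b κ B g → c (nrm d) = 0 → c' (nrm d) = 0 →
    (∀ h, 0 < h → |wf p g (Function.update c (nrm d) h) - wf p g (Function.update c' (nrm d) h)| ≤ M) →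
    (∀ h, h0 ≤ h →
      |wf p g (Function.update c (nrm d) h) - wf p g (Function.update c' (nrm d) h)| ≤ A) →
    B * h0 ^ (p + P.σ - b) ≤ A → ∀ h, 0 < h →
    |wf p g (Function.update c (nrm d) h) - wf p g (Function.update c' (nrm d) h)| ≤ C * A := by
  set η := b - p with hη
  set ϑ := p + P.σ - b with hϑd
  -- If `p + σ - b = 0` the a priori growth rate is `σ` itself and nonresonance is needed. Otherwise
  -- it is smaller than `σ`, and the control at large heights supplies the missing information.
  have hseq : ∃ C : ℝ, 0 ≤ C ∧ ∀ (y : ℤ → ℝ) (M B : ℝ), 0 ≤ B →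
      (∀ k : ℤ, |y k| ≤ M * (2 : ℝ) ^ ((k : ℝ) * η)) →
      (∀ k : ℤ, 0 ≤ k → |y k| ≤ B * (2 : ℝ) ^ ((k : ℝ) * η)) →
      (∀ k : ℤ, |charOp seqShift ds y k| ≤ B * (2 : ℝ) ^ ((k : ℝ) * P.σ)) →
      ∀ k : ℤ, |y k| ≤ C * B * (2 : ℝ) ^ ((k : ℝ) * η) := by
    rcases hϑ.eq_or_lt with h | h
    · have e : P.σ = η := by rw [hη]; linarith
      obtain ⟨C, hC, H⟩ := seq_two_sided ds P.σ hσ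
      refine ⟨C, hC, fun y M B _ h1 _ h3 => ?_⟩
      rw [← e] at *
      exact H y M B h1 h3
    · obtain ⟨C, hC, H⟩ := seq_one_sided ds (η := η) (σ := P.σ) (by rw [hη]; linarith)
      exact ⟨C, hC, fun y M B hB h1 h2 h3 => H y M B hB h1 h2 fun k _ => h3 k⟩
  obtain ⟨C, hC, H⟩ := hseq
  have h2 : ∀ x : ℝ, (0 : ℝ) < (2 : ℝ) ^ x := fun x => Real.rpow_pos_of_pos two_pos _
  have h2ϑ : (1 : ℝ) ≤ 2 ^ ϑ := Real.one_le_rpow one_le_two hϑ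
  refine ⟨1 + C * (2 * 2 ^ ϑ), by positivity, fun g B A M h0 c c' hB hA hh0 hg hc hc' hM hAb hBA h hh => ?_⟩
  rcases le_or_gt h0 h with hle | hlt
  · refine (hAb h hle).trans (le_mul_of_one_le_left hA (le_add_of_nonneg_right (by positivity)))
  -- The sequence starts at a height `l` in `[h0, 2 h0)` whose `n`-th halving is `h`, so nonnegative
  -- indices lie in the controlled range and index `-n` is the height sought.
  obtain ⟨n, hn1, hn2⟩ := exists_dyadic hh hlt
  set l := h * 2 ^ n with hl
  have hl0 : 0 < l := hh0.trans_le hn1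
  set y : ℤ → ℝ := P.seqAt b l c (e1 d) g - P.seqAt b l c' (e1 d) g with hy
  have hyk : ∀ k : ℤ, y k = (l * (2 : ℝ) ^ (k : ℝ)) ^ η *
      (wf p g (Function.update c (nrm d) (l * (2 : ℝ) ^ (k : ℝ))) -
        wf p g (Function.update c' (nrm d) (l * (2 : ℝ) ^ (k : ℝ)))) := by
    intro k
    have hL : 0 < l * (2 : ℝ) ^ (k : ℝ) := mul_pos hl0 (h2 _)
    rw [hy, Pi.sub_apply, seqAt_apply, seqAt_apply, P.scal_e1 hc, P.scal_e1 hc', wf, wf,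
      Function.update_self, Function.update_self, hη, Real.rpow_sub hL]
    have := (Real.rpow_pos_of_pos hL p).ne'
    field_simp
  have hlη : 0 < l ^ η := Real.rpow_pos_of_pos hl0 _
  have b1 : ∀ k : ℤ, |y k| ≤ (M * l ^ η) * (2 : ℝ) ^ ((k : ℝ) * η) := by
    intro k
    have hL : 0 < l * (2 : ℝ) ^ (k : ℝ) := mul_pos hl0 (h2 _)
    rw [hyk, abs_mul, abs_of_pos (Real.rpow_pos_of_pos hL _), mul_assoc M, ← rpow_dyadic hl0, mul_comm]
    exact mul_le_mul_of_nonneg_right (hM _ hL) (Real.rpow_pos_of_pos hL _).le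
  have b2 : ∀ k : ℤ, 0 ≤ k → |y k| ≤ (2 * 2 ^ ϑ * A * l ^ η) * (2 : ℝ) ^ ((k : ℝ) * η) := by
    intro k hk
    have hL : 0 < l * (2 : ℝ) ^ (k : ℝ) := mul_pos hl0 (h2 _)
    have hL' : h0 ≤ l * (2 : ℝ) ^ (k : ℝ) :=
      hn1.trans (le_mul_of_one_le_right hl0.le (Real.one_le_rpow one_le_two (by exact_mod_cast hk)))
    rw [hyk, abs_mul, abs_of_pos (Real.rpow_pos_of_pos hL _), mul_assoc (2 * 2 ^ ϑ * A),
      ← rpow_dyadic hl0, mul_comm]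
    refine mul_le_mul_of_nonneg_right ((hAb _ hL').trans ?_) (Real.rpow_pos_of_pos hL _).le
    exact le_mul_of_one_le_left hA (by linarith)
  have b3 : ∀ k : ℤ, |charOp seqShift ds y k| ≤ (2 * 2 ^ ϑ * A * l ^ η) * (2 : ℝ) ^ ((k : ℝ) * P.σ) := by
    intro k
    rw [hy, map_sub, Pi.sub_apply]
    refine (abs_sub _ _).trans ?_
    have g1 := hg.bound l hl0 c hc _ e1_mem k
    have g2 := hg.bound l hl0 c' hc' _ e1_mem k
    have e1 : l ^ P.σ = l ^ ϑ * l ^ η := by rw [← Real.rpow_add hl0]; congr 1; rw [hϑd, hη]; ring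
    have e2 : l ^ ϑ ≤ 2 ^ ϑ * h0 ^ ϑ := by
      rw [← Real.mul_rpow two_pos.le hh0.le]; exact Real.rpow_le_rpow hl0.le hn2.le hϑ
    rw [rpow_dyadic hl0, e1] at g1 g2
    have h2k := (h2 ((k : ℝ) * P.σ)).le
    calc _ ≤ 2 * ((B * l ^ ϑ) * (l ^ η * 2 ^ ((k : ℝ) * P.σ))) := by linarith
      _ ≤ 2 * ((B * (2 ^ ϑ * h0 ^ ϑ)) * (l ^ η * 2 ^ ((k : ℝ) * P.σ))) := by gcongr
      _ = 2 * (2 ^ ϑ * (B * h0 ^ ϑ)) * (l ^ η * 2 ^ ((k : ℝ) * P.σ)) := by ring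
      _ ≤ 2 * (2 ^ ϑ * A) * (l ^ η * 2 ^ ((k : ℝ) * P.σ)) := by gcongr
      _ = _ := by ring
  have h3 := H y _ _ (by positivity) b1 b2 b3 (-(n : ℤ))
  rw [hyk, mul_assoc C, mul_assoc (2 * 2 ^ ϑ * A), ← rpow_dyadic hl0, hl, rpow_neg_dyadic, abs_mul,
    abs_of_pos (Real.rpow_pos_of_pos hh _), ← mul_assoc, mul_comm] at h3
  refine (le_of_mul_le_mul_right h3 (Real.rpow_pos_of_pos hh _)).trans ?_
  calc _ = C * (2 * 2 ^ ϑ) * A := by ring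
    _ ≤ _ := mul_le_mul_of_nonneg_right (le_add_of_nonneg_left zero_le_one) hA

lemma update_base {z : Idx d → ℝ} : Function.update (base z) (nrm d) (z (nrm d)) = z := by
  rw [base, Function.update_idem, Function.update_eq_self]

/-- Tangential estimate. -/
lemma exists_tang_bound {ds : List ℝ} (hσ : P.σ ∉ ds) {b p s : ℝ} {κ : Idx d → ℝ} (hs0 : 0 ≤ s)
    (hs : p + P.σ - b = s) (hκs : ∀ i, κ (some i) = s) (hκt : 0 < κ none) :
    ∃ C : ℝ, 0 ≤ C ∧ ∀ (g : (Idx d → ℝ) → ℝ) (B M : ℝ), 0 ≤ B → P.Recurrent ds b κ B g →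
    (∀ z ∈ halfQ d, ∀ z' ∈ halfQ d, z none = z' none → z (nrm d) = z' (nrm d) →
      |wf p g z - wf p g z'| ≤ M * spd z z' ^ s) →
    ∀ z ∈ halfQ d, ∀ z' ∈ halfQ d, z none = z' none → z (nrm d) = z' (nrm d) →
      |wf p g z - wf p g z'| ≤ C * B * spd z z' ^ s := by
  obtain ⟨C₁, hC₁, H₁⟩ := P.exists_local_pair (d := d) hσ b κ p
  obtain ⟨C₂, hC₂, H₂⟩ := P.exists_column (d := d) hσ (b := b) (p := p) (κ := κ) (by rw [hs]; exact hs0)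
  have h2s : (0 : ℝ) < 2 ^ s := Real.rpow_pos_of_pos two_pos _
  refine ⟨C₂ * (C₁ * (d + 1) + 2 ^ s), by positivity, fun g B M hB hg hM => ?_⟩
  have loc : ∀ z ∈ halfQ d, ∀ z' ∈ halfQ d, z none = z' none → z (nrm d) = z' (nrm d) →
      spd z z' ≤ z (nrm d) / 2 → |wf p g z - wf p g z'| ≤ C₁ * (d + 1) * B * spd z z' ^ s := by
    intro z hz z' hz' ht hN hd
    have hl0 : 0 < z (nrm d) := hz
    have hnz : P.nz z z' ∈ unitBox d := by
      refine P.nz_mem hz hN.ge (by linarith) fun i hi => ?_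
      rcases i with _ | i
      · rw [ht, sub_self, abs_zero]; exact Real.rpow_nonneg hl0.le _
      · rw [abs_sub_comm]; simp only [wt, Real.rpow_one]
        exact (abs_sub_le_spd z z' i).trans (by linarith)
    have hnN : P.nz z z' (nrm d) = 1 := by rw [nz_nrm, ← hN, inv_mul_cancel₀ hl0.ne']
    have h1 := H₁ g B hB hg z hz z' hz' hnz (M * spd (e1 d) (P.nz z z') ^ s) ?_
    · rw [hnN, Real.one_rpow, sub_self, abs_zero, add_zero, hs] at h1
      have hS := P.sum_normalized_le hl0 hs0 hκs hκt ht (le_refl (spd z z'))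
      refine h1.trans ((mul_le_mul_of_nonneg_left hS (by positivity)).trans (le_of_eq ?_))
      rw [Real.div_rpow (spd_nonneg _ _) hl0.le]
      have := (Real.rpow_pos_of_pos hl0 s).ne'
      field_simp
    · intro l' hl'
      have h5 := hM _ (P.scal_mem hl' (base_nrm z) (unitBox_subset e1_mem)) _
        (P.scal_mem hl' (base_nrm z) (unitBox_subset hnz)) (by
          simp only [scal, nz, base]; simp [e1, ht]) (by
          rw [P.scal_nrm (base_nrm z), P.scal_nrm (base_nrm z), e1_nrm, hnN])
      rw [spd_scal P hl', Real.mul_rpow hl'.le (spd_nonneg _ _)] at h5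
      rw [hs]; linarith
  intro z hz z' hz' ht hN
  have hl0 : 0 < z (nrm d) := hz
  rcases (spd_nonneg z z').eq_or_lt with h0 | h0
  · have : z = z' := by
      ext i
      rcases i with _ | i
      · exact ht
      · have := abs_sub_le_spd z z' i
        rw [← h0] at this
        exact sub_eq_zero.1 (abs_nonpos_iff.1 this)
    rw [this, sub_self, abs_zero]
    have := Real.rpow_nonneg (spd_nonneg z' z') s
    positivity
  have up : ∀ y : Idx d → ℝ, ∀ h, 0 < h → Function.update (base y) (nrm d) h ∈ halfQ d := fun y h hh => by
    show 0 < Function.update (base y) (nrm d) h (nrm d)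
    simpa using hh
  have hne : (none : Idx d) ≠ nrm d := by simp
  have hcol : ∀ h, spd (Function.update (base z) (nrm d) h) (Function.update (base z') (nrm d) h) =
      spd z z' := by
    intro h
    rw [spd_eq, spd_eq]; congr 1
    refine Finset.sum_congr rfl fun i _ => ?_
    by_cases hi : (some i : Idx d) = nrm d
    · rw [hi, Function.update_self, Function.update_self, hN, sub_self, sub_self]
    · simp only [base, Function.update_of_ne hi]
  -- Above height `2 * spd z z'` the two columns are close enough for the local estimate; below it,
  -- `exists_column` takes over.
  have hr : 0 < spd z z' ^ s := Real.rpow_pos_of_pos h0 _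
  have h3 := H₂ g B ((C₁ * (d + 1) + 2 ^ s) * B * spd z z' ^ s) (M * spd z z' ^ s) (2 * spd z z')
    (base z) (base z') hB (by positivity) (by linarith) hg (base_nrm z) (base_nrm z')
    (fun h hh => by
      have := hM _ (up z h hh) _ (up z' h hh) (by simp [base, ht]) (by simp)
      rwa [hcol] at this)
    (fun h hh => by
      have hh0 : 0 < h := by linarith
      have := loc _ (up z h hh0) _ (up z' h hh0) (by simp [base, ht]) (by simp) (by
        rw [hcol, Function.update_self]; linarith)
      rw [hcol] at this
      refine this.trans (mul_le_mul_of_nonneg_right (mul_le_mul_of_nonneg_right ?_ hB) hr.le)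
      linarith)
    (by
      rw [hs, Real.mul_rpow two_pos.le h0.le]
      have : 0 ≤ C₁ * (d + 1) * B * spd z z' ^ s := by positivity
      nlinarith) (z (nrm d)) hl0
  rw [update_base] at h3
  conv_lhs at h3 => rw [hN]
  rw [update_base] at h3
  refine h3.trans (le_of_eq ?_); ring

/-- Time estimate. -/
lemma exists_t_bound {ds : List ℝ} (hσ : P.σ ∉ ds) {b p : ℝ} {κ : Idx d → ℝ} (hκt : 0 < κ none)
    (hs : p + P.σ - b = P.μ * κ none) (hκs : ∀ i, 0 < κ (some i)) :
    ∃ C : ℝ, 0 ≤ C ∧ ∀ (g : (Idx d → ℝ) → ℝ) (B M : ℝ), 0 ≤ B → P.Recurrent ds b κ B g →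
    (∀ z ∈ halfQ d, ∀ z' ∈ halfQ d, (∀ i, z (some i) = z' (some i)) →
      |wf p g z - wf p g z'| ≤ M * |z none - z' none| ^ κ none) →
    ∀ z ∈ halfQ d, ∀ z' ∈ halfQ d, (∀ i, z (some i) = z' (some i)) →
      |wf p g z - wf p g z'| ≤ C * B * |z none - z' none| ^ κ none := by
  have hμ := P.μ_pos
  have hϑ : 0 ≤ P.μ * κ none := by positivity
  obtain ⟨C₁, hC₁, H₁⟩ := P.exists_local_pair (d := d) hσ b κ p
  obtain ⟨C₂, hC₂, H₂⟩ := P.exists_column (d := d) hσ (b := b) (p := p) (κ := κ) (by rw [hs]; exact hϑ)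
  refine ⟨C₂ * (C₁ + 1), by positivity, fun g B M hB hg hM => ?_⟩
  have loc : ∀ z ∈ halfQ d, ∀ z' ∈ halfQ d, (∀ i, z (some i) = z' (some i)) →
      |z none - z' none| ≤ z (nrm d) ^ P.μ →
      |wf p g z - wf p g z'| ≤ C₁ * B * |z none - z' none| ^ κ none := by
    intro z hz z' hz' hx hd
    have hl0 : 0 < z (nrm d) := hz
    have hN := hx (Fin.last d)
    have hnz : P.nz z z' ∈ unitBox d := by
      refine P.nz_mem hz hN.ge (by linarith) fun i hi => ?_
      rcases i with _ | i
      · rw [abs_sub_comm]; exact hd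
      · rw [hx i, sub_self, abs_zero]; exact Real.rpow_nonneg hl0.le _
    have hnN : P.nz z z' (nrm d) = 1 := by rw [nz_nrm, ← hN, inv_mul_cancel₀ hl0.ne']
    have h1 := H₁ g B hB hg z hz z' hz' hnz (M * |e1 d none - P.nz z z' none| ^ κ none) ?_
    · have hS : ∑ i, ((z (nrm d) ^ P.wt i)⁻¹ * |z' i - z i|) ^ κ i =
          ((z (nrm d) ^ P.μ)⁻¹ * |z none - z' none|) ^ κ none := by
        have h0 : ∀ i ∈ (Finset.univ : Finset (Fin (d + 1))),
            ((z (nrm d) ^ P.wt (some i))⁻¹ * |z' (some i) - z (some i)|) ^ κ (some i) = 0 := fun i _ => by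
          rw [hx i, sub_self, abs_zero, mul_zero, Real.zero_rpow (hκs i).ne']
        rw [Fintype.sum_option, Finset.sum_eq_zero h0, add_zero, abs_sub_comm]; rfl
      rw [hnN, Real.one_rpow, sub_self, abs_zero, add_zero, hs, hS] at h1
      refine h1.trans (le_of_eq ?_)
      have hp : 0 < z (nrm d) ^ P.μ := Real.rpow_pos_of_pos hl0 _
      rw [Real.mul_rpow (inv_nonneg.2 hp.le) (abs_nonneg _), Real.inv_rpow hp.le,
        ← Real.rpow_mul hl0.le]
      have := (Real.rpow_pos_of_pos hl0 (P.μ * κ none)).ne'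
      field_simp
    · intro l' hl'
      have h5 := hM _ (P.scal_mem hl' (base_nrm z) (unitBox_subset e1_mem)) _
        (P.scal_mem hl' (base_nrm z) (unitBox_subset hnz)) (fun i => by
          have e := P.nz_sub_e1 hz z' (some i)
          rw [hx i, sub_self, mul_zero, sub_eq_zero] at e
          simp only [scal, e])
      have e : P.scal l' (base z) (e1 d) none - P.scal l' (base z) (P.nz z z') none =
          l' ^ P.μ * (e1 d none - P.nz z z' none) := by simp only [scal, wt]; ring
      have hp : 0 < l' ^ P.μ := Real.rpow_pos_of_pos hl' _
      rw [e, abs_mul, abs_of_pos hp, Real.mul_rpow hp.le (abs_nonneg _), ← Real.rpow_mul hl'.le] at h5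
      rw [hs]; linarith
  intro z hz z' hz' hx
  have hl0 : 0 < z (nrm d) := hz
  set ρ := |z none - z' none| with hρ
  rcases (abs_nonneg (z none - z' none)).eq_or_lt with h0 | h0
  · have : z = z' := by
      ext i
      rcases i with _ | i
      · exact sub_eq_zero.1 (abs_eq_zero.1 h0.symm)
      · exact hx i
    rw [this, sub_self, abs_zero]
    have : 0 ≤ ρ ^ κ none := Real.rpow_nonneg (abs_nonneg _) _
    positivity
  rw [← hρ] at h0
  have up : ∀ y : Idx d → ℝ, ∀ h, 0 < h → Function.update (base y) (nrm d) h ∈ halfQ d := fun y h hh => by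
    show 0 < Function.update (base y) (nrm d) h (nrm d)
    simpa using hh
  have hsame : ∀ h, ∀ i, Function.update (base z) (nrm d) h (some i) =
      Function.update (base z') (nrm d) h (some i) := by
    intro h i
    by_cases hi : (some i : Idx d) = nrm d
    · rw [hi, Function.update_self, Function.update_self]
    · simp only [base, Function.update_of_ne hi, hx]
  have hcol : ∀ h, |Function.update (base z) (nrm d) h none - Function.update (base z') (nrm d) h none| =
      ρ := by intro h; simp [base, hρ]
  have hr : 0 < ρ ^ κ none := Real.rpow_pos_of_pos h0 _
  -- The starting height of the columns is where `h^μ = ρ`, the parabolic scale at which the time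
  -- distance becomes local.
  have hp0 : 0 < ρ ^ (P.μ⁻¹) := Real.rpow_pos_of_pos h0 _
  have h3 := H₂ g B ((C₁ + 1) * B * ρ ^ κ none) (M * ρ ^ κ none) (ρ ^ (P.μ⁻¹))
    (base z) (base z') hB (by positivity) hp0 hg (base_nrm z) (base_nrm z')
    (fun h hh => by
      have := hM _ (up z h hh) _ (up z' h hh) (hsame h)
      rwa [hcol] at this)
    (fun h hh => by
      have hh0 : 0 < h := hp0.trans_le hh
      have := loc _ (up z h hh0) _ (up z' h hh0) (hsame h) (by
        rw [hcol, Function.update_self]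
        have := Real.rpow_le_rpow hp0.le hh hμ.le
        rwa [← Real.rpow_mul h0.le, inv_mul_cancel₀ hμ.ne', Real.rpow_one] at this)
      rw [hcol] at this
      refine this.trans (mul_le_mul_of_nonneg_right (mul_le_mul_of_nonneg_right ?_ hB) hr.le)
      linarith)
    (by
      rw [hs, ← Real.rpow_mul h0.le, ← mul_assoc, inv_mul_cancel₀ hμ.ne', one_mul]
      have : 0 ≤ C₁ * B * ρ ^ κ none := by positivity
      linarith) (z (nrm d)) hl0
  rw [update_base] at h3
  have hN : z (nrm d) = z' (nrm d) := hx _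
  conv_lhs at h3 => rw [hN]
  rw [update_base] at h3
  refine h3.trans (le_of_eq ?_); ring

lemma σ_pos : 0 < P.σ := by
  rw [σ_eq]
  have h1 := P.μ_pos
  have h2 := P.γ_pos
  have h3 := P.m_pos
  positivity

/-- Decay at the boundary. -/
lemma exists_decay {ds : List ℝ} {b p : ℝ} {κ : Idx d → ℝ} (hb : 0 ≤ b) (hη0 : 0 ≤ b - p)
    (hησ : b - p < P.σ) (hds : ∀ x ∈ ds, b - p < x) :
    ∃ ε C R : ℝ, 0 < ε ∧ 0 ≤ C ∧ ∀ (g : (Idx d → ℝ) → ℝ) (B A : ℝ) (c : Idx d → ℝ), 0 ≤ B → 0 ≤ A →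
    P.Recurrent ds b κ B g → c (nrm d) = 0 →
    (∀ h, 1 ≤ h → h ≤ R → |g (Function.update c (nrm d) h)| ≤ A) → ∀ h, 0 < h → h < 1 →
    |wf p g (Function.update c (nrm d) h)| ≤ C * (A + B) * h ^ ε := by
  obtain ⟨η', C, hη', hC, H⟩ := seq_decay ds hησ hds
  set N := ds.length with hN
  -- The sequence starts at a height in `[1, 2)` and needs its values at the indices `0, …, N`,
  -- hence on heights up to `2 * 2^N`.
  set R : ℝ := 2 * 2 ^ (N : ℝ) with hR
  have h2 : ∀ x : ℝ, (0 : ℝ) < (2 : ℝ) ^ x := fun x => Real.rpow_pos_of_pos two_pos _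
  have hR0 : 0 < R := mul_pos two_pos (h2 _)
  have hRb : 0 < R ^ b := Real.rpow_pos_of_pos hR0 _
  refine ⟨η' - (b - p), C * (R ^ b + 2 ^ P.σ), R, by linarith, by positivity,
    fun g B A c hB hA hg hc hgA h hh hh1 => ?_⟩
  obtain ⟨n, hn1, hn2⟩ := exists_dyadic hh hh1
  set l := h * 2 ^ n with hl
  have hl0 : 0 < l := one_pos.trans_le hn1
  have h3 := H (P.seqAt b l c (e1 d) g) (R ^ b * A + 2 ^ P.σ * B) (by positivity)
    (fun k hk hk' => ?_) (fun k _ => ?_) (-(n : ℤ)) (by omega)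
  · rw [seqAt_apply, hl, rpow_neg_dyadic, P.scal_e1 hc, abs_mul,
      abs_of_pos (Real.rpow_pos_of_pos hh _)] at h3
    have e1 : |wf p g (Function.update c (nrm d) h)| =
        h ^ (p - b) * (h ^ b * |g (Function.update c (nrm d) h)|) := by
      rw [wf, Function.update_self, abs_mul, abs_of_pos (Real.rpow_pos_of_pos hh _), ← mul_assoc,
        ← Real.rpow_add hh]; congr 2; ring
    have e2 : (2 : ℝ) ^ (((-(n : ℤ) : ℤ) : ℝ) * η') ≤ h ^ η' := by
      rw [Real.rpow_mul two_pos.le]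
      refine Real.rpow_le_rpow (h2 _).le ?_ (by linarith)
      have e3 := rpow_neg_dyadic h n
      rw [← hl] at e3
      have := le_mul_of_one_le_left (h2 (((-(n : ℤ) : ℤ) : ℝ))).le hn1
      linarith
    have e4 : h ^ (η' - (b - p)) = h ^ (p - b) * h ^ η' := by
      rw [← Real.rpow_add hh]; congr 1; ring
    have hX : 0 ≤ C * (R ^ b * A + 2 ^ P.σ * B) := by positivity
    rw [e1, e4]
    calc _ ≤ h ^ (p - b) * (C * (R ^ b * A + 2 ^ P.σ * B) * h ^ η') :=
          mul_le_mul_of_nonneg_left (h3.trans (mul_le_mul_of_nonneg_left e2 hX))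
            (Real.rpow_nonneg hh.le _)
      _ = C * (R ^ b * A + 2 ^ P.σ * B) * (h ^ (p - b) * h ^ η') := by ring
      _ ≤ _ := by
        refine mul_le_mul_of_nonneg_right ?_ (mul_nonneg (Real.rpow_nonneg hh.le _) (Real.rpow_nonneg hh.le _))
        rw [mul_assoc]
        refine mul_le_mul_of_nonneg_left ?_ hC
        have h5 : 0 ≤ R ^ b * B := by positivity
        have h6 : 0 ≤ 2 ^ P.σ * A := by positivity
        linarith
  · have hk1 : (1 : ℝ) ≤ (2 : ℝ) ^ (k : ℝ) := Real.one_le_rpow one_le_two (by exact_mod_cast hk)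
    have hk2 : (2 : ℝ) ^ (k : ℝ) ≤ 2 ^ (N : ℝ) :=
      Real.rpow_le_rpow_of_exponent_le one_le_two (by exact_mod_cast hk')
    have g1 : 1 ≤ l * (2 : ℝ) ^ (k : ℝ) := by nlinarith
    have g2 : l * (2 : ℝ) ^ (k : ℝ) ≤ R := mul_le_mul (by linarith) hk2 (h2 _).le two_pos.le
    rw [seqAt_apply, P.scal_e1 hc, abs_mul, abs_of_pos (Real.rpow_pos_of_pos (by linarith) _)]
    have h4 := mul_le_mul (Real.rpow_le_rpow (by linarith) g2 hb) (hgA _ g1 g2) (abs_nonneg _) hRb.le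
    have : 0 ≤ 2 ^ P.σ * B := by positivity
    linarith
  · have h4 := hg.bound l hl0 c hc _ e1_mem k
    rw [rpow_dyadic hl0] at h4
    have h5 : l ^ P.σ ≤ 2 ^ P.σ := Real.rpow_le_rpow hl0.le (by linarith) P.σ_pos.le
    have h6 := (h2 ((k : ℝ) * P.σ)).le
    have h7 : 0 ≤ R ^ b * A := by positivity
    calc _ ≤ B * (l ^ P.σ * 2 ^ ((k : ℝ) * P.σ)) := h4
      _ ≤ B * (2 ^ P.σ * 2 ^ ((k : ℝ) * P.σ)) := by gcongr
      _ = (2 ^ P.σ * B) * 2 ^ ((k : ℝ) * P.σ) := by ring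
      _ ≤ _ := mul_le_mul_of_nonneg_right (by linarith) h6

end Params

/-! ### From continuous partial derivatives to joint smoothness -/

section ContDiff

variable {ι : Type*} [Fintype ι] [DecidableEq ι]

lemma hasDerivAt_line_of_differentiable {Ω : Set (ι → ℝ)} {v : (ι → ℝ) → ℝ} {i : ι}
    (h : ∀ z ∈ Ω, DifferentiableAt ℝ (fun s : ℝ => v (z + s • Pi.single i 1)) 0) {z : ι → ℝ} {s : ℝ}
    (hz : z + s • Pi.single i (1 : ℝ) ∈ Ω) :
    HasDerivAt (fun s : ℝ => v (z + s • Pi.single i 1)) (pd i v (z + s • Pi.single i 1)) s := by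
  have h1 : HasDerivAt (fun r : ℝ => v (z + s • Pi.single i (1 : ℝ) + r • Pi.single i 1))
      (pd i v (z + s • Pi.single i 1)) (s - s) := by rw [sub_self]; exact (h _ hz).hasDerivAt
  have h2 := HasDerivAt.comp_sub_const s s h1
  refine h2.congr_of_eventuallyEq (Filter.Eventually.of_forall fun r => ?_)
  beta_reduce
  congr 1
  rw [add_assoc, ← add_smul]; congr 2; ring

/-- After subtraction of the candidate linear map all partial derivatives are small near `x`. The
mean value inequality along each axis and the exchange of one coordinate at a time give the little-o
bound. -/
lemma hasFDerivAt_of_continuous_pd {Ω : Set (ι → ℝ)} (hΩ : IsOpen Ω) {v : (ι → ℝ) → ℝ}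
    (hd : ∀ i, ∀ z ∈ Ω, DifferentiableAt ℝ (fun s : ℝ => v (z + s • Pi.single i 1)) 0)
    (hc : ∀ i, ContinuousOn (pd i v) Ω) {x : ι → ℝ} (hx : x ∈ Ω) :
    HasFDerivAt v (∑ i, pd i v x • (ContinuousLinearMap.proj i : (ι → ℝ) →L[ℝ] ℝ)) x := by
  rw [hasFDerivAt_iff_isLittleO, Asymptotics.isLittleO_iff]
  intro c hc0
  set N : ℝ := Fintype.card ι + 1 with hN
  have hN0 : 0 < N := by positivity
  have hev : ∀ᶠ y in 𝓝 x, y ∈ Ω ∧ ∀ i, |pd i v y - pd i v x| ≤ c / N := by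
    refine Filter.Eventually.and (hΩ.eventually_mem hx) (eventually_all.2 fun i => ?_)
    have := ((hc i).continuousAt (hΩ.mem_nhds hx)).eventually (Metric.closedBall_mem_nhds _ (div_pos hc0 hN0))
    simpa [Metric.mem_closedBall, Real.dist_eq] using this
  obtain ⟨r, hr, hball⟩ := Metric.eventually_nhds_iff_ball.1 hev
  filter_upwards [Metric.ball_mem_nhds x hr] with y hy
  set f : (ι → ℝ) → ℝ := fun z => v z - ∑ i, pd i v x * z i with hf
  have key : ∀ i, ∀ z ∈ Metric.ball x r, ∀ η : ℝ, 0 < η → z + η • Pi.single i (1 : ℝ) ∈ Metric.ball x r →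
      |f (z + η • Pi.single i (1 : ℝ)) - f z| ≤ c / N * η ^ (1 : ℝ) := by
    intro i z hz η hη hz'
    have hseg : ∀ s ∈ Icc (0 : ℝ) η, z + s • Pi.single i (1 : ℝ) ∈ Metric.ball x r := by
      intro s hs
      have := mem_ball_segment (M := 1) (η := η) (i := i) hz (by simpa using hz') (l := s / η)
        (div_nonneg hs.1 hη.le) (by rw [div_le_one hη]; exact hs.2)
      rwa [smul_smul, div_mul_cancel₀ _ hη.ne'] at this
    have hderiv : ∀ s ∈ Icc (0 : ℝ) η, HasDerivWithinAt (fun s : ℝ => f (z + s • Pi.single i 1))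
        (pd i v (z + s • Pi.single i 1) - pd i v x) (Icc 0 η) s := by
      intro s hs
      have h1 := hasDerivAt_line_of_differentiable (hd i) (z := z) (s := s) (hball _ (hseg s hs)).1
      have h2 : HasDerivAt (fun s : ℝ => ∑ j, pd j v x * (z + s • Pi.single i (1 : ℝ) : ι → ℝ) j)
          (pd i v x) s := by
        have e : (fun s : ℝ => ∑ j, pd j v x * (z + s • Pi.single i (1 : ℝ) : ι → ℝ) j) =
            fun s => ∑ j, pd j v x * z j + pd i v x * s := by
          ext s
          simp only [Pi.add_apply, Pi.smul_apply, smul_eq_mul, mul_add, Finset.sum_add_distrib]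
          congr 1
          rw [Finset.sum_eq_single i (fun j _ hj => by simp [hj]) (fun h => absurd (Finset.mem_univ i) h)]
          simp
        rw [e]
        simpa using ((hasDerivAt_id s).const_mul (pd i v x)).const_add (∑ j, pd j v x * z j)
      exact (h1.sub h2).hasDerivWithinAt
    have := (convex_Icc (0 : ℝ) η).norm_image_sub_le_of_norm_hasDerivWithin_le
      (f := fun s : ℝ => f (z + s • Pi.single i 1)) hderiv
      (fun s hs => (hball _ (hseg s hs)).2 i) (left_mem_Icc.2 hη.le) (right_mem_Icc.2 hη.le)
    simpa [Real.norm_eq_abs, abs_of_pos hη] using this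
  have h1 := abs_sub_le_sum_of_coordinates (κ := fun _ => (1 : ℝ)) (div_pos hc0 hN0).le key
    (Metric.mem_ball_self hr) hy
  have h2 : v y - v x - (∑ i, pd i v x • (ContinuousLinearMap.proj i : (ι → ℝ) →L[ℝ] ℝ)) (y - x) =
      f y - f x := by
    simp only [hf, _root_.sum_apply, _root_.smul_apply,
      ContinuousLinearMap.proj_apply, Pi.sub_apply, smul_eq_mul, mul_sub, Finset.sum_sub_distrib]
    ring
  rw [h2, Real.norm_eq_abs]
  refine h1.trans ?_
  have h3 : ∑ i, |y i - x i| ^ (1 : ℝ) ≤ N * ‖y - x‖ := by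
    have : ∀ i ∈ (Finset.univ : Finset ι), |y i - x i| ^ (1 : ℝ) ≤ ‖y - x‖ := fun i _ => by
      rw [Real.rpow_one]; exact norm_le_pi_norm (y - x) i
    refine (Finset.sum_le_card_nsmul _ _ _ this).trans ?_
    rw [nsmul_eq_mul, Finset.card_univ, hN]
    have := norm_nonneg (y - x)
    linarith
  calc c / N * ∑ i, |y i - x i| ^ (1 : ℝ) ≤ c / N * (N * ‖y - x‖) :=
        mul_le_mul_of_nonneg_left h3 (div_pos hc0 hN0).le
    _ = c * ‖y - x‖ := by field_simp

lemma pdL_append (L L' : List ι) (v : (ι → ℝ) → ℝ) : pdL (L ++ L') v = pdL L (pdL L' v) := by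
  induction L with
  | nil => rfl
  | cons i L ih => rw [List.cons_append]; change pd i _ = pd i _; rw [ih]

lemma PdReg.append {L L' : List ι} {Ω : Set (ι → ℝ)} {v : (ι → ℝ) → ℝ} (h : PdReg (L ++ L') Ω v) :
    PdReg L Ω (pdL L' v) := by
  induction L with
  | nil => trivial
  | cons i L ih => exact ⟨ih h.1, fun z hz => by rw [← pdL_append]; exact h.2 z hz⟩

/-- The derivative is the combination of the `pd i v` with constant linear maps, and each `pd i v`
satisfies the hypothesis with one order less. -/
lemma contDiffOn_of_pdL {Ω : Set (ι → ℝ)} (hΩ : IsOpen Ω) (k : ℕ) {v : (ι → ℝ) → ℝ}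
    (h : ∀ L : List ι, L.length ≤ k → PdReg L Ω v ∧ ContinuousOn (pdL L v) Ω) :
    ContDiffOn ℝ k v Ω := by
  induction k generalizing v with
  | zero => exact contDiffOn_zero.2 (h [] le_rfl).2
  | succ k ih =>
    have hf : ∀ x ∈ Ω, HasFDerivAt v
        (∑ i, pd i v x • (ContinuousLinearMap.proj i : (ι → ℝ) →L[ℝ] ℝ)) x := fun x hx =>
      hasFDerivAt_of_continuous_pd hΩ (fun i => ((h [i] (by simp)).1).2) (fun i => (h [i] (by simp)).2) hx
    push_cast
    refine (contDiffOn_succ_iff_fderiv_of_isOpen hΩ).2 ⟨fun x hx =>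
      (hf x hx).differentiableAt.differentiableWithinAt, by simp, ?_⟩
    have h1 : ContDiffOn ℝ k (fun x => ∑ i, pd i v x • (ContinuousLinearMap.proj i : (ι → ℝ) →L[ℝ] ℝ)) Ω := by
      refine ContDiffOn.sum fun i _ => ContDiffOn.smul (ih fun L hL => ?_) contDiffOn_const
      have := h (L ++ [i]) (by simpa using hL)
      refine ⟨PdReg.append (L' := [i]) this.1, ?_⟩
      have e := pdL_append L [i] v
      rw [e] at this
      exact this.2
    exact h1.congr fun x hx => (hf x hx).fderiv

end ContDiff

/-! ### Passage from `(x, t)` to functions on `Idx d → ℝ` -/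

section Lift

variable {d : ℕ}

/-- The point `(x, t)`. -/
def pt (x : Space d) (t : ℝ) : Idx d → ℝ
  | none => t
  | some i => x i

/-- The spatial part. -/
noncomputable def sp (z : Idx d → ℝ) : Space d := WithLp.toLp 2 fun i => z (some i)

/-- A function of `(x, t)` in the variables indexed by `Idx d`. -/
noncomputable def lift (u : Space d → ℝ → ℝ) (z : Idx d → ℝ) : ℝ := u (sp z) (z none)

lemma pt_sp (z : Idx d → ℝ) : pt (sp z) (z none) = z := by
  ext i; rcases i with _ | i <;> rfl

lemma lift_pt (u : Space d → ℝ → ℝ) (x : Space d) (t : ℝ) : lift u (pt x t) = u x t := rfl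

lemma pt_add_single (x : Space d) (t : ℝ) (i : Fin (d + 1)) (s : ℝ) :
    pt x t + s • Pi.single (some i) (1 : ℝ) = pt (x + s • e i) t := by
  ext j
  rcases j with _ | j
  · simp [pt]
  · simp only [pt, Pi.add_apply, Pi.smul_apply, PiLp.add_apply, PiLp.smul_apply, e,
      EuclideanSpace.single, PiLp.single_apply, Pi.single_apply, Option.some.injEq]

lemma pureD_eq_pdL (W : (Idx d → ℝ) → ℝ) (t : ℝ) (i : Fin (d + 1)) (k : ℕ) (x : Space d) :
    pureD i k (fun y => W (pt y t)) x = pdL (List.replicate k (some i)) W (pt x t) := by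
  induction k generalizing x with
  | zero => simp [pureD, pdL]
  | succ k ih =>
    rw [List.replicate_succ]
    change _ = deriv (fun s : ℝ => pdL (List.replicate k (some i)) W (pt x t + s • Pi.single (some i) 1)) 0
    have : (fun s : ℝ => pdL (List.replicate k (some i)) W (pt x t + s • Pi.single (some i) 1)) =
        iteratedDeriv k fun s : ℝ => W (pt (x + s • e i) t) := by
      ext s
      rw [pt_add_single, ← ih, pureD]
      have h1 := iteratedDeriv_comp_const_add k (fun s : ℝ => W (pt (x + s • e i) t)) s
      have h2 := congrFun h1 0
      rw [add_zero] at h2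
      rw [← h2]
      congr 1; ext r; rw [add_assoc, ← add_smul]
    rw [this, ← iteratedDeriv_succ]; rfl

/-- The list of derivatives corresponding to a multi-index. -/
def lst (α : Fin (d + 1) → ℕ) : List (Idx d) :=
  (List.finRange (d + 1)).flatMap fun i => List.replicate (α i) (some i)

lemma mixedD_eq_pdL (α : Fin (d + 1) → ℕ) (W : (Idx d → ℝ) → ℝ) (t : ℝ) :
    mixedD α (fun y => W (pt y t)) = fun x => pdL (lst α) W (pt x t) := by
  unfold mixedD lst
  induction List.finRange (d + 1) with
  | nil => rfl
  | cons i l ih =>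
    rw [List.foldr_cons, ih, List.flatMap_cons]
    ext x
    rw [pureD_eq_pdL, pdL_append]

lemma mixedD_lift (α : Fin (d + 1) → ℕ) (u : Space d → ℝ → ℝ) (t : ℝ) (x : Space d) :
    mixedD α (fun y => u y t) x = pdL (lst α) (lift u) (pt x t) :=
  congrFun (mixedD_eq_pdL α (lift u) t) x

lemma dT_eq_pdL (u : Space d → ℝ → ℝ) (x : Space d) (t : ℝ) :
    dT u x t = pdL [none] (lift u) (pt x t) := by
  change deriv (u x) t = deriv (fun s : ℝ => lift u (pt x t + s • Pi.single none 1)) 0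
  have : (fun s : ℝ => lift u (pt x t + s • Pi.single none 1)) = fun s => u x (t + s) := by
    ext s
    have e1 : pt x t + s • Pi.single none (1 : ℝ) = pt x (t + s) := by
      ext j; rcases j with _ | j <;> simp [pt]
    rw [e1, lift_pt]
  rw [this, deriv_comp_const_add, add_zero]

lemma sum_map_lst {f : Idx d → ℝ} (hf : ∀ i, f (some i) = 1) (α : Fin (d + 1) → ℕ) :
    ((lst α).map f).sum = ∑ i, (α i : ℝ) := by
  have : ∀ l : List (Fin (d + 1)), ((l.flatMap fun i => List.replicate (α i) (some i)).map f).sum =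
      (l.map fun i => (α i : ℝ)).sum := by
    intro l
    induction l with
    | nil => simp
    | cons i l ih => simp [List.flatMap_cons, ih, hf]
  rw [lst, this, ← List.ofFn_eq_map, List.sum_ofFn]

lemma count_lst (α : Fin (d + 1) → ℕ) (i : Fin (d + 1)) : (lst α).count (some i) = α i := by
  have key : ∀ l : List (Fin (d + 1)), l.Nodup →
      (l.flatMap fun i => List.replicate (α i) (some i)).count (some i) = if i ∈ l then α i else 0 := by
    intro l hl
    induction l with
    | nil => simp
    | cons j l ih =>
      rw [List.nodup_cons] at hl
      rw [List.flatMap_cons, List.count_append, ih hl.2, List.count_replicate]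
      by_cases h : i = j
      · subst h; simp [hl.1]
      · have h' : ¬ (j = i) := fun h1 => h h1.symm
        simp [h, h']
  rw [lst, key _ (List.nodup_finRange _), if_pos (List.mem_finRange i)]

end Lift

/-! ### Extended seminorms and pointwise bounds -/

section Quotients

/-- On the diagonal the quotient is `0 / 0 = 0`, so coinciding points impose no condition on either
side. -/
lemma ofReal_div_le_iff {a b M : ℝ} (hb : 0 ≤ b) (hab : b = 0 → a = 0) (hM : 0 ≤ M) :
    ENNReal.ofReal (a / b) ≤ ENNReal.ofReal M ↔ a ≤ M * b := by
  rw [ENNReal.ofReal_le_ofReal_iff hM]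
  rcases hb.eq_or_lt with h | h
  · rw [hab h.symm, ← h]; simp [hM]
  · exact div_le_iff₀ h

variable {d : ℕ}

lemma quot_le_iff {θ s M : ℝ} (hM : 0 ≤ M) {v : Space d → ℝ} {x y : Space d} :
    quot θ s v x y ≤ ENNReal.ofReal M ↔
      (max (xN x) (xN y)) ^ θ * |v x - v y| ≤ M * ‖x - y‖ ^ s := by
  refine ofReal_div_le_iff (Real.rpow_nonneg (norm_nonneg _) _) (fun h => ?_) hM
  have := ((Real.rpow_eq_zero_iff_of_nonneg (norm_nonneg _)).1 h).1
  rw [norm_eq_zero, sub_eq_zero] at this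
  simp [this]

lemma semiT_le_iff {s M : ℝ} (hM : 0 ≤ M) {v : Space d → ℝ → ℝ} :
    semiT s v ≤ ENNReal.ofReal M ↔
      ∀ x ∈ H d, ∀ t τ, |v x t - v x τ| ≤ M * |t - τ| ^ s := by
  simp only [semiT, iSup_le_iff]
  refine forall_congr' fun x => forall_congr' fun _ => forall_congr' fun t => forall_congr' fun τ => ?_
  refine ofReal_div_le_iff (Real.rpow_nonneg (abs_nonneg _) _) (fun h => ?_) hM
  have := ((Real.rpow_eq_zero_iff_of_nonneg (abs_nonneg _)).1 h).1
  rw [abs_eq_zero, sub_eq_zero] at this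
  simp [this]

lemma finitePart_le {a b : ℝ≥0∞} (h : a ≠ ⊤ → a ≤ b) : finitePart a ≤ b := by
  unfold finitePart
  split_ifs with h0
  · exact zero_le
  · exact h h0

lemma finitePart_add_le (a b : ℝ≥0∞) : finitePart (a + b) ≤ finitePart a + finitePart b := by
  refine finitePart_le fun h => ?_
  rw [ENNReal.add_ne_top] at h
  simp [finitePart, h.1, h.2]

end Quotients

/-! ### The data imply the Hölder conditions -/

section Data

variable {d : ℕ} (P : Params)

/-- The right-hand side of the parabolic estimate. -/
noncomputable def Params.rhs (u : Space d → ℝ → ℝ) : ℝ≥0∞ := parabolicRHS P.m P.n P.γ u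

lemma sp_update (z : Idx d → ℝ) (i : Fin (d + 1)) (s r : ℝ) :
    sp (Function.update z (some i) (s + r)) = sp (Function.update z (some i) s) + r • e i := by
  ext j
  by_cases h : j = i
  · subst h; simp [sp, e]
  · simp [sp, e, h]

lemma update_mem_halfQ {z : Idx d → ℝ} (hz : z ∈ halfQ d) {i : Idx d} {s : ℝ} :
    s ∈ Params.Ji i ↔ Function.update z i s ∈ halfQ d := by
  unfold Params.Ji halfQ
  by_cases h : i = nrm d
  · subst h; simp
  · have : nrm d ≠ i := fun h' => h h'.symm
    simp only [h, if_false, mem_univ, true_iff, mem_ofPred_eq, Function.update_of_ne this]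
    exact hz

variable {P}

/-- The summands of the finite right-hand side are the required Hölder bounds, written along
coordinate lines. The data assume only differentiability in `t`; the finite Hölder seminorm of `D_t
u` makes it continuous, so `u` is `C^1` in `t`. -/
lemma good_lift {u : Space d → ℝ → ℝ}
    (hc : ContinuousOn (fun p : Space d × ℝ => u p.1 p.2) (closedH d ×ˢ Set.univ))
    (hp : ∀ t : ℝ, HasPureDerivs P.m (fun x => u x t)) (ht : ∀ x ∈ H d, Differentiable ℝ (u x))
    (hR : P.rhs u < ⊤) : P.Good (P.rhs u).toReal (lift u) := by
  have hA : 0 ≤ (P.rhs u).toReal := ENNReal.toReal_nonneg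
  have hRA : P.rhs u = ENNReal.ofReal (P.rhs u).toReal := (ENNReal.ofReal_toReal hR.ne).symm
  have hX : ∀ (i : Fin (d + 1)) (t : ℝ), ∀ x ∈ H d, ∀ y ∈ H d, (∀ k, k ≠ i → x k = y k) →
      (max (xN x) (xN y)) ^ (P.n / P.m * P.γ) * |xN x ^ P.n * pureD i P.m (fun y => u y t) x -
        xN y ^ P.n * pureD i P.m (fun y => u y t) y| ≤ (P.rhs u).toReal * ‖x - y‖ ^ P.γ := by
    intro i t x hx y hy hxy
    have h0 : semiXi (P.n / P.m * P.γ) P.γ i (fun x => xN x ^ P.n * pureD i P.m (fun y => u y t) x) ≤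
        P.rhs u := by
      refine (le_iSup (fun t => semiXi (P.n / P.m * P.γ) P.γ i
        (fun x => xN x ^ P.n * pureD i P.m (fun y => u y t) x)) t).trans ?_
      refine le_trans ?_ le_self_add
      exact Finset.single_le_sum (f := fun i => ⨆ t, semiXi (P.n / P.m * P.γ) P.γ i
        (fun x => xN x ^ P.n * pureD i P.m (fun y => u y t) x)) (fun _ _ => zero_le) (Finset.mem_univ i)
    rw [hRA] at h0
    simp only [semiXi, iSup_le_iff] at h0
    exact (quot_le_iff hA).1 (h0 x hx y hy hxy)
  have hT : ∀ x ∈ H d, ∀ t τ, |dT u x t - dT u x τ| ≤ (P.rhs u).toReal * |t - τ| ^ (P.γ / P.m) := by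
    refine (semiT_le_iff hA).1 ?_
    rw [← hRA]
    exact le_add_self
  have hline : ∀ (i : Fin (d + 1)) (z : Idx d → ℝ) (s r : ℝ),
      lift u (Function.update z (some i) (s + r)) =
        u (sp (Function.update z (some i) s) + r • e i) (z none) := by
    intro i z s r
    rw [lift, sp_update]; rfl
  have hγm : 0 < P.γ / P.m := div_pos P.γ_pos P.m_pos
  have hlineT : ∀ z : Idx d → ℝ, (fun s => lift u (Function.update z none s)) = u (sp z) := by
    intro z; ext s
    rw [lift, Function.update_self]; rfl
  refine ⟨?_, ?_, ?_⟩
  · have : Continuous fun z : Idx d → ℝ => (sp z, z none) := by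
      unfold sp
      fun_prop
    refine hc.comp this.continuousOn fun z hz => ⟨?_, mem_univ _⟩
    exact (show 0 < xN (sp z) from hz).le
  · intro i z hz
    rcases i with _ | i
    · rw [hlineT]
      refine ContDiff.contDiffOn ?_
      change ContDiff ℝ (1 : ℕ) _
      rw [Nat.cast_one, contDiff_one_iff_deriv]
      refine ⟨ht _ hz, ?_⟩
      have := hT (sp z) hz
      rw [continuous_iff_continuousAt]
      intro t
      rw [ContinuousAt, tendsto_iff_norm_sub_tendsto_zero]
      refine squeeze_zero (fun _ => norm_nonneg _) (fun τ => this τ t) ?_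
      have h1 : Tendsto (fun τ : ℝ => |τ - t|) (𝓝 t) (𝓝 0) := by
        have : Continuous fun τ : ℝ => |τ - t| := by fun_prop
        simpa using this.tendsto t
      have h2 := (h1.rpow_const (p := P.γ / P.m) (Or.inr hγm.le)).const_mul (P.rhs u).toReal
      rwa [Real.zero_rpow hγm.ne', mul_zero] at h2
    · have h0 := hp (z none) i (sp z) hz
      have e1 : (fun s => lift u (Function.update z (some i) s)) =
          (fun s : ℝ => u (sp z + s • e i) (z none)) ∘ fun s => s - z (some i) := by
        ext s
        have := hline i z (z (some i)) (s - z (some i))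
        rw [add_sub_cancel, Function.update_eq_self] at this
        exact this
      rw [e1]
      refine h0.comp (contDiff_id.sub contDiff_const).contDiffOn fun s hs => ?_
      have h1 := (update_mem_halfQ hz).1 hs
      have h2 := sp_update z i (z (some i)) (s - z (some i))
      rw [add_sub_cancel, Function.update_eq_self] at h2
      change sp z + (s - z (some i)) • e i ∈ H d
      rw [← h2]
      exact h1
  · intro i z hz s hs s' hs'
    rcases i with _ | i
    · rw [hlineT]
      have := hT (sp z) hz s s'
      change max _ _ ^ (0 : ℝ) * |_ ^ (0 : ℝ) * iteratedDeriv 1 _ _ - _ ^ (0 : ℝ) * iteratedDeriv 1 _ _| ≤ _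
      simp only [Real.rpow_zero, one_mul, iteratedDeriv_one]
      exact this
    · have h1 := hX i (z none) (sp (Function.update z (some i) s)) ((update_mem_halfQ hz).1 hs)
        (sp (Function.update z (some i) s')) ((update_mem_halfQ hz).1 hs') (fun k hk => by simp [sp, hk])
      have e1 : ‖sp (Function.update z (some i) s) - sp (Function.update z (some i) s')‖ = |s - s'| := by
        have := sp_update z i s' (s - s')
        rw [add_sub_cancel] at this
        rw [this, add_sub_cancel_left, norm_smul, e]
        simp
      have e2 : ∀ s, pureD i P.m (fun y => u y (z none)) (sp (Function.update z (some i) s)) =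
          iteratedDeriv P.m (fun s => lift u (Function.update z (some i) s)) s := by
        intro s
        have h1 := iteratedDeriv_comp_const_add P.m (fun s => lift u (Function.update z (some i) s)) s
        have h2 := congrFun h1 0
        rw [add_zero] at h2
        rw [← h2, pureD]
        congr 1; ext r
        rw [hline]
      rw [e1, e2, e2] at h1
      exact h1

end Data

/-! ### Estimates of the finite terms on the left -/

/-- The Hölder exponents with a common value in the variables `x`. -/
def exps {d : ℕ} (a b : ℝ) : Idx d → ℝ
  | none => a
  | some _ => b

namespace Params

variable (P : Params) {d : ℕ}

/-- A quantity is bounded by the data of the parabolic problem. -/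
def Controlled (F : (Space d → ℝ → ℝ) → ℝ≥0∞) : Prop :=
  ∃ C : ℝ≥0, ∀ u : Space d → ℝ → ℝ, P.rhs u < ⊤ → P.Good (P.rhs u).toReal (lift u) →
    F u ≤ C * P.rhs u

variable {P}

lemma Controlled.add {F G : (Space d → ℝ → ℝ) → ℝ≥0∞} (hF : P.Controlled F) (hG : P.Controlled G) :
    P.Controlled fun u => F u + G u := by
  obtain ⟨C, hC⟩ := hF
  obtain ⟨D, hD⟩ := hG
  refine ⟨C + D, fun u h1 h2 => ?_⟩
  rw [ENNReal.coe_add, add_mul]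
  exact add_le_add (hC u h1 h2) (hD u h1 h2)

lemma Controlled.mono {F G : (Space d → ℝ → ℝ) → ℝ≥0∞} (hG : P.Controlled G) (h : ∀ u, F u ≤ G u) :
    P.Controlled F := by
  obtain ⟨C, hC⟩ := hG
  exact ⟨C, fun u h1 h2 => (h u).trans (hC u h1 h2)⟩

lemma Controlled.sum {ι : Type*} (s : Finset ι) {F : ι → (Space d → ℝ → ℝ) → ℝ≥0∞}
    (hF : ∀ i ∈ s, P.Controlled (F i)) : P.Controlled fun u => ∑ i ∈ s, F i u := by
  classical
  induction s using Finset.induction_on with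
  | empty => exact ⟨0, fun u _ _ => by simp⟩
  | insert i s hi ih =>
    simp only [Finset.sum_insert hi]
    exact (hF i (Finset.mem_insert_self i s)).add (ih fun j hj => hF j (Finset.mem_insert_of_mem hj))

/-- An infinite term counts as `0`, so only the finite case has to be estimated, and there
finiteness is available as a hypothesis. -/
lemma Controlled.of_real {F : (Space d → ℝ → ℝ) → ℝ≥0∞}
    (h : ∃ C : ℝ, 0 ≤ C ∧ ∀ (u : Space d → ℝ → ℝ) (A : ℝ), 0 ≤ A → P.Good A (lift u) → F u ≠ ⊤ →
      F u ≤ ENNReal.ofReal (C * A)) : P.Controlled fun u => finitePart (F u) := by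
  obtain ⟨C, hC0, hC⟩ := h
  refine ⟨C.toNNReal, fun u h1 h2 => finitePart_le fun h3 => ?_⟩
  refine (hC u _ ENNReal.toReal_nonneg h2 h3).trans ?_
  rw [ENNReal.ofReal_mul hC0, ENNReal.ofReal_toReal h1.ne]
  rfl

variable (P)

lemma exists_recurrent_exps (L : List (Idx d)) (hL : (L.map P.ord).sum < P.m + P.γ) {a s : ℝ}
    (ha0 : 0 ≤ a) (ha1 : a < 1) (ha : a * P.m ≤ P.m + P.γ - (L.map P.ord).sum)
    (hs0 : 0 ≤ s) (hs1 : s < 1) (hs : s ≤ P.m + P.γ - (L.map P.ord).sum) :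
    ∃ C : ℝ, 0 ≤ C ∧ ∀ (U : (Idx d → ℝ) → ℝ) (A : ℝ), 0 ≤ A → P.Good A U →
      P.Recurrent (P.degList L) (L.map P.wt).sum (exps a s) (C * A) (pdL L U) := by
  refine P.exists_recurrent L hL ?_ ?_ ?_
  · rintro (_ | _) <;> assumption
  · rintro (_ | _) <;> assumption
  · rintro (_ | _)
    · exact ha
    · simpa [exps, ord] using hs

variable {P}

/-- The seminorm itself, finite but not yet estimated, serves as the constant `M` of the a priori
growth; the conclusion of `exists_x_bound` no longer contains it. -/
lemma controlled_semiX (L : List (Idx d)) (hLm : (L.map P.ord).sum ≤ P.m) {p θ s : ℝ}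
    (hp : 0 ≤ p) (hθ : 0 ≤ θ) (hθs : θ < s) (hs1 : s < 1)
    (hs : θ + (p + P.σ - (L.map P.wt).sum) = s) (hsL : s ≤ P.m + P.γ - (L.map P.ord).sum) :
    P.Controlled fun u : Space d → ℝ → ℝ => finitePart
      (⨆ t : ℝ, semiX θ s fun x => wf p (pdL L (lift u)) (pt x t)) := by
  have hm := P.m_pos
  have hm1 : (1 : ℝ) ≤ P.m := by exact_mod_cast P.one_le_m
  have hγ := P.γ_pos
  have hγm : 0 < P.γ / P.m := div_pos hγ hm
  obtain ⟨C, hC0, hC⟩ := P.exists_recurrent_exps L (by linarith) hγm.le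
    (by rw [div_lt_one hm]; linarith [P.γ_lt]) (by rw [div_mul_cancel₀ _ hm.ne']; linarith)
    (hθ.trans hθs.le) hs1 hsL
  obtain ⟨D, hD0, hD⟩ := P.exists_x_bound (P.σ_notMem_degList L) (κ := exps (P.γ / P.m) s) hp hθ hθs hs1.le hs
    (fun _ => rfl) hγm
  refine Controlled.of_real ⟨D * C, mul_nonneg hD0 hC0, fun u A hA hG hfin => ?_⟩
  set M := (⨆ t : ℝ, semiX θ s fun x => wf p (pdL L (lift u)) (pt x t)).toReal with hM
  have h := hD (pdL L (lift u)) (C * A) M (mul_nonneg hC0 hA) (hC _ A hA hG) ?_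
  · refine iSup_le fun t => iSup₂_le fun x hx => iSup₂_le fun y hy => ?_
    rw [quot_le_iff (mul_nonneg (mul_nonneg hD0 hC0) hA), mul_assoc D]
    exact h (pt x t) hx (pt y t) hy rfl
  · intro z hz z' hz' hzz
    have h2 := le_iSup (fun t : ℝ => semiX θ s fun x => wf p (pdL L (lift u)) (pt x t)) (z none)
    rw [← ENNReal.ofReal_toReal hfin] at h2
    simp only [semiX, iSup_le_iff] at h2
    have h3 := (quot_le_iff ENNReal.toReal_nonneg).1 (h2 (sp z) hz (sp z') hz')
    rw [pt_sp, hzz, pt_sp] at h3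
    exact h3

lemma controlled_semiTang (L : List (Idx d)) (hLm : (L.map P.ord).sum ≤ P.m) {θ s : ℝ}
    (hs0 : 0 ≤ s) (hs1 : s < 1)
    (hs : θ + P.σ - (L.map P.wt).sum = s) (hsL : s ≤ P.m + P.γ - (L.map P.ord).sum) :
    P.Controlled fun u : Space d → ℝ → ℝ => finitePart
      (⨆ t : ℝ, semiTang θ s fun x => pdL L (lift u) (pt x t)) := by
  have hm := P.m_pos
  have hm1 : (1 : ℝ) ≤ P.m := by exact_mod_cast P.one_le_m
  have hγ := P.γ_pos
  have hγm : 0 < P.γ / P.m := div_pos hγ hm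
  obtain ⟨C, hC0, hC⟩ := P.exists_recurrent_exps L (by linarith) hγm.le
    (by rw [div_lt_one hm]; linarith [P.γ_lt]) (by rw [div_mul_cancel₀ _ hm.ne']; linarith) hs0 hs1 hsL
  obtain ⟨D, hD0, hD⟩ := P.exists_tang_bound (P.σ_notMem_degList L) (κ := exps (P.γ / P.m) s) hs0 hs
    (fun _ => rfl) hγm
  refine Controlled.of_real ⟨D * C, mul_nonneg hD0 hC0, fun u A hA hG hfin => ?_⟩
  set M := (⨆ t : ℝ, semiTang θ s fun x => pdL L (lift u) (pt x t)).toReal with hM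
  -- At equal heights the Hölder weight passes inside the difference, so the weighted tangential
  -- seminorm is an unweighted one of `wf θ g`.
  have key : ∀ z z' : Idx d → ℝ, z ∈ halfQ d → z (nrm d) = z' (nrm d) → ∀ g : (Idx d → ℝ) → ℝ,
      max (z (nrm d)) (z' (nrm d)) ^ θ * |g z - g z'| = |wf θ g z - wf θ g z'| := by
    intro z z' hz h g
    rw [wf, wf, ← h, max_self, ← mul_sub, abs_mul, abs_of_pos (Real.rpow_pos_of_pos hz _)]
  have h := hD (pdL L (lift u)) (C * A) M (mul_nonneg hC0 hA) (hC _ A hA hG) ?_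
  · refine iSup_le fun t => iSup₂_le fun x hx => iSup₂_le fun y hy => iSup_le fun hxy => ?_
    rw [quot_le_iff (mul_nonneg (mul_nonneg hD0 hC0) hA), mul_assoc D]
    have := h (pt x t) hx (pt y t) hy rfl hxy
    rw [← key (pt x t) (pt y t) hx hxy] at this
    exact this
  · intro z hz z' hz' hzz hN
    have h2 := le_iSup (fun t : ℝ => semiTang θ s fun x => pdL L (lift u) (pt x t)) (z none)
    rw [← ENNReal.ofReal_toReal hfin] at h2
    simp only [semiTang, iSup_le_iff] at h2
    have h3 := (quot_le_iff ENNReal.toReal_nonneg).1 (h2 (sp z) hz (sp z') hz' hN)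
    rw [pt_sp, hzz, pt_sp] at h3
    rw [← key z z' hz hN]
    exact h3

lemma controlled_semiT (L : List (Idx d)) (hLm : (L.map P.ord).sum ≤ P.m) {p s : ℝ}
    (hs0 : 0 < s) (hs1 : s < 1) (hs : p + P.σ - (L.map P.wt).sum = P.μ * s)
    (hsL : s * P.m ≤ P.m + P.γ - (L.map P.ord).sum) :
    P.Controlled fun u : Space d → ℝ → ℝ => finitePart
      (semiT s fun x t => wf p (pdL L (lift u)) (pt x t)) := by
  have hγ := P.γ_pos
  obtain ⟨C, hC0, hC⟩ := P.exists_recurrent_exps L (by linarith) hs0.le hs1 hsL P.γ_pos.le P.γ_lt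
    (by linarith)
  obtain ⟨D, hD0, hD⟩ := P.exists_t_bound (P.σ_notMem_degList L) (κ := exps s P.γ) hs0 hs
    (fun _ => P.γ_pos)
  refine Controlled.of_real ⟨D * C, mul_nonneg hD0 hC0, fun u A hA hG hfin => ?_⟩
  have h := hD (pdL L (lift u)) (C * A)
    (semiT s fun x t => wf p (pdL L (lift u)) (pt x t)).toReal (mul_nonneg hC0 hA) (hC _ A hA hG) ?_
  · rw [semiT_le_iff (mul_nonneg (mul_nonneg hD0 hC0) hA), mul_assoc D]
    intro x hx t τ
    exact h (pt x t) hx (pt x τ) hx fun _ => rfl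
  · intro z hz z' hz' hzz
    have h2 := (ENNReal.ofReal_toReal hfin).ge
    rw [semiT_le_iff ENNReal.toReal_nonneg] at h2
    have h3 := h2 (sp z) hz (z none) (z' none)
    rw [pt_sp] at h3
    have e1 : pt (sp z) (z' none) = z' := by
      ext i
      rcases i with _ | i
      · rfl
      · exact hzz i
    rw [e1] at h3
    exact h3

end Params

namespace Params

variable {P : Params} {d : ℕ}

lemma sum_lst_of_mem {k : ℕ} {α : Fin (d + 1) → ℕ} (hα : α ∈ multiIdx (d + 1) k) {f : Idx d → ℝ}
    (hf : ∀ i, f (some i) = 1) : ((lst α).map f).sum = k := by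
  rw [sum_map_lst hf, ← (Finset.mem_piAntidiag.1 hα).1]
  push_cast; rfl

lemma tangIdx_mem {j k : ℕ} (hj : j ≤ k) {α : Fin d → ℕ} (hα : α ∈ multiIdx d (k - j)) :
    tangIdx α j ∈ multiIdx (d + 1) k := by
  refine Finset.mem_piAntidiag.2 ⟨?_, fun i _ => Finset.mem_univ i⟩
  have h := (Finset.mem_piAntidiag.1 hα).1
  change ∑ i, tangIdx α j i = k
  change ∑ i, α i = k - j at h
  rw [Fin.sum_univ_castSucc]
  simp only [tangIdx, Fin.snoc_castSucc, Fin.snoc_last, h]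
  omega

/-- Both halves of the parabolic seminorm have the same homogeneity, because `(1 - n/m) γ = μ γ /
m`. -/
lemma controlled_semiXT (L : List (Idx d)) (hLm : (L.map P.ord).sum ≤ P.m) {p : ℝ} (hp : 0 ≤ p)
    (hs : p + P.σ - (L.map P.wt).sum = (1 - P.n / P.m) * P.γ) :
    P.Controlled fun u : Space d → ℝ → ℝ => finitePart
      (semiXT P.m (P.n / P.m * P.γ) P.γ fun x t => wf p (pdL L (lift u)) (pt x t)) := by
  have hm := P.m_pos
  have hγ := P.γ_pos
  have hm1 : (1 : ℝ) ≤ P.m := by exact_mod_cast P.one_le_m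
  have hγm : 0 < P.γ / P.m := div_pos hγ hm
  have hω : P.n / P.m < 1 := by rw [div_lt_one hm]; exact P.n_lt
  have hω0 : 0 < P.n / P.m := div_pos P.n_pos hm
  refine Controlled.mono (Controlled.add
    (controlled_semiX L hLm (p := p) (θ := P.n / P.m * P.γ) (s := P.γ) hp (by positivity) (by nlinarith)
      P.γ_lt (by linarith) (by linarith))
    (controlled_semiT L hLm (p := p) (s := P.γ / P.m) hγm
      (by rw [div_lt_one hm]; linarith [P.γ_lt]) ?_ (by rw [div_mul_cancel₀ _ hm.ne']; linarith)))
    fun u => finitePart_add_le _ _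
  rw [hs, μ]; field_simp

-- Each summand is matched with one of the three estimates by counting homogeneity: the power of the
-- weight plus `σ` minus the order of the derivative must equal the Hölder exponent, times `μ` in
-- the time direction. Interior regularity imposes a second inequality in terms of `ord`.
variable (P) in
lemma controlled_parabolicLHS :
    P.Controlled fun u : Space d → ℝ → ℝ => parabolicLHS P.m P.n P.γ u := by
  have hm := P.m_pos
  have hγ := P.γ_pos
  have hγ1 := P.γ_lt
  have hn := P.n_pos
  have hnm := P.n_lt
  have hm1 : (1 : ℝ) ≤ P.m := by exact_mod_cast P.one_le_m
  have hγm : 0 < P.γ / P.m := div_pos hγ hm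
  have hω : P.n / P.m < 1 := by rw [div_lt_one hm]; exact P.n_lt
  have hω0 : 0 < P.n / P.m := div_pos P.n_pos hm
  have hωm : P.n / P.m * P.m = P.n := div_mul_cancel₀ _ hm.ne'
  have hγmm : P.γ / P.m * P.m = P.γ := div_mul_cancel₀ _ hm.ne'
  have hμ := P.μ_pos
  have hjn : ∀ j ∈ Finset.range (⌊P.n⌋₊ + 1), (j : ℝ) ≤ P.n := fun j hj =>
    (Nat.le_floor_iff hn.le).1 (Nat.lt_succ_iff.1 (Finset.mem_range.1 hj))
  have hjm : ∀ j ∈ Finset.range (⌊P.n⌋₊ + 1), ((P.m - j : ℕ) : ℝ) = P.m - j := fun j hj => by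
    have : j ≤ P.m := by exact_mod_cast (hjn j hj).trans hnm.le
    rw [Nat.cast_sub this]
  -- Both tangential sums have this form: `θ = 0` with `r = σ`, and `θ = ωγ` with `r = m - n + γ`.
  -- The integer part of `r` is the order of the derivatives, the fractional part the Hölder
  -- exponent.
  have tang : ∀ θ : ℝ, 0 ≤ θ → ∀ r : ℝ, P.m - P.n ≤ r → r < P.m + 1 → r ≤ P.m + P.γ → θ + P.σ = r →
      P.Controlled fun u : Space d → ℝ → ℝ =>
        ∑ j ∈ Finset.range (⌊P.m - P.n⌋₊ + 1), ∑ α ∈ multiIdx d (⌊r⌋₊ - j),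
          finitePart (⨆ t : ℝ, semiTang θ (Int.fract r) (mixedD (tangIdx α j) (fun y => u y t))) := by
    intro θ hθ r hr hr1 hr2 hθr
    have hr0 : 0 ≤ r := hμ.le.trans hr
    refine Controlled.sum _ fun j hj => Controlled.sum _ fun α hα => ?_
    have hj' : j ≤ ⌊r⌋₊ :=
      (Nat.lt_succ_iff.1 (Finset.mem_range.1 hj)).trans (Nat.floor_le_floor hr)
    have hα' := tangIdx_mem hj' hα
    have hfl : (⌊r⌋₊ : ℝ) ≤ P.m := by
      have : ⌊r⌋₊ < P.m + 1 := (Nat.floor_lt hr0).2 (by push_cast; exact hr1)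
      exact_mod_cast Nat.lt_succ_iff.1 this
    have hfr : Int.fract r = r - (⌊r⌋₊ : ℝ) := by
      rw [Int.fract, natCast_floor_eq_intCast_floor hr0]
    have ho := sum_lst_of_mem hα' (f := P.ord) fun _ => rfl
    have hw := sum_lst_of_mem hα' (f := P.wt) fun _ => rfl
    have := controlled_semiTang (P := P) (lst (tangIdx α j)) (by rw [ho]; exact hfl) (θ := θ)
      (s := Int.fract r) (Int.fract_nonneg r) (Int.fract_lt_one r) (by rw [hw, hfr, hθr])
      (by rw [ho, hfr]; linarith)
    simpa only [← mixedD_lift] using this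
  have hσ : P.σ = P.m - P.n + (1 - P.n / P.m) * P.γ := rfl
  have hωγ : (1 - P.n / P.m) * P.γ ≤ P.γ := by nlinarith
  have hωγ0 : 0 ≤ (1 - P.n / P.m) * P.γ := mul_nonneg (by linarith) hγ.le
  unfold parabolicLHS
  refine (((((?_ : Controlled _ _).add ?_).add ?_).add ?_).add ?_).add ?_
  · refine Controlled.sum _ fun j hj => Controlled.sum _ fun α hα => ?_
    have ho := sum_lst_of_mem hα (f := P.ord) fun _ => rfl
    have hw := sum_lst_of_mem hα (f := P.wt) fun _ => rfl
    rw [hjm j hj] at ho hw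
    have := controlled_semiXT (P := P) (lst α) (by rw [ho]; simp) (p := P.n - j)
      (sub_nonneg.2 (hjn j hj)) (by rw [hw, hσ]; ring)
    have e : ∀ (u : Space d → ℝ → ℝ), (fun x t => wf (P.n - j) (pdL (lst α) (lift u)) (pt x t)) =
        fun x t => wD (P.n - j) α (fun y => u y t) x := by
      intro u; ext x t; rw [wD, mixedD_lift]; rfl
    simpa only [e] using this
  · refine Controlled.sum _ fun j hj => Controlled.sum _ fun α hα => ?_
    have ho := sum_lst_of_mem hα (f := P.ord) fun _ => rfl
    have hw := sum_lst_of_mem hα (f := P.wt) fun _ => rfl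
    rw [hjm j hj] at ho hw
    have hj1 : (j : ℝ) ≤ P.m - 1 := by
      have : j < P.m := by exact_mod_cast (hjn j hj).trans_lt hnm
      have : (j : ℝ) + 1 ≤ P.m := by exact_mod_cast this
      linarith
    have := controlled_semiT (P := P) (lst α) (by rw [ho]; simp) (p := P.n - j * (P.n / P.m))
      (s := (P.γ + j) / P.m) (by positivity) (by rw [div_lt_one hm]; linarith)
      (by rw [hw, hσ, μ]; field_simp; ring) (by rw [ho, div_mul_cancel₀ _ hm.ne']; linarith)
    have e : ∀ (u : Space d → ℝ → ℝ),
        (fun x t => wf (P.n - j * (P.n / P.m)) (pdL (lst α) (lift u)) (pt x t)) =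
        fun x t => wD (P.n - j * (P.n / P.m)) α (fun y => u y t) x := by
      intro u; ext x t; rw [wD, mixedD_lift]; rfl
    simpa only [e] using this
  · have := controlled_semiXT (P := P) (d := d) [none] (by simp [ord]) (p := 0) le_rfl
      (by simp only [List.map_cons, List.map_nil, List.sum_cons, List.sum_nil, wt, hσ, μ]; ring)
    have e : ∀ (u : Space d → ℝ → ℝ), (fun x t => wf 0 (pdL [none] (lift u)) (pt x t)) = dT u := by
      intro u; ext x t; rw [dT_eq_pdL, wf, Real.rpow_zero, one_mul]
    simpa only [e] using this
  · exact tang 0 le_rfl _ (by linarith) (by linarith) (by linarith) (by rw [hσ]; ring)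
  · exact tang (P.n / P.m * P.γ) (by positivity) _ (by linarith) (by linarith) (by linarith)
      (by rw [hσ]; ring)
  · refine Controlled.sum _ fun j hj => Controlled.sum _ fun α hα => ?_
    have ho := sum_lst_of_mem hα (f := P.ord) fun _ => rfl
    have hw := sum_lst_of_mem hα (f := P.wt) fun _ => rfl
    obtain ⟨hj1, hj2⟩ := Finset.mem_Icc.1 hj
    have hj1' : (1 : ℝ) ≤ j := by exact_mod_cast hj1
    have hj2' : (j : ℝ) ≤ P.m - P.n := (Nat.le_floor_iff hμ.le).1 hj2
    have hμ0 : 0 < P.m - P.n := hμ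
    have h1 : (j : ℝ) / (P.m - P.n) ≤ 1 := by rw [div_le_one hμ0]; exact hj2'
    have h2 : P.γ / P.m < j / (P.m - P.n) := by
      rw [div_lt_div_iff₀ hm hμ0]; nlinarith
    have h3 : (j : ℝ) / P.m ≤ j / (P.m - P.n) :=
      div_le_div_of_nonneg_left (by linarith) hμ0 (by linarith)
    have := controlled_semiT (P := P) (lst α) (by rw [ho]; linarith) (p := 0)
      (s := 1 - j / (P.m - P.n) + P.γ / P.m) (by linarith) (by linarith)
      (by rw [hw, σ_eq, μ]; field_simp; ring)
      (by
        rw [ho]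
        have : (j : ℝ) ≤ j / (P.m - P.n) * P.m := by
          rw [div_le_iff₀ hm] at h3; exact h3
        nlinarith)
    have e : ∀ (u : Space d → ℝ → ℝ), (fun x t => wf 0 (pdL (lst α) (lift u)) (pt x t)) =
        fun x t => mixedD α (fun y => u y t) x := by
      intro u; ext x t; rw [mixedD_lift, wf, Real.rpow_zero, one_mul]
    simpa only [e] using this

end Params

/-! ### Smoothness in space and decay at the boundary -/

section Slices

variable {d : ℕ}

lemma pdL_slice (W : (Idx d → ℝ) → ℝ) (t : ℝ) (L : List (Fin (d + 1))) :
    pdL L (fun y => W (pt (WithLp.toLp 2 y) t)) =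
      fun y => pdL (L.map some) W (pt (WithLp.toLp 2 y) t) := by
  induction L with
  | nil => rfl
  | cons i L ih =>
    ext y
    rw [List.map_cons]
    change deriv (fun s : ℝ => pdL L _ (y + s • Pi.single i 1)) 0 =
      deriv (fun s : ℝ => pdL (L.map some) W (pt (WithLp.toLp 2 y) t + s • Pi.single (some i) 1)) 0
    rw [ih]
    congr 1; ext s
    rw [pt_add_single]
    rfl

lemma PdReg.slice {W : (Idx d → ℝ) → ℝ} {t : ℝ} {L : List (Fin (d + 1))}
    (h : PdReg (L.map some) (halfQ d) W) :
    PdReg L {y | 0 < y (Fin.last d)} (fun y => W (pt (WithLp.toLp 2 y) t)) := by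
  induction L with
  | nil => trivial
  | cons i L ih =>
    refine ⟨ih h.1, fun y hy => ?_⟩
    have := h.2 (pt (WithLp.toLp 2 y) t) hy
    rw [pdL_slice]
    convert this using 2 with s
    rw [pt_add_single]
    rfl

end Slices

namespace Params

variable {P : Params} {d : ℕ}

/-- Purely spatial derivatives of length at most `m` have interior order at most `m < m + γ`, so
they exist and are continuous in the half-space. -/
lemma Good.contDiffOn_slice {A : ℝ} (hA : 0 ≤ A) {u : Space d → ℝ → ℝ} (hu : P.Good A (lift u))
    (t : ℝ) : ContDiffOn ℝ P.m (fun x => u x t) (H d) := by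
  have h0 : ContDiffOn ℝ P.m (fun y : Fin (d + 1) → ℝ => lift u (pt (WithLp.toLp 2 y) t))
      {y | 0 < y (Fin.last d)} := by
    refine contDiffOn_of_pdL (isOpen_lt continuous_const (continuous_apply _)) P.m fun L hL => ?_
    have hs : ((L.map some).map (P.ord (d := d))).sum < P.m + P.γ := by
      have : ((L.map some).map (P.ord (d := d))).sum = L.length := by
        clear hL
        induction L with
        | nil => simp
        | cons i L ih =>
          rw [List.map_cons, List.map_cons, List.sum_cons, ih, List.length_cons]
          simp only [ord]; push_cast; ring
      rw [this]
      have : (L.length : ℝ) ≤ P.m := by exact_mod_cast hL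
      linarith [P.γ_pos]
    obtain ⟨h1, h2⟩ := Good.pdReg_continuousOn P (L.map some) hs hA hu
    refine ⟨h1.slice, ?_⟩
    rw [pdL_slice]
    refine h2.comp (Continuous.continuousOn ?_) fun y hy => hy
    refine continuous_pi fun i => ?_
    rcases i with _ | i
    · exact continuous_const
    · exact continuous_apply i
  exact h0.comp (PiLp.continuousLinearEquiv 2 ℝ fun _ : Fin (d + 1) => ℝ).contDiff.contDiffOn
    fun x hx => hx

/-- Since `α` contains a tangential direction, every kernel mode of `D^α` has degree above `m - n`,
the threshold at which `x_N^(n-j) D^α` would be of order one at the boundary. The recurrence then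
forces power decay along each vertical line, uniformly for nearby base points. -/
lemma Good.tendsto_zero {A : ℝ} (hA : 0 ≤ A) {u : Space d → ℝ → ℝ} (hu : P.Good A (lift u)) {j : ℕ}
    (hj : (j : ℝ) < P.n) {α : Fin (d + 1) → ℕ} (hα : α ∈ multiIdx (d + 1) (P.m - j))
    (hαN : α (Fin.last d) < P.m - j) {x₀ : Space d} (t₀ : ℝ) (hx₀ : xN x₀ = 0) :
    Tendsto (fun p : Space d × ℝ => wD (P.n - j) α (fun y => u y p.2) p.1)
      (𝓝[H d ×ˢ Set.univ] (x₀, t₀)) (𝓝 0) := by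
  have hm := P.m_pos
  have hγ := P.γ_pos
  have hm1 : (1 : ℝ) ≤ P.m := by exact_mod_cast P.one_le_m
  have hμ := P.μ_pos
  have hγm : 0 < P.γ / P.m := div_pos hγ hm
  have hjm : ((P.m - j : ℕ) : ℝ) = P.m - j := by
    have : j ≤ P.m := by exact_mod_cast (hj.trans P.n_lt).le
    rw [Nat.cast_sub this]
  have ho := sum_lst_of_mem hα (f := P.ord) fun _ => rfl
  have hw := sum_lst_of_mem hα (f := P.wt) fun _ => rfl
  rw [hjm] at ho hw
  have hj0 : (0 : ℝ) ≤ j := Nat.cast_nonneg j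
  have hμd : P.μ = P.m - P.n := rfl
  obtain ⟨C, hC0, hC⟩ := P.exists_recurrent_exps (lst α) (by rw [ho]; linarith) hγm.le
    (by rw [div_lt_one hm]; linarith [P.γ_lt]) (by rw [ho, div_mul_cancel₀ _ hm.ne']; linarith)
    hγ.le P.γ_lt (by rw [ho]; linarith)
  have hsum : ∑ i, α i = P.m - j := (Finset.mem_piAntidiag.1 hα).1
  have hcnt : cnt (lst α) = P.m - j := by
    simp only [cnt, count_lst]; exact hsum
  have htcnt : 1 ≤ tcnt (lst α) := by
    simp only [tcnt, count_lst]
    rw [Fin.sum_univ_castSucc] at hsum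
    omega
  have hds : ∀ x ∈ P.degList (lst α), (P.m - j) - (P.n - j) < x := by
    intro x hx
    rw [degList, List.mem_append, mem_degs, mem_degs] at hx
    -- Polynomial modes have degree at least `m - j > m - n` because `j < n`. Modes with the profile
    -- have degree at least `1 + μ`, the `1` coming from the tangential derivative.
    rcases hx with ⟨l, a, h1, -, -, rfl⟩ | ⟨l, a, h1, -, -, rfl⟩
    · rw [hcnt] at h1
      have h2 : ((P.m - j : ℕ) : ℝ) ≤ l := by exact_mod_cast h1
      rw [hjm] at h2
      have h3 : 0 ≤ ((a : ℝ) + (0 : ℕ)) * P.μ := by positivity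
      linarith
    · have h2 : (1 : ℝ) ≤ l := by exact_mod_cast htcnt.trans h1
      have h3 : 0 ≤ (a : ℝ) * P.μ := by positivity
      push_cast
      linarith
  obtain ⟨ε, D, R, hε, hD0, hD⟩ := P.exists_decay (d := d) (κ := exps (P.γ / P.m) P.γ) (b := P.m - j)
    (p := P.n - j) (ds := P.degList (lst α)) (by linarith [P.n_lt]) (by linarith)
    (by rw [σ_eq]; have := mul_pos hμ hγm; linarith) hds
  have hrec := hC _ A hA hu
  rw [hw] at hrec
  obtain ⟨-, hcont⟩ := Good.pdReg_continuousOn P (lst α) (by rw [ho]; linarith) hA hu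
  set g := pdL (lst α) (lift u) with hg
  -- A compact box with heights in `[1, R]` above a neighbourhood of the base point; the bound of
  -- the derivative there makes the decay constant uniform.
  set lo : Idx d → ℝ := Function.update (fun i => pt x₀ t₀ i - 1) (nrm d) 1 with hlo
  set hi : Idx d → ℝ := Function.update (fun i => pt x₀ t₀ i + 1) (nrm d) R with hhi
  have hK : Icc lo hi ⊆ halfQ d := by
    intro z hz
    have := hz.1 (nrm d)
    rw [hlo, Function.update_self] at this
    exact lt_of_lt_of_le one_pos this
  obtain ⟨M, hM⟩ := isCompact_Icc.exists_bound_of_continuousOn (hcont.mono hK)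
  set M' := max M 0 with hM'
  have hev : ∀ᶠ p : Space d × ℝ in 𝓝[H d ×ˢ Set.univ] (x₀, t₀), p.1 ∈ H d ∧ xN p.1 < 1 ∧
      ∀ i, |pt p.1 p.2 i - pt x₀ t₀ i| ≤ 1 := by
    refine (eventually_mem_nhdsWithin.mono fun p hp => hp.1).and ?_
    refine Filter.Eventually.filter_mono nhdsWithin_le_nhds ?_
    have hc : ∀ i : Idx d, Continuous fun p : Space d × ℝ => pt p.1 p.2 i := by
      intro i
      rcases i with _ | i
      · exact continuous_snd
      · change Continuous fun p : Space d × ℝ => p.1 i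
        fun_prop
    refine Filter.Eventually.and ?_ (eventually_all.2 fun i => ?_)
    · refine (hc (nrm d)).continuousAt.eventually_lt continuousAt_const ?_
      change xN x₀ < 1
      rw [hx₀]; exact one_pos
    · have := ((hc i).tendsto (x₀, t₀)).eventually (Metric.closedBall_mem_nhds (pt x₀ t₀ i) one_pos)
      simpa [Metric.mem_closedBall, Real.dist_eq] using this
  have hbd : ∀ᶠ p : Space d × ℝ in 𝓝[H d ×ˢ Set.univ] (x₀, t₀),
      ‖wD (P.n - j) α (fun y => u y p.2) p.1‖ ≤ D * (M' + C * A) * xN p.1 ^ ε := by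
    filter_upwards [hev] with p ⟨hp1, hp2, hp3⟩
    have h1 := hD g (C * A) M' (base (pt p.1 p.2)) (mul_nonneg hC0 hA) (le_max_right _ _) hrec
      (base_nrm _) (fun h h1 h2 => ?_) (xN p.1) hp1 hp2
    · have e : Function.update (base (pt p.1 p.2)) (nrm d) (xN p.1) = pt p.1 p.2 := update_base
      rw [e] at h1
      rw [wD, mixedD_lift]
      exact h1
    · refine (hM _ ⟨?_, ?_⟩).trans (le_max_left _ _)
      · intro i
        by_cases hi : i = nrm d
        · subst hi; simpa [hlo] using h1
        · simp only [hlo, base, Function.update_of_ne hi]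
          linarith [(abs_le.1 (hp3 i)).1]
      · intro i
        by_cases hi' : i = nrm d
        · subst hi'; simpa [hhi] using h2
        · simp only [hhi, base, Function.update_of_ne hi']
          linarith [(abs_le.1 (hp3 i)).2]
  refine squeeze_zero_norm' hbd ?_
  have h1 : Tendsto (fun p : Space d × ℝ => xN p.1) (𝓝[H d ×ˢ Set.univ] (x₀, t₀)) (𝓝 0) := by
    have hc : Continuous fun p : Space d × ℝ => xN p.1 := by unfold xN; fun_prop
    have := hc.tendsto (x₀, t₀)
    rw [hx₀] at this
    exact this.mono_left nhdsWithin_le_nhds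
  have h2 := (h1.rpow_const (p := ε) (Or.inr hε.le)).const_mul (D * (M' + C * A))
  rwa [Real.zero_rpow hε.ne', mul_zero] at h2

end Params

/-! ### The elliptic case as a time-independent problem -/

section Elliptic

variable {d : ℕ}

lemma semiT_const {s : ℝ} {v : Space d → ℝ → ℝ} (hv : ∀ x t τ, v x t = v x τ) : semiT s v = 0 := by
  have h := (semiT_le_iff (s := s) (v := v) le_rfl).2 fun x _ t τ => by rw [hv x t τ]; simp
  simpa using h

lemma parabolicRHS_const (m : ℕ) (n γ : ℝ) (v : Space d → ℝ) :
    parabolicRHS m n γ (fun x _ => v x) = ellipticRHS m n γ v := by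
  have h : semiT (γ / m) (dT fun x (_ : ℝ) => v x) = 0 := semiT_const fun x t τ => by simp [dT]
  simp only [parabolicRHS, ellipticRHS, h, add_zero, ciSup_const]

/-- For a time-independent function the time seminorms vanish and the suprema over `t` are trivial.
What remains is a rearrangement, the two tangential sums appearing in opposite order on the two
sides. -/
lemma ellipticLHS_le (m : ℕ) (n γ : ℝ) (v : Space d → ℝ) :
    ellipticLHS m n γ v ≤ parabolicLHS m n γ (fun x _ => v x) := by
  have h : ∀ s : ℝ, ∀ w : Space d → ℝ, semiT s (fun x (_ : ℝ) => w x) = 0 := fun s w =>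
    semiT_const fun x t τ => rfl
  simp only [parabolicLHS, ellipticLHS, semiXT, h, ciSup_const, add_zero]
  have key : ∀ a b c x y z : ℝ≥0∞, a + b + c ≤ a + x + y + c + b + z := fun a b c x y z => by
    have e : a + x + y + c + b + z = a + b + c + (x + y + z) := by ring
    rw [e]; exact le_self_add
  exact key _ _ _ _ _ _

end Elliptic

end WeightedHolder

theorem mainTheorem1 (d m : ℕ) (hm : 1 ≤ m) (n γ : ℝ) (hn0 : 0 < n) (hnm : n < m)
    (hγ0 : 0 < γ) (hγ1 : γ < 1)
    (hnγ : (¬ ∃ k : ℤ, (k : ℝ) = n) →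
      γ * (1 - n / m) < min (Int.fract n) (1 - Int.fract n)) :
    -- the parabolic case, on the closure of `Q = H × ℝ`
    (∃ C : ℝ≥0, ∀ u : WeightedHolder.Space d → ℝ → ℝ,
      ContinuousOn (fun p : WeightedHolder.Space d × ℝ => u p.1 p.2)
        (WeightedHolder.closedH d ×ˢ Set.univ) →
      (∀ t : ℝ, WeightedHolder.HasPureDerivs m (fun x => u x t)) →
      (∀ x ∈ WeightedHolder.H d, Differentiable ℝ (u x)) →
      WeightedHolder.parabolicRHS m n γ u < ⊤ →
        (∀ t : ℝ, ContDiffOn ℝ m (fun x => u x t) (WeightedHolder.H d)) ∧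
        WeightedHolder.parabolicLHS m n γ u ≤ C * WeightedHolder.parabolicRHS m n γ u ∧
        ∀ j : ℕ, (j : ℝ) < n → ∀ α ∈ WeightedHolder.multiIdx (d + 1) (m - j),
          α (Fin.last d) < m - j →
          ∀ (x₀ : WeightedHolder.Space d) (t₀ : ℝ), WeightedHolder.xN x₀ = 0 →
            Tendsto
              (fun p : WeightedHolder.Space d × ℝ =>
                WeightedHolder.wD (n - j) α (fun y => u y p.2) p.1)
              (𝓝[WeightedHolder.H d ×ˢ Set.univ] (x₀, t₀)) (𝓝 0)) ∧
    -- the elliptic case, on the closure of `H`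
    (∃ C : ℝ≥0, ∀ u : WeightedHolder.Space d → ℝ,
      ContinuousOn u (WeightedHolder.closedH d) →
      WeightedHolder.HasPureDerivs m u →
      WeightedHolder.ellipticRHS m n γ u < ⊤ →
        ContDiffOn ℝ m u (WeightedHolder.H d) ∧
        WeightedHolder.ellipticLHS m n γ u ≤ C * WeightedHolder.ellipticRHS m n γ u ∧
        ∀ j : ℕ, (j : ℝ) < n → ∀ α ∈ WeightedHolder.multiIdx (d + 1) (m - j),
          α (Fin.last d) < m - j →
          ∀ x₀ : WeightedHolder.Space d, WeightedHolder.xN x₀ = 0 →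
            Tendsto (WeightedHolder.wD (n - j) α u)
              (𝓝[WeightedHolder.H d] x₀) (𝓝 0)) := by
  let P : WeightedHolder.Params := ⟨m, n, γ, hm, hn0, hnm, hγ0, hγ1, hnγ⟩
  obtain ⟨C, hC⟩ := P.controlled_parabolicLHS (d := d)
  refine ⟨⟨C, fun u hc hp ht hR => ?_⟩, ⟨C, fun v hc hp hR => ?_⟩⟩
  · have hG : P.Good _ _ := WeightedHolder.good_lift (P := P) hc hp ht hR
    exact ⟨fun t => hG.contDiffOn_slice ENNReal.toReal_nonneg t, hC u hR hG,
      fun j hj α hα hαN x₀ t₀ hx₀ => hG.tendsto_zero ENNReal.toReal_nonneg hj hα hαN t₀ hx₀⟩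
  -- The elliptic problem is the parabolic one for `u(x, t) = v(x)`: the two right-hand sides
  -- coincide, and the limit is taken along the slice `t = 0`.
  · have hR' : P.rhs (fun x _ => v x) < ⊤ := by
      rw [WeightedHolder.Params.rhs, WeightedHolder.parabolicRHS_const]; exact hR
    have hG : P.Good _ _ := WeightedHolder.good_lift (P := P) (u := fun x _ => v x)
      (hc.comp continuousOn_fst fun p hp => hp.1) (fun _ => hp)
      (fun x _ => differentiable_const _) hR'
    refine ⟨hG.contDiffOn_slice ENNReal.toReal_nonneg 0, ?_, fun j hj α hα hαN x₀ hx₀ => ?_⟩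
    · have h := (WeightedHolder.ellipticLHS_le m n γ v).trans (hC _ hR' hG)
      rwa [WeightedHolder.Params.rhs, WeightedHolder.parabolicRHS_const] at h
    · have h := hG.tendsto_zero ENNReal.toReal_nonneg hj hα hαN 0 hx₀
      refine h.comp (f := fun x => (x, (0 : ℝ))) ?_
      refine tendsto_nhdsWithin_iff.2 ⟨?_, eventually_mem_nhdsWithin.mono fun x hx => ⟨hx, mem_univ _⟩⟩
      exact (Continuous.prodMk continuous_id continuous_const).continuousAt.tendsto.mono_left
        nhdsWithin_le_nhds
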